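/- For a finite graph $G$ of order $n$ let $N(G)$ be the number of vertex subsets $S$ for which $G[S]$ is connected (in particular $S\neq\emptyset$), let $N_{dom}(G)$ be the number of those that are moreover dominating (every vertex outside $S$ has a neighbour in $S$), and put $c(G)=N(G)^{1/n}$, $\tilde c(G)=N_{dom}(G)^{1/n}$. Let $c_d(n)$ and $\tilde c_d(n)$ be the maxima of $c(G)$ and $\tilde c(G)$ over all $d$-regular graphs $G$ of order $n$, and $c_d=\limsup_n c_d(n)$, $\tilde c_d=\limsup_n\tilde c_d(n)$. **Gluing.** Let $M$ be a $d$-regular graph and $C=v_1v_2\dots v_\ell$ a cycle in $M$. The graph $M^{\bullet k}$ has the vertices $(v,j)$, $v\in V(M)$, $1\le j\le k$, and the following adjacencies: $(v,j)\sim(w,j)$ if $vw\in E(M)\setminus E(C)$; $(v_i,j)\sim(v_i,j+1)$ for $1\le i\le \ell$, $1\le j<k$; and $(v_i,k)\sim(v_{i+1},1)$ for $1\le i\le\ell$ (where $v_{\ell+1}=v_1$). Let $H$ be the graph $(V(M),E(M)\setminus E(C))$. **Transfer matrix.** A *state* is a map $\sigma:V(M)\to\{\text{empty},\text{fixed},\text{loose}\}$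 such that some vertex is fixed and no fixed vertex is adjacent in $H$ to a loose one. A vertex that is not empty is called occupied, and two occupied vertices are linked in $\sigma$ if they are joined by a path of occupied vertices in $H$. A state $\tau$ can be preceded by $\sigma$ if (a) an occupied vertex $v$ of $\tau$ is fixed in $\tau$ if and only if it is linked in $\tau$ to some $v_i\in C$ that is fixed in $\sigma$, and (b) every loose vertex of $\sigma$ is linked in $\sigma$ to some $v_i\in C$ that is occupied in $\tau$. The transfer matrix for connected sets has the entry $1$ in row $\tau$ and column $\sigma$ if $\tau$ can be preceded by $\sigma$, and $0$ otherwise. For connected dominating sets every empty vertex is moreover marked as dominated or undominated; an undominated vertex of a state has no occupied neighbour in $H$; and, for $\tau$ to be preceded by $\sigma$, it is required in addition that (c) an empty vertex $v$ of $\tau$ is dominated in $\tau$ if and only if it has an $H$-neighbour that is occupied in $\tau$ or it lies on $C$ and is occupied in $\sigma$, and (d) every undominated vertex of $\sigma$ lies on $C$ and is occupied in $\tau$. Let $\lambda$ and $\tilde\lambda$ be the spectral radii of the two matrices. **Result.** For each row $(d,M,C)$ of the table below, with $C$ a cycle of the indicated length in $M$ (unique up to automorphisms of $M$), all graphs $M^{\bullet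 k}$, $k\ge1$, are $d$-regular, $$\lambda^{1/|M|}\le\liminf_{k\to\infty}c(M^{\bullet k}),\qquad \lambda^{1/|M|}\le c_d,\qquad \tilde\lambda^{1/|M|}\le\liminf_{k\to\infty}\tilde c(M^{\bullet k}),\qquad \tilde\lambda^{1/|M|}\le\tilde c_d ,$$ and $\lambda,\tilde\lambda$ and their $|M|$-th roots have the following values, up to an error of at most $0.005$ for $\lambda,\tilde\lambda$ and $0.0005$ for the roots: | $d$ | $M$ | $C$ | $\lambda$ | $\lambda^{1/\lvert M\rvert}$ | $\tilde\lambda$ | $\tilde\lambda^{1/\lvert M\rvert}$ | |---|---|---|---|---|---|---| | 3 | $K_{3,3}$ | $C_4$ | 30.30 | 1.766 | 26.15 | 1.723 | | 3 | Petersen graph | $C_6$ | 329.81 | 1.786 | 252.7 | 1.739 | | 3 | Heawood graph | $C_8$ | 3512.31 | 1.792 | 2396.46 | 1.743 | | 4 | $K_{4,4}$ | $C_6$ | 167.97 | 1.897 | 152.66 | 1.875 | | 5 | $K_{5,5}$ | $C_8$ | 807.93 | 1.953 | 756.64 | 1.940 | Moreover $c_3\ge1.792$, $c_4\ge1.897$,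 $c_5\ge1.953$, $\tilde c_3\ge1.743$, $\tilde c_4\ge1.875$ and $\tilde c_5\ge1.940$. -/

import Mathlib

open Filter

/-! ### Connected sets and connected dominating sets -/

section ConnectedSets

variable {V : Type*}

/-- `s` is a connected (vertex) set of `G`: the induced subgraph `G[s]` is connected
(in particular `s` is non-empty). -/
def IsConnectedSet (G : SimpleGraph V) (s : Set V) : Prop :=
  (G.induce s).Connected

/-- `s` is a dominating set of `G`: every vertex outside `s` has a neighbour in `s`. -/
def IsDominatingSet (G : SimpleGraph V) (s : Set V) : Prop :=
  ∀ v, v ∉ s → ∃ w ∈ s, G.Adj v w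

/-- `N(G)`, the number of connected sets. -/
noncomputable def numConn (G : SimpleGraph V) : ℕ :=
  {s : Set V | IsConnectedSet G s}.ncard

/-- `N_dom(G)`, the number of connected dominating sets. -/
noncomputable def numDomConn (G : SimpleGraph V) : ℕ :=
  {s : Set V | IsDominatingSet G s ∧ IsConnectedSet G s}.ncard

/-- `c(G) = N(G)^(1/n)`, where `n` is the order of `G`. -/
noncomputable def connBase (G : SimpleGraph V) : ℝ :=
  (numConn G : ℝ) ^ ((1 : ℝ) / Nat.card V)

/-- `c̃(G) = N_dom(G)^(1/n)`, where `n` is the order of `G`. -/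
noncomputable def domConnBase (G : SimpleGraph V) : ℝ :=
  (numDomConn G : ℝ) ^ ((1 : ℝ) / Nat.card V)

end ConnectedSets

/-- Every vertex of the finite graph `G` has degree `d`. -/
def IsDRegular {V : Type*} [Fintype V] (G : SimpleGraph V) (d : ℕ) : Prop :=
  letI : DecidableRel G.Adj := Classical.decRel _
  G.IsRegularOfDegree d

/-- `c_d(n)`, the maximum of `c(G)` over the (finitely many) `d`-regular graphs on `n` labelled
vertices; it is `0` if there is no such graph. -/
noncomputable def maxConnBase (d n : ℕ) : ℝ :=
  sSup {x : ℝ | ∃ G : SimpleGraph (Fin n), IsDRegular G d ∧ x = connBase G}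

/-- `c̃_d(n)`, the maximum of `c̃(G)` over the `d`-regular graphs on `n` labelled vertices. -/
noncomputable def maxDomConnBase (d n : ℕ) : ℝ :=
  sSup {x : ℝ | ∃ G : SimpleGraph (Fin n), IsDRegular G d ∧ x = domConnBase G}

/-- `c_d = limsup_n c_d(n)`. -/
noncomputable def connConst (d : ℕ) : ℝ :=
  limsup (fun n : ℕ => maxConnBase d n) atTop

/-- `c̃_d = limsup_n c̃_d(n)`. -/
noncomputable def domConnConst (d : ℕ) : ℝ :=
  limsup (fun n : ℕ => maxDomConnBase d n) atTop

/-! ### Gluing copies of a gadget along a cycle -/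

/-- A cycle `v_0, v_1, …, v_{ℓ-1}` of length `ℓ ≥ 3` in the graph `M`; indices are taken
modulo `ℓ`. -/
structure CycleIn {V : Type*} (M : SimpleGraph V) (ℓ : ℕ) [NeZero ℓ] where
  vert : Fin ℓ → V
  three_le : 3 ≤ ℓ
  inj : Function.Injective vert
  adj : ∀ i, M.Adj (vert i) (vert (i + 1))

namespace CycleIn

variable {V : Type*} {M : SimpleGraph V} {ℓ : ℕ} [NeZero ℓ]

/-- The edges of the cycle `C`. -/
def edges (C : CycleIn M ℓ) : Set (Sym2 V) :=
  Set.range fun i => s(C.vert i, C.vert (i + 1))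

/-- The graph of the adjacencies inside one copy (one column): the vertex set `V(M)` with the edge
set `E(M) \ E(C)`. -/
def column (C : CycleIn M ℓ) : SimpleGraph V :=
  M.deleteEdges C.edges

/-- The graph `M^{•k}`: `k` copies of `M` glued cyclically along `C`. The vertex `(v, j)` is the
copy of `v` in column `j`. -/
def glue (C : CycleIn M ℓ) (k : ℕ) : SimpleGraph (V × Fin k) :=
  SimpleGraph.fromRel fun x y =>
    -- the edges of `E(M) \ E(C)` inside every column
    (x.2 = y.2 ∧ C.column.Adj x.1 y.1) ∨
    -- `(v_i, j)` and `(v_i, j + 1)` are adjacent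
    (∃ i, x.1 = C.vert i ∧ y.1 = C.vert i ∧ (x.2 : ℕ) + 1 = y.2) ∨
    -- `(v_i, last column)` and `(v_{i+1}, first column)` are adjacent
    (∃ i, x.1 = C.vert i ∧ y.1 = C.vert (i + 1) ∧ (x.2 : ℕ) + 1 = k ∧ (y.2 : ℕ) = 0)

end CycleIn

/-! ### The coefficient (transfer) matrix for connected sets

A vertex subset of `M^{•k}` is read column by column. An occupied cell of a column is *fixed* if it
is joined to the first column by a path of occupied cells that only moves inside columns and to the
left, and it is *loose* otherwise. -/

/-- The type of a cell. -/
inductive Cell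
  | empty | fixed | loose
  deriving DecidableEq

instance : Fintype Cell where
  elems := {.empty, .fixed, .loose}
  complete := fun x => by cases x <;> decide

namespace CycleIn

variable {V : Type*} {M : SimpleGraph V} {ℓ : ℕ} [NeZero ℓ]

/-- `v` and `w` are connected inside the column by a path of occupied cells (for an occupied
cell `v`). -/
def Linked (C : CycleIn M ℓ) (σ : V → Cell) (v w : V) : Prop :=
  (SimpleGraph.fromRel fun a b =>
    C.column.Adj a b ∧ σ a ≠ Cell.empty ∧ σ b ≠ Cell.empty).Reachable v w

/-- The valid columns: some cell is fixed, and a fixed cell is never adjacent, inside the column,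
to a loose cell. -/
def IsState (C : CycleIn M ℓ) (σ : V → Cell) : Prop :=
  (∃ v, σ v = Cell.fixed) ∧
  ∀ v w, C.column.Adj v w → σ v = Cell.fixed → σ w ≠ Cell.loose

/-- The column `τ` can be preceded by the column `σ` (immediately to its left). -/
structure Precedes (C : CycleIn M ℓ) (σ τ : V → Cell) : Prop where
  /-- An occupied cell of `τ` is fixed exactly if it is linked inside `τ` to a cell whose left
  neighbour is fixed. -/
  fixed_iff : ∀ v, τ v ≠ Cell.empty →
    (τ v = Cell.fixed ↔ ∃ i, σ (C.vert i) = Cell.fixed ∧ C.Linked τ v (C.vert i))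
  /-- A loose cell of `σ` is linked inside `σ` to a cell whose right neighbour is occupied. -/
  loose_continues : ∀ v, σ v = Cell.loose →
    ∃ i, C.Linked σ v (C.vert i) ∧ τ (C.vert i) ≠ Cell.empty

/-- The states of the transfer matrix for connected sets. -/
abbrev State (C : CycleIn M ℓ) : Type _ := {σ : V → Cell // C.IsState σ}

open Classical in
/-- The transfer matrix for connected sets: the entry in row `τ` and column `σ` is `1` if `τ` can be
preceded by `σ`, and `0` otherwise. -/
noncomputable def transfer (C : CycleIn M ℓ) : Matrix C.State C.State ℂ :=
  Matrix.of fun τ σ => if C.Precedes σ.1 τ.1 then 1 else 0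

open Classical in
/-- `λ`, the spectral radius (largest modulus of an eigenvalue) of the transfer matrix for
connected sets. -/
noncomputable def rho [Fintype V] (C : CycleIn M ℓ) : ℝ :=
  (spectralRadius ℂ C.transfer).toReal

end CycleIn

/-! ### The transfer matrix for connected dominating sets

Here an unoccupied cell is *dominated* if it has an occupied neighbour in its own column or in the
column to its left, and *undominated* otherwise. -/

/-- The type of a cell in the dominating case. -/
inductive DomCell
  | dominated | undominated | fixed | loose
  deriving DecidableEq

instance : Fintype DomCell where
  elems := {.dominated, .undominated, .fixed, .loose}
  complete := fun x => by cases x <;> decide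

/-- Forget whether an unoccupied cell is dominated. -/
def DomCell.toCell : DomCell → Cell
  | .dominated => .empty
  | .undominated => .empty
  | .fixed => .fixed
  | .loose => .loose

namespace CycleIn

variable {V : Type*} {M : SimpleGraph V} {ℓ : ℕ} [NeZero ℓ]

/-- The valid columns in the dominating case: moreover, an undominated cell has no occupied
neighbour inside the column. -/
def IsDomState (C : CycleIn M ℓ) (σ : V → DomCell) : Prop :=
  C.IsState (fun v => (σ v).toCell) ∧
  ∀ v w, C.column.Adj v w → σ v = DomCell.undominated → (σ w).toCell = Cell.empty

/-- The column `τ` can be preceded by the column `σ` in the dominating case. -/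
structure DomPrecedes (C : CycleIn M ℓ) (σ τ : V → DomCell) : Prop where
  precedes : C.Precedes (fun v => (σ v).toCell) (fun v => (τ v).toCell)
  /-- An unoccupied cell of `τ` is dominated exactly if it has an occupied neighbour inside `τ` or
  an occupied left neighbour. -/
  dominated_iff : ∀ v, (τ v).toCell = Cell.empty →
    (τ v = DomCell.dominated ↔
      (∃ w, C.column.Adj v w ∧ (τ w).toCell ≠ Cell.empty) ∨
      (∃ i, v = C.vert i ∧ (σ v).toCell ≠ Cell.empty))
  /-- An undominated cell of `σ` has an occupied right neighbour. -/
  undominated_continues : ∀ v, σ v = DomCell.undominated →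
    ∃ i, v = C.vert i ∧ (τ v).toCell ≠ Cell.empty

/-- The states of the transfer matrix for connected dominating sets. -/
abbrev DomState (C : CycleIn M ℓ) : Type _ := {σ : V → DomCell // C.IsDomState σ}

open Classical in
/-- The transfer matrix for connected dominating sets. -/
noncomputable def domTransfer (C : CycleIn M ℓ) : Matrix C.DomState C.DomState ℂ :=
  Matrix.of fun τ σ => if C.DomPrecedes σ.1 τ.1 then 1 else 0

open Classical in
/-- `λ`, the spectral radius of the transfer matrix for connected dominating sets. -/
noncomputable def domRho [Fintype V] (C : CycleIn M ℓ) : ℝ :=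
  (spectralRadius ℂ C.domTransfer).toReal

/-- The line of the table for a `d`-regular gadget `M` with the cycle `C`.

All graphs `M^{•k}`, `k ≥ 1`, are `d`-regular; the spectral radii `λ` of the two transfer matrices
are `lam` and `domLam`, rounded to two decimals; their `|V(M)|`-th roots are `b` and `domB`, rounded
to three decimals; and these roots are lower bounds for `c(M^{•k})` and `c̃(M^{•k})` in the limit,
and thus for `c_d` and `c̃_d`. -/
structure TableRow [Fintype V] (C : CycleIn M ℓ) (d : ℕ) (lam b domLam domB : ℝ) : Prop where
  regular : ∀ k, 1 ≤ k → IsDRegular (C.glue k) d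
  rho_approx : |C.rho - lam| ≤ 0.005
  root_approx : |C.rho ^ ((1 : ℝ) / Fintype.card V) - b| ≤ 0.0005
  root_le_liminf :
    C.rho ^ ((1 : ℝ) / Fintype.card V) ≤ liminf (fun k : ℕ => connBase (C.glue k)) atTop
  root_le_connConst : C.rho ^ ((1 : ℝ) / Fintype.card V) ≤ connConst d
  domRho_approx : |C.domRho - domLam| ≤ 0.005
  domRoot_approx : |C.domRho ^ ((1 : ℝ) / Fintype.card V) - domB| ≤ 0.0005
  domRoot_le_liminf :
    C.domRho ^ ((1 : ℝ) / Fintype.card V) ≤ liminf (fun k : ℕ => domConnBase (C.glue k)) atTop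
  domRoot_le_domConnConst : C.domRho ^ ((1 : ℝ) / Fintype.card V) ≤ domConnConst d

end CycleIn

/-! ### The gadgets

In each of them, any two cycles of the given length differ by an automorphism. -/

/-- `K_{d,d}`. -/
abbrev Kdd (d : ℕ) : SimpleGraph (Fin d ⊕ Fin d) := completeBipartiteGraph (Fin d) (Fin d)

/-- The Petersen graph `P_{5,2}`: outer vertices `inl i`, inner vertices `inr i`, edges
`inl i - inl (i + 1)`, `inl i - inr i` and `inr i - inr (i + 2)`, with indices modulo `5`. -/
def petersen : SimpleGraph (Fin 5 ⊕ Fin 5) :=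
  SimpleGraph.fromRel fun x y =>
    (∃ i, x = Sum.inl i ∧ y = Sum.inl (i + 1)) ∨
    (∃ i, x = Sum.inl i ∧ y = Sum.inr i) ∨
    (∃ i, x = Sum.inr i ∧ y = Sum.inr (i + 2))

/-- The Heawood graph, the point-line incidence graph of the Fano plane: the points are `inl p` and
the lines are `inr q = {q, q + 1, q + 3}`, modulo `7`. -/
def heawood : SimpleGraph (Fin 7 ⊕ Fin 7) :=
  SimpleGraph.fromRel fun x y =>
    ∃ p q, x = Sum.inl p ∧ y = Sum.inr q ∧ (p = q ∨ p = q + 1 ∨ p = q + 3)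

/-- A cycle `C_4` in `K_{3,3}`. -/
def cycleK33 : CycleIn (Kdd 3) 4 where
  vert := ![.inl 0, .inr 0, .inl 1, .inr 1]
  three_le := by norm_num
  inj := by decide
  adj := by simp only [Kdd, completeBipartiteGraph]; decide

/-- A cycle `C_6` in the Petersen graph. -/
def cyclePetersen : CycleIn petersen 6 where
  vert := ![.inl 0, .inl 1, .inl 2, .inl 3, .inr 3, .inr 0]
  three_le := by norm_num
  inj := by decide
  adj := by simp only [petersen, SimpleGraph.fromRel_adj]; decide

/-- A cycle `C_8` in the Heawood graph. -/
def cycleHeawood : CycleIn heawood 8 where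
  vert := ![.inl 0, .inr 0, .inl 1, .inr 1, .inl 2, .inr 2, .inl 5, .inr 4]
  three_le := by norm_num
  inj := by decide
  adj := by simp only [heawood, SimpleGraph.fromRel_adj]; decide

/-- A cycle `C_6` in `K_{4,4}`. -/
def cycleK44 : CycleIn (Kdd 4) 6 where
  vert := ![.inl 0, .inr 0, .inl 1, .inr 1, .inl 2, .inr 2]
  three_le := by norm_num
  inj := by decide
  adj := by simp only [Kdd, completeBipartiteGraph]; decide

/-- A cycle `C_8` in `K_{5,5}`. -/
def cycleK55 : CycleIn (Kdd 5) 8 where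
  vert := ![.inl 0, .inr 0, .inl 1, .inr 1, .inl 2, .inr 2, .inl 3, .inr 3]
  three_le := by norm_num
  inj := by decide
  adj := by simp only [Kdd, completeBipartiteGraph]; decide

section MatrixBounds

variable {S : Type*} [Fintype S] [DecidableEq S]

theorem Matrix.exists_eigenvector_of_mem_spectrum {A : Matrix S S ℂ} {k : ℂ}
    (hk : k ∈ spectrum ℂ A) : ∃ v : S → ℂ, v ≠ 0 ∧ A.mulVec v = k • v := by
  rw [spectrum.mem_iff, Matrix.isUnit_iff_isUnit_det, isUnit_iff_ne_zero, not_not] at hk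
  obtain ⟨v, hv, h⟩ := Matrix.exists_mulVec_eq_zero_iff.2 hk
  refine ⟨v, hv, ?_⟩
  rw [Matrix.sub_mulVec, sub_eq_zero, Matrix.algebraMap_eq_diagonal] at h
  rw [← h]
  ext i
  simp [Matrix.mulVec_diagonal]

/-- Upper Collatz–Wielandt bound for a non-negative matrix; the weight `y` may vanish on columns
that are zero. -/
theorem Matrix.spectralRadius_toReal_le_of_weight (a : S → S → ℝ) (ha : ∀ τ σ, 0 ≤ a τ σ)
    (A : Matrix S S ℂ) (hA : ∀ τ σ, A τ σ = (a τ σ : ℂ)) (y : S → ℝ) (hy : ∀ σ, 0 ≤ y σ)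
    {μ : ℝ} (hμ : 0 ≤ μ) (h : ∀ σ, ∑ τ, y τ * a τ σ ≤ μ * y σ)
    (h0 : ∀ σ, y σ = 0 → ∀ τ, a τ σ = 0) : (spectralRadius ℂ A).toReal ≤ μ := by
  refine ENNReal.toReal_le_of_le_ofReal hμ (iSup₂_le fun k hk => ?_)
  obtain ⟨v, hv, hkv⟩ := Matrix.exists_eigenvector_of_mem_spectrum hk
  have hk' : ∀ τ, ‖k‖ * ‖v τ‖ ≤ ∑ σ, a τ σ * ‖v σ‖ := fun τ => by
    have h1 : k * v τ = ∑ σ, A τ σ * v σ := by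
      have := congrFun hkv τ
      simpa [Matrix.mulVec, dotProduct] using this.symm
    rw [← norm_mul, h1]
    refine (norm_sum_le _ _).trans (Finset.sum_le_sum fun σ _ => ?_)
    rw [norm_mul, hA, Complex.norm_real, Real.norm_of_nonneg (ha _ _)]
  have main : ‖k‖ * ∑ τ, y τ * ‖v τ‖ ≤ μ * ∑ τ, y τ * ‖v τ‖ := by
    calc ‖k‖ * ∑ τ, y τ * ‖v τ‖ = ∑ τ, y τ * (‖k‖ * ‖v τ‖) := by
          rw [Finset.mul_sum]; exact Finset.sum_congr rfl fun _ _ => by ring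
      _ ≤ ∑ τ, y τ * ∑ σ, a τ σ * ‖v σ‖ :=
          Finset.sum_le_sum fun τ _ => mul_le_mul_of_nonneg_left (hk' τ) (hy τ)
      _ = ∑ σ, (∑ τ, y τ * a τ σ) * ‖v σ‖ := by
          simp_rw [Finset.mul_sum, Finset.sum_mul]
          rw [Finset.sum_comm]
          exact Finset.sum_congr rfl fun _ _ => Finset.sum_congr rfl fun _ _ => by ring
      _ ≤ ∑ σ, μ * y σ * ‖v σ‖ :=
          Finset.sum_le_sum fun σ _ => mul_le_mul_of_nonneg_right (h σ) (norm_nonneg _)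
      _ = μ * ∑ τ, y τ * ‖v τ‖ := by
          rw [Finset.mul_sum]; exact Finset.sum_congr rfl fun _ _ => by ring
  have hnn : 0 ≤ ∑ τ, y τ * ‖v τ‖ :=
    Finset.sum_nonneg fun τ _ => mul_nonneg (hy τ) (norm_nonneg _)
  have hle : ‖k‖ ≤ μ := by
    rcases hnn.lt_or_eq with hpos | hzero
    · exact le_of_mul_le_mul_right main hpos
    · have hz : ∀ σ, y σ * ‖v σ‖ = 0 := fun σ =>
        (Finset.sum_eq_zero_iff_of_nonneg fun τ _ => mul_nonneg (hy τ) (norm_nonneg _)).1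
          hzero.symm σ (Finset.mem_univ _)
      obtain ⟨τ, hτ⟩ := Function.ne_iff.1 hv
      have h2 : ∑ σ, a τ σ * ‖v σ‖ = 0 := Finset.sum_eq_zero fun σ _ => by
        rcases mul_eq_zero.1 (hz σ) with h3 | h3
        · rw [h0 σ h3, zero_mul]
        · rw [h3, mul_zero]
      have h3 := hk' τ
      rw [h2] at h3
      have h4 : 0 < ‖v τ‖ := norm_pos_iff.2 hτ
      have : ‖k‖ ≤ 0 := by
        by_contra hcon
        push Not at hcon
        exact absurd h3 (not_le.2 (mul_pos hcon h4))
      exact this.trans hμ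
  rw [← ENNReal.ofReal_coe_nnreal, coe_nnnorm]
  exact ENNReal.ofReal_le_ofReal hle

theorem Matrix.spectralRadius_ne_top (A : Matrix S S ℂ) : spectralRadius ℂ A ≠ ⊤ := by
  let := Matrix.linftyOpNormedRing (n := S) (α := ℂ)
  let := Matrix.linftyOpNormedAlgebra (n := S) (R := ℂ) (α := ℂ)
  cases isEmpty_or_nonempty S
  · rw [spectralRadius]
    simp
  · exact ne_top_of_le_ne_top ENNReal.coe_ne_top (spectrum.spectralRadius_le_nnnorm A)

/-- The powers of the spectral radius are bounded by the sum of the entries of the powers. -/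
theorem Matrix.spectralRadius_toReal_pow_le (a : Matrix S S ℝ) (ha : ∀ τ σ, 0 ≤ a τ σ)
    (A : Matrix S S ℂ) (hA : ∀ τ σ, A τ σ = (a τ σ : ℂ)) (m : ℕ) (hm : m ≠ 0) :
    (spectralRadius ℂ A).toReal ^ m ≤ ∑ τ, ∑ σ, (a ^ m) τ σ := by
  let := Matrix.linftyOpNormedRing (n := S) (α := ℂ)
  let := Matrix.linftyOpNormedAlgebra (n := S) (R := ℂ) (α := ℂ)
  have hAm : A ^ m = (a ^ m).map Complex.ofRealHom := by
    have : A = a.map Complex.ofRealHom := by ext i j; simp [hA]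
    rw [this, Matrix.map_pow]
  have hnn : ∀ m τ σ, 0 ≤ (a ^ m) τ σ := by
    intro m
    induction m with
    | zero => intro τ σ; rw [pow_zero, Matrix.one_apply]; split_ifs <;> norm_num
    | succ m ih =>
      intro τ σ
      rw [pow_succ, Matrix.mul_apply]
      exact Finset.sum_nonneg fun i _ => mul_nonneg (ih _ _) (ha _ _)
  rcases isEmpty_or_nonempty S with hS | hS
  · simp [spectralRadius, hm]
  · rw [← ENNReal.toReal_pow]
    have h1 : spectralRadius ℂ A ^ m ≤ (‖A ^ m‖₊ : ENNReal) :=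
      (spectrum.spectralRadius_pow_le A m hm).trans (spectrum.spectralRadius_le_nnnorm _)
    refine (ENNReal.toReal_mono ENNReal.coe_ne_top h1).trans ?_
    rw [ENNReal.coe_toReal, coe_nnnorm, Matrix.linfty_opNorm_def]
    obtain ⟨τ, -, hτ⟩ := Finset.exists_mem_eq_sup (Finset.univ : Finset S) Finset.univ_nonempty
      (fun i => ∑ j, ‖(A ^ m) i j‖₊)
    rw [hτ]
    push_cast
    have : ∀ σ, ‖(A ^ m) τ σ‖ = (a ^ m) τ σ := fun σ => by
      rw [hAm]; simp [abs_of_nonneg (hnn m τ σ)]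
    simp_rw [this]
    exact Finset.single_le_sum (f := fun τ => ∑ σ, (a ^ m) τ σ)
      (fun i _ => Finset.sum_nonneg fun j _ => hnn m i j) (Finset.mem_univ τ)

/-- Lower Collatz–Wielandt bound for a non-negative matrix. -/
theorem Matrix.le_spectralRadius_toReal_of_weight (a : Matrix S S ℝ) (ha : ∀ τ σ, 0 ≤ a τ σ)
    (A : Matrix S S ℂ) (hA : ∀ τ σ, A τ σ = (a τ σ : ℂ)) (y : S → ℝ) (hy : ∀ σ, 0 ≤ y σ)
    {μ : ℝ} (hμ : 0 < μ) (h : ∀ σ, μ * y σ ≤ ∑ τ, y τ * a τ σ)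
    (h0 : ∃ σ, 0 < y σ) : μ ≤ (spectralRadius ℂ A).toReal := by
  let := Matrix.linftyOpNormedRing (n := S) (α := ℂ)
  let := Matrix.linftyOpNormedAlgebra (n := S) (R := ℂ) (α := ℂ)
  obtain ⟨σ₀, hσ₀⟩ := h0
  have hpow : ∀ m σ, μ ^ m * y σ ≤ ∑ τ, y τ * (a ^ m) τ σ := by
    intro m
    induction m with
    | zero => intro σ; simp [Matrix.one_apply]
    | succ m ih =>
      intro σ
      calc μ ^ (m + 1) * y σ = μ ^ m * (μ * y σ) := by ring
        _ ≤ μ ^ m * ∑ τ, y τ * a τ σ := mul_le_mul_of_nonneg_left (h σ) (by positivity)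
        _ = ∑ τ, (μ ^ m * y τ) * a τ σ := by
            rw [Finset.mul_sum]; exact Finset.sum_congr rfl fun _ _ => by ring
        _ ≤ ∑ τ, (∑ ρ, y ρ * (a ^ m) ρ τ) * a τ σ :=
            Finset.sum_le_sum fun τ _ => mul_le_mul_of_nonneg_right (ih τ) (ha _ _)
        _ = ∑ τ, y τ * (a ^ (m + 1)) τ σ := by
            simp_rw [pow_succ, Matrix.mul_apply, Finset.mul_sum, Finset.sum_mul]
            rw [Finset.sum_comm]
            exact Finset.sum_congr rfl fun _ _ => Finset.sum_congr rfl fun _ _ => by ring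
  set B : ℝ := ∑ τ, y τ with hB
  have hBpos : 0 < B := hσ₀.trans_le
    (Finset.single_le_sum (f := y) (fun i _ => hy i) (Finset.mem_univ σ₀))
  have hnorm : ∀ m, μ ^ m * (y σ₀ / B) ≤ ‖A ^ m‖ := by
    intro m
    have hAm : A ^ m = (a ^ m).map Complex.ofRealHom := by
      have : A = a.map Complex.ofRealHom := by ext i j; simp [hA]
      rw [this, Matrix.map_pow]
    have hent : ∀ τ, (a ^ m) τ σ₀ ≤ ‖A ^ m‖ := fun τ => by
      rw [Matrix.linfty_opNorm_def]
      have h1 : (∑ j, ‖(A ^ m) τ j‖₊) ≤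
          Finset.univ.sup fun i => ∑ j, ‖(A ^ m) i j‖₊ :=
        Finset.le_sup (f := fun i => ∑ j, ‖(A ^ m) i j‖₊) (Finset.mem_univ τ)
      have h2 : ‖(A ^ m) τ σ₀‖₊ ≤ ∑ j, ‖(A ^ m) τ j‖₊ :=
        Finset.single_le_sum (f := fun j => ‖(A ^ m) τ j‖₊) (fun _ _ => zero_le)
          (Finset.mem_univ σ₀)
      have h3 : ‖(A ^ m) τ σ₀‖ ≤
          ((Finset.univ.sup fun i => ∑ j, ‖(A ^ m) i j‖₊ : NNReal) : ℝ) := by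
        exact_mod_cast h2.trans h1
      refine le_trans ?_ h3
      rw [hAm]
      simpa using le_abs_self _
    rw [mul_div_assoc', div_le_iff₀ hBpos]
    calc μ ^ m * y σ₀ ≤ ∑ τ, y τ * (a ^ m) τ σ₀ := hpow m σ₀
      _ ≤ ∑ τ, y τ * ‖A ^ m‖ :=
          Finset.sum_le_sum fun τ _ => mul_le_mul_of_nonneg_left (hent τ) (hy τ)
      _ = ‖A ^ m‖ * B := by rw [← Finset.sum_mul, mul_comm]
  have hlim := spectrum.pow_norm_pow_one_div_tendsto_nhds_spectralRadius A
  have hlim2 : Tendsto (fun m : ℕ => ENNReal.ofReal ((μ ^ m * (y σ₀ / B)) ^ (1 / (m : ℝ))))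
      atTop (nhds (ENNReal.ofReal μ)) := by
    refine ENNReal.tendsto_ofReal ?_
    have hc : 0 < y σ₀ / B := div_pos hσ₀ hBpos
    have h1 : Tendsto (fun m : ℕ => μ * (y σ₀ / B) ^ (1 / (m : ℝ))) atTop (nhds (μ * 1)) := by
      refine Tendsto.const_mul _ ?_
      have := (Real.continuousAt_const_rpow hc.ne' (b := 0)).tendsto.comp
        (tendsto_one_div_atTop_nhds_zero_nat (𝕜 := ℝ))
      simpa [Function.comp_def] using this
    rw [mul_one] at h1
    refine h1.congr' ?_
    filter_upwards [eventually_ge_atTop 1] with m hm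
    have hm0 : (m : ℝ) ≠ 0 := by positivity
    rw [Real.mul_rpow (by positivity) hc.le, ← Real.rpow_natCast μ m, ← Real.rpow_mul hμ.le,
      mul_one_div_cancel hm0, Real.rpow_one]
  have hle : ENNReal.ofReal μ ≤ spectralRadius ℂ A := by
    refine le_of_tendsto_of_tendsto' hlim2 hlim fun m => ENNReal.ofReal_le_ofReal ?_
    exact Real.rpow_le_rpow (by positivity) (hnorm m) (by positivity)
  have := ENNReal.toReal_mono (Matrix.spectralRadius_ne_top A) hle
  rwa [ENNReal.toReal_ofReal hμ.le] at this

end MatrixBounds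


/-! ### Columns and their cut states -/

section ColumnModel

variable {V ι : Type*}

/-- `v` and `w` are joined by a path in `G` all of whose vertices are occupied in `O`. -/
def OccLinked (G : SimpleGraph V) (O : V → Bool) (v w : V) : Prop :=
  (SimpleGraph.fromRel fun a b => G.Adj a b ∧ O a = true ∧ O b = true).Reachable v w

namespace OccLinked

variable {G : SimpleGraph V} {O : V → Bool} {u v w : V}

theorem refl (v : V) : OccLinked G O v v := SimpleGraph.Reachable.refl v

theorem symm (h : OccLinked G O v w) : OccLinked G O w v := SimpleGraph.Reachable.symm h

theorem trans (h : OccLinked G O u v) (h' : OccLinked G O v w) : OccLinked G O u w :=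
  SimpleGraph.Reachable.trans h h'

theorem of_adj (h : G.Adj v w) (hv : O v = true) (hw : O w = true) : OccLinked G O v w :=
  SimpleGraph.Adj.reachable (by
    rw [SimpleGraph.fromRel_adj]
    exact ⟨h.ne, Or.inl ⟨h, hv, hw⟩⟩)

/-- A property that spreads along edges between occupied vertices spreads along paths. -/
theorem induct (p : V → Prop) (hp : ∀ a b, G.Adj a b → O a = true → O b = true → p a → p b)
    (h : OccLinked G O v w) (hv : p v) : p w := by
  obtain ⟨q⟩ := h
  induction q with
  | nil => exact hv
  | cons hadj _ ih =>
    rw [SimpleGraph.fromRel_adj] at hadj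
    rcases hadj.2 with h | h
    · exact ih (hp _ _ h.1 h.2.1 h.2.2 hv)
    · exact ih (hp _ _ h.1.symm h.2.2 h.2.1 hv)

theorem occ (h : OccLinked G O v w) (hv : O v = true) : O w = true :=
  h.induct (fun x => O x = true) (fun _ _ _ _ hb _ => hb) hv

theorem eq_of_not_occ (h : OccLinked G O v w) (hv : O v = false) : v = w :=
  (h.induct (fun x => x = v) (fun a b _ ha _ hav => by
    rw [hav, hv] at ha; exact absurd ha (by simp)) rfl).symm

end OccLinked

/-- A cut state `c` describes two consecutive columns `σ`, `τ` along the cycle: `(c i).1` says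
whether the `i`-th cycle vertex of `τ` is occupied; if it is, then `(c i).2` says whether the
`i`-th cycle vertex of `σ` is fixed, and otherwise whether it is occupied. -/
abbrev CutState (ι : Type*) := ι → Bool × Bool

/-- Some fixed vertex has an occupied right neighbour. -/
def CutState.Live (c : CutState ι) : Prop := ∃ i, c i = (true, true)

/-- The column with occupied set `O`, preceded as described by `c`, may be followed by a column
whose occupied cycle vertices are given by `p`. -/
def ColumnOk (D : Bool) (G : SimpleGraph V) (vert : ι → V) (c : CutState ι) (O : V → Bool)
    (p : ι → Bool) : Prop :=
  (∀ v, O v = true → ∃ i, OccLinked G O v (vert i) ∧ (c i = (true, true) ∨ p i = true)) ∧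
  (D = true → ∀ v, O v = false →
    (∃ w, G.Adj v w ∧ O w = true) ∨ ∃ i, v = vert i ∧ (c i = (false, true) ∨ p i = true))

open Classical in
/-- The next cut state. -/
noncomputable def nextCut (G : SimpleGraph V) (vert : ι → V) (c : CutState ι) (O : V → Bool)
    (p : ι → Bool) : CutState ι := fun i =>
  (p i, if p i = true then decide (∃ j, c j = (true, true) ∧ OccLinked G O (vert i) (vert j))
    else O (vert i))

open Classical in
/-- The transfer operator on functions of cut states. -/
noncomputable def cutTransfer [Fintype V] [Fintype ι] (D : Bool) (G : SimpleGraph V) (vert : ι → V)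
    (z : CutState ι → ℝ) (c : CutState ι) : ℝ :=
  ∑ O : V → Bool, ∑ p : ι → Bool,
    if (∀ i, O (vert i) = (c i).1) ∧ ColumnOk D G vert c O p then z (nextCut G vert c O p) else 0

/-- The common features of the two transfer matrices: every state `σ` has a set of occupied, a set
of fixed and a set of undominated vertices, and the relation between the states is determined by
them. -/
structure ColumnModel (G : SimpleGraph V) (vert : ι → V) (D : Bool) (S : Type*) where
  rel : S → S → Prop
  occ : S → V → Bool
  fix : S → V → Prop
  und : S → V → Prop
  ext_state : ∀ σ τ, occ σ = occ τ → fix σ = fix τ → und σ = und τ → σ = τ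
  fix_iff : ∀ σ τ, rel σ τ → ∀ v, fix τ v ↔
    occ τ v = true ∧ ∃ i, fix σ (vert i) ∧ OccLinked G (occ τ) v (vert i)
  und_iff : ∀ σ τ, rel σ τ → ∀ v, und τ v ↔ D = true ∧ occ τ v = false ∧
    (∀ w, G.Adj v w → occ τ w = false) ∧ ∀ i, v = vert i → occ σ v = false
  loose_continues : ∀ σ τ, rel σ τ → ∀ v, occ σ v = true → ¬ fix σ v →
    ∃ i, OccLinked G (occ σ) v (vert i) ∧ occ τ (vert i) = true
  und_continues : ∀ σ τ, rel σ τ → ∀ v, und σ v → ∃ i, v = vert i ∧ occ τ (vert i) = true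
  fix_continues : ∀ σ τ, rel σ τ → ∃ i, fix σ (vert i) ∧ occ τ (vert i) = true
  exists_rel : ∀ σ O,
    (∀ v, occ σ v = true → ¬ fix σ v →
      ∃ i, OccLinked G (occ σ) v (vert i) ∧ O (vert i) = true) →
    (∀ v, und σ v → ∃ i, v = vert i ∧ O (vert i) = true) →
    (∃ i, fix σ (vert i) ∧ O (vert i) = true) → ∃ τ, rel σ τ ∧ occ τ = O
  fix_occ : ∀ σ v, fix σ v → occ σ v = true
  exists_full : ∃ σ, ∀ v, occ σ v = true ∧ fix σ v ∧ ¬ und σ v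

namespace ColumnModel

variable {G : SimpleGraph V} {vert : ι → V} {D : Bool} {S : Type*}
  (m : ColumnModel G vert D S)

/-- The state `σ` may be followed by a column whose occupied cycle vertices are given by `p`. -/
def Valid (σ : S) (p : ι → Bool) : Prop :=
  (∀ v, m.occ σ v = true → ¬ m.fix σ v →
    ∃ i, OccLinked G (m.occ σ) v (vert i) ∧ p i = true) ∧
  (∀ v, m.und σ v → ∃ i, v = vert i ∧ p i = true) ∧
  ∃ i, m.fix σ (vert i) ∧ p i = true

open Classical in
/-- The cut state of `σ` and the occupied cycle vertices of the next column. -/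
noncomputable def cut (σ : S) (p : ι → Bool) : CutState ι := fun i =>
  (p i, if p i = true then decide (m.fix σ (vert i)) else m.occ σ (vert i))

theorem valid_of_rel {σ τ : S} (h : m.rel σ τ) : m.Valid σ (fun i => m.occ τ (vert i)) :=
  ⟨m.loose_continues σ τ h, m.und_continues σ τ h, m.fix_continues σ τ h⟩

theorem exists_rel_of_valid {σ : S} {O : V → Bool} (h : m.Valid σ (fun i => O (vert i))) :
    ∃ τ, m.rel σ τ ∧ m.occ τ = O :=
  m.exists_rel σ O h.1 h.2.1 h.2.2

theorem eq_of_rel {σ τ τ' : S} (h : m.rel σ τ) (h' : m.rel σ τ') (ho : m.occ τ = m.occ τ') :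
    τ = τ' := by
  refine m.ext_state τ τ' ho ?_ ?_
  · ext v
    rw [m.fix_iff σ τ h, m.fix_iff σ τ' h', ho]
  · ext v
    rw [m.und_iff σ τ h, m.und_iff σ τ' h', ho]

theorem cut_eq_tt {σ : S} {p : ι → Bool} {i : ι} :
    m.cut σ p i = (true, true) ↔ p i = true ∧ m.fix σ (vert i) := by
  unfold cut
  by_cases h : p i = true <;> simp [h]

theorem cut_eq_ft {σ : S} {p : ι → Bool} {i : ι} :
    m.cut σ p i = (false, true) ↔ p i = false ∧ m.occ σ (vert i) = true := by
  unfold cut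
  by_cases h : p i = true <;> simp [h]

theorem live_cut_iff {σ : S} {p : ι → Bool} :
    (m.cut σ p).Live ↔ ∃ i, m.fix σ (vert i) ∧ p i = true := by
  simp only [CutState.Live, cut_eq_tt]
  exact exists_congr fun i => and_comm

theorem fix_iff_cut {σ τ : S} (h : m.rel σ τ) (v : V) : m.fix τ v ↔ m.occ τ v = true ∧
    ∃ j, m.cut σ (fun i => m.occ τ (vert i)) j = (true, true) ∧
      OccLinked G (m.occ τ) v (vert j) := by
  rw [m.fix_iff σ τ h]
  refine and_congr_right fun hv => exists_congr fun i => ?_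
  rw [cut_eq_tt]
  constructor
  · rintro ⟨h1, h2⟩
    exact ⟨⟨h2.occ hv, h1⟩, h2⟩
  · rintro ⟨⟨_, h1⟩, h2⟩
    exact ⟨h1, h2⟩

theorem cut_eq_nextCut {σ τ : S} (h : m.rel σ τ) (p : ι → Bool) :
    m.cut τ p = nextCut G vert (m.cut σ fun i => m.occ τ (vert i)) (m.occ τ) p := by
  funext i
  unfold nextCut
  rw [cut]
  by_cases hp : p i = true
  · simp only [hp, if_true, Prod.mk.injEq, true_and, decide_eq_decide]
    rw [m.fix_iff_cut h]
    constructor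
    · rintro ⟨_, h1⟩; exact h1
    · rintro ⟨j, h1, h2⟩
      refine ⟨?_, j, h1, h2⟩
      rw [cut_eq_tt] at h1
      exact h2.symm.occ h1.1
  · simp [hp]

theorem valid_iff_columnOk {σ τ : S} (h : m.rel σ τ) (p : ι → Bool) :
    m.Valid τ p ↔ ColumnOk D G vert (m.cut σ fun i => m.occ τ (vert i)) (m.occ τ) p ∧
      (m.cut τ p).Live := by
  rw [live_cut_iff]
  unfold Valid ColumnOk
  rw [and_assoc]
  refine and_congr ?_ (and_congr ?_ Iff.rfl)
  · refine forall_congr' fun v => imp_congr_right fun hv => ?_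
    rw [m.fix_iff_cut h]
    constructor
    · intro h1
      by_cases h2 : ∃ j, m.cut σ (fun i => m.occ τ (vert i)) j = (true, true) ∧
          OccLinked G (m.occ τ) v (vert j)
      · obtain ⟨j, h3, h4⟩ := h2
        exact ⟨j, h4, Or.inl h3⟩
      · obtain ⟨i, h3, h4⟩ := h1 fun h5 => h2 h5.2
        exact ⟨i, h3, Or.inr h4⟩
    · rintro ⟨i, h1, h2 | h2⟩ h3
      · exact absurd ⟨hv, i, h2, h1⟩ h3
      · exact ⟨i, h1, h2⟩
  · constructor
    · intro h1 hD v hv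
      by_cases h2 : ∃ w, G.Adj v w ∧ m.occ τ w = true
      · exact Or.inl h2
      · refine Or.inr ?_
        by_cases h3 : m.und τ v
        · obtain ⟨i, h4, h5⟩ := h1 v h3
          exact ⟨i, h4, Or.inr h5⟩
        · rw [m.und_iff σ τ h] at h3
          push Not at h3 h2
          obtain ⟨i, h4, h5⟩ := h3 hD hv fun w hw => by simpa using h2 w hw
          refine ⟨i, h4, Or.inl (m.cut_eq_ft.2 ⟨h4 ▸ hv, ?_⟩)⟩
          rw [← h4]; simpa using h5
    · intro h1 v hv
      rw [m.und_iff σ τ h] at hv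
      obtain ⟨hD, h2, h3, h4⟩ := hv
      rcases h1 hD v h2 with ⟨w, h5, h6⟩ | ⟨i, h5, h6 | h6⟩
      · rw [h3 w h5] at h6; simp at h6
      · rw [cut_eq_ft, ← h5, h4 i h5] at h6
        simp at h6
      · exact ⟨i, h5, h6⟩

variable [Fintype V] [Fintype ι] [Fintype S]

open Classical in
/-- The weight of a state that is induced by a function of cut states. -/
noncomputable def weight (z : CutState ι → ℝ) (σ : S) : ℝ :=
  ∑ p : ι → Bool, if m.Valid σ p then z (m.cut σ p) else 0

open Classical in
theorem sum_weight_rel (z : CutState ι → ℝ) (hz : ∀ c, ¬ c.Live → z c = 0) (σ : S)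
    [DecidableRel m.rel] :
    ∑ τ, (m.weight z τ * if m.rel σ τ then 1 else 0) =
      ∑ p : ι → Bool, if m.Valid σ p then cutTransfer D G vert z (m.cut σ p) else 0 := by
  classical
  simp only [mul_ite, mul_one, mul_zero]
  rw [← Finset.sum_filter]
  have hR : ∀ p : ι → Bool, (if m.Valid σ p then cutTransfer D G vert z (m.cut σ p) else 0) =
      ∑ O : V → Bool, if (fun i => O (vert i)) = p then (if m.Valid σ p then
        ∑ q : ι → Bool, if ColumnOk D G vert (m.cut σ p) O q then
          z (nextCut G vert (m.cut σ p) O q) else 0 else 0) else 0 := by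
    intro p
    by_cases hp : m.Valid σ p
    · simp only [hp, if_true, cutTransfer]
      refine Finset.sum_congr rfl fun O _ => ?_
      by_cases hO : (fun i => O (vert i)) = p
      · have : ∀ i, O (vert i) = (m.cut σ p i).1 := fun i => congrFun hO i
        rw [if_pos hO]
        exact Finset.sum_congr rfl fun q _ => if_congr (and_iff_right this) rfl rfl
      · have : ¬ ∀ i, O (vert i) = (m.cut σ p i).1 := fun h => hO (funext h)
        rw [if_neg hO]
        exact Finset.sum_eq_zero fun q _ => if_neg fun h => this h.1
    · simp [hp]
  simp_rw [hR]
  rw [Finset.sum_comm]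
  have hL : ∀ O : V → Bool, (∑ p : ι → Bool, if (fun i => O (vert i)) = p then
      (if m.Valid σ p then ∑ q : ι → Bool, if ColumnOk D G vert (m.cut σ p) O q then
        z (nextCut G vert (m.cut σ p) O q) else 0 else 0) else 0) =
      if m.Valid σ (fun i => O (vert i)) then
        ∑ q : ι → Bool, if ColumnOk D G vert (m.cut σ fun i => O (vert i)) O q then
          z (nextCut G vert (m.cut σ fun i => O (vert i)) O q) else 0 else 0 := fun O => by
    rw [Finset.sum_ite_eq]
    simp
  simp_rw [hL]
  rw [← Finset.sum_filter]
  refine Finset.sum_nbij m.occ ?_ ?_ ?_ ?_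
  · intro τ hτ
    simp only [Finset.mem_filter, Finset.mem_univ, true_and] at hτ ⊢
    exact m.valid_of_rel hτ
  · intro τ hτ τ' hτ' ho
    simp only [Finset.coe_filter, Finset.mem_univ, true_and, Set.mem_ofPred_eq] at hτ hτ'
    exact m.eq_of_rel hτ hτ' ho
  · intro O hO
    simp only [Finset.coe_filter, Finset.mem_univ, true_and, Set.mem_ofPred_eq] at hO
    obtain ⟨τ, h1, h2⟩ := m.exists_rel_of_valid hO
    exact ⟨τ, by simpa using h1, h2⟩
  · intro τ hτ
    simp only [Finset.mem_filter, Finset.mem_univ, true_and] at hτ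
    unfold weight
    refine Finset.sum_congr rfl fun p _ => ?_
    rw [m.cut_eq_nextCut hτ p]
    by_cases hl : (m.cut τ p).Live
    · have h1 : m.Valid τ p ↔ ColumnOk D G vert (m.cut σ fun i => m.occ τ (vert i)) (m.occ τ) p := by
        rw [m.valid_iff_columnOk hτ p]; exact and_iff_left hl
      simp [h1]
    · rw [← m.cut_eq_nextCut hτ p, hz _ hl]
      simp

variable [DecidableEq S]

theorem spectralRadius_toReal_le [DecidableRel m.rel] {A : Matrix S S ℂ}
    (hA : ∀ τ σ, A τ σ = if m.rel σ τ then 1 else 0)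
    (z : CutState ι → ℝ) (hz0 : ∀ c, ¬ c.Live → z c = 0) (hz1 : ∀ c : CutState ι, c.Live → 0 < z c)
    {μ : ℝ} (hμ : 0 ≤ μ) (h : ∀ c : CutState ι, c.Live → cutTransfer D G vert z c ≤ μ * z c) :
    (spectralRadius ℂ A).toReal ≤ μ := by
  classical
  have hz : ∀ c, 0 ≤ z c := fun c => by
    by_cases hc : c.Live
    · exact (hz1 c hc).le
    · exact (hz0 c hc).ge
  have hnn : ∀ σ p, 0 ≤ if m.Valid σ p then z (m.cut σ p) else 0 := fun σ p => by
    split_ifs <;> simp [hz]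
  refine Matrix.spectralRadius_toReal_le_of_weight (fun τ σ => if m.rel σ τ then 1 else 0)
    (fun τ σ => by split_ifs <;> norm_num) A (fun τ σ => by rw [hA]; split_ifs <;> simp)
    (m.weight z) (fun σ => Finset.sum_nonneg fun p (_ : p ∈ Finset.univ) => hnn σ p) hμ ?_ ?_
  · intro σ
    rw [m.sum_weight_rel z hz0 σ, weight, Finset.mul_sum]
    refine Finset.sum_le_sum fun p _ => ?_
    by_cases hp : m.Valid σ p
    · simp only [hp, if_true]
      exact h _ (m.live_cut_iff.2 hp.2.2)
    · simp [hp]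
  · intro σ hσ τ
    by_contra hne
    have hrel : m.rel σ τ := by
      by_contra hr
      exact hne (if_neg hr)
    have hv := m.valid_of_rel hrel
    have hpos := hz1 _ (m.live_cut_iff.2 hv.2.2)
    rw [weight, Finset.sum_eq_zero_iff_of_nonneg (fun p _ => hnn σ p)] at hσ
    have := hσ _ (Finset.mem_univ (fun i => m.occ τ (vert i)))
    rw [if_pos hv] at this
    exact hpos.ne' this

theorem le_spectralRadius_toReal [Nonempty ι] [DecidableRel m.rel] {A : Matrix S S ℂ}
    (hA : ∀ τ σ, A τ σ = if m.rel σ τ then 1 else 0)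
    (z : CutState ι → ℝ) (hz : ∀ c, 0 ≤ z c) (hz0 : ∀ c, ¬ c.Live → z c = 0)
    (hz1 : 0 < z fun _ => (true, true))
    {μ : ℝ} (hμ : 0 < μ) (h : ∀ c : CutState ι, c.Live → μ * z c ≤ cutTransfer D G vert z c) :
    μ ≤ (spectralRadius ℂ A).toReal := by
  classical
  have hnn : ∀ σ p, 0 ≤ if m.Valid σ p then z (m.cut σ p) else 0 := fun σ p => by
    split_ifs <;> simp [hz]
  refine Matrix.le_spectralRadius_toReal_of_weight (fun τ σ => if m.rel σ τ then 1 else 0)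
    (fun τ σ => by split_ifs <;> norm_num) A (fun τ σ => by rw [hA]; split_ifs <;> simp)
    (m.weight z) (fun σ => Finset.sum_nonneg fun p (_ : p ∈ Finset.univ) => hnn σ p) hμ ?_ ?_
  · intro σ
    rw [m.sum_weight_rel z hz0 σ, weight, Finset.mul_sum]
    refine Finset.sum_le_sum fun p _ => ?_
    by_cases hp : m.Valid σ p
    · simp only [hp, if_true]
      exact h _ (m.live_cut_iff.2 hp.2.2)
    · simp [hp]
  · obtain ⟨σ, hσ⟩ := m.exists_full
    refine ⟨σ, ?_⟩
    have hv : m.Valid σ fun _ => true :=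
      ⟨fun v _ h2 => absurd (hσ v).2.1 h2, fun v h2 => absurd h2 (hσ v).2.2,
        Classical.arbitrary ι, (hσ _).2.1, rfl⟩
    have hc : m.cut σ (fun _ => true) = fun _ => (true, true) := by
      funext i
      exact m.cut_eq_tt.2 ⟨rfl, (hσ _).2.1⟩
    refine lt_of_lt_of_le ?_ (Finset.single_le_sum (fun p _ => hnn σ p)
      (Finset.mem_univ fun _ => true))
    rw [if_pos hv, hc]
    exact hz1

end ColumnModel

end ColumnModel


/-! ### The two transfer matrices -/

namespace CycleIn

variable {V : Type*} {M : SimpleGraph V} {ℓ : ℕ} [NeZero ℓ] (C : CycleIn M ℓ)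

/-- The occupied vertices of a column. -/
def cellOcc (σ : V → Cell) (v : V) : Bool := decide (σ v ≠ Cell.empty)

theorem cellOcc_eq_true {σ : V → Cell} {v : V} : cellOcc σ v = true ↔ σ v ≠ Cell.empty := by
  simp [cellOcc]

theorem cellOcc_eq_false {σ : V → Cell} {v : V} : cellOcc σ v = false ↔ σ v = Cell.empty := by
  simp [cellOcc]

theorem linked_iff {σ : V → Cell} {v w : V} :
    C.Linked σ v w ↔ OccLinked C.column (cellOcc σ) v w := by
  simp only [Linked, OccLinked, cellOcc_eq_true]

/-- Every vertex of an occupied set is fixed if it is linked to a continued fixed vertex of the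
previous column, and loose otherwise. -/
noncomputable def nextColumn (F : V → Prop) (O : V → Bool) (v : V) : Cell :=
  open Classical in
  if O v = true then
    if ∃ i, F (C.vert i) ∧ OccLinked C.column O v (C.vert i) then .fixed else .loose
  else .empty

theorem cellOcc_nextColumn (F : V → Prop) (O : V → Bool) : cellOcc (C.nextColumn F O) = O := by
  funext v
  unfold cellOcc nextColumn
  cases h : O v
  · simp
  · simp only [if_true]; split_ifs <;> simp

theorem nextColumn_eq_fixed {F : V → Prop} {O : V → Bool} {v : V} :
    C.nextColumn F O v = .fixed ↔
      O v = true ∧ ∃ i, F (C.vert i) ∧ OccLinked C.column O v (C.vert i) := by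
  unfold nextColumn
  cases h : O v
  · simp
  · simp

theorem isState_nextColumn {F : V → Prop} {O : V → Bool}
    (h : ∃ i, F (C.vert i) ∧ O (C.vert i) = true) : C.IsState (C.nextColumn F O) := by
  obtain ⟨i, h1, h2⟩ := h
  refine ⟨⟨C.vert i, C.nextColumn_eq_fixed.2 ⟨h2, i, h1, OccLinked.refl _⟩⟩, ?_⟩
  intro v w hvw hv hw
  obtain ⟨h3, j, h4, h5⟩ := C.nextColumn_eq_fixed.1 hv
  have hwO : O w = true := by
    have : cellOcc (C.nextColumn F O) w = true := cellOcc_eq_true.2 (by simp [hw])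
    rwa [cellOcc_nextColumn] at this
  have : C.nextColumn F O w = .fixed :=
    C.nextColumn_eq_fixed.2 ⟨hwO, j, h4, (OccLinked.of_adj hvw h3 hwO).symm.trans h5⟩
  rw [hw] at this
  exact absurd this (by simp)

theorem fixed_iff_of_precedes {σ τ : V → Cell} (h : C.Precedes σ τ) (v : V) :
    τ v = .fixed ↔ cellOcc τ v = true ∧
      ∃ i, σ (C.vert i) = .fixed ∧ OccLinked C.column (cellOcc τ) v (C.vert i) := by
  rw [cellOcc_eq_true]
  constructor
  · intro hv
    have h1 : τ v ≠ .empty := by simp [hv]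
    obtain ⟨i, h2, h3⟩ := (h.fixed_iff v h1).1 hv
    exact ⟨h1, i, h2, (C.linked_iff).1 h3⟩
  · rintro ⟨h1, i, h2, h3⟩
    exact (h.fixed_iff v h1).2 ⟨i, h2, (C.linked_iff).2 h3⟩

theorem loose_continues_of_precedes {σ τ : V → Cell} (h : C.Precedes σ τ) (v : V)
    (hv : cellOcc σ v = true) (hf : σ v ≠ .fixed) :
    ∃ i, OccLinked C.column (cellOcc σ) v (C.vert i) ∧ cellOcc τ (C.vert i) = true := by
  have : σ v = .loose := by
    rw [cellOcc_eq_true] at hv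
    cases hs : σ v <;> simp_all
  obtain ⟨i, h1, h2⟩ := h.loose_continues v this
  exact ⟨i, (C.linked_iff).1 h1, cellOcc_eq_true.2 h2⟩

theorem exists_fixed_of_precedes {σ τ : V → Cell} (h : C.Precedes σ τ) (hτ : C.IsState τ) :
    ∃ i, σ (C.vert i) = .fixed ∧ cellOcc τ (C.vert i) = true := by
  obtain ⟨v, hv⟩ := hτ.1
  obtain ⟨h1, i, h2, h3⟩ := (C.fixed_iff_of_precedes h v).1 hv
  exact ⟨i, h2, h3.occ h1⟩

theorem precedes_nextColumn {σ : V → Cell} {O : V → Bool}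
    (h : ∀ v, cellOcc σ v = true → σ v ≠ .fixed →
      ∃ i, OccLinked C.column (cellOcc σ) v (C.vert i) ∧ O (C.vert i) = true) :
    C.Precedes σ (C.nextColumn (fun v => σ v = .fixed) O) := by
  constructor
  · intro v hv
    have hO : O v = true := by
      have := cellOcc_eq_true.2 hv
      rwa [cellOcc_nextColumn] at this
    rw [nextColumn_eq_fixed, and_iff_right hO]
    simp_rw [linked_iff, cellOcc_nextColumn]
  · intro v hv
    obtain ⟨i, h1, h2⟩ := h v (cellOcc_eq_true.2 (by simp [hv])) (by simp [hv])
    refine ⟨i, (C.linked_iff).2 h1, cellOcc_eq_true.1 ?_⟩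
    rwa [cellOcc_nextColumn]

theorem Cell.eq_of_occ_of_fixed {σ τ : V → Cell} (ho : cellOcc σ = cellOcc τ)
    (hf : (fun v => σ v = .fixed) = fun v => τ v = .fixed) : σ = τ := by
  funext v
  have h1 := congrFun ho v
  have h2 := congrFun hf v
  cases h3 : σ v <;> cases h4 : τ v <;> simp_all [cellOcc]

/-- The transfer matrix for connected sets as a column model. -/
def connModel : ColumnModel C.column C.vert false C.State where
  rel σ τ := C.Precedes σ.1 τ.1
  occ σ := cellOcc σ.1
  fix σ v := σ.1 v = .fixed
  und _ _ := False
  ext_state σ τ ho hf _ := Subtype.ext (Cell.eq_of_occ_of_fixed ho hf)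
  fix_iff _ _ h := C.fixed_iff_of_precedes h
  und_iff := by simp
  loose_continues _ _ h := C.loose_continues_of_precedes h
  und_continues := by simp
  fix_continues _ τ h := C.exists_fixed_of_precedes h τ.2
  exists_rel σ O h1 _ h3 :=
    ⟨⟨C.nextColumn (fun v => σ.1 v = .fixed) O, C.isState_nextColumn h3⟩,
      C.precedes_nextColumn h1, C.cellOcc_nextColumn (fun v => σ.1 v = .fixed) O⟩
  fix_occ σ v h := by simp [cellOcc, h]
  exists_full := ⟨⟨fun _ => .fixed, ⟨C.vert 0, rfl⟩, by simp⟩, by simp [cellOcc]⟩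

/-- Forget the marks of the unoccupied cells of a column. -/
def forget (σ : V → DomCell) (v : V) : Cell := (σ v).toCell

/-- Every unoccupied vertex is marked as dominated if it has an occupied neighbour in its own or
in the previous column. -/
noncomputable def nextDomColumn (σ : V → DomCell) (O : V → Bool) (v : V) : DomCell :=
  open Classical in
  match C.nextColumn (fun v => forget σ v = .fixed) O v with
  | .fixed => .fixed
  | .loose => .loose
  | .empty => if (∃ w, C.column.Adj v w ∧ O w = true) ∨
      ∃ i, v = C.vert i ∧ cellOcc (forget σ) v = true then .dominated else .undominated

theorem forget_nextDomColumn (σ : V → DomCell) (O : V → Bool) :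
    forget (C.nextDomColumn σ O) = C.nextColumn (fun v => forget σ v = .fixed) O := by
  funext v
  unfold forget nextDomColumn
  cases h : C.nextColumn (fun v => (σ v).toCell = .fixed) O v
  · simp only [forget, h]; split_ifs <;> rfl
  · simp only [forget, h]; rfl
  · simp only [forget, h]; rfl

theorem nextDomColumn_eq_dominated {σ : V → DomCell} {O : V → Bool} {v : V} (hv : O v = false) :
    C.nextDomColumn σ O v = .dominated ↔ (∃ w, C.column.Adj v w ∧ O w = true) ∨
      ∃ i, v = C.vert i ∧ cellOcc (forget σ) v = true := by
  have : C.nextColumn (fun v => forget σ v = .fixed) O v = .empty := by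
    simp [nextColumn, hv]
  unfold nextDomColumn
  simp only [this]
  split_ifs with h
  · exact ⟨fun _ => h, fun _ => rfl⟩
  · exact ⟨fun h' => absurd h' (by simp), fun h' => absurd h' h⟩

theorem und_iff_of_toCell {x : DomCell} (h : x.toCell = .empty) :
    x = .undominated ↔ x ≠ .dominated := by
  cases x <;> simp_all [DomCell.toCell]

/-- The transfer matrix for connected dominating sets as a column model. -/
def domModel : ColumnModel C.column C.vert true C.DomState where
  rel σ τ := C.DomPrecedes σ.1 τ.1
  occ σ := cellOcc (forget σ.1)
  fix σ v := forget σ.1 v = .fixed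
  und σ v := σ.1 v = .undominated
  ext_state σ τ ho hf hu := by
    refine Subtype.ext (funext fun v => ?_)
    have h1 := congrFun (Cell.eq_of_occ_of_fixed ho hf) v
    have h2 := congrFun hu v
    simp only [forget] at h1
    cases h3 : σ.1 v <;> cases h4 : τ.1 v <;> simp_all [DomCell.toCell]
  fix_iff _ _ h := C.fixed_iff_of_precedes h.precedes
  und_iff σ τ h v := by
    constructor
    · intro hv
      have he : (τ.1 v).toCell = .empty := by rw [hv]; rfl
      have hd := (und_iff_of_toCell he).1 hv
      rw [Ne, h.dominated_iff v he] at hd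
      push Not at hd
      refine ⟨rfl, cellOcc_eq_false.2 he, fun w hw => cellOcc_eq_false.2 (hd.1 w hw),
        fun i hi => cellOcc_eq_false.2 (hd.2 i hi)⟩
    · rintro ⟨-, he, h1, h2⟩
      have he := cellOcc_eq_false.1 he
      refine (und_iff_of_toCell he).2 fun hd => ?_
      rcases (h.dominated_iff v he).1 hd with ⟨w, h3, h4⟩ | ⟨i, h3, h4⟩
      · exact h4 (cellOcc_eq_false.1 (h1 w h3))
      · exact h4 (cellOcc_eq_false.1 (h2 i h3))
  loose_continues _ _ h := C.loose_continues_of_precedes h.precedes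
  und_continues σ τ h v hv := by
    obtain ⟨i, h1, h2⟩ := h.undominated_continues v hv
    exact ⟨i, h1, h1 ▸ cellOcc_eq_true.2 h2⟩
  fix_continues _ τ h := C.exists_fixed_of_precedes h.precedes τ.2.1
  exists_rel σ O h1 h2 h3 := by
    have hf := C.forget_nextDomColumn σ.1 O
    have hocc : ∀ v, (C.nextDomColumn σ.1 O v).toCell = .empty ↔ O v = false := fun v => by
      have h4 := congrFun (C.cellOcc_nextColumn (fun v => forget σ.1 v = .fixed) O) v
      rw [← h4, cellOcc_eq_false, ← hf]
      rfl
    refine ⟨⟨C.nextDomColumn σ.1 O, ?_, ?_⟩, ⟨?_, ?_, ?_⟩, ?_⟩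
    · change C.IsState (forget (C.nextDomColumn σ.1 O))
      rw [hf]
      exact C.isState_nextColumn h3
    · intro v w hvw hv
      have he : O v = false := (hocc v).1 (by rw [hv]; rfl)
      rw [hocc]
      by_contra hw
      have := (C.nextDomColumn_eq_dominated (σ := σ.1) he).2 (Or.inl ⟨w, hvw, by simpa using hw⟩)
      rw [hv] at this
      exact absurd this (by simp)
    · change C.Precedes (forget σ.1) (forget (C.nextDomColumn σ.1 O))
      rw [hf]
      exact C.precedes_nextColumn h1
    · intro v hv
      rw [C.nextDomColumn_eq_dominated ((hocc v).1 hv)]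
      simp only [ne_eq, hocc, Bool.not_eq_false, cellOcc_eq_true]
      rfl
    · intro v hv
      obtain ⟨i, h4, h5⟩ := h2 v hv
      refine ⟨i, h4, ?_⟩
      simp only [ne_eq, hocc]
      rw [h4, h5]; simp
    · change cellOcc (forget (C.nextDomColumn σ.1 O)) = O
      rw [hf, C.cellOcc_nextColumn]
  fix_occ σ v h := by simp [cellOcc, h]
  exists_full := ⟨⟨fun _ => .fixed, ⟨⟨C.vert 0, rfl⟩, by simp [DomCell.toCell]⟩, by simp⟩,
    by simp [cellOcc, forget, DomCell.toCell]⟩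

variable [Fintype V]

theorem rho_le (z : CutState (Fin ℓ) → ℝ) (hz0 : ∀ c, ¬ c.Live → z c = 0)
    (hz1 : ∀ c : CutState (Fin ℓ), c.Live → 0 < z c) {μ : ℝ} (hμ : 0 ≤ μ)
    (h : ∀ c : CutState (Fin ℓ), c.Live →
      cutTransfer false C.column C.vert z c ≤ μ * z c) : C.rho ≤ μ := by
  classical
  exact C.connModel.spectralRadius_toReal_le (A := C.transfer) (fun τ σ => rfl) z hz0 hz1 hμ h

theorem le_rho (z : CutState (Fin ℓ) → ℝ) (hz : ∀ c, 0 ≤ z c) (hz0 : ∀ c, ¬ c.Live → z c = 0)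
    (hz1 : 0 < z fun _ => (true, true)) {μ : ℝ} (hμ : 0 < μ)
    (h : ∀ c : CutState (Fin ℓ), c.Live →
      μ * z c ≤ cutTransfer false C.column C.vert z c) : μ ≤ C.rho := by
  classical
  exact C.connModel.le_spectralRadius_toReal (A := C.transfer) (fun τ σ => rfl) z hz hz0 hz1 hμ h

theorem domRho_le (z : CutState (Fin ℓ) → ℝ) (hz0 : ∀ c, ¬ c.Live → z c = 0)
    (hz1 : ∀ c : CutState (Fin ℓ), c.Live → 0 < z c) {μ : ℝ} (hμ : 0 ≤ μ)
    (h : ∀ c : CutState (Fin ℓ), c.Live →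
      cutTransfer true C.column C.vert z c ≤ μ * z c) : C.domRho ≤ μ := by
  classical
  exact C.domModel.spectralRadius_toReal_le (A := C.domTransfer) (fun τ σ => rfl) z hz0 hz1 hμ h

theorem le_domRho (z : CutState (Fin ℓ) → ℝ) (hz : ∀ c, 0 ≤ z c) (hz0 : ∀ c, ¬ c.Live → z c = 0)
    (hz1 : 0 < z fun _ => (true, true)) {μ : ℝ} (hμ : 0 < μ)
    (h : ∀ c : CutState (Fin ℓ), c.Live →
      μ * z c ≤ cutTransfer true C.column C.vert z c) : μ ≤ C.domRho := by
  classical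
  exact C.domModel.le_spectralRadius_toReal (A := C.domTransfer) (fun τ σ => rfl) z hz hz0 hz1 hμ h

end CycleIn


/-! ### Regularity of the glued graphs -/

theorem isDRegular_iff_ncard {V : Type*} [Fintype V] {G : SimpleGraph V} {d : ℕ} :
    IsDRegular G d ↔ ∀ v, (G.neighborSet v).ncard = d := by
  classical
  unfold IsDRegular SimpleGraph.IsRegularOfDegree
  refine forall_congr' fun v => ?_
  rw [← SimpleGraph.card_neighborSet_eq_degree, ← Nat.card_eq_fintype_card]
  rfl

namespace CycleIn

variable {V : Type*} {M : SimpleGraph V} {ℓ : ℕ} [NeZero ℓ] (C : CycleIn M ℓ)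

theorem vert_add_one_ne_sub_one (i : Fin ℓ) : C.vert (i + 1) ≠ C.vert (i - 1) := by
  intro h
  replace h := C.inj h
  have h2 : (1 : Fin ℓ) + 1 = 0 := by
    have : i + 1 - (i - 1) = 0 := by rw [h, sub_self]
    rw [← this]; abel
  have h3 := C.three_le
  have h4 := congrArg Fin.val h2
  rw [Fin.val_add, Fin.val_one', Fin.val_zero, Nat.mod_eq_of_lt (by omega : 1 < ℓ),
    Nat.mod_eq_of_lt (by omega : 1 + 1 < ℓ)] at h4
  omega

theorem mem_edges_vert {i : Fin ℓ} {w : V} :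
    s(C.vert i, w) ∈ C.edges ↔ w = C.vert (i + 1) ∨ w = C.vert (i - 1) := by
  unfold edges
  simp only [Set.mem_range, Sym2.eq_iff]
  constructor
  · rintro ⟨j, ⟨h1, h2⟩ | ⟨h1, h2⟩⟩
    · rw [C.inj h1] at h2
      exact Or.inl h2.symm
    · rw [← C.inj h2, add_sub_cancel_right]
      exact Or.inr h1.symm
  · rintro (h | h)
    · exact ⟨i, Or.inl ⟨rfl, h.symm⟩⟩
    · exact ⟨i - 1, Or.inr ⟨h.symm, by rw [sub_add_cancel]⟩⟩

theorem vert_of_mem_edges {v w : V} (h : s(v, w) ∈ C.edges) : ∃ i, v = C.vert i := by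
  obtain ⟨i, hi⟩ := h
  rw [Sym2.eq_iff] at hi
  rcases hi with ⟨h, -⟩ | ⟨-, h⟩
  · exact ⟨i, h.symm⟩
  · exact ⟨i + 1, h.symm⟩

theorem column_adj {v w : V} : C.column.Adj v w ↔ M.Adj v w ∧ s(v, w) ∉ C.edges := by
  rw [column, SimpleGraph.deleteEdges_adj]

theorem neighborSet_vert (i : Fin ℓ) : M.neighborSet (C.vert i) =
    insert (C.vert (i + 1)) (insert (C.vert (i - 1)) (C.column.neighborSet (C.vert i))) := by
  ext w
  simp only [SimpleGraph.mem_neighborSet, Set.mem_insert_iff, column_adj, mem_edges_vert]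
  constructor
  · intro h
    by_cases h1 : w = C.vert (i + 1)
    · exact Or.inl h1
    · by_cases h2 : w = C.vert (i - 1)
      · exact Or.inr (Or.inl h2)
      · exact Or.inr (Or.inr ⟨h, by simp [h1, h2]⟩)
  · rintro (rfl | rfl | h)
    · exact C.adj i
    · have := C.adj (i - 1)
      rw [sub_add_cancel] at this
      exact this.symm
    · exact h.1

/-- The right neighbour of a cell on the cycle. -/
def rightCell (k : ℕ) (i : Fin ℓ) (j : Fin k) : V × Fin k :=
  if h : (j : ℕ) + 1 < k then (C.vert i, ⟨j + 1, h⟩)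
  else (C.vert (i + 1), ⟨0, Nat.zero_lt_of_lt j.2⟩)

/-- The left neighbour of a cell on the cycle. -/
def leftCell (k : ℕ) (i : Fin ℓ) (j : Fin k) : V × Fin k :=
  if (j : ℕ) = 0 then (C.vert (i - 1), ⟨k - 1, Nat.sub_one_lt (Nat.ne_of_gt (Nat.zero_lt_of_lt j.2))⟩)
  else (C.vert i, ⟨j - 1, (Nat.sub_le _ _).trans_lt j.2⟩)

theorem glue_adj_vert {k : ℕ} (i : Fin ℓ) (j : Fin k) (x : V × Fin k) :
    (C.glue k).Adj (C.vert i, j) x ↔ (x.2 = j ∧ C.column.Adj (C.vert i) x.1) ∨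
      x = C.rightCell k i j ∨ x = C.leftCell k i j := by
  obtain ⟨v, b⟩ := x
  have hj := j.2
  have hb := b.2
  unfold glue rightCell leftCell
  rw [SimpleGraph.fromRel_adj]
  dsimp only
  constructor
  · rintro ⟨-, (h | ⟨i', h1, h2, h3⟩ | ⟨i', h1, h2, h3, h4⟩) |
      (h | ⟨i', h1, h2, h3⟩ | ⟨i', h1, h2, h3, h4⟩)⟩
    · exact Or.inl ⟨h.1.symm, h.2⟩
    · right; left
      rw [dif_pos (by omega), Prod.mk.injEq, Fin.ext_iff]
      exact ⟨h2.trans h1.symm, h3.symm⟩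
    · right; left
      rw [dif_neg (by omega), Prod.mk.injEq, Fin.ext_iff, C.inj h1]
      exact ⟨h2, h4⟩
    · exact Or.inl ⟨h.1, h.2.symm⟩
    · right; right
      rw [if_neg (by omega), Prod.mk.injEq, Fin.ext_iff]
      exact ⟨h1.trans h2.symm, by simp only; omega⟩
    · right; right
      rw [if_pos (by omega), Prod.mk.injEq, Fin.ext_iff, C.inj h2, add_sub_cancel_right]
      exact ⟨h1, by simp only; omega⟩
  · rintro (⟨h1, h2⟩ | h | h)
    · exact ⟨fun h => h2.ne (Prod.mk.inj h).1, Or.inl (Or.inl ⟨h1.symm, h2⟩)⟩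
    · split_ifs at h with h0
      · rw [Prod.mk.injEq, Fin.ext_iff] at h
        refine ⟨fun h1 => ?_, Or.inl (Or.inr (Or.inl ⟨i, rfl, h.1, h.2.symm⟩))⟩
        have := Fin.ext_iff.1 (Prod.mk.inj h1).2
        have := h.2
        simp only at this
        omega
      · rw [Prod.mk.injEq, Fin.ext_iff] at h
        refine ⟨fun h1 => ?_, Or.inl (Or.inr (Or.inr ⟨i, rfl, h.1, by omega, h.2⟩))⟩
        exact (C.adj i).ne ((Prod.mk.inj h1).1.trans h.1)
    · split_ifs at h with h0
      · rw [Prod.mk.injEq, Fin.ext_iff] at h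
        have h2 := h.2
        simp only at h2
        refine ⟨fun h1 => ?_, Or.inr (Or.inr (Or.inr
          ⟨i - 1, h.1, by rw [sub_add_cancel], by omega, h0⟩))⟩
        have := C.adj (i - 1)
        rw [sub_add_cancel] at this
        exact this.ne (h.1.symm.trans (Prod.mk.inj h1).1.symm)
      · rw [Prod.mk.injEq, Fin.ext_iff] at h
        have h2 := h.2
        simp only at h2
        refine ⟨fun h1 => ?_, Or.inr (Or.inr (Or.inl ⟨i, h.1, rfl, by omega⟩))⟩
        have := Fin.ext_iff.1 (Prod.mk.inj h1).2
        omega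

theorem glue_adj_of_not_vert {k : ℕ} {v : V} (hv : ∀ i, v ≠ C.vert i) (j : Fin k)
    (x : V × Fin k) : (C.glue k).Adj (v, j) x ↔ x.2 = j ∧ C.column.Adj v x.1 := by
  unfold glue
  rw [SimpleGraph.fromRel_adj]
  dsimp only
  constructor
  · rintro ⟨-, (h | ⟨i', h1, h2, h3⟩ | ⟨i', h1, h2, h3, h4⟩) |
      (h | ⟨i', h1, h2, h3⟩ | ⟨i', h1, h2, h3, h4⟩)⟩
    · exact ⟨h.1.symm, h.2⟩
    · exact absurd h1 (hv _)
    · exact absurd h1 (hv _)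
    · exact ⟨h.1, h.2.symm⟩
    · exact absurd h2 (hv _)
    · exact absurd h2 (hv _)
  · rintro ⟨h1, h2⟩
    refine ⟨fun h => ?_, Or.inl (Or.inl ⟨h1.symm, h2⟩)⟩
    rw [← h] at h2
    exact C.column.loopless.irrefl _ h2

theorem ncard_column_neighbors {k : ℕ} (v : V) (j : Fin k) :
    {x : V × Fin k | x.2 = j ∧ C.column.Adj v x.1}.ncard = (C.column.neighborSet v).ncard := by
  rw [← Set.ncard_image_of_injective (C.column.neighborSet v) (Prod.mk_left_injective j)]
  congr 1
  ext ⟨w, b⟩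
  simp only [Set.mem_ofPred_eq, Set.mem_image, SimpleGraph.mem_neighborSet, Prod.mk.injEq]
  constructor
  · rintro ⟨rfl, h⟩; exact ⟨w, h, rfl, rfl⟩
  · rintro ⟨w', h, rfl, rfl⟩; exact ⟨rfl, h⟩

theorem isDRegular_glue [Fintype V] {d : ℕ} (hM : IsDRegular M d) (k : ℕ) :
    IsDRegular (C.glue k) d := by
  rw [isDRegular_iff_ncard] at hM ⊢
  rintro ⟨v, j⟩
  rw [← hM v]
  by_cases hv : ∃ i, v = C.vert i
  · obtain ⟨i, rfl⟩ := hv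
    have h1 : (C.glue k).neighborSet (C.vert i, j) = insert (C.rightCell k i j)
        (insert (C.leftCell k i j) {x | x.2 = j ∧ C.column.Adj (C.vert i) x.1}) := by
      ext x
      rw [SimpleGraph.mem_neighborSet, glue_adj_vert]
      simp only [Set.mem_insert_iff, Set.mem_ofPred_eq]
      tauto
    have hj := j.2
    have hcol : ∀ w, C.column.Adj (C.vert i) w → w ≠ C.vert (i + 1) ∧ w ≠ C.vert (i - 1) := by
      intro w hw
      rw [column_adj, mem_edges_vert] at hw
      exact not_or.1 hw.2
    have hself : ¬ C.column.Adj (C.vert i) (C.vert i) := C.column.loopless.irrefl _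
    have hprev : C.vert i ≠ C.vert (i - 1) := by
      have := (C.adj (i - 1)).ne'
      rwa [sub_add_cancel] at this
    have hne := C.vert_add_one_ne_sub_one i
    have h2 : C.rightCell k i j ∉
        insert (C.leftCell k i j) {x | x.2 = j ∧ C.column.Adj (C.vert i) x.1} := by
      rw [Set.mem_insert_iff, Set.mem_ofPred_eq, not_or]
      refine ⟨?_, ?_⟩
      · unfold rightCell leftCell
        split_ifs <;> simp only [Prod.mk.injEq, Fin.mk.injEq, not_and]
        · intro h; exact absurd h hprev
        · intro _; omega
        · exact fun h => absurd h hne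
        · intro h; exact absurd h (C.adj i).ne'
      · rintro ⟨-, h⟩
        unfold rightCell at h
        split_ifs at h
        · exact hself h
        · exact (hcol _ h).1 rfl
    have h3 : C.leftCell k i j ∉ {x : V × Fin k | x.2 = j ∧ C.column.Adj (C.vert i) x.1} := by
      rintro ⟨-, h⟩
      unfold leftCell at h
      split_ifs at h
      · exact (hcol _ h).2 rfl
      · exact hself h
    have h4 : C.vert (i + 1) ∉
        insert (C.vert (i - 1)) (C.column.neighborSet (C.vert i)) := by
      rw [Set.mem_insert_iff, not_or]
      exact ⟨hne, fun h => (hcol _ h).1 rfl⟩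
    have h5 : C.vert (i - 1) ∉ C.column.neighborSet (C.vert i) := fun h => (hcol _ h).2 rfl
    rw [h1, C.neighborSet_vert i, Set.ncard_insert_of_notMem h2, Set.ncard_insert_of_notMem h3,
      Set.ncard_insert_of_notMem h4, Set.ncard_insert_of_notMem h5, C.ncard_column_neighbors]
  · push Not at hv
    have h1 : (C.glue k).neighborSet (v, j) = {x | x.2 = j ∧ C.column.Adj v x.1} := by
      ext x
      exact C.glue_adj_of_not_vert hv j x
    rw [h1, C.ncard_column_neighbors]
    congr 1
    ext w
    rw [SimpleGraph.mem_neighborSet, SimpleGraph.mem_neighborSet, column_adj]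
    refine and_iff_left fun h => ?_
    obtain ⟨i, hi⟩ := C.vert_of_mem_edges h
    exact hv i hi

end CycleIn


/-! ### Walks in the transfer matrix and connected sets of the glued graph -/

theorem OccLinked.mono {V : Type*} {G : SimpleGraph V} {O O' : V → Bool} {v w : V}
    (h : OccLinked G O v w) (hO : ∀ x, O x = true → O' x = true) : OccLinked G O' v w :=
  h.induct (fun x => OccLinked G O' v x)
    (fun _ _ hab ha hb hv => hv.trans (.of_adj hab (hO _ ha) (hO _ hb))) (.refl v)

theorem isConnectedSet_of_occLinked {V : Type*} {G : SimpleGraph V} {O : V → Bool} (x : V)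
    (hx : O x = true) (h : ∀ y, O y = true → OccLinked G O x y) :
    IsConnectedSet G {v | O v = true} := by
  have key : ∀ y (hy : O y = true),
      (G.induce {v | O v = true}).Reachable ⟨x, hx⟩ ⟨y, hy⟩ := fun y hy => by
    have := (h y hy).induct
      (fun z => ∃ hz : O z = true, (G.induce {v | O v = true}).Reachable ⟨x, hx⟩ ⟨z, hz⟩)
      (fun a b hab ha hb ⟨_, h1⟩ => ⟨hb, h1.trans (SimpleGraph.Adj.reachable hab)⟩)
      ⟨hx, SimpleGraph.Reachable.refl _⟩
    exact this.2
  have : Nonempty {v | O v = true} := ⟨⟨x, hx⟩⟩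
  exact SimpleGraph.Connected.mk fun a b => (key a.1 a.2).symm.trans (key b.1 b.2)

section Walks

variable {S : Type*} (r : S → S → Prop)

/-- The walks with `n` steps. -/
def walks (n : ℕ) : Set (Fin (n + 1) → S) := {w | ∀ i : Fin n, r (w i.castSucc) (w i.succ)}

open Classical in
theorem sum_pow_eq_sum_walks [Fintype S] [DecidableEq S] (n : ℕ) (σ : S) :
    ∑ τ, ((Matrix.of fun τ σ => if r σ τ then (1 : ℝ) else 0) ^ n) τ σ =
      ∑ w : Fin n → S, if Fin.cons σ w ∈ walks r n then (1 : ℝ) else 0 := by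
  induction n generalizing σ with
  | zero => simp [walks, Matrix.one_apply]
  | succ n ih =>
    have hL : ∑ τ, ((Matrix.of fun τ σ => if r σ τ then (1 : ℝ) else 0) ^ (n + 1)) τ σ =
        ∑ ρ, if r σ ρ then
          ∑ w : Fin n → S, if Fin.cons ρ w ∈ walks r n then (1 : ℝ) else 0 else 0 := by
      simp_rw [pow_succ, Matrix.mul_apply]
      rw [Finset.sum_comm]
      refine Finset.sum_congr rfl fun ρ _ => ?_
      rw [← ih ρ, ← Finset.sum_mul]
      simp
    rw [hL, ← (Fin.consEquiv fun _ => S).sum_comp, Fintype.sum_prod_type]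
    refine Finset.sum_congr rfl fun ρ _ => ?_
    have : ∀ w : Fin n → S, (Fin.cons σ ((Fin.consEquiv fun _ => S) (ρ, w)) ∈ walks r (n + 1)) ↔
        r σ ρ ∧ Fin.cons ρ w ∈ walks r n := by
      intro w
      simp only [walks, Fin.consEquiv, Set.mem_ofPred_eq, Equiv.coe_fn_mk]
      rw [Fin.forall_fin_succ]
      rfl
    simp_rw [this]
    by_cases h : r σ ρ <;> simp [h]

theorem sum_pow_eq_ncard_walks [Fintype S] [DecidableEq S] [DecidableRel r] (n : ℕ) :
    ∑ τ, ∑ σ, ((Matrix.of fun τ σ => if r σ τ then (1 : ℝ) else 0) ^ n) τ σ =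
      (walks r n).ncard := by
  classical
  refine Finset.sum_comm.trans ?_
  have h1 := fun σ => sum_pow_eq_sum_walks r n σ
  have h2 : ∀ σ, ∑ τ, ((Matrix.of fun τ σ => if r σ τ then (1 : ℝ) else 0) ^ n) τ σ =
      ∑ w : Fin n → S, if Fin.cons σ w ∈ walks r n then (1 : ℝ) else 0 := fun σ => by
    rw [← h1 σ]; congr!
  simp_rw [h2]
  rw [← Fintype.sum_prod_type' (f := fun σ (w : Fin n → S) =>
    if (Fin.cons σ w : Fin (n + 1) → S) ∈ walks r n then (1 : ℝ) else 0)]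
  have h3 := (Fin.consEquiv fun _ : Fin (n + 1) => S).sum_comp
    (fun w => if w ∈ walks r n then (1 : ℝ) else 0)
  refine Eq.trans (Finset.sum_congr rfl fun x _ => ?_) (h3.trans ?_)
  · rfl
  · rw [Finset.sum_boole, Set.ncard_eq_toFinset_card', Set.toFinset_card,
      ← Fintype.card_subtype]

end Walks

namespace CycleIn

variable {V : Type*} {M : SimpleGraph V} {ℓ : ℕ} [NeZero ℓ] (C : CycleIn M ℓ)
  {D : Bool} {S : Type*} (m : ColumnModel C.column C.vert D S)

/-- The vertex set of `M^{•(n+1)}` described by a walk with `n` steps; the first and the last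
column are filled. -/
def walkSet {n : ℕ} (w : Fin (n + 1) → S) (x : V × Fin (n + 1)) : Bool :=
  decide (x.2 = 0) || decide (x.2 = Fin.last n) || m.occ (w x.2) x.1

theorem occLinked_walkSet_column {n : ℕ} (w : Fin (n + 1) → S) (j : Fin (n + 1)) {u v : V}
    (h : OccLinked C.column (fun x => C.walkSet m w (x, j)) u v) :
    OccLinked (C.glue (n + 1)) (C.walkSet m w) (u, j) (v, j) := by
  refine h.induct (fun x => OccLinked (C.glue (n + 1)) (C.walkSet m w) (u, j) (x, j)) ?_ (.refl _)
  intro a b hab ha hb hu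
  refine hu.trans (.of_adj ?_ ha hb)
  unfold glue
  rw [SimpleGraph.fromRel_adj]
  exact ⟨fun h => hab.ne (Prod.mk.inj h).1, Or.inl (Or.inl ⟨rfl, hab⟩)⟩

theorem occLinked_walkSet_of_occ {n : ℕ} (w : Fin (n + 1) → S) (j : Fin (n + 1)) {u v : V}
    (h : OccLinked C.column (m.occ (w j)) u v) :
    OccLinked (C.glue (n + 1)) (C.walkSet m w) (u, j) (v, j) :=
  C.occLinked_walkSet_column m w j (h.mono fun x hx => by simp [walkSet, hx])

theorem occLinked_walkSet_full (hC : C.column.Connected) {n : ℕ} (w : Fin (n + 1) → S)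
    (j : Fin (n + 1)) (hj : j = 0 ∨ j = Fin.last n) (u v : V) :
    OccLinked (C.glue (n + 1)) (C.walkSet m w) (u, j) (v, j) := by
  refine C.occLinked_walkSet_column m w j ?_
  obtain ⟨q⟩ := hC.preconnected u v
  induction q with
  | nil => exact .refl _
  | cons hadj _ ih =>
    refine OccLinked.trans (.of_adj hadj ?_ ?_) ih <;>
    · rcases hj with rfl | rfl <;> simp [walkSet]

theorem glue_adj_succ {n : ℕ} (i : Fin ℓ) (j : Fin n) :
    (C.glue (n + 1)).Adj (C.vert i, j.castSucc) (C.vert i, j.succ) := by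
  unfold glue
  rw [SimpleGraph.fromRel_adj]
  refine ⟨fun h => ?_, Or.inl (Or.inr (Or.inl ⟨i, rfl, rfl, by simp⟩))⟩
  have := Fin.ext_iff.1 (Prod.mk.inj h).2
  simp at this

theorem occLinked_walkSet_of_fix (hC : C.column.Connected) {n : ℕ} {w : Fin (n + 1) → S}
    (hw : w ∈ walks m.rel n) (j : Fin (n + 1)) (v : V) (hv : j = 0 ∨ m.fix (w j) v)
    (hocc : j = 0 ∨ m.occ (w j) v = true) :
    OccLinked (C.glue (n + 1)) (C.walkSet m w) (C.vert 0, 0) (v, j) := by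
  induction j using Fin.induction generalizing v with
  | zero => exact C.occLinked_walkSet_full m hC w 0 (Or.inl rfl) _ _
  | succ j ih =>
    have h0 : j.succ ≠ 0 := Fin.succ_ne_zero j
    have hv' := hv.resolve_left h0
    have ho' := hocc.resolve_left h0
    obtain ⟨-, i, h1, h2⟩ := (m.fix_iff _ _ (hw j) v).1 hv'
    by_cases hs : C.walkSet m w (C.vert i, j.castSucc) = true
    · have hl : OccLinked (C.glue (n + 1)) (C.walkSet m w) (C.vert 0, 0)
          (C.vert i, j.castSucc) := by
        by_cases h3 : m.occ (w j.castSucc) (C.vert i) = true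
        · exact ih _ (Or.inr h1) (Or.inr h3)
        · have h4 : j.castSucc = 0 := by
            have hlast : j.castSucc ≠ Fin.last n := (Fin.castSucc_lt_last j).ne
            simpa [walkSet, h3, hlast] using hs
          exact ih _ (Or.inl h4) (Or.inl h4)
      refine hl.trans ((OccLinked.of_adj (C.glue_adj_succ i j) hs ?_).trans
        (C.occLinked_walkSet_of_occ m w j.succ h2.symm))
      simp [walkSet, h2.occ ho']
    · exfalso
      have h5 := m.fix_occ _ _ h1
      simp [walkSet, h5] at hs

theorem occLinked_walkSet (hC : C.column.Connected) {n : ℕ} {w : Fin (n + 1) → S}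
    (hw : w ∈ walks m.rel n) (j : Fin (n + 1)) (v : V) (hv : C.walkSet m w (v, j) = true) :
    OccLinked (C.glue (n + 1)) (C.walkSet m w) (C.vert 0, 0) (v, j) := by
  induction j using Fin.reverseInduction generalizing v with
  | last =>
    refine OccLinked.trans ?_ (C.occLinked_walkSet_full m hC w (Fin.last n) (Or.inr rfl)
      (C.vert (-1)) v)
    rcases Nat.eq_zero_or_pos n with rfl | hn
    · exact C.occLinked_walkSet_full m hC w 0 (Or.inl rfl) _ _
    · refine .of_adj ?_ (by simp [walkSet]) (by simp [walkSet])
      unfold glue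
      rw [SimpleGraph.fromRel_adj]
      refine ⟨fun h => ?_, Or.inr (Or.inr (Or.inr ⟨-1, rfl, by simp, by simp, rfl⟩))⟩
      have := Fin.ext_iff.1 (Prod.mk.inj h).2
      simp at this
      omega
  | cast j ih =>
    by_cases h0 : j.castSucc = 0
    · exact C.occLinked_walkSet_of_fix m hC hw _ v (Or.inl h0) (Or.inl h0)
    · have hlast : j.castSucc ≠ Fin.last n := (Fin.castSucc_lt_last j).ne
      have ho : m.occ (w j.castSucc) v = true := by simpa [walkSet, h0, hlast] using hv
      by_cases hf : m.fix (w j.castSucc) v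
      · exact C.occLinked_walkSet_of_fix m hC hw _ v (Or.inr hf) (Or.inr ho)
      · obtain ⟨i, h1, h2⟩ := m.loose_continues _ _ (hw j) v ho hf
        have h3 : C.walkSet m w (C.vert i, j.succ) = true := by simp [walkSet, h2]
        refine (ih _ h3).trans (OccLinked.trans (.of_adj (C.glue_adj_succ i j).symm h3 ?_)
          (C.occLinked_walkSet_of_occ m w j.castSucc h1.symm))
        simp [walkSet, h1.occ ho]

theorem isConnectedSet_walkSet (hC : C.column.Connected) {n : ℕ} {w : Fin (n + 1) → S}
    (hw : w ∈ walks m.rel n) :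
    IsConnectedSet (C.glue (n + 1)) {x | C.walkSet m w x = true} :=
  isConnectedSet_of_occLinked (C.vert 0, 0) (by simp [walkSet])
    fun y hy => C.occLinked_walkSet m hC hw y.2 y.1 hy

theorem isDominatingSet_walkSet (hD : D = true) {n : ℕ} {w : Fin (n + 1) → S}
    (hw : w ∈ walks m.rel n) :
    IsDominatingSet (C.glue (n + 1)) {x | C.walkSet m w x = true} := by
  rintro ⟨v, j⟩ hv
  rw [Set.mem_ofPred_eq, Bool.not_eq_true] at hv
  have hv' : (j ≠ 0 ∧ j ≠ Fin.last n) ∧ m.occ (w j) v = false := by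
    simpa [walkSet] using hv
  obtain ⟨⟨h0, hl⟩, ho⟩ := hv'
  obtain ⟨a, rfl⟩ := Fin.exists_succ_eq.2 h0
  by_cases hu : m.und (w a.succ) v
  · obtain ⟨b, hb⟩ := Fin.exists_castSucc_eq.2 hl
    have := hw b
    rw [hb] at this
    obtain ⟨i, rfl, h2⟩ := m.und_continues _ _ this v hu
    refine ⟨(C.vert i, b.succ), by simp [walkSet, h2], ?_⟩
    rw [← hb]
    exact C.glue_adj_succ i b
  · rw [m.und_iff _ _ (hw a)] at hu
    push Not at hu
    by_cases hadj : ∃ x, C.column.Adj v x ∧ m.occ (w a.succ) x = true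
    · obtain ⟨x, h1, h2⟩ := hadj
      refine ⟨(x, a.succ), by simp [walkSet, h2], ?_⟩
      unfold glue
      rw [SimpleGraph.fromRel_adj]
      exact ⟨fun h => h1.ne (Prod.mk.inj h).1, Or.inl (Or.inl ⟨rfl, h1⟩)⟩
    · push Not at hadj
      obtain ⟨i, rfl, h2⟩ := hu hD ho fun x hx => by simpa using hadj x hx
      refine ⟨(C.vert i, a.castSucc), ?_, (C.glue_adj_succ i a).symm⟩
      have : m.occ (w a.castSucc) (C.vert i) = true := by simpa using h2
      simp [walkSet, this]

theorem walkSet_injOn {n : ℕ} : Set.InjOn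
    (fun w : Fin (n + 1) → S => (w 0, {x | C.walkSet m w x = true}, w (Fin.last n)))
    (walks m.rel n) := by
  intro w hw w' hw' h
  simp only [Prod.mk.injEq] at h
  obtain ⟨h0, hs, hl⟩ := h
  funext j
  induction j using Fin.induction with
  | zero => exact h0
  | succ j ih =>
    by_cases hj : j.succ = Fin.last n
    · rw [hj]; exact hl
    · have h1 := hw' j
      rw [← ih] at h1
      refine m.eq_of_rel (hw j) h1 (funext fun v => ?_)
      have h2 : C.walkSet m w (v, j.succ) = true ↔ C.walkSet m w' (v, j.succ) = true :=
        Set.ext_iff.1 hs (v, j.succ)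
      have h3 : ∀ w : Fin (n + 1) → S, C.walkSet m w (v, j.succ) = m.occ (w j.succ) v :=
        fun w => by unfold walkSet; rw [decide_eq_false (Fin.succ_ne_zero j), decide_eq_false hj]; rfl
      rwa [h3, h3, ← Bool.eq_iff_iff] at h2

theorem ncard_walks_le [Fintype V] [Fintype S] (n : ℕ) (F : Set (Set (V × Fin (n + 1))))
    (hF : ∀ w ∈ walks m.rel n, {x | C.walkSet m w x = true} ∈ F) :
    (walks m.rel n).ncard ≤ Fintype.card S * (F.ncard * Fintype.card S) := by
  have h1 := Set.ncard_le_ncard_of_injOn (s := walks m.rel n)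
    (t := (Set.univ : Set S) ×ˢ (F ×ˢ (Set.univ : Set S)))
    (fun w : Fin (n + 1) → S => (w 0, {x | C.walkSet m w x = true}, w (Fin.last n)))
    (fun w hw => ⟨trivial, hF w hw, trivial⟩) (C.walkSet_injOn m) (Set.toFinite _)
  rwa [Set.ncard_prod, Set.ncard_prod, Set.ncard_univ, Nat.card_eq_fintype_card] at h1

theorem rho_pow_le [Fintype V] (hC : C.column.Connected) {n : ℕ} (hn : n ≠ 0) :
    C.rho ^ n ≤ (Nat.card C.State : ℝ) ^ 2 * numConn (C.glue (n + 1)) := by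
  classical
  have h1 := Matrix.spectralRadius_toReal_pow_le
    (Matrix.of fun τ σ => if C.connModel.rel σ τ then (1 : ℝ) else 0)
    (fun τ σ => by rw [Matrix.of_apply]; split_ifs <;> norm_num) C.transfer (fun τ σ => by
      rw [Matrix.of_apply, apply_ite Complex.ofReal, Complex.ofReal_one, Complex.ofReal_zero]
      rfl) n hn
  rw [sum_pow_eq_ncard_walks] at h1
  refine h1.trans ?_
  have h2 := C.ncard_walks_le C.connModel n {s | IsConnectedSet (C.glue (n + 1)) s}
    fun w hw => C.isConnectedSet_walkSet C.connModel hC hw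
  rw [Nat.card_eq_fintype_card, sq, mul_assoc, mul_comm (Fintype.card C.State : ℝ) (numConn _)]
  exact_mod_cast h2

theorem domRho_pow_le [Fintype V] (hC : C.column.Connected) {n : ℕ} (hn : n ≠ 0) :
    C.domRho ^ n ≤ (Nat.card C.DomState : ℝ) ^ 2 * numDomConn (C.glue (n + 1)) := by
  classical
  have h1 := Matrix.spectralRadius_toReal_pow_le
    (Matrix.of fun τ σ => if C.domModel.rel σ τ then (1 : ℝ) else 0)
    (fun τ σ => by rw [Matrix.of_apply]; split_ifs <;> norm_num) C.domTransfer (fun τ σ => by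
      rw [Matrix.of_apply, apply_ite Complex.ofReal, Complex.ofReal_one, Complex.ofReal_zero]
      rfl) n hn
  rw [sum_pow_eq_ncard_walks] at h1
  refine h1.trans ?_
  have h2 := C.ncard_walks_le C.domModel n
    {s | IsDominatingSet (C.glue (n + 1)) s ∧ IsConnectedSet (C.glue (n + 1)) s}
    fun w hw => ⟨C.isDominatingSet_walkSet C.domModel rfl hw,
      C.isConnectedSet_walkSet C.domModel hC hw⟩
  rw [Nat.card_eq_fintype_card, sq, mul_assoc, mul_comm (Fintype.card C.DomState : ℝ) (numDomConn _)]
  exact_mod_cast h2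

end CycleIn


/-! ### Limits -/

section Limits

variable {V W : Type*}

theorem numConn_le [Finite V] (G : SimpleGraph V) : numConn G ≤ 2 ^ Nat.card V := by
  have := Fintype.ofFinite V
  unfold numConn
  calc _ ≤ (Set.univ : Set (Set V)).ncard := Set.ncard_le_ncard (Set.subset_univ _)
    _ = _ := by rw [Set.ncard_univ]; simp [Nat.card_eq_fintype_card]

theorem numDomConn_le [Finite V] (G : SimpleGraph V) : numDomConn G ≤ 2 ^ Nat.card V := by
  have := Fintype.ofFinite V
  unfold numDomConn
  calc _ ≤ (Set.univ : Set (Set V)).ncard := Set.ncard_le_ncard (Set.subset_univ _)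
    _ = _ := by rw [Set.ncard_univ]; simp [Nat.card_eq_fintype_card]

theorem rpow_one_div_le_two {N n : ℕ} (h : N ≤ 2 ^ n) : (N : ℝ) ^ ((1 : ℝ) / n) ≤ 2 := by
  rcases Nat.eq_zero_or_pos n with rfl | hn
  · simp
  · have h1 : (N : ℝ) ≤ 2 ^ n := by exact_mod_cast h
    calc (N : ℝ) ^ ((1 : ℝ) / n) ≤ ((2 : ℝ) ^ n) ^ ((1 : ℝ) / n) :=
          Real.rpow_le_rpow (by positivity) h1 (by positivity)
      _ = 2 := by
          rw [← Real.rpow_natCast, ← Real.rpow_mul (by norm_num),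
            mul_one_div_cancel (by positivity), Real.rpow_one]

theorem isConnectedSet_image_iff {G : SimpleGraph V} {H : SimpleGraph W} (e : G ≃g H) (s : Set V) :
    IsConnectedSet H (e '' s) ↔ IsConnectedSet G s := by
  unfold IsConnectedSet
  refine SimpleGraph.Iso.connected_iff (SimpleGraph.Iso.symm
    ⟨(e.toEquiv.image s), ?_⟩)
  intro a b
  simp only [SimpleGraph.comap_adj, Function.Embedding.subtype_apply]
  exact e.map_adj_iff

theorem isDominatingSet_image_iff {G : SimpleGraph V} {H : SimpleGraph W} (e : G ≃g H)
    (s : Set V) : IsDominatingSet H (e '' s) ↔ IsDominatingSet G s := by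
  unfold IsDominatingSet
  rw [← e.toEquiv.forall_congr_right]
  refine forall_congr' fun v => ?_
  have h1 : (e v ∉ e '' s) ↔ v ∉ s := not_congr (e.injective.mem_set_image)
  refine imp_congr h1 ?_
  rw [Set.exists_mem_image]
  exact exists_congr fun w => and_congr_right fun _ => e.map_adj_iff

theorem numConn_congr {G : SimpleGraph V} {H : SimpleGraph W} (e : G ≃g H) :
    numConn G = numConn H := by
  unfold numConn
  rw [← Set.ncard_image_of_injective _ (Set.image_injective.2 e.injective)]
  congr 1
  ext t
  constructor
  · rintro ⟨s, hs, rfl⟩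
    exact (isConnectedSet_image_iff e s).2 hs
  · intro ht
    have : e '' (e ⁻¹' t) = t := Set.image_preimage_eq t e.surjective
    refine ⟨e ⁻¹' t, ?_, this⟩
    rw [← this] at ht
    exact (isConnectedSet_image_iff e _).1 ht

theorem numDomConn_congr {G : SimpleGraph V} {H : SimpleGraph W} (e : G ≃g H) :
    numDomConn G = numDomConn H := by
  unfold numDomConn
  rw [← Set.ncard_image_of_injective _ (Set.image_injective.2 e.injective)]
  congr 1
  ext t
  constructor
  · rintro ⟨s, hs, rfl⟩
    exact ⟨(isDominatingSet_image_iff e s).2 hs.1, (isConnectedSet_image_iff e s).2 hs.2⟩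
  · intro ht
    have : e '' (e ⁻¹' t) = t := Set.image_preimage_eq t e.surjective
    refine ⟨e ⁻¹' t, ?_, this⟩
    rw [← this] at ht
    exact ⟨(isDominatingSet_image_iff e _).1 ht.1, (isConnectedSet_image_iff e _).1 ht.2⟩

theorem isDRegular_congr [Fintype V] [Fintype W] {G : SimpleGraph V} {H : SimpleGraph W}
    (e : G ≃g H) {d : ℕ} (h : IsDRegular G d) : IsDRegular H d := by
  rw [isDRegular_iff_ncard] at h ⊢
  intro w
  rw [← h (e.symm w), ← Set.ncard_image_of_injective _ e.injective]
  congr 1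
  ext x
  simp only [SimpleGraph.mem_neighborSet, Set.mem_image]
  constructor
  · intro hx
    exact ⟨e.symm x, e.symm.map_adj_iff.2 hx, e.apply_symm_apply x⟩
  · rintro ⟨y, hy, rfl⟩
    have := e.map_adj_iff.2 hy
    rwa [e.apply_symm_apply] at this

theorem connBase_congr {G : SimpleGraph V} {H : SimpleGraph W} (e : G ≃g H) :
    connBase G = connBase H := by
  rw [connBase, connBase, numConn_congr e, Nat.card_congr e.toEquiv]

theorem domConnBase_congr {G : SimpleGraph V} {H : SimpleGraph W} (e : G ≃g H) :
    domConnBase G = domConnBase H := by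
  rw [domConnBase, domConnBase, numDomConn_congr e, Nat.card_congr e.toEquiv]

theorem connBase_le_two [Finite V] (G : SimpleGraph V) : connBase G ≤ 2 :=
  rpow_one_div_le_two (numConn_le G)

theorem domConnBase_le_two [Finite V] (G : SimpleGraph V) : domConnBase G ≤ 2 :=
  rpow_one_div_le_two (numDomConn_le G)

theorem connBase_nonneg (G : SimpleGraph V) : 0 ≤ connBase G := by unfold connBase; positivity

theorem domConnBase_nonneg (G : SimpleGraph V) : 0 ≤ domConnBase G := by
  unfold domConnBase; positivity

theorem sSup_regular_mem {d n : ℕ} (f : SimpleGraph (Fin n) → ℝ) (hf0 : ∀ G, 0 ≤ f G)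
    (hf : ∀ G, f G ≤ 2) :
    sSup {x : ℝ | ∃ G : SimpleGraph (Fin n), IsDRegular G d ∧ x = f G} ∈ Set.Icc 0 2 :=
  ⟨Real.sSup_nonneg (by rintro x ⟨G, -, rfl⟩; exact hf0 G),
    Real.sSup_le (by rintro x ⟨G, -, rfl⟩; exact hf G) (by norm_num)⟩

theorem connBase_le_maxConnBase [Fintype V] {G : SimpleGraph V} {d : ℕ} (h : IsDRegular G d) :
    connBase G ≤ maxConnBase d (Nat.card V) := by
  rw [Nat.card_eq_fintype_card]
  let e := G.overFinIso rfl
  rw [connBase_congr e]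
  exact le_csSup ⟨2, by rintro x ⟨G, -, rfl⟩; exact connBase_le_two G⟩
    ⟨_, isDRegular_congr e h, rfl⟩

theorem domConnBase_le_maxDomConnBase [Fintype V] {G : SimpleGraph V} {d : ℕ}
    (h : IsDRegular G d) : domConnBase G ≤ maxDomConnBase d (Nat.card V) := by
  rw [Nat.card_eq_fintype_card]
  let e := G.overFinIso rfl
  rw [domConnBase_congr e]
  exact le_csSup ⟨2, by rintro x ⟨G, -, rfl⟩; exact domConnBase_le_two G⟩
    ⟨_, isDRegular_congr e h, rfl⟩

theorem isBoundedUnder_of_mem_Icc {f : ℕ → ℝ} (hf : ∀ n, f n ∈ Set.Icc (0 : ℝ) 2) (F : Filter ℕ) :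
    F.IsBoundedUnder (· ≤ ·) f ∧ F.IsBoundedUnder (· ≥ ·) f :=
  ⟨isBoundedUnder_of ⟨2, fun n => (hf n).2⟩, isBoundedUnder_of ⟨0, fun n => (hf n).1⟩⟩

theorem liminf_le_limsup_of_subsequence {f g : ℕ → ℝ} (hf : ∀ n, f n ∈ Set.Icc (0 : ℝ) 2)
    (hg : ∀ n, g n ∈ Set.Icc (0 : ℝ) 2) {φ : ℕ → ℕ} (hφ : Tendsto φ atTop atTop)
    (h : ∀ᶠ k in atTop, g k ≤ f (φ k)) : liminf g atTop ≤ limsup f atTop := by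
  have hfφ : ∀ n, (f ∘ φ) n ∈ Set.Icc (0 : ℝ) 2 := fun n => hf _
  have hb := isBoundedUnder_of_mem_Icc hf
  have hbφ := isBoundedUnder_of_mem_Icc hfφ
  have hbg := isBoundedUnder_of_mem_Icc hg
  calc liminf g atTop ≤ limsup g atTop := liminf_le_limsup (hbg _).1 (hbg _).2
    _ ≤ limsup (f ∘ φ) atTop := limsup_le_limsup h ((hbg _).2.isCoboundedUnder_le) (hbφ _).1
    _ = limsup f (map φ atTop) := rfl
    _ ≤ limsup f atTop := limsup_le_limsup_of_le hφ ((hb _).2.isCoboundedUnder_le) (hb _).1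

/-- Exponential growth of `N` gives a lower bound for its normalized roots. -/
theorem rpow_le_liminf_of_pow_le {ρ c : ℝ} (hρ : 0 < ρ) (hc : 0 < c) {N : ℕ → ℕ} {a : ℕ}
    (ha : 0 < a) (h : ∀ n : ℕ, n ≠ 0 → ρ ^ n ≤ c * N (n + 1)) (hN : ∀ k, N k ≤ 2 ^ (a * k)) :
    ρ ^ ((1 : ℝ) / a) ≤ liminf (fun k => (N k : ℝ) ^ ((1 : ℝ) / ((a * k : ℕ) : ℝ))) atTop := by
  have ha' : (0 : ℝ) < a := by exact_mod_cast ha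
  have hlim : Tendsto (fun k : ℕ => ρ ^ ((1 : ℝ) / a) * ((ρ * c)⁻¹) ^ ((1 : ℝ) / ((a * k : ℕ) : ℝ)))
      atTop (nhds (ρ ^ ((1 : ℝ) / a))) := by
    have hd : 0 < (ρ * c)⁻¹ := by positivity
    have h0 : Tendsto (fun k : ℕ => (1 : ℝ) / ((a * k : ℕ) : ℝ)) atTop (nhds 0) :=
      (tendsto_one_div_atTop_nhds_zero_nat (𝕜 := ℝ)).comp
        (tendsto_id.const_mul_atTop' ha)
    have h1 := (Real.continuousAt_const_rpow hd.ne' (b := 0)).tendsto.comp h0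
    rw [Real.rpow_zero] at h1
    simpa [Function.comp_def] using h1.const_mul (ρ ^ ((1 : ℝ) / a))
  rw [← hlim.liminf_eq]
  refine liminf_le_liminf ?_ hlim.isBoundedUnder_ge ?_
  · filter_upwards [eventually_ge_atTop 2] with k hk
    obtain ⟨n, rfl⟩ : ∃ n, k = n + 1 := ⟨k - 1, by omega⟩
    have hn : n ≠ 0 := by omega
    have hak : (0 : ℝ) < ((a * (n + 1) : ℕ) : ℝ) := by positivity
    have h1 : ρ ^ (n + 1) * (ρ * c)⁻¹ ≤ N (n + 1) := by
      rw [pow_succ, mul_inv]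
      have := h n hn
      field_simp
      linarith
    have h2 : ρ ^ ((1 : ℝ) / a) = (ρ ^ (n + 1)) ^ ((1 : ℝ) / ((a * (n + 1) : ℕ) : ℝ)) := by
      rw [← Real.rpow_natCast, ← Real.rpow_mul hρ.le]
      congr 1
      push_cast
      have : (n : ℝ) + 1 ≠ 0 := by positivity
      field_simp
    rw [h2, ← Real.mul_rpow (by positivity) (by positivity)]
    exact Real.rpow_le_rpow (by positivity) h1 (by positivity)
  · exact (isBoundedUnder_of ⟨2, fun k => rpow_one_div_le_two (hN k)⟩ :
      atTop.IsBoundedUnder (· ≤ ·) _).isCoboundedUnder_ge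

end Limits

namespace CycleIn

variable {V : Type*} {M : SimpleGraph V} {ℓ : ℕ} [NeZero ℓ] (C : CycleIn M ℓ) [Fintype V]

theorem card_glue_vertices (k : ℕ) : Nat.card (V × Fin k) = Fintype.card V * k := by
  simp

theorem rho_root_le_liminf (hC : C.column.Connected) (hρ : 0 < C.rho) :
    C.rho ^ ((1 : ℝ) / Fintype.card V) ≤
      liminf (fun k : ℕ => connBase (C.glue k)) atTop := by
  have hV : 0 < Fintype.card V := Fintype.card_pos_iff.2 ⟨C.vert 0⟩
  have hc : (0 : ℝ) < (Nat.card C.State : ℝ) ^ 2 := by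
    obtain ⟨σ, -⟩ := C.connModel.exists_full
    have : 0 < Nat.card C.State := Nat.card_pos_iff.2 ⟨⟨σ⟩, inferInstance⟩
    positivity
  have := rpow_le_liminf_of_pow_le hρ hc (N := fun k => numConn (C.glue k)) hV
    (fun n hn => C.rho_pow_le hC hn)
    (fun k => by rw [← card_glue_vertices]; exact numConn_le _)
  simpa only [connBase, card_glue_vertices] using this

theorem domRho_root_le_liminf (hC : C.column.Connected) (hρ : 0 < C.domRho) :
    C.domRho ^ ((1 : ℝ) / Fintype.card V) ≤
      liminf (fun k : ℕ => domConnBase (C.glue k)) atTop := by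
  have hV : 0 < Fintype.card V := Fintype.card_pos_iff.2 ⟨C.vert 0⟩
  have hc : (0 : ℝ) < (Nat.card C.DomState : ℝ) ^ 2 := by
    obtain ⟨σ, -⟩ := C.domModel.exists_full
    have : 0 < Nat.card C.DomState := Nat.card_pos_iff.2 ⟨⟨σ⟩, inferInstance⟩
    positivity
  have := rpow_le_liminf_of_pow_le hρ hc (N := fun k => numDomConn (C.glue k)) hV
    (fun n hn => C.domRho_pow_le hC hn)
    (fun k => by rw [← card_glue_vertices]; exact numDomConn_le _)
  simpa only [domConnBase, card_glue_vertices] using this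

theorem liminf_le_connConst {d : ℕ} (hM : IsDRegular M d) :
    liminf (fun k : ℕ => connBase (C.glue k)) atTop ≤ connConst d :=
  liminf_le_limsup_of_subsequence (φ := fun k => Fintype.card V * k)
    (fun _ => sSup_regular_mem _ connBase_nonneg connBase_le_two)
    (fun _ => ⟨connBase_nonneg _, connBase_le_two _⟩)
    (tendsto_id.const_mul_atTop' (Fintype.card_pos_iff.2 ⟨C.vert 0⟩))
    (Eventually.of_forall fun k => by
      rw [← card_glue_vertices]; exact connBase_le_maxConnBase (C.isDRegular_glue hM k))

theorem liminf_le_domConnConst {d : ℕ} (hM : IsDRegular M d) :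
    liminf (fun k : ℕ => domConnBase (C.glue k)) atTop ≤ domConnConst d :=
  liminf_le_limsup_of_subsequence (φ := fun k => Fintype.card V * k)
    (fun _ => sSup_regular_mem _ domConnBase_nonneg domConnBase_le_two)
    (fun _ => ⟨domConnBase_nonneg _, domConnBase_le_two _⟩)
    (tendsto_id.const_mul_atTop' (Fintype.card_pos_iff.2 ⟨C.vert 0⟩))
    (Eventually.of_forall fun k => by
      rw [← card_glue_vertices]; exact domConnBase_le_maxDomConnBase (C.isDRegular_glue hM k))

/-- Roots of approximated numbers. -/
theorem abs_root_sub_le {x lam b : ℝ} {n : ℕ} (hn : n ≠ 0) (hx : |x - lam| ≤ 0.005)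
    (hb : 0.0005 ≤ b) (h1 : (b - 0.0005) ^ n ≤ lam - 0.005)
    (h2 : lam + 0.005 ≤ (b + 0.0005) ^ n) : |x ^ ((1 : ℝ) / n) - b| ≤ 0.0005 := by
  rw [abs_le] at hx ⊢
  have hx0 : 0 ≤ x := by
    have : 0 ≤ (b - 0.0005) ^ n := pow_nonneg (by linarith) n
    linarith [hx.1]
  have hy0 : 0 ≤ x ^ ((1 : ℝ) / n) := Real.rpow_nonneg hx0 _
  have hpow : (x ^ ((1 : ℝ) / n)) ^ n = x := by
    rw [one_div, Real.rpow_inv_natCast_pow hx0 hn]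
  constructor
  · have : b - 0.0005 ≤ x ^ ((1 : ℝ) / n) :=
      le_of_pow_le_pow_left₀ hn hy0 (by rw [hpow]; linarith [hx.1])
    linarith
  · have : x ^ ((1 : ℝ) / n) ≤ b + 0.0005 :=
      le_of_pow_le_pow_left₀ hn (by linarith) (by rw [hpow]; linarith [hx.2])
    linarith

theorem le_rpow_one_div {x b : ℝ} {n : ℕ} (hn : n ≠ 0) (hb : 0 ≤ b) (h : b ^ n ≤ x) :
    b ≤ x ^ ((1 : ℝ) / n) := by
  have hx0 : 0 ≤ x := (pow_nonneg hb n).trans h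
  refine le_of_pow_le_pow_left₀ hn (Real.rpow_nonneg hx0 _) ?_
  rwa [one_div, Real.rpow_inv_natCast_pow hx0 hn]

/-- A line of the table follows from the approximations of the spectral radii. -/
theorem tableRow_of_rho {d n : ℕ} {lam b domLam domB : ℝ} (hM : IsDRegular M d)
    (hC : C.column.Connected) (hn : Fintype.card V = n) (hn0 : n ≠ 0)
    (hρ : |C.rho - lam| ≤ 0.005) (hb : 0.0005 ≤ b) (h1 : (b - 0.0005) ^ n ≤ lam - 0.005)
    (h2 : lam + 0.005 ≤ (b + 0.0005) ^ n) (hlam : 0.005 < lam)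
    (hρ' : |C.domRho - domLam| ≤ 0.005) (hb' : 0.0005 ≤ domB)
    (h1' : (domB - 0.0005) ^ n ≤ domLam - 0.005)
    (h2' : domLam + 0.005 ≤ (domB + 0.0005) ^ n) (hlam' : 0.005 < domLam) :
    C.TableRow d lam b domLam domB := by
  have hpos : 0 < C.rho := by linarith [(abs_le.1 hρ).1]
  have hpos' : 0 < C.domRho := by linarith [(abs_le.1 hρ').1]
  have hl := C.rho_root_le_liminf hC hpos
  have hl' := C.domRho_root_le_liminf hC hpos'
  exact
    { regular := fun k _ => C.isDRegular_glue hM k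
      rho_approx := hρ
      root_approx := by rw [hn]; exact abs_root_sub_le hn0 hρ hb h1 h2
      root_le_liminf := hl
      root_le_connConst := hl.trans (C.liminf_le_connConst hM)
      domRho_approx := hρ'
      domRoot_approx := by rw [hn]; exact abs_root_sub_le hn0 hρ' hb' h1' h2'
      domRoot_le_liminf := hl'
      domRoot_le_domConnConst := hl'.trans (C.liminf_le_domConnConst hM) }

theorem le_connConst_of_le_rho {d n : ℕ} {b : ℝ} (hM : IsDRegular M d)
    (hC : C.column.Connected) (hn : Fintype.card V = n) (hn0 : n ≠ 0) (hb : 0 < b)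
    (h : b ^ n ≤ C.rho) : b ≤ connConst d := by
  refine (le_rpow_one_div hn0 hb.le h).trans ?_
  rw [← hn]
  exact (C.rho_root_le_liminf hC ((pow_pos hb n).trans_le h)).trans (C.liminf_le_connConst hM)

theorem le_domConnConst_of_le_domRho {d n : ℕ} {b : ℝ} (hM : IsDRegular M d)
    (hC : C.column.Connected) (hn : Fintype.card V = n) (hn0 : n ≠ 0) (hb : 0 < b)
    (h : b ^ n ≤ C.domRho) : b ≤ domConnConst d := by
  refine (le_rpow_one_div hn0 hb.le h).trans ?_
  rw [← hn]
  exact (C.domRho_root_le_liminf hC ((pow_pos hb n).trans_le h)).trans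
    (C.liminf_le_domConnConst hM)

end CycleIn


/-! ### Isomorphic columns -/

section Transport

variable {V W ι κ : Type*}

theorem OccLinked.map {G : SimpleGraph V} {H : SimpleGraph W} {O : V → Bool} {O' : W → Bool}
    (f : V → W) (hf : ∀ v w, G.Adj v w → O v = true → O w = true → OccLinked H O' (f v) (f w))
    {v w : V} (h : OccLinked G O v w) : OccLinked H O' (f v) (f w) :=
  h.induct (fun x => OccLinked H O' (f v) (f x))
    (fun a b hab ha hb hva => hva.trans (hf a b hab ha hb)) (OccLinked.refl _)

theorem occLinked_comp_equiv {G : SimpleGraph V} {H : SimpleGraph W} (e : V ≃ W)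
    (he : ∀ v w, G.Adj v w ↔ H.Adj (e v) (e w)) {O : W → Bool} {v w : V} :
    OccLinked G (O ∘ e) v w ↔ OccLinked H O (e v) (e w) := by
  constructor
  · exact fun h => h.map e fun a b hab ha hb => OccLinked.of_adj ((he a b).1 hab) ha hb
  · intro h
    have := h.map (H := G) (O' := O ∘ e) e.symm fun a b hab ha hb =>
      OccLinked.of_adj (by rw [he]; simpa using hab) (by simpa using ha) (by simpa using hb)
    simpa using this

variable {G : SimpleGraph V} {H : SimpleGraph W} {vert : ι → V} {vert' : κ → W}

theorem columnOk_comp_equiv {D : Bool} (e : V ≃ W) (s : ι ≃ κ)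
    (he : ∀ v w, G.Adj v w ↔ H.Adj (e v) (e w)) (hv : ∀ i, e (vert i) = vert' (s i))
    (c : CutState κ) (O : W → Bool) (p : κ → Bool) :
    ColumnOk D G vert (c ∘ s) (O ∘ e) (p ∘ s) ↔ ColumnOk D H vert' c O p := by
  unfold ColumnOk
  rw [← e.forall_congr_right, ← e.forall_congr_right]
  refine and_congr (forall_congr' fun v => imp_congr_right fun _ => ?_)
    (imp_congr_right fun _ => forall_congr' fun v => imp_congr_right fun _ => or_congr ?_ ?_)
  · rw [← s.exists_congr_right]
    refine exists_congr fun i => ?_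
    rw [occLinked_comp_equiv e he, hv]
    rfl
  · rw [← e.exists_congr_right]
    refine exists_congr fun w => ?_
    rw [he]
    rfl
  · rw [← s.exists_congr_right]
    refine exists_congr fun i => ?_
    rw [← hv, e.apply_eq_iff_eq]
    rfl

theorem nextCut_comp_equiv (e : V ≃ W) (s : ι ≃ κ)
    (he : ∀ v w, G.Adj v w ↔ H.Adj (e v) (e w)) (hv : ∀ i, e (vert i) = vert' (s i))
    (c : CutState κ) (O : W → Bool) (p : κ → Bool) :
    nextCut G vert (c ∘ s) (O ∘ e) (p ∘ s) = nextCut H vert' c O p ∘ s := by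
  funext i
  have hl : ∀ j, OccLinked G (O ∘ e) (vert i) (vert j) ↔
      OccLinked H O (vert' (s i)) (vert' (s j)) := fun j => by
    rw [occLinked_comp_equiv e he, hv, hv]
  have he : (∃ j, (c ∘ s) j = (true, true) ∧ OccLinked G (O ∘ e) (vert i) (vert j)) ↔
      ∃ j, c j = (true, true) ∧ OccLinked H O (vert' (s i)) (vert' j) := by
    rw [← s.exists_congr_right]
    exact exists_congr fun j => and_congr_right fun _ => hl j
  simp only [nextCut, Function.comp_apply, hv, Prod.mk.injEq, true_and]
  exact if_congr Iff.rfl (decide_eq_decide.2 he) rfl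

/-- An isomorphism of columns that matches the cycle vertices commutes with the transfer operator. -/
theorem cutTransfer_comp_equiv [Fintype V] [Fintype W] [Fintype ι] [Fintype κ] {D : Bool}
    (e : V ≃ W) (s : ι ≃ κ) (he : ∀ v w, G.Adj v w ↔ H.Adj (e v) (e w))
    (hv : ∀ i, e (vert i) = vert' (s i)) (z : CutState ι → ℝ) (c : CutState κ) :
    cutTransfer D G vert z (c ∘ s) = cutTransfer D H vert' (fun c => z (c ∘ s)) c := by
  classical
  unfold cutTransfer
  rw [← (e.symm.arrowCongr (Equiv.refl Bool)).sum_comp]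
  refine Finset.sum_congr rfl fun O _ => ?_
  rw [← (s.symm.arrowCongr (Equiv.refl Bool)).sum_comp]
  refine Finset.sum_congr rfl fun p _ => ?_
  have hO : e.symm.arrowCongr (Equiv.refl Bool) O = O ∘ e := rfl
  have hp : s.symm.arrowCongr (Equiv.refl Bool) p = p ∘ s := rfl
  rw [hO, hp, columnOk_comp_equiv e s he hv, nextCut_comp_equiv e s he hv]
  refine if_congr (and_congr_left fun _ => ?_) rfl rfl
  rw [← s.forall_congr_right]
  simp only [Function.comp_apply, hv]

end Transport


/-! ### Vertex sets as bit masks -/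

section Masks

/-- The two bit masks have a common bit. -/
def meets (a b : ℕ) : Bool := Nat.ble 1 (Nat.land a b)

theorem meets_iff {a b : ℕ} :
    meets a b = true ↔ ∃ i, a.testBit i = true ∧ b.testBit i = true := by
  have h : ∀ i, (Nat.land a b).testBit i = (a.testBit i && b.testBit i) :=
    fun i => Nat.testBit_and a b i
  rw [meets, Nat.ble_eq]
  constructor
  · intro h1
    obtain ⟨i, hi⟩ := Nat.exists_testBit_of_ne_zero (Nat.one_le_iff_ne_zero.1 h1)
    rw [h, Bool.and_eq_true] at hi
    exact ⟨i, hi⟩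
  · rintro ⟨i, hi⟩
    by_contra h1
    have h2 : Nat.land a b = 0 := by omega
    have := h i
    rw [h2, hi.1, hi.2] at this
    simp at this

theorem testBit_lor (a b i : ℕ) : (Nat.lor a b).testBit i = (a.testBit i || b.testBit i) :=
  Nat.testBit_or a b i

theorem testBit_land (a b i : ℕ) : (Nat.land a b).testBit i = (a.testBit i && b.testBit i) :=
  Nat.testBit_and a b i

theorem testBit_foldr_lor {l : List ℕ} {m i : ℕ} :
    (l.foldr Nat.lor m).testBit i = true ↔ (∃ K ∈ l, K.testBit i = true) ∨ m.testBit i = true := by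
  induction l with
  | nil => simp
  | cons K l ih => simp [ih, or_assoc]

/-- The set with the given bit mask. -/
def maskVec (n m : ℕ) : Fin n → Bool := fun i => m.testBit i

theorem maskVec_ofBits {n : ℕ} (f : Fin n → Bool) : maskVec n (Nat.ofBits f) = f := by
  funext i
  exact Nat.testBit_ofBits_lt f i i.2

theorem eq_of_maskVec_eq {n a b : ℕ} (ha : a < 2 ^ n) (hb : b < 2 ^ n)
    (h : maskVec n a = maskVec n b) : a = b := by
  refine Nat.eq_of_testBit_eq fun i => ?_
  by_cases hi : i < n
  · exact congrFun h ⟨i, hi⟩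
  · rw [Nat.testBit_lt_two_pow (ha.trans_le (Nat.pow_le_pow_right (by norm_num) (by omega))),
      Nat.testBit_lt_two_pow (hb.trans_le (Nat.pow_le_pow_right (by norm_num) (by omega)))]

theorem sum_maskVec {n : ℕ} (F : (Fin n → Bool) → ℝ) :
    ∑ f : Fin n → Bool, F f = ∑ m ∈ Finset.range (2 ^ n), F (maskVec n m) := by
  refine Finset.sum_nbij' (fun f => Nat.ofBits f) (maskVec n) ?_ ?_ ?_ ?_ ?_
  · exact fun f _ => Finset.mem_range.2 (Nat.ofBits_lt_two_pow f)
  · exact fun _ _ => Finset.mem_univ _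
  · exact fun f _ => maskVec_ofBits f
  · intro m hm
    exact eq_of_maskVec_eq (Nat.ofBits_lt_two_pow _) (Finset.mem_range.1 hm) (maskVec_ofBits _)
  · intro f _
    rw [maskVec_ofBits]

theorem testBit_mul_add {l a b : ℕ} (hb : b < 2 ^ l) (j : ℕ) :
    (2 ^ l * a + b).testBit j = if j < l then b.testBit j else a.testBit (j - l) :=
  Nat.testBit_two_pow_mul_add a hb j

/-- The sum over the sets whose first `l` elements are prescribed. -/
theorem sum_maskVec_prefix {n l k : ℕ} (hn : n = l + k) {P : ℕ} (hP : P < 2 ^ l)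
    (F : (Fin n → Bool) → ℝ) (q : (Fin n → Bool) → Prop) {_ : DecidablePred q}
    (hq : ∀ f, q f ↔ ∀ i (hi : i < l), f ⟨i, by omega⟩ = P.testBit i) :
    (∑ f : Fin n → Bool, if q f then F f else 0) =
      ∑ I ∈ Finset.range (2 ^ k), F (maskVec n (2 ^ l * I + P)) := by
  rw [← Finset.sum_filter]
  have hlt : ∀ {I}, I < 2 ^ k → 2 ^ l * I + P < 2 ^ n := fun {I} hI => by
    have : 2 ^ l * (I + 1) ≤ 2 ^ l * 2 ^ k := Nat.mul_le_mul_left _ hI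
    rw [hn, pow_add]
    rw [mul_add] at this
    omega
  refine (Finset.sum_nbij (fun I => maskVec n (2 ^ l * I + P)) ?_ ?_ ?_ fun _ _ => rfl).symm
  · intro I _
    rw [Finset.mem_filter, hq]
    refine ⟨Finset.mem_univ _, fun i hi => ?_⟩
    simp [maskVec, testBit_mul_add hP, hi]
  · intro I hI J hJ h
    rw [Finset.mem_coe, Finset.mem_range] at hI hJ
    have h1 : 2 ^ l * I + P = 2 ^ l * J + P := eq_of_maskVec_eq (hlt hI) (hlt hJ) h
    exact Nat.eq_of_mul_eq_mul_left (by positivity) (Nat.add_right_cancel h1)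
  · intro f hf
    rw [Finset.mem_coe, Finset.mem_filter, hq] at hf
    refine ⟨Nat.ofBits f / 2 ^ l, ?_, ?_⟩
    · rw [Finset.mem_coe, Finset.mem_range]
      refine Nat.div_lt_of_lt_mul ?_
      rw [← pow_add, ← hn]
      exact Nat.ofBits_lt_two_pow f
    · funext i
      simp only [maskVec, testBit_mul_add hP]
      split_ifs with hi
      · exact (hf.2 i hi).symm
      · rw [Nat.testBit_div_two_pow]
        have : i - l + l = i := by omega
        rw [this]
        exact Nat.testBit_ofBits_lt f i i.2

end Masks

/-! ### Components of a column as bit masks -/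

section Components

/-- Join all sets of the list that meet `a` with the set `m`. -/
def joinAt (a m : ℕ) (cs : List ℕ) : List ℕ :=
  (cs.filter fun K => meets K a).foldr Nat.lor m :: cs.filter fun K => !meets K a

/-- The components of the subgraph of the occupied vertices in the list; `N` lists the
neighbourhoods of the vertices. -/
def components (N : List ℕ) (O : ℕ) : List ℕ → List ℕ
  | [] => []
  | v :: vs => bif O.testBit v then joinAt (N.getD v 0) (2 ^ v) (components N O vs)
      else components N O vs

variable {n : ℕ} {G : SimpleGraph (Fin n)} {N : List ℕ}

/-- The list `N` holds the neighbourhoods of the vertices of `G`. -/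
def IsNeighborList (G : SimpleGraph (Fin n)) (N : List ℕ) : Prop :=
  ∀ v w : Fin n, (N.getD v 0).testBit w = true ↔ G.Adj v w

/-- `cs` lists the components of the subgraph of `G` of the vertices in `vs` that are occupied. -/
structure IsComponents (G : SimpleGraph (Fin n)) (O : ℕ) (vs : List ℕ) (cs : List ℕ) : Prop where
  mem : ∀ K ∈ cs, ∀ x, K.testBit x = true → x ∈ vs ∧ O.testBit x = true
  linked : ∀ K ∈ cs, ∀ v w : Fin n, K.testBit v = true → K.testBit w = true →
    OccLinked G (maskVec n O) v w
  exists_mem : ∀ x ∈ vs, O.testBit x = true → ∃ K ∈ cs, K.testBit x = true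
  closed : ∀ K ∈ cs, ∀ v w : Fin n, (w : ℕ) ∈ vs → O.testBit w = true → G.Adj v w →
    K.testBit v = true → K.testBit w = true
  nonempty : ∀ K ∈ cs, ∃ x, K.testBit x = true

theorem isComponents_components (hN : IsNeighborList G N) (O : ℕ) (vs : List ℕ)
    (hvs : ∀ v ∈ vs, v < n) : IsComponents G O vs (components N O vs) := by
  induction vs with
  | nil => exact ⟨by simp [components], by simp [components], by simp, by simp [components],
      by simp [components]⟩
  | cons u vs ih =>
    have hu : u < n := hvs u (by simp)
    obtain ⟨h1, h2, h3, h4, h5⟩ := ih fun v hv => hvs v (by simp [hv])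
    rw [components]
    cases hO : O.testBit u
    · rw [cond_false]
      refine ⟨fun K hK x hx => ⟨List.mem_cons_of_mem _ (h1 K hK x hx).1, (h1 K hK x hx).2⟩, h2,
        fun x hx hx' => ?_, fun K hK v w hw hw' => ?_, h5⟩
      · rcases List.mem_cons.1 hx with rfl | hx
        · rw [hO] at hx'; simp at hx'
        · exact h3 x hx hx'
      · rcases List.mem_cons.1 hw with hw1 | hw
        · rw [hw1, hO] at hw'; simp at hw'
        · exact h4 K hK v w hw hw'
    · rw [cond_true]
      set a := N.getD u 0 with ha
      have hadj : ∀ w : Fin n, a.testBit w = true ↔ G.Adj ⟨u, hu⟩ w := hN ⟨u, hu⟩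
      -- the new component
      have hnew : ∀ x, ((List.filter (fun K => meets K a) (components N O vs)).foldr Nat.lor
          (2 ^ u)).testBit x = true ↔
          (∃ K ∈ components N O vs, meets K a = true ∧ K.testBit x = true) ∨ u = x := fun x => by
        rw [testBit_foldr_lor, Nat.testBit_two_pow, decide_eq_true_iff]
        simp [and_assoc]
      have hlink : ∀ K ∈ components N O vs, meets K a = true → ∀ x : Fin n, K.testBit x = true →
          OccLinked G (maskVec n O) ⟨u, hu⟩ x := by
        intro K hK hKa x hx
        obtain ⟨y, hy, hya⟩ := meets_iff.1 hKa
        have hyn : y < n := hvs y (List.mem_cons_of_mem _ (h1 K hK y hy).1)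
        exact (OccLinked.of_adj (G := G) (w := ⟨y, hyn⟩) ((hadj ⟨y, hyn⟩).1 hya) hO (h1 K hK y hy).2).trans
          (h2 K hK ⟨y, hyn⟩ x hy hx)
      have hlink' : ∀ x : Fin n, ((List.filter (fun K => meets K a)
          (components N O vs)).foldr Nat.lor (2 ^ u)).testBit x = true →
          OccLinked G (maskVec n O) ⟨u, hu⟩ x := by
        intro x hx
        rcases (hnew x).1 hx with ⟨K, hK, hKa, hx⟩ | hx
        · exact hlink K hK hKa x hx
        · have : x = ⟨u, hu⟩ := Fin.ext hx.symm
          rw [this]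
          exact OccLinked.refl _
      unfold joinAt
      refine ⟨?_, ?_, ?_, ?_, ?_⟩
      · intro K hK x hx
        rcases List.mem_cons.1 hK with rfl | hK
        · rcases (hnew x).1 hx with ⟨K, hK, -, hx⟩ | rfl
          · exact ⟨List.mem_cons_of_mem _ (h1 K hK x hx).1, (h1 K hK x hx).2⟩
          · exact ⟨List.mem_cons_self, hO⟩
        · have := h1 K (List.mem_filter.1 hK).1 x hx
          exact ⟨List.mem_cons_of_mem _ this.1, this.2⟩
      · intro K hK v w hv hw
        rcases List.mem_cons.1 hK with rfl | hK
        · exact (hlink' v hv).symm.trans (hlink' w hw)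
        · exact h2 K (List.mem_filter.1 hK).1 v w hv hw
      · intro x hx hx'
        rcases List.mem_cons.1 hx with rfl | hx
        · exact ⟨_, List.mem_cons_self, (hnew x).2 (Or.inr rfl)⟩
        · obtain ⟨K, hK, hKx⟩ := h3 x hx hx'
          by_cases hKa : meets K a = true
          · exact ⟨_, List.mem_cons_self, (hnew x).2 (Or.inl ⟨K, hK, hKa, hKx⟩)⟩
          · exact ⟨K, List.mem_cons_of_mem _ (List.mem_filter.2 ⟨hK, by simpa using hKa⟩), hKx⟩
      · intro K hK v w hw hw' hvw hv
        rcases List.mem_cons.1 hK with rfl | hK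
        · rw [hnew]
          rcases List.mem_cons.1 hw with hw1 | hw
          · exact Or.inr hw1.symm
          · left
            rcases (hnew v).1 hv with ⟨K, hK, hKa, hKv⟩ | hv
            · exact ⟨K, hK, hKa, h4 K hK v w hw hw' hvw hKv⟩
            · obtain ⟨K, hK, hKw⟩ := h3 w hw hw'
              have : v = ⟨u, hu⟩ := Fin.ext hv.symm
              exact ⟨K, hK, meets_iff.2 ⟨w, hKw, (hadj w).2 (this ▸ hvw)⟩, hKw⟩
        · obtain ⟨hK, hKa⟩ := List.mem_filter.1 hK
          rcases List.mem_cons.1 hw with hw1 | hw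
          · exfalso
            have hw2 : w = ⟨u, hu⟩ := Fin.ext hw1
            have : meets K a = true := meets_iff.2 ⟨v, hv, (hadj v).2 (hw2 ▸ hvw.symm)⟩
            simp [this] at hKa
          · exact h4 K hK v w hw hw' hvw hv
      · intro K hK
        rcases List.mem_cons.1 hK with rfl | hK
        · exact ⟨u, (hnew u).2 (Or.inr rfl)⟩
        · exact h5 K (List.mem_filter.1 hK).1

theorem IsComponents.linked_iff {O : ℕ} {cs : List ℕ} (h : IsComponents G O (List.range n) cs)
    {K : ℕ} (hK : K ∈ cs) {v : Fin n} (hv : K.testBit v = true) (w : Fin n) :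
    OccLinked G (maskVec n O) v w ↔ K.testBit w = true := by
  refine ⟨fun hl => hl.induct (fun x : Fin n => K.testBit x = true) ?_ hv, h.linked K hK v w hv⟩
  exact fun a b hab _ hb ha => h.closed K hK a b (List.mem_range.2 b.2) hb hab ha

/-- The unoccupied vertices without an occupied neighbour. -/
def isolatedVertices (N : List ℕ) (n O : ℕ) : List ℕ :=
  (List.range n).filter fun v => !O.testBit v && !meets (N.getD v 0) O

theorem mem_isolatedVertices (hN : IsNeighborList G N) {O : ℕ} (hO : O < 2 ^ n) {v : Fin n} :
    (v : ℕ) ∈ isolatedVertices N n O ↔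
      O.testBit v = false ∧ ¬ ∃ w, G.Adj v w ∧ maskVec n O w = true := by
  simp only [isolatedVertices, List.mem_filter, List.mem_range, v.2, true_and, Bool.and_eq_true,
    Bool.not_eq_true']
  refine and_congr_right fun _ => ?_
  rw [← Bool.not_eq_true, not_iff_not, meets_iff]
  constructor
  · rintro ⟨i, h1, h2⟩
    have hi : i < n := by
      by_contra hi
      rw [Nat.testBit_lt_two_pow (hO.trans_le (Nat.pow_le_pow_right (by norm_num)
        (by omega)))] at h2
      simp at h2
    exact ⟨⟨i, hi⟩, (hN v ⟨i, hi⟩).1 h1, h2⟩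
  · rintro ⟨w, h1, h2⟩
    exact ⟨w, (hN v w).2 h1, h2⟩

end Components


/-! ### Certificates for the transfer operator by tables of bit masks -/

/-- The index of a pattern: which of the masks in the list meet `Q`. -/
def hitIndex (Q : ℕ) : List ℕ → ℕ → ℕ
  | [], i => i
  | K :: Ks, i => hitIndex Q Ks (bif meets K Q then Nat.succ (Nat.mul 2 i) else Nat.mul 2 i)

/-- The union of `F` and the masks that meet `Q`. -/
def hitUnion (Q : ℕ) : List ℕ → ℕ → ℕ
  | [], F => F
  | K :: Ks, F => hitUnion Q Ks (bif meets K Q then Nat.lor F K else F)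

/-- The masks that do not meet `Q`, in front of the list `miss`. -/
def hitMiss (Q : ℕ) : List ℕ → List ℕ → List ℕ
  | [], miss => miss
  | K :: Ks, miss => hitMiss Q Ks (bif meets K Q then miss else K :: miss)

/-- The test `k` succeeds for all patterns. -/
def forallHits (k : ℕ → List ℕ → ℕ → Bool) : List ℕ → ℕ → List ℕ → ℕ → Bool
  | [], F, miss, i => k F miss i
  | K :: Ks, F, miss, i => forallHits k Ks F (K :: miss) (Nat.mul 2 i) &&
      forallHits k Ks (Nat.lor F K) miss (Nat.succ (Nat.mul 2 i))

theorem of_forallHits {k : ℕ → List ℕ → ℕ → Bool} (Q : ℕ) {Ks : List ℕ} {F : ℕ} {miss : List ℕ}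
    {i : ℕ} (h : forallHits k Ks F miss i = true) :
    k (hitUnion Q Ks F) (hitMiss Q Ks miss) (hitIndex Q Ks i) = true := by
  induction Ks generalizing F miss i with
  | nil => exact h
  | cons K Ks ih =>
    rw [forallHits, Bool.and_eq_true] at h
    rw [hitUnion, hitMiss, hitIndex]
    cases meets K Q
    · exact ih h.1
    · exact ih h.2

theorem testBit_hitUnion {Q : ℕ} {Ks : List ℕ} {F x : ℕ} :
    (hitUnion Q Ks F).testBit x = true ↔
      F.testBit x = true ∨ ∃ K ∈ Ks, meets K Q = true ∧ K.testBit x = true := by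
  induction Ks generalizing F with
  | nil => simp [hitUnion]
  | cons K Ks ih =>
    rw [hitUnion, ih]
    cases h : meets K Q <;> simp [h, or_assoc]

theorem mem_hitMiss {Q : ℕ} {Ks miss : List ℕ} {K : ℕ} :
    K ∈ hitMiss Q Ks miss ↔ K ∈ miss ∨ K ∈ Ks ∧ meets K Q = false := by
  induction Ks generalizing miss with
  | nil => simp [hitMiss]
  | cons L Ks ih =>
    rw [hitMiss, ih]
    cases h : meets L Q
    · simp only [cond_false, List.mem_cons]
      constructor
      · rintro ((rfl | h1) | h1)
        · exact Or.inr ⟨Or.inl rfl, h⟩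
        · exact Or.inl h1
        · exact Or.inr ⟨Or.inr h1.1, h1.2⟩
      · rintro (h1 | ⟨rfl | h1, h2⟩)
        · exact Or.inl (Or.inr h1)
        · exact Or.inl (Or.inl rfl)
        · exact Or.inr ⟨h1, h2⟩
    · simp only [cond_true, List.mem_cons]
      refine or_congr_right (and_congr_left fun h1 => ⟨Or.inr, ?_⟩)
      rintro (rfl | h2)
      · rw [h] at h1; simp at h1
      · exact h2

/-- A family of columns with the same traces on the cycle: the components, the undominated cycle
vertices, the number of the columns, and the position of their values in the table. -/
abbrev MaskEntry := List ℕ × List ℕ × ℕ × ℕ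

/-- A table that describes a function of cut states. The vertices of the column are numbered
beginning with those on the cycle; `entries` lists, for all sets of occupied cycle vertices, the
corresponding columns. -/
structure CutTable where
  dom : Bool
  len : ℕ
  inner : ℕ
  nbrs : List ℕ
  width : ℕ
  values : ℕ
  entries : List (List MaskEntry)

namespace CutTable

variable (T : CutTable)

/-- The traces of the components and of the undominated vertices of a column on the cycle, if every
component meets the cycle and every undominated vertex lies on it. -/
def columnParts (O : ℕ) : Option (List ℕ × List ℕ) :=
  let cs := components T.nbrs O (List.range (T.len + T.inner))
  let iso := bif T.dom then isolatedVertices T.nbrs (T.len + T.inner) O else []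
  bif cs.all (fun K => meets K (2 ^ T.len - 1)) && iso.all (fun v => Nat.blt v T.len) then
    some (cs.map fun K => Nat.land K (2 ^ T.len - 1), iso.map fun v => 2 ^ v) else none

/-- The value number `i`. -/
def value (i : ℕ) : ℕ := Nat.mod (Nat.shiftRight T.values (Nat.mul T.width i)) (Nat.pow 2 T.width)

/-- The contribution of some entries. -/
def entrySum (Q R : ℕ) : List MaskEntry → ℕ
  | [] => 0
  | e :: es => Nat.add (Nat.mul e.2.2.1
      (T.value (Nat.add e.2.2.2 (hitIndex R e.2.1 (hitIndex Q e.1 0))))) (entrySum Q R es)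

/-- The value at the cut state with the sets `P` of occupied vertices, `Q` of vertices with fixed
left neighbour, and `R` of empty vertices with occupied left neighbour. -/
def maskValue (P Q R : ℕ) : ℕ := T.entrySum Q R (T.entries.getD P [])

/-- The sum of the values over all next columns: `P` is the set of occupied cycle vertices, `F` of the
fixed ones, and the next column has to meet all sets in `miss`. -/
def columnSum (P F : ℕ) (miss : List ℕ) : ℕ → List (List MaskEntry) → ℕ
  | _, [] => 0
  | p, rs :: t =>
    Nat.add (bif meets F p && miss.all (fun K => meets K p) then
      T.entrySum (Nat.land F p) (Nat.xor P (Nat.land P p)) rs else 0)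
      (columnSum P F miss (Nat.succ p) t)

/-- The entries for `P` are correct, and `rel` holds between the values and the sums of the values of
the successors; in the strict case, there is an entry. -/
def check (strict : Bool) (rel : ℕ → ℕ → Bool) (P : ℕ) : Bool :=
  let rs := T.entries.getD P []
  ((List.range (2 ^ T.inner)).filterMap fun I => T.columnParts (2 ^ T.len * I + P)).isPerm
    (rs.flatMap fun e => List.replicate e.2.2.1 (e.1, e.2.1)) &&
  !(strict && rs.isEmpty) && rs.all fun e => Nat.blt 0 e.2.2.1 &&
    forallHits (fun F miss i => Nat.beq F 0 || forallHits (fun _ miss j =>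
      rel (T.value (Nat.add e.2.2.2 j)) (T.columnSum P F miss 0 T.entries)) e.2.1 0 miss i)
      e.1 0 [] 0

theorem columnSum_eq (P F : ℕ) (miss : List ℕ) (p : ℕ) (t : List (List MaskEntry)) :
    T.columnSum P F miss p t = ∑ i ∈ Finset.range t.length,
      if meets F (p + i) = true ∧ ∀ K ∈ miss, meets K (p + i) = true then
        T.entrySum (Nat.land F (p + i)) (Nat.xor P (Nat.land P (p + i))) (t.getD i []) else 0 := by
  induction t generalizing p with
  | nil => simp [columnSum]
  | cons rs t ih =>
    rw [columnSum, ih, List.length_cons, Finset.sum_range_succ']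
    refine (Nat.add_comm _ _).trans (congrArg₂ _ (Finset.sum_congr rfl fun i _ => ?_) ?_)
    · have : Nat.succ p + i = p + (i + 1) := by omega
      rw [this]
      rfl
    · rw [Bool.cond_eq_ite]
      refine if_congr ?_ rfl rfl
      simp

theorem sum_filterMap {α : Type*} (f : ℕ → Option α) (g : α → ℕ) (m : ℕ) :
    (((List.range m).filterMap f).map g).sum =
      ∑ i ∈ Finset.range m, ((f i).elim 0 g) := by
  induction m with
  | zero => simp
  | succ m ih =>
    rw [List.range_succ, List.filterMap_append, List.map_append, List.sum_append, ih,
      Finset.sum_range_succ]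
    cases h : f m <;> simp [h]

theorem sum_flatMap_replicate {α β : Type*} (l : List α) (m : α → ℕ) (k : α → β) (g : β → ℕ) :
    ((l.flatMap fun e => List.replicate (m e) (k e)).map g).sum =
      (l.map fun e => m e * g (k e)).sum := by
  induction l with
  | nil => simp
  | cons a l ih => simp [ih]

theorem entrySum_eq (Q R : ℕ) (rs : List MaskEntry) : T.entrySum Q R rs =
    (rs.map fun e => e.2.2.1 *
      T.value (e.2.2.2 + hitIndex R e.2.1 (hitIndex Q e.1 0))).sum := by
  induction rs with
  | nil => rfl
  | cons e rs ih => rw [entrySum, ih]; rfl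

end CutTable

/-! ### The masks of a cut state -/

namespace CutState

variable {l : ℕ} (c : CutState (Fin l))

/-- The occupied vertices. -/
def occMask : ℕ := Nat.ofBits fun i => (c i).1

/-- The occupied vertices with a fixed left neighbour. -/
def fixMask : ℕ := Nat.ofBits fun i => (c i).1 && (c i).2

/-- The empty vertices with an occupied left neighbour. -/
def domMask : ℕ := Nat.ofBits fun i => !(c i).1 && (c i).2

theorem testBit_ofBits {f : Fin l → Bool} {i : ℕ} :
    (Nat.ofBits f).testBit i = true ↔ ∃ h : i < l, f ⟨i, h⟩ = true := by
  by_cases h : i < l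
  · simp [Nat.testBit_ofBits_lt f i h, h]
  · simp [Nat.testBit_ofBits_ge f i (by omega), h]

theorem live_iff : c.Live ↔ c.fixMask ≠ 0 := by
  constructor
  · rintro ⟨i, hi⟩ h0
    have : c.fixMask.testBit i = true := testBit_ofBits.2 ⟨i.2, by simp [hi]⟩
    rw [h0] at this
    simp at this
  · intro h
    obtain ⟨i, hi⟩ := Nat.exists_testBit_of_ne_zero h
    obtain ⟨h, hi⟩ := testBit_ofBits.1 hi
    refine ⟨⟨i, h⟩, ?_⟩
    rw [Bool.and_eq_true] at hi
    exact Prod.ext hi.1 hi.2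

end CutState


namespace CutTable

variable {T : CutTable} {G : SimpleGraph (Fin (T.len + T.inner))}
  {vert : Fin T.len → Fin (T.len + T.inner)}

theorem meets_land_iff {l K p : ℕ} : meets (Nat.land K (2 ^ l - 1)) p = true ↔
    ∃ i : Fin l, K.testBit i = true ∧ maskVec l p i = true := by
  rw [meets_iff]
  simp only [testBit_land, Nat.testBit_two_pow_sub_one, Bool.and_eq_true, decide_eq_true_iff]
  constructor
  · rintro ⟨i, ⟨h1, h2⟩, h3⟩
    exact ⟨⟨i, h2⟩, h1, h3⟩
  · rintro ⟨i, h1, h2⟩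
    exact ⟨i, ⟨h1, i.2⟩, h2⟩

theorem meets_two_pow {a v : ℕ} : meets (2 ^ v) a = true ↔ a.testBit v = true := by
  rw [meets_iff]
  simp [Nat.testBit_two_pow]

theorem columnParts_eq_some {O : ℕ} {s : List ℕ × List ℕ} : T.columnParts O = some s ↔
    (∀ K ∈ components T.nbrs O (List.range (T.len + T.inner)),
      meets K (2 ^ T.len - 1) = true) ∧
    (T.dom = true → ∀ v ∈ isolatedVertices T.nbrs (T.len + T.inner) O, v < T.len) ∧
    s = ((components T.nbrs O (List.range (T.len + T.inner))).map fun K =>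
        Nat.land K (2 ^ T.len - 1),
      (bif T.dom then isolatedVertices T.nbrs (T.len + T.inner) O else []).map fun v => 2 ^ v) := by
  unfold columnParts
  simp only [Bool.cond_eq_ite]
  rw [Option.ite_none_right_eq_some, Bool.and_eq_true, List.all_eq_true, List.all_eq_true, and_assoc]
  refine and_congr_right fun _ => and_congr ?_ ?_
  · cases T.dom <;> simp [Nat.blt_eq]
  · rw [Option.some_inj, eq_comm]

theorem columnOk_iff (hN : IsNeighborList G T.nbrs) (hv : ∀ i, (vert i : ℕ) = i)
    (c : CutState (Fin T.len)) {O : ℕ} (hO : O < 2 ^ (T.len + T.inner)) (p : ℕ) :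
    ColumnOk T.dom G vert c (maskVec _ O) (maskVec _ p) ↔
      ∃ s, T.columnParts O = some s ∧
        (∀ K ∈ s.1, meets K c.fixMask = true ∨ meets K p = true) ∧
        ∀ e ∈ s.2, meets e c.domMask = true ∨ meets e p = true := by
  have hc := isComponents_components hN O (List.range (T.len + T.inner))
    fun v hv => List.mem_range.1 hv
  have hfix : ∀ i, maskVec T.len c.fixMask i = true ↔ c i = (true, true) := fun i => by
    rw [CutState.fixMask, maskVec_ofBits, Bool.and_eq_true, Prod.ext_iff]
  have hdom : ∀ i, maskVec T.len c.domMask i = true ↔ c i = (false, true) := fun i => by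
    rw [CutState.domMask, maskVec_ofBits, Bool.and_eq_true, Prod.ext_iff, Bool.not_eq_true']
  have hvert : ∀ (v : Fin (T.len + T.inner)) i, v = vert i ↔ (v : ℕ) = i := fun v i => by
    rw [Fin.ext_iff, hv]
  constructor
  · rintro ⟨h1, h2⟩
    have h3 : ∀ K ∈ components T.nbrs O (List.range (T.len + T.inner)), ∃ i : Fin T.len,
        K.testBit i = true ∧ (c i = (true, true) ∨ maskVec _ p i = true) := by
      intro K hK
      obtain ⟨x, hx⟩ := hc.nonempty K hK
      obtain ⟨hx1, hx2⟩ := hc.mem K hK x hx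
      obtain ⟨i, hi, hi'⟩ := h1 ⟨x, List.mem_range.1 hx1⟩ hx2
      refine ⟨i, ?_, hi'⟩
      have := (hc.linked_iff hK hx _).1 hi
      rwa [hv] at this
    have h4 : T.dom = true → ∀ v ∈ isolatedVertices T.nbrs (T.len + T.inner) O, ∃ i : Fin T.len,
        v = i ∧ (c i = (false, true) ∨ maskVec _ p i = true) := by
      intro hD v hvI
      have hvn : v < T.len + T.inner := List.mem_range.1 (List.mem_filter.1 hvI).1
      obtain ⟨hv1, hv2⟩ := (mem_isolatedVertices hN hO (v := ⟨v, hvn⟩)).1 hvI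
      obtain ⟨i, hi, hi'⟩ := (h2 hD ⟨v, hvn⟩ hv1).resolve_left hv2
      exact ⟨i, (hvert _ _).1 hi, hi'⟩
    refine ⟨_, columnParts_eq_some.2 ⟨fun K hK => ?_, fun hD v hvI => ?_, rfl⟩, ?_, ?_⟩
    · obtain ⟨i, hi, -⟩ := h3 K hK
      exact meets_iff.2 ⟨i, hi, by simp [Nat.testBit_two_pow_sub_one]⟩
    · obtain ⟨i, hi, -⟩ := h4 hD v hvI
      omega
    · intro L hL
      obtain ⟨K, hK, rfl⟩ := List.mem_map.1 hL
      obtain ⟨i, hi, h | h⟩ := h3 K hK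
      · exact Or.inl (meets_land_iff.2 ⟨i, hi, (hfix i).2 h⟩)
      · exact Or.inr (meets_land_iff.2 ⟨i, hi, h⟩)
    · intro e he
      obtain ⟨v, hvI, rfl⟩ := List.mem_map.1 he
      cases hD : T.dom
      · rw [hD] at hvI; simp at hvI
      · rw [hD, cond_true] at hvI
        obtain ⟨i, rfl, h | h⟩ := h4 hD v hvI
        · exact Or.inl (meets_two_pow.2 ((hdom i).2 h))
        · exact Or.inr (meets_two_pow.2 h)
  · rintro ⟨s, hs, h1, h2⟩
    obtain ⟨h3, h4, rfl⟩ := columnParts_eq_some.1 hs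
    refine ⟨fun v hvO => ?_, fun hD v hvO => ?_⟩
    · obtain ⟨K, hK, hKv⟩ := hc.exists_mem v (List.mem_range.2 v.2) hvO
      rcases h1 _ (List.mem_map.2 ⟨K, hK, rfl⟩) with h | h
      · obtain ⟨i, hi, hi'⟩ := meets_land_iff.1 h
        exact ⟨i, (hc.linked_iff hK hKv _).2 (by rwa [hv]), Or.inl ((hfix i).1 hi')⟩
      · obtain ⟨i, hi, hi'⟩ := meets_land_iff.1 h
        exact ⟨i, (hc.linked_iff hK hKv _).2 (by rwa [hv]), Or.inr hi'⟩
    · by_cases hw : ∃ w, G.Adj v w ∧ maskVec _ O w = true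
      · exact Or.inl hw
      · right
        have hvI := (mem_isolatedVertices hN hO).2 ⟨hvO, hw⟩
        have hvl := h4 hD v hvI
        refine ⟨⟨v, hvl⟩, (hvert _ _).2 rfl, ?_⟩
        rw [hD, cond_true] at h2
        rcases h2 _ (List.mem_map.2 ⟨v, hvI, rfl⟩) with h | h
        · exact Or.inl ((hdom ⟨v, hvl⟩).1 (meets_two_pow.1 h))
        · exact Or.inr (meets_two_pow.1 h)

/-- The masks of the next cut state. -/
theorem nextCut_masks (hN : IsNeighborList G T.nbrs) (hv : ∀ i, (vert i : ℕ) = i)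
    (c : CutState (Fin T.len)) {O : ℕ} {s : List ℕ × List ℕ} (hs : T.columnParts O = some s)
    (hOc : ∀ i : Fin T.len, O.testBit i = (c i).1) {p : ℕ} (hp : p < 2 ^ T.len) :
    (nextCut G vert c (maskVec _ O) (maskVec _ p)).occMask = p ∧
    (nextCut G vert c (maskVec _ O) (maskVec _ p)).fixMask =
      Nat.land (hitUnion c.fixMask s.1 0) p ∧
    (nextCut G vert c (maskVec _ O) (maskVec _ p)).domMask =
      Nat.xor c.occMask (Nat.land c.occMask p) := by
  have hc := isComponents_components hN O (List.range (T.len + T.inner))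
    fun v hv => List.mem_range.1 hv
  obtain ⟨h3, -, rfl⟩ := columnParts_eq_some.1 hs
  have hP : c.occMask < 2 ^ T.len := Nat.ofBits_lt_two_pow _
  have hland : ∀ a, Nat.land a p < 2 ^ T.len := fun a => Nat.and_lt_two_pow a hp
  have hxor : Nat.xor c.occMask (Nat.land c.occMask p) < 2 ^ T.len :=
    Nat.xor_lt_two_pow hP (hland _)
  have k1 : ∀ i : Fin T.len, (nextCut G vert c (maskVec _ O) (maskVec _ p) i).1 = p.testBit i :=
    fun i => rfl
  have k2 : ∀ i : Fin T.len, p.testBit i = true →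
      ((nextCut G vert c (maskVec _ O) (maskVec _ p) i).2 = true ↔
        ∃ j, c j = (true, true) ∧ OccLinked G (maskVec _ O) (vert i) (vert j)) := fun i hi => by
    have : maskVec T.len p i = true := hi
    simp only [nextCut, this, if_true, decide_eq_true_iff]
  have k3 : ∀ i : Fin T.len, p.testBit i = false →
      (nextCut G vert c (maskVec _ O) (maskVec _ p) i).2 = (c i).1 := fun i hi => by
    have h1 : maskVec T.len p i = false := hi
    have h2 : maskVec (T.len + T.inner) O (vert i) = (c i).1 := by rw [maskVec, hv, hOc]
    simp only [nextCut, h1, h2, Bool.false_eq_true, if_false]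
  refine ⟨eq_of_maskVec_eq (Nat.ofBits_lt_two_pow _) hp ?_,
    eq_of_maskVec_eq (Nat.ofBits_lt_two_pow _) (hland _) ?_,
    eq_of_maskVec_eq (Nat.ofBits_lt_two_pow _) hxor ?_⟩
  · rw [CutState.occMask, maskVec_ofBits]
    rfl
  · rw [CutState.fixMask, maskVec_ofBits]
    funext i
    rw [k1, maskVec, testBit_land]
    cases hpi : p.testBit i
    · simp
    · rw [Bool.true_and, Bool.and_true, Bool.eq_iff_iff, k2 i hpi, testBit_hitUnion]
      simp only [Nat.zero_testBit, Bool.false_eq_true, false_or]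
      constructor
      · rintro ⟨j, hj, hl⟩
        have hjO : O.testBit (vert j) = true := by rw [hv, hOc, hj]
        obtain ⟨K, hK, hKj⟩ := hc.exists_mem (vert j) (List.mem_range.2 (vert j).2) hjO
        have hKi := (hc.linked_iff hK hKj _).1 hl.symm
        rw [hv] at hKi hKj
        refine ⟨_, List.mem_map.2 ⟨K, hK, rfl⟩, meets_land_iff.2 ⟨j, hKj, ?_⟩, ?_⟩
        · rw [CutState.fixMask, maskVec_ofBits, hj]; rfl
        · simp [hKi]
      · rintro ⟨L, hL, hm, hLi⟩
        obtain ⟨K, hK, rfl⟩ := List.mem_map.1 hL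
        obtain ⟨j, hj, hj'⟩ := meets_land_iff.1 hm
        rw [testBit_land, Bool.and_eq_true] at hLi
        rw [CutState.fixMask, maskVec_ofBits, Bool.and_eq_true] at hj'
        exact ⟨j, Prod.ext hj'.1 hj'.2, (hc.linked_iff hK (by rw [hv]; exact hLi.1) _).2
          (by rw [hv]; exact hj)⟩
  · rw [CutState.domMask, maskVec_ofBits]
    funext i
    have h1 : (Nat.xor c.occMask (Nat.land c.occMask p)).testBit i =
        (c.occMask.testBit i ^^ (c.occMask.testBit i && p.testBit i)) := by
      rw [← testBit_land]
      exact Nat.testBit_xor _ _ _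
    have h2 : c.occMask.testBit i = (c i).1 := Nat.testBit_ofBits_lt _ i i.2
    rw [k1, maskVec, h1, h2]
    cases hpi : p.testBit i
    · rw [k3 i hpi]; simp
    · simp

end CutTable


open Classical in
theorem cutTransfer_eq_sum {V ι : Type*} [Fintype V] [DecidableEq V] [Fintype ι] [DecidableEq ι]
    (D : Bool) (G : SimpleGraph V) (vert : ι → V) (z : CutState ι → ℝ) (c : CutState ι) :
    cutTransfer D G vert z c = ∑ O : V → Bool, if ∀ i, O (vert i) = (c i).1 then ∑ p : ι → Bool,
      if ColumnOk D G vert c O p then z (nextCut G vert c O p) else 0 else 0 := by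
  unfold cutTransfer
  simp only [ite_and]
  convert (Finset.sum_congr rfl fun O _ => ?_) using 1
  · congr!
  · by_cases h : ∀ i, O (vert i) = (c i).1
    · simp only [h, implies_true, if_true]
      congr!
    · simp only [h, if_false, Finset.sum_const_zero]

namespace CutTable

variable (T : CutTable)

/-- The function of cut states that is given by the table. -/
noncomputable def cutValue (c : CutState (Fin T.len)) : ℝ :=
  if c.fixMask = 0 then 0 else T.maskValue c.occMask c.fixMask c.domMask

variable {T} {G : SimpleGraph (Fin (T.len + T.inner))}
  {vert : Fin T.len → Fin (T.len + T.inner)}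

theorem cutTransfer_cutValue (hN : IsNeighborList G T.nbrs) (hv : ∀ i, (vert i : ℕ) = i)
    (hlen : T.entries.length = 2 ^ T.len) (c : CutState (Fin T.len)) :
    cutTransfer T.dom G vert T.cutValue c = (∑ I ∈ Finset.range (2 ^ T.inner),
      ((T.columnParts (2 ^ T.len * I + c.occMask)).elim 0 fun s =>
        T.columnSum c.occMask (hitUnion c.fixMask s.1 0)
          (hitMiss c.domMask s.2 (hitMiss c.fixMask s.1 [])) 0 T.entries) : ℕ) := by
  classical
  have hP : c.occMask < 2 ^ T.len := Nat.ofBits_lt_two_pow _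
  have hbit : ∀ i : Fin T.len, c.occMask.testBit i = (c i).1 := fun i =>
    Nat.testBit_ofBits_lt _ i i.2
  rw [cutTransfer_eq_sum]
  refine (sum_maskVec_prefix rfl hP (fun O => ∑ p : Fin T.len → Bool,
      if ColumnOk T.dom G vert c O p then T.cutValue (nextCut G vert c O p) else 0)
    (fun O => ∀ i, O (vert i) = (c i).1) ?_).trans ?_
  rotate_left
  · push_cast
    refine Finset.sum_congr rfl fun I hI => ?_
    rw [Finset.mem_range] at hI
    have hO : 2 ^ T.len * I + c.occMask < 2 ^ (T.len + T.inner) := by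
      have : 2 ^ T.len * (I + 1) ≤ 2 ^ T.len * 2 ^ T.inner := Nat.mul_le_mul_left _ hI
      rw [pow_add]
      rw [mul_add] at this
      omega
    have hOc : ∀ i : Fin T.len, (2 ^ T.len * I + c.occMask).testBit i = (c i).1 := fun i => by
      rw [testBit_mul_add hP, if_pos i.2, hbit]
    generalize 2 ^ T.len * I + c.occMask = O at hO hOc
    rw [sum_maskVec]
    cases hs : T.columnParts O with
    | none =>
      refine (Finset.sum_eq_zero fun p hp => if_neg fun h => ?_).trans (by simp)
      obtain ⟨s, hs', -⟩ := (columnOk_iff hN hv c hO p).1 h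
      rw [hs] at hs'
      exact absurd hs' (by simp)
    | some s =>
      rw [Option.elim_some, columnSum_eq, hlen]
      push_cast
      refine Finset.sum_congr rfl fun p hp => ?_
      obtain ⟨m1, m2, m3⟩ := nextCut_masks hN hv c hs hOc (Finset.mem_range.1 hp)
      have hcol : ColumnOk T.dom G vert c (maskVec _ O) (maskVec _ p) ↔
          ∀ K ∈ hitMiss c.domMask s.2 (hitMiss c.fixMask s.1 []), meets K p = true := by
        rw [columnOk_iff hN hv c hO]
        simp only [hs, Option.some_inj, exists_eq_left', mem_hitMiss, List.not_mem_nil, false_or]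
        constructor
        · rintro ⟨h1, h2⟩ K (⟨hK, hK'⟩ | ⟨hK, hK'⟩)
          · exact (h1 K hK).resolve_left (by simp [hK'])
          · exact (h2 K hK).resolve_left (by simp [hK'])
        · intro h
          refine ⟨fun K hK => ?_, fun K hK => ?_⟩
          · by_cases h1 : meets K c.fixMask = true
            · exact Or.inl h1
            · exact Or.inr (h K (Or.inl ⟨hK, by simpa using h1⟩))
          · by_cases h1 : meets K c.domMask = true
            · exact Or.inl h1
            · exact Or.inr (h K (Or.inr ⟨hK, by simpa using h1⟩))
      have hfix : Nat.land (hitUnion c.fixMask s.1 0) p = 0 ↔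
          ¬ meets (hitUnion c.fixMask s.1 0) p = true := by
        rw [meets, Nat.ble_eq]
        omega
      rw [zero_add, cutValue, m1, m2, m3, maskValue]
      by_cases hok : ColumnOk T.dom G vert c (maskVec _ O) (maskVec _ p)
      · rw [if_pos hok]
        by_cases hm : meets (hitUnion c.fixMask s.1 0) p = true
        · rw [if_neg (fun h => hfix.1 h hm), if_pos ⟨hm, hcol.1 hok⟩]
        · rw [if_pos (hfix.2 hm), if_neg fun h => hm h.1]
      · rw [if_neg hok, if_neg fun h => hok (hcol.2 h.2)]
  · intro O
    constructor
    · intro h i hi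
      rw [hbit ⟨i, hi⟩, ← h]
      exact congrArg O (Fin.ext (hv ⟨i, hi⟩).symm)
    · intro h i
      rw [← hbit, ← h i i.2]
      exact congrArg O (Fin.ext (hv i))

/-- `c` is a combination of cut states for which `rel` holds between the value and the sum of the
values of the successors; in the strict case, the combination is not empty. -/
def Certified {l : ℕ} (strict : Bool) (rel : ℕ → ℕ → Bool) (z z' : CutState (Fin l) → ℝ)
    (c : CutState (Fin l)) : Prop :=
  ∃ L : List (ℕ × ℕ × ℕ), (strict = true → L ≠ []) ∧
    (∀ x ∈ L, 0 < x.1 ∧ rel x.2.1 x.2.2 = true) ∧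
    z c = ((L.map fun x => x.1 * x.2.1).sum : ℕ) ∧ z' c = ((L.map fun x => x.1 * x.2.2).sum : ℕ)

theorem certified_of_check (hN : IsNeighborList G T.nbrs) (hv : ∀ i, (vert i : ℕ) = i)
    (hlen : T.entries.length = 2 ^ T.len) {strict : Bool} {rel : ℕ → ℕ → Bool}
    {c : CutState (Fin T.len)} (hc : c.Live) (h : T.check strict rel c.occMask = true) :
    Certified strict rel T.cutValue (cutTransfer T.dom G vert T.cutValue) c := by
  rw [check] at h
  simp only [Bool.and_eq_true, List.isPerm_iff, List.all_eq_true, Bool.not_eq_true',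
    Nat.blt_eq] at h
  obtain ⟨⟨hperm, hne⟩, hall⟩ := h
  set rs := T.entries.getD c.occMask [] with hrs
  let S : List ℕ × List ℕ → ℕ := fun s => T.columnSum c.occMask (hitUnion c.fixMask s.1 0)
    (hitMiss c.domMask s.2 (hitMiss c.fixMask s.1 [])) 0 T.entries
  refine ⟨rs.map fun e => (e.2.2.1, T.value (e.2.2.2 + hitIndex c.domMask e.2.1
    (hitIndex c.fixMask e.1 0)), S (e.1, e.2.1)), ?_, ?_, ?_, ?_⟩
  · intro hs
    rw [hs] at hne
    simpa using hne
  · intro x hx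
    obtain ⟨e, he, rfl⟩ := List.mem_map.1 hx
    obtain ⟨h1, h2⟩ := hall e he
    refine ⟨h1, ?_⟩
    have h3 := of_forallHits c.fixMask h2
    have h4 : Nat.beq (hitUnion c.fixMask e.1 0) 0 = false := by
      rw [← Bool.not_eq_true, Nat.beq_eq]
      -- the fixed vertices belong to some component
      intro h0
      obtain ⟨i, hi⟩ := hc
      have hmem : (e.1, e.2.1) ∈ (List.range (2 ^ T.inner)).filterMap fun I =>
          T.columnParts (2 ^ T.len * I + c.occMask) :=
        hperm.mem_iff.2 (List.mem_flatMap.2 ⟨e, he, List.mem_replicate.2 ⟨by omega, rfl⟩⟩)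
      obtain ⟨I, hI, hIe⟩ := List.mem_filterMap.1 hmem
      obtain ⟨-, -, h5⟩ := columnParts_eq_some.1 hIe
      have h6 := congrArg Prod.fst h5
      dsimp only at h6
      have hcomp := isComponents_components hN (2 ^ T.len * I + c.occMask)
        (List.range (T.len + T.inner)) fun v hv => List.mem_range.1 hv
      have hP : c.occMask < 2 ^ T.len := Nat.ofBits_lt_two_pow _
      have hOi : (2 ^ T.len * I + c.occMask).testBit i = true := by
        rw [testBit_mul_add hP, if_pos i.2, CutState.occMask, Nat.testBit_ofBits_lt _ i i.2]
        simp [hi]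
      obtain ⟨K, hK, hKi⟩ := hcomp.exists_mem i (List.mem_range.2 (by omega)) hOi
      have hbits : (hitUnion c.fixMask e.1 0).testBit i = true := by
        rw [testBit_hitUnion, h6]
        refine Or.inr ⟨_, List.mem_map.2 ⟨K, hK, rfl⟩, meets_land_iff.2 ⟨i, hKi, ?_⟩, ?_⟩
        · rw [CutState.fixMask, maskVec_ofBits, hi]; rfl
        · simp [hKi]
      rw [h0] at hbits
      simp at hbits
    rw [h4, Bool.false_or] at h3
    exact of_forallHits c.domMask h3
  · rw [cutValue, if_neg (c.live_iff.1 hc), maskValue, entrySum_eq, List.map_map]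
    rfl
  · rw [cutTransfer_cutValue hN hv hlen, ← sum_filterMap _ S, (hperm.map S).sum_eq,
      sum_flatMap_replicate, List.map_map]
    rfl

theorem Certified.mul_le {l : ℕ} {strict : Bool} {rel : ℕ → ℕ → Bool}
    {z z' : CutState (Fin l) → ℝ} {c : CutState (Fin l)} (h : Certified strict rel z z' c) {a b : ℝ}
    (hab : ∀ v s : ℕ, rel v s = true → a * v ≤ b * s) : a * z c ≤ b * z' c := by
  obtain ⟨L, -, hL, h1, h2⟩ := h
  rw [h1, h2]
  clear h1 h2
  induction L with
  | nil => simp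
  | cons x L ih =>
    have h1 := ih fun y hy => hL y (List.mem_cons_of_mem _ hy)
    have h2 := hab _ _ (hL x List.mem_cons_self).2
    have h3 : (0 : ℝ) ≤ x.1 := Nat.cast_nonneg _
    have h4 := mul_le_mul_of_nonneg_left h2 h3
    simp only [List.map_cons, List.sum_cons, Nat.cast_add, Nat.cast_mul, mul_add]
    linarith

theorem Certified.pos {l : ℕ} {rel : ℕ → ℕ → Bool} {z z' : CutState (Fin l) → ℝ}
    {c : CutState (Fin l)} (h : Certified true rel z z' c)
    (hrel : ∀ v s : ℕ, rel v s = true → 0 < v) : 0 < z c := by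
  obtain ⟨L, h0, hL, h1, -⟩ := h
  rw [h1]
  obtain ⟨x, L, rfl⟩ := List.exists_cons_of_ne_nil (h0 rfl)
  have hx := hL x List.mem_cons_self
  have := Nat.mul_pos hx.1 (hrel _ _ hx.2)
  rw [List.map_cons, List.sum_cons]
  exact_mod_cast Nat.add_pos_left this _

end CutTable


namespace CycleIn

variable {V : Type*} {M : SimpleGraph V} {ℓ : ℕ} [NeZero ℓ] (C : CycleIn M ℓ) [Fintype V]

/-- A weight of the cut states that is positive exactly on live ones and is multiplied by the transfer
operator by a factor between `lo` and `hi`. -/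
def HasWeight (D : Bool) (lo hi : ℝ) : Prop :=
  ∃ z : CutState (Fin ℓ) → ℝ, (∀ c, ¬ c.Live → z c = 0) ∧ (∀ c : CutState (Fin ℓ), c.Live → 0 < z c ∧
    lo * z c ≤ cutTransfer D C.column C.vert z c ∧ cutTransfer D C.column C.vert z c ≤ hi * z c)

/-- A weight of the cut states that is multiplied by the transfer operator by a factor of at least
`lo`. -/
def HasLowerWeight (D : Bool) (lo : ℝ) : Prop :=
  ∃ z : CutState (Fin ℓ) → ℝ, (∀ c, 0 ≤ z c) ∧ (∀ c, ¬ c.Live → z c = 0) ∧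
    (0 < z fun _ => (true, true)) ∧
    ∀ c : CutState (Fin ℓ), c.Live → lo * z c ≤ cutTransfer D C.column C.vert z c

theorem live_const_true : CutState.Live fun _ : Fin ℓ => (true, true) := ⟨0, rfl⟩

theorem rho_mem_Icc {lo hi : ℝ} (hlo : 0 < lo) (hhi : 0 ≤ hi) (h : C.HasWeight false lo hi) :
    C.rho ∈ Set.Icc lo hi := by
  obtain ⟨z, h0, h1⟩ := h
  refine ⟨C.le_rho z (fun c => ?_) h0 (h1 _ live_const_true).1 hlo fun c hc => (h1 c hc).2.1,
    C.rho_le z h0 (fun c hc => (h1 c hc).1) hhi fun c hc => (h1 c hc).2.2⟩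
  by_cases hc : c.Live
  · exact (h1 c hc).1.le
  · exact (h0 c hc).ge

theorem domRho_mem_Icc {lo hi : ℝ} (hlo : 0 < lo) (hhi : 0 ≤ hi) (h : C.HasWeight true lo hi) :
    C.domRho ∈ Set.Icc lo hi := by
  obtain ⟨z, h0, h1⟩ := h
  refine ⟨C.le_domRho z (fun c => ?_) h0 (h1 _ live_const_true).1 hlo fun c hc => (h1 c hc).2.1,
    C.domRho_le z h0 (fun c hc => (h1 c hc).1) hhi fun c hc => (h1 c hc).2.2⟩
  by_cases hc : c.Live
  · exact (h1 c hc).1.le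
  · exact (h0 c hc).ge

theorem le_domRho_of_hasLowerWeight {lo : ℝ} (hlo : 0 < lo) (h : C.HasLowerWeight true lo) :
    lo ≤ C.domRho := by
  obtain ⟨z, h0, h1, h2, h3⟩ := h
  exact C.le_domRho z h0 h1 h2 hlo h3

end CycleIn

/-! ### Symmetric tables -/

/-- The map `ρ` of bit masks is induced by the permutation `σ` of the bits. -/
def IsMaskPerm (l : ℕ) (ρ : ℕ → ℕ) (σ : Equiv.Perm (Fin l)) : Prop :=
  ∀ m < 2 ^ l, ρ m < 2 ^ l ∧ ∀ i : Fin l, (ρ m).testBit i = m.testBit (σ i)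

namespace IsMaskPerm

variable {l : ℕ} {ρ : ℕ → ℕ} {σ : Equiv.Perm (Fin l)}

theorem ofBits_comp (h : IsMaskPerm l ρ σ) (f : Fin l → Bool) :
    Nat.ofBits (f ∘ σ) = ρ (Nat.ofBits f) := by
  obtain ⟨h1, h2⟩ := h _ (Nat.ofBits_lt_two_pow f)
  refine eq_of_maskVec_eq (Nat.ofBits_lt_two_pow _) h1 ?_
  rw [maskVec_ofBits]
  funext i
  rw [maskVec, h2, Nat.testBit_ofBits_lt _ _ (σ i).2]
  rfl

theorem meets_eq (h : IsMaskPerm l ρ σ) {a b : ℕ} (ha : a < 2 ^ l) (hb : b < 2 ^ l) :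
    meets (ρ a) (ρ b) = meets a b := by
  have key : ∀ {x : ℕ}, x < 2 ^ l → ∀ {i}, x.testBit i = true → i < l := fun {x} hx {i} hi => by
    by_contra h
    rw [Nat.testBit_lt_two_pow (hx.trans_le (Nat.pow_le_pow_right (by norm_num) (by omega)))] at hi
    simp at hi
  rw [Bool.eq_iff_iff, meets_iff, meets_iff]
  constructor
  · rintro ⟨i, h1, h2⟩
    have hi := key (h a ha).1 h1
    exact ⟨σ ⟨i, hi⟩, by rw [← (h a ha).2]; exact h1, by rw [← (h b hb).2]; exact h2⟩
  · rintro ⟨i, h1, h2⟩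
    have hi := key ha h1
    refine ⟨σ.symm ⟨i, hi⟩, ?_, ?_⟩
    · rw [(h a ha).2]; simpa using h1
    · rw [(h b hb).2]; simpa using h2

end IsMaskPerm

namespace CutState

variable {l : ℕ} {ρ : ℕ → ℕ} {σ : Equiv.Perm (Fin l)} (c : CutState (Fin l))

theorem occMask_comp (h : IsMaskPerm l ρ σ) : occMask (c ∘ σ) = ρ c.occMask :=
  h.ofBits_comp fun i => (c i).1

theorem fixMask_comp (h : IsMaskPerm l ρ σ) : fixMask (c ∘ σ) = ρ c.fixMask :=
  h.ofBits_comp fun i => (c i).1 && (c i).2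

theorem domMask_comp (h : IsMaskPerm l ρ σ) : domMask (c ∘ σ) = ρ c.domMask :=
  h.ofBits_comp fun i => !(c i).1 && (c i).2

theorem live_comp_iff : CutState.Live (c ∘ σ) ↔ c.Live :=
  σ.exists_congr_right (q := fun i => c i = (true, true))

theorem occMask_ne_zero (hc : c.Live) : c.occMask ≠ 0 := by
  obtain ⟨i, hi⟩ := hc
  intro h0
  have : c.occMask.testBit i = true := testBit_ofBits.2 ⟨i.2, by simp [hi]⟩
  rw [h0] at this
  simp at this

/-- The sets of vertices with fixed and of dominated vertices are determined by their union. -/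
theorem land_lor_masks :
    Nat.land (Nat.lor c.fixMask c.domMask) c.occMask = c.fixMask ∧
    Nat.xor (Nat.lor c.fixMask c.domMask)
      (Nat.land (Nat.lor c.fixMask c.domMask) c.occMask) = c.domMask := by
  have h1 : c.fixMask < 2 ^ l := Nat.ofBits_lt_two_pow _
  have h2 : c.domMask < 2 ^ l := Nat.ofBits_lt_two_pow _
  have h3 : c.occMask < 2 ^ l := Nat.ofBits_lt_two_pow _
  have h4 : Nat.lor c.fixMask c.domMask < 2 ^ l := Nat.or_lt_two_pow h1 h2
  have key : Nat.land (Nat.lor c.fixMask c.domMask) c.occMask = c.fixMask := by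
    refine eq_of_maskVec_eq (n := l) (Nat.and_lt_two_pow _ h3) h1 ?_
    funext i
    simp only [maskVec, testBit_land, testBit_lor]
    simp only [fixMask, domMask, occMask, Nat.testBit_ofBits_lt _ _ i.2]
    cases (c i).1 <;> simp
  refine ⟨key, ?_⟩
  rw [key]
  refine eq_of_maskVec_eq (n := l) (Nat.xor_lt_two_pow h4 h1) h2 ?_
  funext i
  have : (Nat.xor (Nat.lor c.fixMask c.domMask) c.fixMask).testBit i =
      ((c.fixMask.testBit i || c.domMask.testBit i) ^^ c.fixMask.testBit i) := by
    rw [← testBit_lor]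
    exact Nat.testBit_xor _ _ _
  rw [maskVec, this]
  simp only [maskVec, fixMask, domMask, Nat.testBit_ofBits_lt _ _ i.2]
  cases (c i).1 <;> simp

end CutState

namespace CutTable

variable (T : CutTable)

/-- The values of the table are invariant under the map `ρ` of bit masks. -/
def symmCheck (ρ : ℕ → ℕ) : Bool :=
  (List.range (2 ^ T.len)).all fun P =>
    ((T.entries.getD P []).all (fun e => e.1.all (fun K => Nat.blt K (2 ^ T.len)) &&
        e.2.1.all (fun K => Nat.blt K (2 ^ T.len))) &&
      T.entries.getD (ρ P) [] ==
        (T.entries.getD P []).map fun e => (e.1.map ρ, e.2.1.map ρ, e.2.2)) ||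
    (List.range (2 ^ T.len)).all fun X =>
      Nat.beq (T.maskValue (ρ P) (ρ (Nat.land X P)) (ρ (Nat.xor X (Nat.land X P))))
        (T.maskValue P (Nat.land X P) (Nat.xor X (Nat.land X P)))

/-- An iterate of `ρ` maps `P` to a representative. -/
def reaches (ρ : ℕ → ℕ) (reps : List ℕ) : ℕ → ℕ → Bool
  | 0, _ => false
  | r + 1, P => reps.any (Nat.beq P) || reaches ρ reps r (ρ P)

variable {T} {ρ : ℕ → ℕ} {σ : Equiv.Perm (Fin T.len)}

theorem hitIndex_map (hρ : IsMaskPerm T.len ρ σ) {Q : ℕ} (hQ : Q < 2 ^ T.len) {Ks : List ℕ}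
    (hKs : ∀ K ∈ Ks, K < 2 ^ T.len) (i : ℕ) :
    hitIndex (ρ Q) (Ks.map ρ) i = hitIndex Q Ks i := by
  induction Ks generalizing i with
  | nil => rfl
  | cons K Ks ih =>
    rw [List.map_cons, hitIndex, hitIndex, hρ.meets_eq (hKs K List.mem_cons_self) hQ,
      ih fun L hL => hKs L (List.mem_cons_of_mem _ hL)]

theorem cutValue_comp (hρ : IsMaskPerm T.len ρ σ) (h : T.symmCheck ρ = true)
    (c : CutState (Fin T.len)) : T.cutValue (c ∘ σ) = T.cutValue c := by
  have hQ : c.fixMask < 2 ^ T.len := Nat.ofBits_lt_two_pow _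
  have hR : c.domMask < 2 ^ T.len := Nat.ofBits_lt_two_pow _
  have hP : c.occMask < 2 ^ T.len := Nat.ofBits_lt_two_pow _
  have h0 : CutState.fixMask (c ∘ σ) = 0 ↔ c.fixMask = 0 := by
    rw [← not_iff_not]
    exact (CutState.live_iff _).symm.trans ((CutState.live_comp_iff c).trans c.live_iff)
  have key : T.maskValue (ρ c.occMask) (ρ c.fixMask) (ρ c.domMask) =
      T.maskValue c.occMask c.fixMask c.domMask := by
    rw [symmCheck, List.all_eq_true] at h
    have h1 := h _ (List.mem_range.2 hP)
    rw [Bool.or_eq_true, Bool.and_eq_true] at h1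
    rcases h1 with ⟨h1, h2⟩ | h1
    · rw [maskValue, beq_iff_eq.1 h2, maskValue, entrySum_eq, entrySum_eq, List.map_map]
      refine congrArg _ (List.map_congr_left fun e he => ?_)
      have h3 := List.all_eq_true.1 h1 e he
      simp only [Bool.and_eq_true, List.all_eq_true, Nat.blt_eq] at h3
      rw [Function.comp_apply, hitIndex_map hρ hQ h3.1, hitIndex_map hρ hR h3.2]
    · have h2 := List.all_eq_true.1 h1 (Nat.lor c.fixMask c.domMask)
        (List.mem_range.2 (Nat.or_lt_two_pow hQ hR))
      rw [Nat.beq_eq, c.land_lor_masks.2, c.land_lor_masks.1] at h2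
      exact h2
  rw [cutValue, cutValue, CutState.occMask_comp c hρ, CutState.domMask_comp c hρ]
  rw [CutState.fixMask_comp c hρ] at h0 ⊢
  rw [key]
  exact if_congr h0 rfl rfl

variable {G : SimpleGraph (Fin (T.len + T.inner))} {vert : Fin T.len → Fin (T.len + T.inner)}

theorem certified_of_symm (hN : IsNeighborList G T.nbrs) (hv : ∀ i, (vert i : ℕ) = i)
    (hlen : T.entries.length = 2 ^ T.len) {strict : Bool} {rel : ℕ → ℕ → Bool}
    (hρ : IsMaskPerm T.len ρ σ)
    (hsymm : T.symmCheck ρ = true) (e : Equiv.Perm (Fin (T.len + T.inner)))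
    (he : ∀ v w, G.Adj v w ↔ G.Adj (e v) (e w)) (hev : ∀ i, e (vert i) = vert (σ i))
    {reps : List ℕ} (hreps : ∀ P ∈ reps, T.check strict rel P = true) {r : ℕ}
    (hr : ∀ P < 2 ^ T.len, P = 0 ∨ reaches ρ reps r P = true) {c : CutState (Fin T.len)}
    (hc : c.Live) : Certified strict rel T.cutValue (cutTransfer T.dom G vert T.cutValue) c := by
  have h1 := (hr c.occMask (Nat.ofBits_lt_two_pow _)).resolve_left (c.occMask_ne_zero hc)
  clear hr
  induction r generalizing c with
  | zero => simp [reaches] at h1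
  | succ r ih =>
    rw [reaches, Bool.or_eq_true] at h1
    rcases h1 with h1 | h1
    · obtain ⟨P, hP, hP'⟩ := List.any_eq_true.1 h1
      rw [Nat.beq_eq] at hP'
      exact certified_of_check hN hv hlen hc (hP' ▸ hreps P hP)
    · obtain ⟨L, h2, h3, h4, h5⟩ := ih (c := c ∘ σ) ((CutState.live_comp_iff c).2 hc) (by
        rwa [CutState.occMask_comp c hρ])
      refine ⟨L, h2, h3, ?_, ?_⟩
      · rw [← h4, cutValue_comp hρ hsymm]
      · rw [← h5, cutTransfer_comp_equiv e σ he hev]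
        simp only [cutValue_comp hρ hsymm]

/-- The columns that are described by the table are those of the cycle `C`. -/
structure Fits {V : Type*} {M : SimpleGraph V} {ℓ n : ℕ} [NeZero ℓ] (T : CutTable) (C : CycleIn M ℓ)
    (f : Fin n → V) : Prop where
  len_eq : ℓ = T.len
  card_eq : n = T.len + T.inner
  bijective : f.Bijective
  adj_iff : ∀ v w, C.column.Adj (f v) (f w) ↔ (T.nbrs.getD v 0).testBit w = true
  vert_eq : ∀ (i : Fin ℓ) (h : (i : ℕ) < n), f ⟨i, h⟩ = C.vert i

theorem Fits.exists_certified {V : Type*} [Fintype V] {M : SimpleGraph V} {ℓ n : ℕ} [NeZero ℓ]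
    {C : CycleIn M ℓ} {f : Fin n → V} (hf : T.Fits C f) (hlen : T.entries.length = 2 ^ T.len)
    {strict : Bool} {rel : ℕ → ℕ → Bool} {σ : Equiv.Perm (Fin ℓ)}
    (hρ : IsMaskPerm ℓ ρ σ) (hsymm : T.symmCheck ρ = true) (e : Equiv.Perm (Fin n))
    (he : ∀ v w : Fin n, (T.nbrs.getD v 0).testBit w = (T.nbrs.getD (e v) 0).testBit (e w))
    (hev : ∀ (i : Fin ℓ) (h : (i : ℕ) < n), (e ⟨i, h⟩ : ℕ) = σ i) {reps : List ℕ}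
    (hreps : ∀ P ∈ reps, T.check strict rel P = true) {r : ℕ}
    (hr : ∀ P < 2 ^ T.len, P = 0 ∨ reaches ρ reps r P = true) :
    ∃ z : CutState (Fin ℓ) → ℝ, (∀ c, 0 ≤ z c) ∧ (∀ c, ¬ c.Live → z c = 0) ∧
      (∀ c : CutState (Fin ℓ), c.Live →
        Certified strict rel z (cutTransfer T.dom C.column C.vert z) c) ∧
      ∀ (rel' : ℕ → ℕ → Bool) (c : CutState (Fin ℓ)), c.Live → T.check true rel' c.occMask = true →
        Certified true rel' z (cutTransfer T.dom C.column C.vert z) c := by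
  obtain ⟨rfl, rfl, hbij, hadj, hvert⟩ := hf
  let g := Equiv.ofBijective f hbij
  let G := C.column.comap f
  have hG : ∀ v w, G.Adj v w ↔ C.column.Adj (f v) (f w) := fun v w => Iff.rfl
  have hN : IsNeighborList G T.nbrs := fun v w => by rw [hG, hadj]
  have hT : cutTransfer T.dom C.column C.vert T.cutValue =
      cutTransfer T.dom G (Fin.castAdd _) T.cutValue := funext fun c => by
    exact (cutTransfer_comp_equiv g (Equiv.refl _) hG (fun i => hvert i _) T.cutValue c).symm
  refine ⟨T.cutValue, fun c => ?_, fun c hc => ?_, fun c hc => ?_, fun rel' c hc h => ?_⟩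
  · rw [cutValue]
    split_ifs <;> simp
  · rw [cutValue, if_pos]
    rw [c.live_iff] at hc
    exact not_not.1 hc
  · rw [hT]
    exact certified_of_symm hN (fun i => rfl) hlen hρ hsymm e
      (fun v w => by rw [← hN, ← hN, he]) (fun i => Fin.ext (hev i _)) hreps hr hc
  · rw [hT]
    exact certified_of_check hN (fun i => rfl) hlen hc h

/-- Bounds for the quotients of the values. -/
def ratioBetween (lo hi den v s : ℕ) : Bool :=
  Nat.blt 0 v && Nat.ble (Nat.mul lo v) (Nat.mul den s) && Nat.ble (Nat.mul den s) (Nat.mul hi v)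

theorem Fits.hasWeight {V : Type*} [Fintype V] {M : SimpleGraph V} {ℓ n : ℕ} [NeZero ℓ]
    {C : CycleIn M ℓ} {f : Fin n → V} (hf : T.Fits C f) {D : Bool} (hD : T.dom = D) {lo hi den : ℕ}
    (hden : 0 < den) (hlen : T.entries.length = 2 ^ T.len) {σ : Equiv.Perm (Fin ℓ)}
    (hρ : IsMaskPerm ℓ ρ σ) (hsymm : T.symmCheck ρ = true) (e : Equiv.Perm (Fin n))
    (he : ∀ v w : Fin n, (T.nbrs.getD v 0).testBit w = (T.nbrs.getD (e v) 0).testBit (e w))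
    (hev : ∀ (i : Fin ℓ) (h : (i : ℕ) < n), (e ⟨i, h⟩ : ℕ) = σ i) {reps : List ℕ}
    (hreps : ∀ P ∈ reps, T.check true (ratioBetween lo hi den) P = true) {r : ℕ}
    (hr : ∀ P < 2 ^ T.len, P = 0 ∨ reaches ρ reps r P = true) :
    C.HasWeight D (lo / den) (hi / den) := by
  subst hD
  obtain ⟨z, -, h0, hcert, -⟩ := hf.exists_certified hlen hρ hsymm e he hev hreps hr
  have hden' : (0 : ℝ) < den := by exact_mod_cast hden
  refine ⟨z, h0, fun c hc => ⟨?_, ?_, ?_⟩⟩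
  · refine (hcert c hc).pos fun v s h => ?_
    simp only [ratioBetween, Bool.and_eq_true, Nat.blt_eq] at h
    exact h.1.1
  · rw [div_mul_eq_mul_div, div_le_iff₀ hden', mul_comm _ (den : ℝ)]
    refine (hcert c hc).mul_le fun v s h => ?_
    simp only [ratioBetween, Bool.and_eq_true, Nat.ble_eq] at h
    exact_mod_cast h.1.2
  · rw [div_mul_eq_mul_div, le_div_iff₀ hden', mul_comm _ (den : ℝ)]
    have := (hcert c hc).mul_le (a := -hi) (b := -den) fun v s h => by
      simp only [ratioBetween, Bool.and_eq_true, Nat.ble_eq] at h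
      have h2 : (den * s : ℝ) ≤ hi * v := by exact_mod_cast h.2
      linarith
    linarith

theorem Fits.hasLowerWeight {V : Type*} [Fintype V] {M : SimpleGraph V} {ℓ n : ℕ} [NeZero ℓ]
    {C : CycleIn M ℓ} {f : Fin n → V} (hf : T.Fits C f) {D : Bool} (hD : T.dom = D) {lo : ℕ}
    (hlen : T.entries.length = 2 ^ T.len) {σ : Equiv.Perm (Fin ℓ)}
    (hρ : IsMaskPerm ℓ ρ σ) (hsymm : T.symmCheck ρ = true) (e : Equiv.Perm (Fin n))
    (he : ∀ v w : Fin n, (T.nbrs.getD v 0).testBit w = (T.nbrs.getD (e v) 0).testBit (e w))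
    (hev : ∀ (i : Fin ℓ) (h : (i : ℕ) < n), (e ⟨i, h⟩ : ℕ) = σ i) {reps : List ℕ}
    (hreps : ∀ P ∈ reps, T.check false (fun v s => Nat.ble (Nat.mul lo v) s) P = true) {r : ℕ}
    (hr : ∀ P < 2 ^ T.len, P = 0 ∨ reaches ρ reps r P = true)
    (hfull : T.check true (fun v _ => Nat.blt 0 v)
      (CutState.occMask fun _ : Fin ℓ => (true, true)) = true) :
    C.HasLowerWeight D lo := by
  subst hD
  obtain ⟨z, h, h0, hcert, hcheck⟩ := hf.exists_certified hlen hρ hsymm e he hev hreps hr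
  refine ⟨z, h, h0, (hcheck _ _ CycleIn.live_const_true hfull).pos fun v _ hv => by
    simpa using hv, fun c hc => ?_⟩
  have := (hcert c hc).mul_le (a := lo) (b := 1) fun v s h => by
    rw [one_mul]
    rw [Nat.ble_eq] at h
    exact_mod_cast h
  simpa using this

end CutTable


/-! ### Decision procedures for gadgets -/

instance CycleIn.decidableColumnAdj {V : Type*} [DecidableEq V] {M : SimpleGraph V}
    [DecidableRel M.Adj] {ℓ : ℕ} [NeZero ℓ] (C : CycleIn M ℓ) : DecidableRel C.column.Adj := fun v w =>
  decidable_of_iff (M.Adj v w ∧ ¬ ∃ i, s(C.vert i, C.vert (i + 1)) = s(v, w)) C.column_adj.symm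

theorem isDRegular_iff_card_filter {V : Type*} [Fintype V] {G : SimpleGraph V} [DecidableRel G.Adj]
    {d : ℕ} : IsDRegular G d ↔ ∀ v, (Finset.univ.filter (G.Adj v)).card = d := by
  rw [isDRegular_iff_ncard]
  refine forall_congr' fun v => ?_
  rw [← Set.ncard_coe_finset]
  have : G.neighborSet v = ↑(Finset.univ.filter (G.Adj v)) := by ext w; simp
  rw [this]

theorem connected_of_components {V : Type*} {G : SimpleGraph V} {n : ℕ} (hn : 0 < n) {f : Fin n → V}
    (hf : Function.Surjective f) {N : List ℕ}
    (hN : ∀ v w, G.Adj (f v) (f w) ↔ (N.getD v 0).testBit w = true)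
    (h : (components N (2 ^ n - 1) (List.range n)).length ≤ 1) : G.Connected := by
  have hc := isComponents_components (G := G.comap f) (N := N) (fun v w => (hN v w).symm) (2 ^ n - 1)
    (List.range n) fun v hv => List.mem_range.1 hv
  have hbit : ∀ v : Fin n, (2 ^ n - 1).testBit v = true := fun v => by
    simp [Nat.testBit_two_pow_sub_one]
  have : Nonempty V := ⟨f ⟨0, hn⟩⟩
  refine SimpleGraph.Connected.mk fun a b => ?_
  obtain ⟨v, rfl⟩ := hf a
  obtain ⟨w, rfl⟩ := hf b
  obtain ⟨K, hK, hKv⟩ := hc.exists_mem v (List.mem_range.2 v.2) (hbit v)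
  obtain ⟨L, hL, hLw⟩ := hc.exists_mem w (List.mem_range.2 w.2) (hbit w)
  have hKL : K = L := by
    match hcs : components N (2 ^ n - 1) (List.range n), h with
    | [], _ => rw [hcs] at hK; simp at hK
    | [x], _ => rw [hcs] at hK hL; simp at hK hL; rw [hK, hL]
    | _ :: _ :: _, h => simp at h
  have hlink := hc.linked K hK v w hKv (hKL ▸ hLw)
  exact hlink.induct (fun x => G.Reachable (f v) (f x))
    (fun x y hxy _ _ hx => hx.trans (SimpleGraph.Adj.reachable hxy)) (SimpleGraph.Reachable.refl _)

/-- The rotation of a bit mask of length `l`. -/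
def rotateMask (l m : ℕ) : ℕ :=
  Nat.lor (Nat.shiftRight m 1) (Nat.shiftLeft (Nat.mod m 2) (Nat.pred l))

theorem CutTable.Fits.connected {V : Type*} {M : SimpleGraph V} {ℓ n : ℕ} [NeZero ℓ] {T : CutTable}
    {C : CycleIn M ℓ} {f : Fin n → V} (hf : T.Fits C f)
    (h : (components T.nbrs (2 ^ n - 1) (List.range n)).length ≤ 1) : C.column.Connected :=
  connected_of_components (by have := hf.len_eq; have := hf.card_eq; have := C.three_le; omega)
    hf.bijective.surjective hf.adj_iff h


/-! ### The gadget `K_{4,4}` -/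

def k44Conn : CutTable where
  dom := false
  len := 6
  inner := 2
  nbrs := [136, 80, 160, 65, 130, 68, 170, 85]
  width := 40
  values :=
    0xffffffffff0000000000ffffffffff9666ef8a3f9666ef8a3f4d071f40909666ef8a3f4d071f40904d071f40900000000000ea7bd0c8bd0000000000ea7bd0c8bd6a4b406b8557a69c220f0000000000ea7bd0c8bd6a4b406b858625f82abf35f51c83bb8625f82abf35f51c83bb36230b0a7c0000000000c525d1fd5a0000000000c525d1fd5a648e86db35648e86db350000000000d482240c4f0000000000d482240c4f5e740e097270648039b526634778375e740e09722629c2c02e26634778370000000000bba55355f00000000000bba55355f04f337fab174f337fab171b8442bd1f4f337fab171b8442bd1f1b8442bd1f0000000000d6ca2cd38e0000000000d6ca2cd38e5edad9449052aad656530000000000d6ca2cd38e5edad9449052aad656530000000000d6ca2cd38e5edad944905edad944902563b12f337433d8360225743ee80925743ee8090000000000af93de92380000000000af93de923846b76f6bcb46e4d396450000000000af93de92380000000000af93de923846b76f6bcb46e4d396450000000000827e80dc4b0000000000c1635af84a0000000000c1635af84a4f381b781c484d0f5c4c0000000000c1635af84a51dfa91c124f381b781c1a4584154951dfa91c121a2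773f3e21a45841549000000000093079fa8e2000000000093079fa8e2326d01d6dd326d01d6dd0000000000985f0d3cd50000000000985f0d3cd5313a41a817313a41a81700000000005c68aa212300000000000000000000
  entries := [
    [([], [], 1, 0)], [([1], [], 3, 1)], [([2], [], 3, 1)], [([1, 2], [], 3, 3), ([3], [], 1, 7)],
    [([4], [], 3, 1)], [([1, 4], [], 1, 9), ([5], [], 2, 13)], [([2, 4], [], 3, 3), ([6], [], 1,
    7)], [([1, 2, 4], [], 2, 15), ([5, 2], [], 1, 23), ([7], [], 1, 27)], [([8], [], 3, 1)],
    [([9], [], 4, 29)], [([2, 8], [], 1, 9), ([10], [], 2, 13)], [([9, 2], [], 2, 31), ([11], [],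
    2, 35)], [([4, 8], [], 3, 3), ([12], [], 1, 7)], [([9, 4], [], 2, 37), ([13], [], 2, 41)],
    [([2, 4, 8], [], 2, 15), ([10, 4], [], 1, 23), ([14], [], 1, 27)], [([9, 2, 4], [], 1, 43),
    ([11, 4], [], 1, 51), ([13, 2], [], 1, 55), ([15], [], 1, 59)], [([16], [], 3, 1)], [([16, 1],
    [], 1, 9), ([17], [], 2, 13)], [([18], [], 4, 29)], [([18, 1], [], 2, 37), ([19], [], 2, 41)],
    [([4, 16], [], 1, 9), ([20], [], 2, 13)], [([1, 4, 16], [], 1, 61), ([21], [], 2, 69)], [([18,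
    4], [], 2, 31), ([22], [], 2, 35)], [([1, 18, 4], [], 2, 71), ([23], [], 2, 79)], [([8, 16],
    [], 3, 3), ([24], [], 1, 7)], [([9, 16], [], 2, 31), ([25], [], 2, 35)], [([18, 8], [], 2,
    37), ([26], [], 2, 41)], [([9, 18], [], 1, 81), ([27], [], 3, 85)], [([4, 8, 16], [], 2, 15),
    ([20, 8], [], 1, 23), ([28], [], 1, 27)], [([4, 9, 16], [], 2, 71), ([29], [], 2, 79)], [([18,
    4, 8], [], 1, 43), ([22, 8], [], 1, 51), ([26, 4], [], 1, 55), ([30], [], 1, 59)], [([9, 18,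
    4], [], 1, 87), ([27, 4], [], 1, 95), ([31], [], 2, 99)], [([32], [], 3, 1)], [([32, 1], [],
    3, 3), ([33], [], 1, 7)], [([32, 2], [], 1, 9), ([34], [], 2, 13)], [([32, 1, 2], [], 2, 15),
    ([34, 1], [], 1, 23), ([35], [], 1, 27)], [([36], [], 4, 29)], [([36, 1], [], 2, 31), ([37],
    [], 2, 35)], [([36, 2], [], 2, 37), ([38], [], 2, 41)], [([36, 1, 2], [], 1, 43), ([37, 2],
    [], 1, 51), ([38, 1], [], 1, 55), ([39], [], 1, 59)], [([8, 32], [], 1, 9), ([40], [], 2,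
    13)], [([9, 32], [], 2, 37), ([41], [], 2, 41)], [([32, 2, 8], [], 1, 61), ([42], [], 2, 69)],
    [([32, 9, 2], [], 2, 71), ([43], [], 2, 79)], [([36, 8], [], 2, 31), ([44], [], 2, 35)],
    [([36, 9], [], 1, 81), ([45], [], 3, 85)], [([2, 36, 8], [], 2, 71), ([46], [], 2, 79)],
    [([36, 9, 2], [], 1, 87), ([45, 2], [], 1, 95), ([47], [], 2, 99)], [([16, 32], [], 3, 3),
    ([48], [], 1, 7)], [([16, 32, 1], [], 2, 15), ([17, 32], [], 1, 23), ([49], [], 1, 27)],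
    [([18, 32], [], 2, 31), ([50], [], 2, 35)], [([18, 32, 1], [], 1, 43), ([50, 1], [], 1, 51),
    ([19, 32], [], 1, 55), ([51], [], 1, 59)], [([36, 16], [], 2, 37), ([52], [], 2, 41)], [([16,
    36, 1], [], 2, 71), ([53], [], 2, 79)], [([18, 36], [], 1, 81), ([54], [], 3, 85)], [([18, 36,
    1], [], 1, 87), ([54, 1], [], 1, 95), ([55], [], 2, 99)], [([8, 16, 32], [], 2, 15), ([40,
    16], [], 1, 23), ([56], [], 1, 27)], [([9, 16, 32], [], 1, 43), ([25, 32], [], 1, 51), ([41,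
    16], [], 1, 55), ([57], [], 1, 59)], [([8, 18, 32], [], 2, 71), ([58], [], 2, 79)], [([9, 18,
    32], [], 1, 87), ([27, 32], [], 1, 95), ([59], [], 2, 99)], [([36, 8, 16], [], 1, 43), ([44,
    16], [], 1, 51), ([52, 8], [], 1, 55), ([60], [], 1, 59)], [([36, 9, 16], [], 1, 87), ([45,
    16], [], 1, 95), ([61], [], 2, 99)], [([18, 36, 8], [], 1, 87), ([54, 8], [], 1, 95), ([62],
    [], 2, 99)], [([9, 18, 36], [], 1, 101), ([63], [], 3, 109)]]

def k44Dom : CutTable where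
  dom := true
  len := 6
  inner := 2
  nbrs := [136, 80, 160, 65, 130, 68, 170, 85]
  width := 40
  values :=
    0xffffffffff0000000000ffffffffff9e96fc514e9e96fc514e538f7c6aa99e96fc514e538f7c6aa9538f7c6aa90000000000e50479d61d0000000000e50479d61d70a71fac0a5d8f0dc1470000000000e50479d61d70a71fac0a8a94f6e5023aba1668368a94f6e5023aba1668363aee1a82520000000000bbc8deb4c20000000000bbc8deb4c270a71fac0a00000000000000000000bbc8deb4c270a71fac0a00000000000000000000bbc8deb4c270a71fac0a70a71fac0a42b74306c764cc55eb443aba1668363aba16683621e4b065c364cc55eb443aba1668363aba16683621e4b065c30000000000000000000000000000000000000000cb1ab6a9a30000000000cb1ab6a9a3613ee2c67e71e9e336b429b5db254c613ee2c67e2974563d3729b5db254c0000000000aff497faaf0000000000cd7eb87a0a0000000000cd7eb87a0a62f4ca16ef563eb9188f0000000000cd7eb87a0a62f4ca16ef563eb9188f0000000000cd7eb87a0a62f4ca16ef62f4ca16ef2901df745676e85e969d29140c39c029140c39c00000000000a4ec71bc220000000000a4ec71bc2262f4ca16ef00000000000000000000a4ec71bc22613ee2c67e46f7bcf1e4297456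3d37472b1e0e9529b5db254c00000000000000000000a4ec71bc22613ee2c67e62f4ca16ef399eb5f86c46f7bcf1e42974563d372901df745617bc1f4956472b1e0e9529b5db254c29140c39c017dbccdcba0000000000000000000000000000000000000000a4ec71bc220000000000a4ec71bc22613ee2c67e46f7bcf1e42974563d37472b1e0e9529b5db254c00000000000000000000a4ec71bc2262f4ca16ef00000000000000000000a4ec71bc22613ee2c67e62f4ca16ef399eb5f86c46f7bcf1e42974563d372901df745617bc1f4956472b1e0e9529b5db254c29140c39c017dbccdcba000000000000000000000000000000000000000078f534e61b000000000078f534e61b46f7bcf1e446f7bcf1e42974563d37000000000000000000000000000000000000000078f534e61b46f7bcf1e446f7bcf1e42974563d37000000000000000000000000000000000000000078f534e61b46f7bcf1e446f7bcf1e42901df745646f7bcf1e4292323f8852974563d3717bc1f495646f7bcf1e42974563d37292323f88517bc1f49562901df745617bc1f495617bc1f49560d938e2cea0000000000000000000000000000000000000000000000000000000000000000000000000000000000000000000000000000000000000000000000000000000000000000000000000000000000000000b59b4b90b90000000000b59b4b90b95177064a9c4a3209152a0000000000b59b4b90b953ece409f85177064a9c1cdf02f45f53ece409f81cbc4fe2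ba1cdf02f45f000000000087fa554dbd000000000087fa554dbd5177064a9c000000000000000000008e30595c3000000000008e30595c3053ece409f831bc9dbb491cbc4fe2ba31bc9dbb491cdf02f45f000000000000000000008e30595c3053ece409f831bc9dbb491cdf02f45f31bc9dbb491cbc4fe2ba000000000000000000008e30595c3053ece409f853ece409f830f1697d5231bc9dbb491cbc4fe2ba1cdf02f45f1087469d5931bc9dbb491cdf02f45f1cbc4fe2ba1087469d59000000000000000000000000000000000000000055947502940000000000559475029431bc9dbb4931bc9dbb491cbc4fe2ba0000000000000000000000000000000000000000
  entries := [
    [], [([1], [2, 32], 1, 0), ([1], [], 1, 8)], [([2], [4, 1], 1, 0), ([2], [], 1, 8)], [([1, 2],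
    [4, 32], 1, 10), ([1, 2], [4], 1, 26), ([1, 2], [32], 1, 34), ([3], [], 1, 42)], [([4], [8,
    2], 1, 0), ([4], [], 1, 8)], [([5], [2], 1, 44), ([5], [], 1, 48)], [([2, 4], [8, 1], 1, 10),
    ([2, 4], [8], 1, 26), ([2, 4], [1], 1, 34), ([6], [], 1, 42)], [([1, 2, 4], [], 2, 50), ([5,
    2], [], 1, 58), ([7], [], 1, 62)], [([8], [16, 4], 1, 0), ([8], [], 1, 8)], [([9], [2, 4, 16,
    32], 1, 64), ([9], [4, 16], 1, 96), ([9], [2, 32], 1, 104), ([9], [], 1, 112)], [([10], [4],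
    1, 44), ([10], [], 1, 48)], [([9, 2], [4, 32], 1, 114), ([11], [4], 1, 130), ([9, 2], [32], 1,
    134), ([11], [], 1, 142)], [([4, 8], [16, 2], 1, 10), ([4, 8], [16], 1, 26), ([4, 8], [2], 1,
    34), ([12], [], 1, 42)], [([9, 4], [2, 16], 1, 144), ([9, 4], [16], 1, 160), ([13], [2], 1,
    168), ([13], [], 1, 172)], [([2, 4, 8], [], 2, 50), ([10, 4], [], 1, 58), ([14], [], 1, 62)],
    [([9, 2, 4], [], 1, 174), ([11, 4], [], 1, 182), ([13, 2], [], 1, 186), ([15], [], 1, 190)],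
    [([16], [32, 8], 1, 0), ([16], [], 1, 8)], [([17], [32], 1, 44), ([17], [], 1, 48)], [([18],
    [32, 1, 4, 8], 1, 64), ([18], [1, 4], 1, 96), ([18], [32, 8], 1, 104), ([18], [], 1, 112)],
    [([18, 1], [32, 4], 1, 144), ([18, 1], [4], 1, 160), ([19], [32], 1, 168), ([19], [], 1,
    172)], [([20], [8], 1, 44), ([20], [], 1, 48)], [([21], [], 2, 192)], [([18, 4], [8, 1], 1,
    114), ([22], [8], 1, 130), ([18, 4], [1], 1, 134), ([22], [], 1, 142)], [([1, 18, 4], [], 2,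
    194), ([23], [], 2, 202)], [([8, 16], [32, 4], 1, 10), ([8, 16], [32], 1, 26), ([8, 16], [4],
    1, 34), ([24], [], 1, 42)], [([9, 16], [32, 4], 1, 114), ([25], [32], 1, 130), ([9, 16], [4],
    1, 134), ([25], [], 1, 142)], [([18, 8], [4, 32], 1, 144), ([18, 8], [32], 1, 160), ([26],
    [4], 1, 168), ([26], [], 1, 172)], [([9, 18], [4, 32], 1, 204), ([27], [4], 1, 220), ([27],
    [32], 1, 224), ([27], [], 1, 228)], [([4, 8, 16], [], 2, 50), ([20, 8], [], 1, 58), ([28], [],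
    1, 62)], [([4, 9, 16], [], 2, 194), ([29], [], 2, 202)], [([18, 4, 8], [], 1, 174), ([22, 8],
    [], 1, 182), ([26, 4], [], 1, 186), ([30], [], 1, 190)], [([9, 18, 4], [], 1, 230), ([27, 4],
    [], 1, 238), ([31], [], 2, 242)], [([32], [1, 16], 1, 0), ([32], [], 1, 8)], [([32, 1], [2,
    16], 1, 10), ([32, 1], [2], 1, 26), ([32, 1], [16], 1, 34), ([33], [], 1, 42)], [([34], [1],
    1, 44), ([34], [], 1, 48)], [([32, 1, 2], [], 2, 50), ([34, 1], [], 1, 58), ([35], [], 1,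
    62)], [([36], [1, 2, 8, 16], 1, 64), ([36], [2, 8], 1, 96), ([36], [1, 16], 1, 104), ([36],
    [], 1, 112)], [([36, 1], [2, 16], 1, 114), ([37], [2], 1, 130), ([36, 1], [16], 1, 134),
    ([37], [], 1, 142)], [([36, 2], [1, 8], 1, 144), ([36, 2], [8], 1, 160), ([38], [1], 1, 168),
    ([38], [], 1, 172)], [([36, 1, 2], [], 1, 174), ([37, 2], [], 1, 182), ([38, 1], [], 1, 186),
    ([39], [], 1, 190)], [([40], [16], 1, 44), ([40], [], 1, 48)], [([9, 32], [16, 2], 1, 144),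
    ([9, 32], [2], 1, 160), ([41], [16], 1, 168), ([41], [], 1, 172)], [([42], [], 2, 192)],
    [([32, 9, 2], [], 2, 194), ([43], [], 2, 202)], [([36, 8], [16, 2], 1, 114), ([44], [16], 1,
    130), ([36, 8], [2], 1, 134), ([44], [], 1, 142)], [([36, 9], [2, 16], 1, 204), ([45], [2], 1,
    220), ([45], [16], 1, 224), ([45], [], 1, 228)], [([2, 36, 8], [], 2, 194), ([46], [], 2,
    202)], [([36, 9, 2], [], 1, 230), ([45, 2], [], 1, 238), ([47], [], 2, 242)], [([16, 32], [1,
    8], 1, 10), ([16, 32], [1], 1, 26), ([16, 32], [8], 1, 34), ([48], [], 1, 42)], [([16, 32, 1],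
    [], 2, 50), ([17, 32], [], 1, 58), ([49], [], 1, 62)], [([18, 32], [1, 8], 1, 114), ([50],
    [1], 1, 130), ([18, 32], [8], 1, 134), ([50], [], 1, 142)], [([18, 32, 1], [], 1, 174), ([50,
    1], [], 1, 182), ([19, 32], [], 1, 186), ([51], [], 1, 190)], [([36, 16], [8, 1], 1, 144),
    ([36, 16], [1], 1, 160), ([52], [8], 1, 168), ([52], [], 1, 172)], [([16, 36, 1], [], 2, 194),
    ([53], [], 2, 202)], [([18, 36], [1, 8], 1, 204), ([54], [1], 1, 220), ([54], [8], 1, 224),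
    ([54], [], 1, 228)], [([18, 36, 1], [], 1, 230), ([54, 1], [], 1, 238), ([55], [], 2, 242)],
    [([8, 16, 32], [], 2, 50), ([40, 16], [], 1, 58), ([56], [], 1, 62)], [([9, 16, 32], [], 1,
    174), ([25, 32], [], 1, 182), ([41, 16], [], 1, 186), ([57], [], 1, 190)], [([8, 18, 32], [],
    2, 194), ([58], [], 2, 202)], [([9, 18, 32], [], 1, 230), ([27, 32], [], 1, 238), ([59], [],
    2, 242)], [([36, 8, 16], [], 1, 174), ([44, 16], [], 1, 182), ([52, 8], [], 1, 186), ([60],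
    [], 1, 190)], [([36, 9, 16], [], 1, 230), ([45, 16], [], 1, 238), ([61], [], 2, 242)], [([18,
    36, 8], [], 1, 230), ([54, 8], [], 1, 238), ([62], [], 2, 242)], [([9, 18, 36], [], 1, 244),
    ([63], [], 3, 252)]]

/-- The numbering of the vertices of `K_{4,4}`. -/
def labelK44 : Fin 8 → Fin 4 ⊕ Fin 4 :=
  ![.inl 0, .inr 0, .inl 1, .inr 1, .inl 2, .inr 2, .inl 3, .inr 3]

instance decidableKddAdj (d : ℕ) : DecidableRel (Kdd d).Adj := fun v w =>
  decidable_of_iff (v.isLeft ∧ w.isRight ∨ v.isRight ∧ w.isLeft) Iff.rfl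

theorem k44Conn_fits : k44Conn.Fits cycleK44 labelK44 :=
  ⟨rfl, rfl, by decide, by decide, by decide⟩

theorem k44Dom_fits : k44Dom.Fits cycleK44 labelK44 :=
  ⟨rfl, rfl, by decide, by decide, by decide⟩

/-- The rotation of the cycle and the corresponding automorphism of the column. -/
def rotationK44 : Equiv.Perm (Fin 8) where
  toFun := ![1, 2, 3, 4, 5, 0, 7, 6]
  invFun := ![5, 0, 1, 2, 3, 4, 7, 6]
  left_inv := by decide
  right_inv := by decide

theorem isMaskPerm_rotateMask_six : IsMaskPerm 6 (rotateMask 6) (finRotate 6) := by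
  unfold IsMaskPerm
  decide +kernel

theorem k44Conn_weight :
    cycleK44.HasWeight false ((167965 : ℕ) / (1000 : ℕ)) ((167975 : ℕ) / (1000 : ℕ)) :=
  k44Conn_fits.hasWeight rfl (ρ := rotateMask 6) (σ := finRotate 6) (by norm_num)
    (by decide +kernel)
    isMaskPerm_rotateMask_six (by decide +kernel) rotationK44 (by decide) (by decide)
    (reps := [1, 3, 5, 7, 9, 11, 13, 15, 21, 23, 27, 31, 63]) (by decide +kernel)
    (r := 6) (by decide +kernel)

theorem k44Dom_weight :
    cycleK44.HasWeight true ((152655 : ℕ) / (1000 : ℕ)) ((152665 : ℕ) / (1000 : ℕ)) :=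
  k44Dom_fits.hasWeight rfl (ρ := rotateMask 6) (σ := finRotate 6) (by norm_num)
    (by decide +kernel)
    isMaskPerm_rotateMask_six (by decide +kernel) rotationK44 (by decide) (by decide)
    (reps := [1, 3, 5, 7, 9, 11, 13, 15, 21, 23, 27, 31, 63]) (by decide +kernel)
    (r := 6) (by decide +kernel)

theorem isDRegular_K44 : IsDRegular (Kdd 4) 4 := isDRegular_iff_card_filter.2 (by decide)

theorem tableRow_K44 : cycleK44.TableRow 4 167.97 1.897 152.66 1.875 := by
  have h1 := cycleK44.rho_mem_Icc (by norm_num) (by norm_num) k44Conn_weight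
  have h2 := cycleK44.domRho_mem_Icc (by norm_num) (by norm_num) k44Dom_weight
  refine cycleK44.tableRow_of_rho (n := 8) isDRegular_K44 (k44Conn_fits.connected (by decide))
    (by simp) (by norm_num) (abs_le.2 ⟨?_, ?_⟩) (by norm_num) (by norm_num) (by norm_num)
    (by norm_num) (abs_le.2 ⟨?_, ?_⟩) (by norm_num) (by norm_num) (by norm_num) (by norm_num)
  · linarith [h1.1]
  · linarith [h1.2]
  · linarith [h2.1]
  · linarith [h2.2]


/-! ### The gadget `K_{5,5}` -/

def k55Conn : CutTable where
  dom := false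
  len := 8
  inner := 2
  nbrs := [552, 336, 672, 321, 642, 261, 522, 276, 682, 341]
  width := 40
  values :=
    0xffffffffff0000000000f772001d360000000000eebcd7315b0000000000eebcd7315ba477333651a4773336510000000000eb9ce5ef200000000000ef23b1dfa50000000000ef23b1dfa5764664c123697283962e0000000000ddbbc701070000000000e6207048a50000000000e6207048a5709a1d6fbe92cffecd473234f07aca709a1d6fbe33608645943234f07aca0000000000dbba1abd490000000000dbba1abd49694fbb2e91694fbb2e912dc6d48c7e694fbb2e912e005939d72dc6d48c7e0f3311c803694fbb2e912dc6d48c7e2e005939d70f3311c8032dc6d48c7e0f3311c8030f3311c8030000000000ef37cf86ed0000000000ef37cf86ed9edd5d9abf93a2e5d0f90000000000e33980b7840000000000e33980b7846e170e40366659bd75f50000000000e2e4ed16f30000000000e2e4ed16f38ee83e36d78aa4fa678e0000000000e2e4ed16f30000000000e2e4ed16f38ee83e36d78aa4fa678e0000000000d3dea398a90000000000d3dea398a962b746213f600d0c9a960000000000d565044f390000000000d565044f39787e548ec1787e548ec10000000000e33980b7840000000000e33980b7846e170e40366659bd75f50000000000cd9cc764930000000000d3dea398a90000000000d3dea398a9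62b746213f600d0c9a960000000000d57e5c14250000000000d57e5c14256331d41bdf6016f69dd10000000000b8d4f14c540000000000e6f6b197880000000000e6f6b1978870fdcda4da66cfc346cf0000000000e6f6b1978870fdcda4da94fa89605a3f20ec625e94fa89605a3f20ec625e3f358eb1a10000000000d95a5ebee60000000000d95a5ebee66717d79c61671f12c5c52b4472fbca7f7011ec8a2b637ab3c12b605a43540000000000d43e9df36c0000000000d43e9df36c784dc7a959784dc7a9590000000000c2b8a729300000000000c2b8a7293053659055715380ac32340000000000d95a5ebee60000000000d95a5ebee6671f12c5c57f7011ec8a2b605a43546717d79c612b4472fbca2b637ab3c10000000000c69ace415f0000000000c69ace415f5824379c3857bb1bc91e1dd5e657b15824379c381dde4bf2d31dd5e657b10000000000c2b8a729300000000000c2b8a729305380ac323453659055710000000000a6be8fbb7f0000000000a6be8fbb7f3a2a4c2e8d3a2a4c2e8d0000000000da5ec4351d0000000000da5ec4351d6721a2e4c860efee4aa50000000000da5ec4351d6721a2e4c860efee4aa50000000000da5ec4351d6721a2e4c86721a2e4c82b790b6e1d80ee610eba2b7bb0a5b62b7bb0a5b60000000000c15cda223b0000000000c15cda223b52ee29f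d425302a8fc380000000000c15cda223b0000000000c15cda223b52ee29fd425302a8fc3800000000009beea879910000000000c9b2a52d990000000000c9b2a52d9958421b9732550ebf7c1e0000000000c9b2a52d9959088bfe8e58421b97321dd2b8aa1f59088bfe8e1dc32c6c291dd2b8aa1f0000000000a549d1c2560000000000a549d1c256390a5ccc35390a5ccc350000000000a83b74cdac0000000000a83b74cdac3968f5f4233968f5f42300000000006c4effe21b00000000000000000000
  entries := [
    [([], [], 1, 0)], [([1], [], 3, 1)], [([2], [], 3, 1)], [([1, 2], [], 3, 3), ([3], [], 1, 7)],
    [([4], [], 3, 1)], [([1, 4], [], 1, 9), ([5], [], 2, 13)], [([2, 4], [], 3, 3), ([6], [], 1,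
    7)], [([1, 2, 4], [], 2, 15), ([5, 2], [], 1, 23), ([7], [], 1, 27)], [([8], [], 3, 1)],
    [([9], [], 4, 29)], [([2, 8], [], 1, 9), ([10], [], 2, 13)], [([9, 2], [], 2, 31), ([11], [],
    2, 35)], [([4, 8], [], 3, 3), ([12], [], 1, 7)], [([9, 4], [], 2, 37), ([13], [], 2, 41)],
    [([2, 4, 8], [], 2, 15), ([10, 4], [], 1, 23), ([14], [], 1, 27)], [([9, 2, 4], [], 1, 43),
    ([11, 4], [], 1, 51), ([13, 2], [], 1, 55), ([15], [], 1, 59)], [([16], [], 3, 1)], [([1, 16],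
    [], 1, 61), ([17], [], 2, 65)], [([18], [], 4, 29)], [([1, 18], [], 2, 67), ([19], [], 2,
    71)], [([4, 16], [], 1, 9), ([20], [], 2, 13)], [([1, 4, 16], [], 1, 73), ([21], [], 2, 81)],
    [([18, 4], [], 2, 31), ([22], [], 2, 35)], [([1, 18, 4], [], 2, 83), ([23], [], 2, 91)], [([8,
    16], [], 3, 3), ([24], [], 1, 7)], [([9, 16], [], 2, 93), ([25], [], 2, 97)], [([18, 8], [],
    2, 37), ([26], [], 2, 41)], [([9, 18], [], 1, 99), ([27], [], 3, 103)], [([4, 8, 16], [], 2,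
    15), ([20, 8], [], 1, 23), ([28], [], 1, 27)], [([9, 4, 16], [], 2, 105), ([29], [], 2, 113)],
    [([18, 4, 8], [], 1, 43), ([22, 8], [], 1, 51), ([26, 4], [], 1, 55), ([30], [], 1, 59)],
    [([9, 18, 4], [], 1, 115), ([27, 4], [], 1, 123), ([31], [], 2, 127)], [([32], [], 3, 1)],
    [([33], [], 4, 29)], [([32, 2], [], 1, 61), ([34], [], 2, 65)], [([33, 2], [], 2, 93), ([35],
    [], 2, 97)], [([36], [], 4, 29)], [([37], [], 4, 129)], [([2, 36], [], 2, 67), ([38], [], 2,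
    71)], [([37, 2], [], 2, 131), ([39], [], 2, 135)], [([8, 32], [], 1, 9), ([40], [], 2, 13)],
    [([41], [], 4, 129)], [([2, 8, 32], [], 1, 73), ([42], [], 2, 81)], [([41, 2], [], 2, 137),
    ([43], [], 2, 141)], [([36, 8], [], 2, 31), ([44], [], 2, 35)], [([45], [], 4, 143)], [([2,
    36, 8], [], 2, 83), ([46], [], 2, 91)], [([45, 2], [], 2, 145), ([47], [], 2, 149)], [([16,
    32], [], 3, 3), ([48], [], 1, 7)], [([16, 33], [], 2, 67), ([49], [], 2, 71)], [([18, 32], [],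
    2, 93), ([50], [], 2, 97)], [([33, 18], [], 1, 151), ([51], [], 3, 155)], [([36, 16], [], 2,
    37), ([52], [], 2, 41)], [([37, 16], [], 2, 157), ([53], [], 2, 161)], [([18, 36], [], 1, 99),
    ([54], [], 3, 103)], [([37, 18], [], 1, 163), ([55], [], 3, 167)], [([8, 16, 32], [], 2, 15),
    ([40, 16], [], 1, 23), ([56], [], 1, 27)], [([41, 16], [], 2, 131), ([57], [], 2, 135)],
    [([18, 8, 32], [], 2, 105), ([58], [], 2, 113)], [([41, 18], [], 1, 169), ([59], [], 3, 173)],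
    [([36, 8, 16], [], 1, 43), ([44, 16], [], 1, 51), ([52, 8], [], 1, 55), ([60], [], 1, 59)],
    [([45, 16], [], 2, 175), ([61], [], 2, 179)], [([18, 36, 8], [], 1, 115), ([54, 8], [], 1,
    123), ([62], [], 2, 127)], [([45, 18], [], 1, 181), ([63], [], 3, 185)], [([64], [], 3, 1)],
    [([64, 1], [], 1, 9), ([65], [], 2, 13)], [([66], [], 4, 29)], [([66, 1], [], 2, 37), ([67],
    [], 2, 41)], [([64, 4], [], 1, 61), ([68], [], 2, 65)], [([64, 1, 4], [], 1, 73), ([69], [],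
    2, 81)], [([66, 4], [], 2, 93), ([70], [], 2, 97)], [([66, 1, 4], [], 2, 105), ([71], [], 2,
    113)], [([72], [], 4, 29)], [([73], [], 4, 129)], [([74], [], 4, 129)], [([75], [], 4, 143)],
    [([4, 72], [], 2, 67), ([76], [], 2, 71)], [([73, 4], [], 2, 157), ([77], [], 2, 161)], [([74,
    4], [], 2, 131), ([78], [], 2, 135)], [([75, 4], [], 2, 175), ([79], [], 2, 179)], [([16, 64],
    [], 1, 9), ([80], [], 2, 13)], [([16, 64, 1], [], 1, 73), ([81], [], 2, 81)], [([82], [], 4,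
    129)], [([82, 1], [], 2, 157), ([83], [], 2, 161)], [([4, 16, 64], [], 1, 73), ([84], [], 2,
    81)], [([1, 4, 16, 64], [], 1, 187), ([85], [], 2, 203)], [([82, 4], [], 2, 137), ([86], [],
    2, 141)], [([1, 82, 4], [], 2, 205), ([87], [], 2, 213)], [([72, 16], [], 2, 31), ([88], [],
    2, 35)], [([73, 16], [], 2, 137), ([89], [], 2, 141)], [([90], [], 4, 143)], [([91], [], 4,
    215)], [([4, 72, 16], [], 2, 83), ([92], [], 2, 91)], [([4, 73, 16], [], 2, 205), ([93], [],
    2, 213)], [([90, 4], [], 2, 145), ([94], [], 2, 149)], [([91, 4], [], 2, 217), ([95], [], 2,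
    221)], [([32, 64], [], 3, 3), ([96], [], 1, 7)], [([33, 64], [], 2, 31), ([97], [], 2, 35)],
    [([32, 66], [], 2, 67), ([98], [], 2, 71)], [([33, 66], [], 1, 99), ([99], [], 3, 103)],
    [([36, 64], [], 2, 93), ([100], [], 2, 97)], [([37, 64], [], 2, 137), ([101], [], 2, 141)],
    [([36, 66], [], 1, 151), ([102], [], 3, 155)], [([37, 66], [], 1, 169), ([103], [], 3, 173)],
    [([72, 32], [], 2, 37), ([104], [], 2, 41)], [([105], [], 4, 143)], [([74, 32], [], 2, 157),
    ([106], [], 2, 161)], [([107], [], 4, 215)], [([36, 72], [], 1, 99), ([108], [], 3, 103)],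
    [([109], [], 4, 215)], [([74, 36], [], 1, 163), ([110], [], 3, 167)], [([111], [], 4, 223)],
    [([16, 32, 64], [], 2, 15), ([80, 32], [], 1, 23), ([112], [], 1, 27)], [([16, 33, 64], [], 2,
    83), ([113], [], 2, 91)], [([82, 32], [], 2, 131), ([114], [], 2, 135)], [([82, 33], [], 1,
    163), ([115], [], 3, 167)], [([36, 16, 64], [], 2, 105), ([116], [], 2, 113)], [([16, 37, 64],
    [], 2, 205), ([117], [], 2, 213)], [([82, 36], [], 1, 169), ([118], [], 3, 173)], [([37, 82],
    [], 1, 225), ([119], [], 3, 229)], [([72, 16, 32], [], 1, 43), ([88, 32], [], 1, 51), ([104,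
    16], [], 1, 55), ([120], [], 1, 59)], [([105, 16], [], 2, 145), ([121], [], 2, 149)], [([90,
    32], [], 2, 175), ([122], [], 2, 179)], [([123], [], 4, 223)], [([36, 72, 16], [], 1, 115),
    ([108, 16], [], 1, 123), ([124], [], 2, 127)], [([109, 16], [], 2, 217), ([125], [], 2, 221)],
    [([90, 36], [], 1, 181), ([126], [], 3, 185)], [([127], [], 4, 231)], [([128], [], 3, 1)],
    [([128, 1], [], 3, 3), ([129], [], 1, 7)], [([128, 2], [], 1, 9), ([130], [], 2, 13)], [([128,
    1, 2], [], 2, 15), ([130, 1], [], 1, 23), ([131], [], 1, 27)], [([132], [], 4, 29)], [([132,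
    1], [], 2, 31), ([133], [], 2, 35)], [([132, 2], [], 2, 37), ([134], [], 2, 41)], [([132, 1,
    2], [], 1, 43), ([133, 2], [], 1, 51), ([134, 1], [], 1, 55), ([135], [], 1, 59)], [([128, 8],
    [], 1, 61), ([136], [], 2, 65)], [([128, 9], [], 2, 67), ([137], [], 2, 71)], [([128, 2, 8],
    [], 1, 73), ([138], [], 2, 81)], [([128, 9, 2], [], 2, 83), ([139], [], 2, 91)], [([132, 8],
    [], 2, 93), ([140], [], 2, 97)], [([132, 9], [], 1, 99), ([141], [], 3, 103)], [([132, 2, 8],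
    [], 2, 105), ([142], [], 2, 113)], [([132, 9, 2], [], 1, 115), ([141, 2], [], 1, 123), ([143],
    [], 2, 127)], [([144], [], 4, 29)], [([144, 1], [], 2, 93), ([145], [], 2, 97)], [([146], [],
    4, 129)], [([146, 1], [], 2, 131), ([147], [], 2, 135)], [([148], [], 4, 129)], [([148, 1],
    [], 2, 137), ([149], [], 2, 141)], [([150], [], 4, 143)], [([150, 1], [], 2, 145), ([151], [],
    2, 149)], [([8, 144], [], 2, 67), ([152], [], 2, 71)], [([144, 9], [], 1, 151), ([153], [], 3,
    155)], [([146, 8], [], 2, 157), ([154], [], 2, 161)], [([146, 9], [], 1, 163), ([155], [], 3,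
    167)], [([148, 8], [], 2, 131), ([156], [], 2, 135)], [([148, 9], [], 1, 169), ([157], [], 3,
    173)], [([150, 8], [], 2, 175), ([158], [], 2, 179)], [([150, 9], [], 1, 181), ([159], [], 3,
    185)], [([32, 128], [], 1, 9), ([160], [], 2, 13)], [([33, 128], [], 2, 37), ([161], [], 2,
    41)], [([32, 128, 2], [], 1, 73), ([162], [], 2, 81)], [([33, 128, 2], [], 2, 105), ([163],
    [], 2, 113)], [([164], [], 4, 129)], [([165], [], 4, 143)], [([164, 2], [], 2, 157), ([166],
    [], 2, 161)], [([165, 2], [], 2, 175), ([167], [], 2, 179)], [([8, 32, 128], [], 1, 73),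
    ([168], [], 2, 81)], [([41, 128], [], 2, 157), ([169], [], 2, 161)], [([128, 2, 8, 32], [], 1,
    187), ([170], [], 2, 203)], [([128, 41, 2], [], 2, 205), ([171], [], 2, 213)], [([164, 8], [],
    2, 137), ([172], [], 2, 141)], [([173], [], 4, 215)], [([2, 164, 8], [], 2, 205), ([174], [],
    2, 213)], [([173, 2], [], 2, 217), ([175], [], 2, 221)], [([144, 32], [], 2, 31), ([176], [],
    2, 35)], [([144, 33], [], 1, 99), ([177], [], 3, 103)], [([146, 32], [], 2, 137), ([178], [],
    2, 141)], [([146, 33], [], 1, 169), ([179], [], 3, 173)], [([180], [], 4, 143)], [([181], [],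
    4, 215)], [([182], [], 4, 215)], [([183], [], 4, 223)], [([8, 144, 32], [], 2, 83), ([184],
    [], 2, 91)], [([41, 144], [], 1, 163), ([185], [], 3, 167)], [([8, 146, 32], [], 2, 205),
    ([186], [], 2, 213)], [([146, 41], [], 1, 225), ([187], [], 3, 229)], [([180, 8], [], 2, 145),
    ([188], [], 2, 149)], [([189], [], 4, 223)], [([182, 8], [], 2, 217), ([190], [], 2, 221)],
    [([191], [], 4, 231)], [([64, 128], [], 3, 3), ([192], [], 1, 7)], [([64, 128, 1], [], 2, 15),
    ([65, 128], [], 1, 23), ([193], [], 1, 27)], [([66, 128], [], 2, 31), ([194], [], 2, 35)],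
    [([66, 128, 1], [], 1, 43), ([194, 1], [], 1, 51), ([67, 128], [], 1, 55), ([195], [], 1,
    59)], [([64, 132], [], 2, 67), ([196], [], 2, 71)], [([64, 132, 1], [], 2, 83), ([197], [], 2,
    91)], [([66, 132], [], 1, 99), ([198], [], 3, 103)], [([66, 132, 1], [], 1, 115), ([198, 1],
    [], 1, 123), ([199], [], 2, 127)], [([72, 128], [], 2, 93), ([200], [], 2, 97)], [([73, 128],
    [], 2, 131), ([201], [], 2, 135)], [([74, 128], [], 2, 137), ([202], [], 2, 141)], [([75,
    128], [], 2, 145), ([203], [], 2, 149)], [([72, 132], [], 1, 151), ([204], [], 3, 155)],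
    [([73, 132], [], 1, 163), ([205], [], 3, 167)], [([74, 132], [], 1, 169), ([206], [], 3,
    173)], [([75, 132], [], 1, 181), ([207], [], 3, 185)], [([144, 64], [], 2, 37), ([208], [], 2,
    41)], [([144, 64, 1], [], 2, 105), ([209], [], 2, 113)], [([210], [], 4, 143)], [([210, 1],
    [], 2, 175), ([211], [], 2, 179)], [([148, 64], [], 2, 157), ([212], [], 2, 161)], [([64, 148,
    1], [], 2, 205), ([213], [], 2, 213)], [([214], [], 4, 215)], [([214, 1], [], 2, 217), ([215],
    [], 2, 221)], [([72, 144], [], 1, 99), ([216], [], 3, 103)], [([73, 144], [], 1, 169), ([217],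
    [], 3, 173)], [([218], [], 4, 215)], [([219], [], 4, 223)], [([148, 72], [], 1, 163), ([220],
    [], 3, 167)], [([73, 148], [], 1, 225), ([221], [], 3, 229)], [([222], [], 4, 223)], [([223],
    [], 4, 231)], [([32, 64, 128], [], 2, 15), ([160, 64], [], 1, 23), ([224], [], 1, 27)], [([33,
    64, 128], [], 1, 43), ([97, 128], [], 1, 51), ([161, 64], [], 1, 55), ([225], [], 1, 59)],
    [([32, 66, 128], [], 2, 83), ([226], [], 2, 91)], [([33, 66, 128], [], 1, 115), ([99, 128],
    [], 1, 123), ([227], [], 2, 127)], [([164, 64], [], 2, 131), ([228], [], 2, 135)], [([165,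
    64], [], 2, 145), ([229], [], 2, 149)], [([164, 66], [], 1, 163), ([230], [], 3, 167)],
    [([165, 66], [], 1, 181), ([231], [], 3, 185)], [([72, 32, 128], [], 2, 105), ([232], [], 2,
    113)], [([105, 128], [], 2, 175), ([233], [], 2, 179)], [([32, 74, 128], [], 2, 205), ([234],
    [], 2, 213)], [([107, 128], [], 2, 217), ([235], [], 2, 221)], [([164, 72], [], 1, 169),
    ([236], [], 3, 173)], [([237], [], 4, 223)], [([164, 74], [], 1, 225), ([238], [], 3, 229)],
    [([239], [], 4, 231)], [([144, 32, 64], [], 1, 43), ([176, 64], [], 1, 51), ([208, 32], [], 1,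
    55), ([240], [], 1, 59)], [([144, 33, 64], [], 1, 115), ([177, 64], [], 1, 123), ([241], [],
    2, 127)], [([210, 32], [], 2, 145), ([242], [], 2, 149)], [([210, 33], [], 1, 181), ([243],
    [], 3, 185)], [([180, 64], [], 2, 175), ([244], [], 2, 179)], [([181, 64], [], 2, 217),
    ([245], [], 2, 221)], [([246], [], 4, 223)], [([247], [], 4, 231)], [([72, 144, 32], [], 1,
    115), ([216, 32], [], 1, 123), ([248], [], 2, 127)], [([105, 144], [], 1, 181), ([249], [], 3,
    185)], [([218, 32], [], 2, 217), ([250], [], 2, 221)], [([251], [], 4, 231)], [([180, 72], [],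
    1, 181), ([252], [], 3, 185)], [([253], [], 4, 231)], [([254], [], 4, 231)], [([255], [], 4,
    233)]]

def k55Dom : CutTable where
  dom := true
  len := 8
  inner := 2
  nbrs := [552, 336, 672, 321, 642, 261, 522, 276, 682, 341]
  width := 40
  values :=
    0xffffffffff0000000000f42e7935d50000000000e7f314687f0000000000e7f314687fa55178fe23a55178fe230000000000e58b7364950000000000e972d48f9f0000000000e972d48f9f79a9f87e516d304b97da0000000000d5aec163500000000000d5aec1635079a9f87e5100000000000000000000ddcde115580000000000ddcde1155872087817ed93efeb5073345dbab18d72087817ed35837c560b345dbab18d0000000000d1b2088cef0000000000e9206a25ab0000000000e9206a25aba05cf94e61958b2d38f80000000000db6f0f13c90000000000db6f0f13c970059037bb687ccbe0350000000000d9f921a4180000000000d9f921a4188e9b6f9a498a8991338b0000000000d9f921a4180000000000d9f921a4188e9b6f9a498a8991338b0000000000ca64d4e1290000000000ca64d4e12972087817ed62c2310c9335837c560b604d178bc8345dbab18d00000000000000000000ca73df56940000000000ca73df569477943c428877943c42880000000000db6f0f13c90000000000db6f0f13c970059037bb687ccbe0350000000000c48cc870080000000000c48cc8700870059037bb0000000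0000000000000c48cc8700870059037bb00000000000000000000c48cc8700870059037bb70059037bb3fae2721160000000000000000000000000000000000000000ca64d4e1290000000000ca64d4e12972087817ed62c2310c9335837c560b604d178bc8345dbab18d00000000000000000000cba8c66daa0000000000cba8c66daa6418c7a97860f8c9eab60000000000af5fec0acc0000000000af5fec0acc6418c7a97800000000000000000000af5fec0acc62c2310c9362c2310c9335837c560b0000000000000000000000000000000000000000af5fec0acc62c2310c9362c2310c9335837c560b6418c7a978383f891bc3383f891bc31e8c3876b700000000000000000000000000000000000000000000000000000000000000000000000000000000ded98676910000000000ded986769172dd51edb06906ed5edf0000000000ded986769172dd51edb0956a1b5e23417c18583c956a1b5e23417c18583c41909580eb0000000000cf7ad246790000000000cf7ad2467967d0bf33aa670e28b8282cbe9e12067f81c3a1102cddf3fbc82cdbb77e8a0000000000ca24621aaa0000000000ca24621aaa72dd51edb000000000000000000000ca24621aaa72dd51edb0770fea5e0e417c18583c770fea5e0e417c18583c00000000000000000000b7fbee61950000000000b7fbee6195670e28b828534a736daa2cbe9e12065365a3fec22cdbb77e8a00000000000000000000cf7ad246790000000000cf7ad24679670e28b8287f81c3a1102cdbb77e8a67d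0bf33aa2cbe9e12062cddf3fbc80000000000bc550e84310000000000b7fbee61950000000000b7fbee6195670e28b8285365a3fec22cdbb77e8a534a736daa2cbe9e1206000000000000000000009c7370a3760000000000d15dc8ed0a0000000000d15dc8ed0a68666dcba36232eb3cc20000000000d15dc8ed0a68666dcba36232eb3cc20000000000d15dc8ed0a68666dcba368666dcba32d8986a010808bad17e02d8c39a39b2d8c39a39b0000000000b7de36e5d30000000000b7de36e5d368666dcba300000000000000000000b7de36e5d367d0bf33aa522b7096ae2cbe9e1206523fc95bac2cddf3fbc800000000000000000000b7de36e5d367d0bf33aa68666dcba33acd11a12a522b7096ae2cbe9e12062d8986a01018cc0c59d9523fc95bac2cddf3fbc82d8c39a39b18d9981e780000000000000000000000000000000000000000b7de36e5d30000000000b7de36e5d367d0bf33aa522b7096ae2cbe9e1206523fc95bac2cddf3fbc800000000000000000000b7de36e5d368666dcba300000000000000000000b7de36e5d367d0bf33aa68666dcba33acd11a12a522b7096ae2cbe9e12062d8986a01018cc0c59d9523fc95bac2cddf3fbc82d8c39a39b18d9981e78000000000000000000000000000000000000000093479b6b30000000000093479b6b30534a736daa522b7096ae2cbe9e1206000000000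000000000000000000000000000000093479b6b30534a736daa522b7096ae2cbe9e1206000000000000000000000000000000000000000093479b6b30534a736daa534a736daa2f00aa98cb522b7096ae2e65f9a64a2cbe9e12061952aada1a522b7096ae2cbe9e12062e65f9a64a1952aada1a2d8986a01018cc0c59d918cc0c59d90d96f45a190000000000000000000000000000000000000000000000000000000000000000000000000000000000000000000000000000000000000000000000000000000000000000000000000000000000000000bfe1de131b0000000000bfe1de131b59616bfb745629e122170000000000bfe1de131b59251f4cac59616bfb741f47997a8a59251f4cac1f375ce44f1f47997a8a00000000009d09c0b27300000000009d09c0b27359616bfb74000000000000000000009f605d0b0b00000000009f605d0b0b59251f4cac3999ed3c3c1f375ce44f3999ed3c3c1f47997a8a000000000000000000009f605d0b0b59251f4cac3999ed3c3c1f47997a8a3999ed3c3c1f375ce44f000000000000000000009f605d0b0b59251f4cac59251f4cac31be9181773999ed3c3c1f375ce44f1f47997a8a10f2bcbb3e3999ed3c3c1f47997a8a1f375ce44f10f2bcbb3e000000000000000000000000000000000000000066ac4fc00c000000000066ac4fc00c3999ed3c3c3999ed3c3c1f375ce44f0000000000000000000000000000000000000000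
  entries := [
    [], [([1], [2, 128], 1, 0), ([1], [], 1, 8)], [([2], [4, 1], 1, 0), ([2], [], 1, 8)], [([1,
    2], [4, 128], 1, 10), ([1, 2], [4], 1, 26), ([1, 2], [128], 1, 34), ([3], [], 1, 42)], [([4],
    [8, 2], 1, 0), ([4], [], 1, 8)], [([5], [2], 1, 44), ([5], [], 1, 48)], [([2, 4], [8, 1], 1,
    10), ([2, 4], [8], 1, 26), ([2, 4], [1], 1, 34), ([6], [], 1, 42)], [([1, 2, 4], [], 2, 50),
    ([5, 2], [], 1, 58), ([7], [], 1, 62)], [([8], [16, 4], 1, 0), ([8], [], 1, 8)], [([9], [2, 4,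
    16, 128], 1, 64), ([9], [4, 16], 1, 96), ([9], [2, 128], 1, 104), ([9], [], 1, 112)], [([10],
    [4], 1, 44), ([10], [], 1, 48)], [([9, 2], [4, 128], 1, 114), ([11], [4], 1, 130), ([9, 2],
    [128], 1, 134), ([11], [], 1, 142)], [([4, 8], [16, 2], 1, 10), ([4, 8], [16], 1, 26), ([4,
    8], [2], 1, 34), ([12], [], 1, 42)], [([9, 4], [2, 16], 1, 144), ([9, 4], [16], 1, 160),
    ([13], [2], 1, 168), ([13], [], 1, 172)], [([2, 4, 8], [], 2, 50), ([10, 4], [], 1, 58),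
    ([14], [], 1, 62)], [([9, 2, 4], [], 1, 174), ([11, 4], [], 1, 182), ([13, 2], [], 1, 186),
    ([15], [], 1, 190)], [([16], [32, 8], 1, 0), ([16], [], 1, 8)], [([17], [], 2, 192)], [([18],
    [4, 8, 32, 1], 1, 64), ([18], [8, 32], 1, 96), ([18], [4, 1], 1, 104), ([18], [], 1, 112)],
    [([1, 18], [4], 2, 194), ([19], [], 2, 202)], [([20], [8], 1, 44), ([20], [], 1, 48)], [([21],
    [], 2, 204)], [([18, 4], [8, 1], 1, 114), ([22], [8], 1, 130), ([18, 4], [1], 1, 134), ([22],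
    [], 1, 142)], [([1, 18, 4], [], 2, 206), ([23], [], 2, 214)], [([8, 16], [32, 4], 1, 10), ([8,
    16], [32], 1, 26), ([8, 16], [4], 1, 34), ([24], [], 1, 42)], [([9, 16], [4], 2, 216), ([25],
    [], 2, 224)], [([18, 8], [4, 32], 1, 144), ([18, 8], [32], 1, 160), ([26], [4], 1, 168),
    ([26], [], 1, 172)], [([9, 18], [4], 1, 226), ([27], [4], 1, 234), ([27], [], 2, 238)], [([4,
    8, 16], [], 2, 50), ([20, 8], [], 1, 58), ([28], [], 1, 62)], [([9, 4, 16], [], 2, 240),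
    ([29], [], 2, 248)], [([18, 4, 8], [], 1, 174), ([22, 8], [], 1, 182), ([26, 4], [], 1, 186),
    ([30], [], 1, 190)], [([9, 18, 4], [], 1, 250), ([27, 4], [], 1, 258), ([31], [], 2, 262)],
    [([32], [64, 16], 1, 0), ([32], [], 1, 8)], [([33], [64, 128, 2, 16], 1, 64), ([33], [128, 2],
    1, 96), ([33], [64, 16], 1, 104), ([33], [], 1, 112)], [([34], [], 2, 192)], [([33, 2], [128],
    2, 216), ([35], [], 2, 224)], [([36], [8, 16, 64, 2], 1, 64), ([36], [16, 64], 1, 96), ([36],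
    [8, 2], 1, 104), ([36], [], 1, 112)], [([37], [2, 16, 64], 1, 264), ([37], [16, 64], 1, 280),
    ([37], [2], 1, 288), ([37], [], 1, 292)], [([2, 36], [8], 2, 194), ([38], [], 2, 202)], [([37,
    2], [], 2, 294), ([39], [], 2, 298)], [([40], [16], 1, 44), ([40], [], 1, 48)], [([41], [16,
    128, 2], 1, 264), ([41], [128, 2], 1, 280), ([41], [16], 1, 288), ([41], [], 1, 292)], [([42],
    [], 2, 204)], [([41, 2], [128], 2, 300), ([43], [], 2, 308)], [([36, 8], [16, 2], 1, 114),
    ([44], [16], 1, 130), ([36, 8], [2], 1, 134), ([44], [], 1, 142)], [([45], [2, 16], 1, 310),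
    ([45], [16], 1, 318), ([45], [2], 1, 322), ([45], [], 1, 326)], [([2, 36, 8], [], 2, 206),
    ([46], [], 2, 214)], [([45, 2], [], 2, 328), ([47], [], 2, 332)], [([16, 32], [64, 8], 1, 10),
    ([16, 32], [64], 1, 26), ([16, 32], [8], 1, 34), ([48], [], 1, 42)], [([16, 33], [64], 2,
    194), ([49], [], 2, 202)], [([18, 32], [8], 2, 216), ([50], [], 2, 224)], [([33, 18], [], 1,
    334), ([51], [], 3, 338)], [([36, 16], [8, 64], 1, 144), ([36, 16], [64], 1, 160), ([52], [8],
    1, 168), ([52], [], 1, 172)], [([37, 16], [64], 2, 340), ([53], [], 2, 348)], [([18, 36], [8],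
    1, 226), ([54], [8], 1, 234), ([54], [], 2, 238)], [([37, 18], [], 1, 350), ([55], [], 3,
    354)], [([8, 16, 32], [], 2, 50), ([40, 16], [], 1, 58), ([56], [], 1, 62)], [([41, 16], [],
    2, 294), ([57], [], 2, 298)], [([18, 8, 32], [], 2, 240), ([58], [], 2, 248)], [([41, 18], [],
    1, 356), ([59], [], 3, 360)], [([36, 8, 16], [], 1, 174), ([44, 16], [], 1, 182), ([52, 8],
    [], 1, 186), ([60], [], 1, 190)], [([45, 16], [], 2, 362), ([61], [], 2, 366)], [([18, 36, 8],
    [], 1, 250), ([54, 8], [], 1, 258), ([62], [], 2, 262)], [([45, 18], [], 1, 368), ([63], [],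
    3, 372)], [([64], [128, 32], 1, 0), ([64], [], 1, 8)], [([65], [128], 1, 44), ([65], [], 1,
    48)], [([66], [128, 1, 4, 32], 1, 64), ([66], [1, 4], 1, 96), ([66], [128, 32], 1, 104),
    ([66], [], 1, 112)], [([66, 1], [128, 4], 1, 144), ([66, 1], [4], 1, 160), ([67], [128], 1,
    168), ([67], [], 1, 172)], [([68], [], 2, 192)], [([69], [], 2, 204)], [([66, 4], [1], 2,
    216), ([70], [], 2, 224)], [([66, 1, 4], [], 2, 240), ([71], [], 2, 248)], [([72], [16, 32,
    128, 4], 1, 64), ([72], [32, 128], 1, 96), ([72], [16, 4], 1, 104), ([72], [], 1, 112)],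
    [([73], [128, 4, 16], 1, 264), ([73], [4, 16], 1, 280), ([73], [128], 1, 288), ([73], [], 1,
    292)], [([74], [4, 32, 128], 1, 264), ([74], [32, 128], 1, 280), ([74], [4], 1, 288), ([74],
    [], 1, 292)], [([75], [128, 4], 1, 310), ([75], [4], 1, 318), ([75], [128], 1, 322), ([75],
    [], 1, 326)], [([4, 72], [16], 2, 194), ([76], [], 2, 202)], [([73, 4], [16], 2, 340), ([77],
    [], 2, 348)], [([74, 4], [], 2, 294), ([78], [], 2, 298)], [([75, 4], [], 2, 362), ([79], [],
    2, 366)], [([80], [32], 1, 44), ([80], [], 1, 48)], [([81], [], 2, 204)], [([82], [32, 1, 4],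
    1, 264), ([82], [1, 4], 1, 280), ([82], [32], 1, 288), ([82], [], 1, 292)], [([82, 1], [4], 2,
    340), ([83], [], 2, 348)], [([84], [], 2, 204)], [([85], [], 2, 374)], [([82, 4], [1], 2,
    300), ([86], [], 2, 308)], [([1, 82, 4], [], 2, 376), ([87], [], 2, 384)], [([72, 16], [32,
    4], 1, 114), ([88], [32], 1, 130), ([72, 16], [4], 1, 134), ([88], [], 1, 142)], [([73, 16],
    [4], 2, 300), ([89], [], 2, 308)], [([90], [4, 32], 1, 310), ([90], [32], 1, 318), ([90], [4],
    1, 322), ([90], [], 1, 326)], [([91], [4], 2, 386), ([91], [], 2, 390)], [([4, 72, 16], [], 2,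
    206), ([92], [], 2, 214)], [([4, 73, 16], [], 2, 376), ([93], [], 2, 384)], [([90, 4], [], 2,
    328), ([94], [], 2, 332)], [([91, 4], [], 2, 392), ([95], [], 2, 396)], [([32, 64], [128, 16],
    1, 10), ([32, 64], [128], 1, 26), ([32, 64], [16], 1, 34), ([96], [], 1, 42)], [([33, 64],
    [128, 16], 1, 114), ([97], [128], 1, 130), ([33, 64], [16], 1, 134), ([97], [], 1, 142)],
    [([32, 66], [128], 2, 194), ([98], [], 2, 202)], [([33, 66], [128], 1, 226), ([99], [128], 1,
    234), ([99], [], 2, 238)], [([36, 64], [16], 2, 216), ([100], [], 2, 224)], [([37, 64], [16],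
    2, 300), ([101], [], 2, 308)], [([36, 66], [], 1, 334), ([102], [], 3, 338)], [([37, 66], [],
    1, 356), ([103], [], 3, 360)], [([72, 32], [16, 128], 1, 144), ([72, 32], [128], 1, 160),
    ([104], [16], 1, 168), ([104], [], 1, 172)], [([105], [16, 128], 1, 310), ([105], [128], 1,
    318), ([105], [16], 1, 322), ([105], [], 1, 326)], [([74, 32], [128], 2, 340), ([106], [], 2,
    348)], [([107], [128], 2, 386), ([107], [], 2, 390)], [([36, 72], [16], 1, 226), ([108], [16],
    1, 234), ([108], [], 2, 238)], [([109], [16], 2, 386), ([109], [], 2, 390)], [([74, 36], [],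
    1, 350), ([110], [], 3, 354)], [([111], [], 4, 398)], [([16, 32, 64], [], 2, 50), ([80, 32],
    [], 1, 58), ([112], [], 1, 62)], [([16, 33, 64], [], 2, 206), ([113], [], 2, 214)], [([82,
    32], [], 2, 294), ([114], [], 2, 298)], [([82, 33], [], 1, 350), ([115], [], 3, 354)], [([36,
    16, 64], [], 2, 240), ([116], [], 2, 248)], [([16, 37, 64], [], 2, 376), ([117], [], 2, 384)],
    [([82, 36], [], 1, 356), ([118], [], 3, 360)], [([37, 82], [], 1, 400), ([119], [], 3, 404)],
    [([72, 16, 32], [], 1, 174), ([88, 32], [], 1, 182), ([104, 16], [], 1, 186), ([120], [], 1,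
    190)], [([105, 16], [], 2, 328), ([121], [], 2, 332)], [([90, 32], [], 2, 362), ([122], [], 2,
    366)], [([123], [], 4, 398)], [([36, 72, 16], [], 1, 250), ([108, 16], [], 1, 258), ([124],
    [], 2, 262)], [([109, 16], [], 2, 392), ([125], [], 2, 396)], [([90, 36], [], 1, 368), ([126],
    [], 3, 372)], [([127], [], 4, 406)], [([128], [1, 64], 1, 0), ([128], [], 1, 8)], [([128, 1],
    [2, 64], 1, 10), ([128, 1], [2], 1, 26), ([128, 1], [64], 1, 34), ([129], [], 1, 42)],
    [([130], [1], 1, 44), ([130], [], 1, 48)], [([128, 1, 2], [], 2, 50), ([130, 1], [], 1, 58),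
    ([131], [], 1, 62)], [([132], [1, 2, 8, 64], 1, 64), ([132], [2, 8], 1, 96), ([132], [1, 64],
    1, 104), ([132], [], 1, 112)], [([132, 1], [2, 64], 1, 114), ([133], [2], 1, 130), ([132, 1],
    [64], 1, 134), ([133], [], 1, 142)], [([132, 2], [1, 8], 1, 144), ([132, 2], [8], 1, 160),
    ([134], [1], 1, 168), ([134], [], 1, 172)], [([132, 1, 2], [], 1, 174), ([133, 2], [], 1,
    182), ([134, 1], [], 1, 186), ([135], [], 1, 190)], [([136], [], 2, 192)], [([128, 9], [2], 2,
    194), ([137], [], 2, 202)], [([138], [], 2, 204)], [([128, 9, 2], [], 2, 206), ([139], [], 2,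
    214)], [([132, 8], [2], 2, 216), ([140], [], 2, 224)], [([132, 9], [2], 1, 226), ([141], [2],
    1, 234), ([141], [], 2, 238)], [([132, 2, 8], [], 2, 240), ([142], [], 2, 248)], [([132, 9,
    2], [], 1, 250), ([141, 2], [], 1, 258), ([143], [], 2, 262)], [([144], [32, 64, 1, 8], 1,
    64), ([144], [64, 1], 1, 96), ([144], [32, 8], 1, 104), ([144], [], 1, 112)], [([144, 1],
    [64], 2, 216), ([145], [], 2, 224)], [([146], [1, 8, 32], 1, 264), ([146], [8, 32], 1, 280),
    ([146], [1], 1, 288), ([146], [], 1, 292)], [([146, 1], [], 2, 294), ([147], [], 2, 298)],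
    [([148], [8, 64, 1], 1, 264), ([148], [64, 1], 1, 280), ([148], [8], 1, 288), ([148], [], 1,
    292)], [([148, 1], [64], 2, 300), ([149], [], 2, 308)], [([150], [1, 8], 1, 310), ([150], [8],
    1, 318), ([150], [1], 1, 322), ([150], [], 1, 326)], [([150, 1], [], 2, 328), ([151], [], 2,
    332)], [([8, 144], [32], 2, 194), ([152], [], 2, 202)], [([144, 9], [], 1, 334), ([153], [],
    3, 338)], [([146, 8], [32], 2, 340), ([154], [], 2, 348)], [([146, 9], [], 1, 350), ([155],
    [], 3, 354)], [([148, 8], [], 2, 294), ([156], [], 2, 298)], [([148, 9], [], 1, 356), ([157],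
    [], 3, 360)], [([150, 8], [], 2, 362), ([158], [], 2, 366)], [([150, 9], [], 1, 368), ([159],
    [], 3, 372)], [([160], [64], 1, 44), ([160], [], 1, 48)], [([33, 128], [64, 2], 1, 144), ([33,
    128], [2], 1, 160), ([161], [64], 1, 168), ([161], [], 1, 172)], [([162], [], 2, 204)], [([33,
    128, 2], [], 2, 240), ([163], [], 2, 248)], [([164], [64, 2, 8], 1, 264), ([164], [2, 8], 1,
    280), ([164], [64], 1, 288), ([164], [], 1, 292)], [([165], [64, 2], 1, 310), ([165], [2], 1,
    318), ([165], [64], 1, 322), ([165], [], 1, 326)], [([164, 2], [8], 2, 340), ([166], [], 2,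
    348)], [([165, 2], [], 2, 362), ([167], [], 2, 366)], [([168], [], 2, 204)], [([41, 128], [2],
    2, 340), ([169], [], 2, 348)], [([170], [], 2, 374)], [([128, 41, 2], [], 2, 376), ([171], [],
    2, 384)], [([164, 8], [2], 2, 300), ([172], [], 2, 308)], [([173], [2], 2, 386), ([173], [],
    2, 390)], [([2, 164, 8], [], 2, 376), ([174], [], 2, 384)], [([173, 2], [], 2, 392), ([175],
    [], 2, 396)], [([144, 32], [64, 8], 1, 114), ([176], [64], 1, 130), ([144, 32], [8], 1, 134),
    ([176], [], 1, 142)], [([144, 33], [64], 1, 226), ([177], [64], 1, 234), ([177], [], 2, 238)],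
    [([146, 32], [8], 2, 300), ([178], [], 2, 308)], [([146, 33], [], 1, 356), ([179], [], 3,
    360)], [([180], [8, 64], 1, 310), ([180], [64], 1, 318), ([180], [8], 1, 322), ([180], [], 1,
    326)], [([181], [64], 2, 386), ([181], [], 2, 390)], [([182], [8], 2, 386), ([182], [], 2,
    390)], [([183], [], 4, 398)], [([8, 144, 32], [], 2, 206), ([184], [], 2, 214)], [([41, 144],
    [], 1, 350), ([185], [], 3, 354)], [([8, 146, 32], [], 2, 376), ([186], [], 2, 384)], [([146,
    41], [], 1, 400), ([187], [], 3, 404)], [([180, 8], [], 2, 328), ([188], [], 2, 332)],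
    [([189], [], 4, 398)], [([182, 8], [], 2, 392), ([190], [], 2, 396)], [([191], [], 4, 406)],
    [([64, 128], [1, 32], 1, 10), ([64, 128], [1], 1, 26), ([64, 128], [32], 1, 34), ([192], [],
    1, 42)], [([64, 128, 1], [], 2, 50), ([65, 128], [], 1, 58), ([193], [], 1, 62)], [([66, 128],
    [1, 32], 1, 114), ([194], [1], 1, 130), ([66, 128], [32], 1, 134), ([194], [], 1, 142)],
    [([66, 128, 1], [], 1, 174), ([194, 1], [], 1, 182), ([67, 128], [], 1, 186), ([195], [], 1,
    190)], [([64, 132], [1], 2, 194), ([196], [], 2, 202)], [([64, 132, 1], [], 2, 206), ([197],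
    [], 2, 214)], [([66, 132], [1], 1, 226), ([198], [1], 1, 234), ([198], [], 2, 238)], [([66,
    132, 1], [], 1, 250), ([198, 1], [], 1, 258), ([199], [], 2, 262)], [([72, 128], [32], 2,
    216), ([200], [], 2, 224)], [([73, 128], [], 2, 294), ([201], [], 2, 298)], [([74, 128], [32],
    2, 300), ([202], [], 2, 308)], [([75, 128], [], 2, 328), ([203], [], 2, 332)], [([72, 132],
    [], 1, 334), ([204], [], 3, 338)], [([73, 132], [], 1, 350), ([205], [], 3, 354)], [([74,
    132], [], 1, 356), ([206], [], 3, 360)], [([75, 132], [], 1, 368), ([207], [], 3, 372)],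
    [([144, 64], [32, 1], 1, 144), ([144, 64], [1], 1, 160), ([208], [32], 1, 168), ([208], [], 1,
    172)], [([144, 64, 1], [], 2, 240), ([209], [], 2, 248)], [([210], [32, 1], 1, 310), ([210],
    [1], 1, 318), ([210], [32], 1, 322), ([210], [], 1, 326)], [([210, 1], [], 2, 362), ([211],
    [], 2, 366)], [([148, 64], [1], 2, 340), ([212], [], 2, 348)], [([64, 148, 1], [], 2, 376),
    ([213], [], 2, 384)], [([214], [1], 2, 386), ([214], [], 2, 390)], [([214, 1], [], 2, 392),
    ([215], [], 2, 396)], [([72, 144], [32], 1, 226), ([216], [32], 1, 234), ([216], [], 2, 238)],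
    [([73, 144], [], 1, 356), ([217], [], 3, 360)], [([218], [32], 2, 386), ([218], [], 2, 390)],
    [([219], [], 4, 398)], [([148, 72], [], 1, 350), ([220], [], 3, 354)], [([73, 148], [], 1,
    400), ([221], [], 3, 404)], [([222], [], 4, 398)], [([223], [], 4, 406)], [([32, 64, 128], [],
    2, 50), ([160, 64], [], 1, 58), ([224], [], 1, 62)], [([33, 64, 128], [], 1, 174), ([97, 128],
    [], 1, 182), ([161, 64], [], 1, 186), ([225], [], 1, 190)], [([32, 66, 128], [], 2, 206),
    ([226], [], 2, 214)], [([33, 66, 128], [], 1, 250), ([99, 128], [], 1, 258), ([227], [], 2,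
    262)], [([164, 64], [], 2, 294), ([228], [], 2, 298)], [([165, 64], [], 2, 328), ([229], [],
    2, 332)], [([164, 66], [], 1, 350), ([230], [], 3, 354)], [([165, 66], [], 1, 368), ([231],
    [], 3, 372)], [([72, 32, 128], [], 2, 240), ([232], [], 2, 248)], [([105, 128], [], 2, 362),
    ([233], [], 2, 366)], [([32, 74, 128], [], 2, 376), ([234], [], 2, 384)], [([107, 128], [], 2,
    392), ([235], [], 2, 396)], [([164, 72], [], 1, 356), ([236], [], 3, 360)], [([237], [], 4,
    398)], [([164, 74], [], 1, 400), ([238], [], 3, 404)], [([239], [], 4, 406)], [([144, 32, 64],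
    [], 1, 174), ([176, 64], [], 1, 182), ([208, 32], [], 1, 186), ([240], [], 1, 190)], [([144,
    33, 64], [], 1, 250), ([177, 64], [], 1, 258), ([241], [], 2, 262)], [([210, 32], [], 2, 328),
    ([242], [], 2, 332)], [([210, 33], [], 1, 368), ([243], [], 3, 372)], [([180, 64], [], 2,
    362), ([244], [], 2, 366)], [([181, 64], [], 2, 392), ([245], [], 2, 396)], [([246], [], 4,
    398)], [([247], [], 4, 406)], [([72, 144, 32], [], 1, 250), ([216, 32], [], 1, 258), ([248],
    [], 2, 262)], [([105, 144], [], 1, 368), ([249], [], 3, 372)], [([218, 32], [], 2, 392),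
    ([250], [], 2, 396)], [([251], [], 4, 406)], [([180, 72], [], 1, 368), ([252], [], 3, 372)],
    [([253], [], 4, 406)], [([254], [], 4, 406)], [([255], [], 4, 408)]]

/-- The numbering of the vertices of `K_{5,5}`. -/
def labelK55 : Fin 10 → Fin 5 ⊕ Fin 5 :=
  ![.inl 0, .inr 0, .inl 1, .inr 1, .inl 2, .inr 2, .inl 3, .inr 3, .inl 4, .inr 4]

theorem k55Conn_fits : k55Conn.Fits cycleK55 labelK55 :=
  ⟨rfl, rfl, by decide, by decide +kernel, by decide⟩

theorem k55Dom_fits : k55Dom.Fits cycleK55 labelK55 :=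
  ⟨rfl, rfl, by decide, by decide +kernel, by decide⟩

/-- The rotation of the cycle and the corresponding automorphism of the column. -/
def rotationK55 : Equiv.Perm (Fin 10) where
  toFun := ![1, 2, 3, 4, 5, 6, 7, 0, 9, 8]
  invFun := ![7, 0, 1, 2, 3, 4, 5, 6, 9, 8]
  left_inv := by decide
  right_inv := by decide

theorem isMaskPerm_rotateMask_eight : IsMaskPerm 8 (rotateMask 8) (finRotate 8) := by
  unfold IsMaskPerm
  decide +kernel

theorem k55Conn_weight :
    cycleK55.HasWeight false ((807925 : ℕ) / (1000 : ℕ)) ((807935 : ℕ) / (1000 : ℕ)) :=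
  k55Conn_fits.hasWeight rfl (ρ := rotateMask 8) (σ := finRotate 8) (by norm_num)
    (by decide +kernel)
    isMaskPerm_rotateMask_eight (by decide +kernel) rotationK55 (by decide) (by decide)
    (reps := [1, 3, 5, 7, 9, 11, 13, 15, 17, 19, 21, 23, 25, 27, 29, 31, 37, 39, 43, 45,
      47, 51, 53, 55, 59, 61, 63, 85, 87, 91, 95, 111, 119, 127, 255]) (by decide +kernel)
    (r := 8) (by decide +kernel)

theorem k55Dom_weight :
    cycleK55.HasWeight true ((756635 : ℕ) / (1000 : ℕ)) ((756645 : ℕ) / (1000 : ℕ)) :=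
  k55Dom_fits.hasWeight rfl (ρ := rotateMask 8) (σ := finRotate 8) (by norm_num)
    (by decide +kernel)
    isMaskPerm_rotateMask_eight (by decide +kernel) rotationK55 (by decide) (by decide)
    (reps := [1, 3, 5, 7, 9, 11, 13, 15, 17, 19, 21, 23, 25, 27, 29, 31, 37, 39, 43, 45,
      47, 51, 53, 55, 59, 61, 63, 85, 87, 91, 95, 111, 119, 127, 255]) (by decide +kernel)
    (r := 8) (by decide +kernel)

theorem isDRegular_K55 : IsDRegular (Kdd 5) 5 := isDRegular_iff_card_filter.2 (by decide)

theorem tableRow_K55 : cycleK55.TableRow 5 807.93 1.953 756.64 1.940 := by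
  have h1 := cycleK55.rho_mem_Icc (by norm_num) (by norm_num) k55Conn_weight
  have h2 := cycleK55.domRho_mem_Icc (by norm_num) (by norm_num) k55Dom_weight
  refine cycleK55.tableRow_of_rho (n := 10) isDRegular_K55 (k55Conn_fits.connected (by decide))
    (by simp) (by norm_num) (abs_le.2 ⟨?_, ?_⟩) (by norm_num) (by norm_num) (by norm_num)
    (by norm_num) (abs_le.2 ⟨?_, ?_⟩) (by norm_num) (by norm_num) (by norm_num) (by norm_num)
  · linarith [h1.1]
  · linarith [h1.2]
  · linarith [h2.1]
  · linarith [h2.2]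


/-! ### The hexagonal prism -/

def prismConn : CutTable where
  dom := false
  len := 6
  inner := 6
  nbrs := [64, 128, 256, 512, 1024, 2048, 2177, 322, 644, 1288, 2576, 1120]
  width := 20
  values :=
    0xfffff00000fffff1efb961ba500000fffff61ba51efb900000fffff38a2b61ba50fdc561ba50fdc5245cb00000fffff61ba51efb900000fffff61ba561ba5245cb38a2b0fdc50fdc500000fffff5412b61ba51bf6e61ba51dc99245cb0798d61ba51bf6e24a6507b14245cb0798d0cd3200000fffff61ba51efb900000fffff6a20761ba525d086a20727b8925d0809b2b61ba525d0824b450c61625d0809b2b0c61600000fffff61ba561ba5245cb38a2b0fdc50fdc500000fffff61ba561ba5245cb61ba524a65245cb0cd325412b1bf6e1dc990798d1bf6e07b140798d00000fffff6a20761ba525d0861ba527240245cb0c4e961ba52724024a650d2e9245cb0d7470cd320344361ba525d0824b450c61624a650d2e90d4410350a245cb0c4e90d4410350a0cd32034430422900000fffff61ba51efb900000fffff61ba56a20725d0861ba524b4525d080c6166a20725d0827b8909b2b25d080c61609b2b00000fffff61ba561ba5245cb38a2b0fdc50fdc500000fffff61ba561ba5245cb61ba524a65245cb0cd325412b1bf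6e1dc990798d1bf6e07b140798d00000fffff61ba561ba5245cb61ba524a65245cb0cd3261ba524b4524a650d441245cb0d4410cd32042296a20725d08272400c4e9272400d2e90d7470344325d080c6160d2e90350a0c4e90350a0344300000fffff61ba51efb900000fffff61ba538a2b0fdc561ba5245cb0fdc500000fffff61ba55412b1bf6e61ba524a651bf6e07b1461ba5245cb1dc990798d245cb0cd320798d00000fffff61ba56a20725d0861ba524b4525d080c6166a20725d0827b8909b2b25d080c61609b2b00000fffff61ba56a20725d0861ba524b4525d080c61661ba524a65272400d2e9245cb0d4410c4e90350a61ba5245cb272400c4e924a650d4410d2e90350a245cb0cd320d747034430cd32042290344300000fffff61ba561ba5245cb38a2b0fdc50fdc500000fffff61ba561ba5245cb5412b1dc991bf6e0798d61ba5245cb24a650cd321bf6e0798d07b1400000fffff61ba561ba5245cb6a2072724025d080c4e961ba524a6524b450d44125d080d2e90c6160350a61ba5245cb24a650cd32272400d7470d2e903443245cb0cd320d441042290c4e9034430350a00000fffff61ba561ba5245cb61ba524a65245cb0cd325412b1bf6e1dc990798d1bf6e07b140798d00000fffff61ba561ba5245cb61ba524a65245cb0cd326a20727240272400d74725d080d2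e90c4e90344361ba5245cb24a650cd3224b450d4410d4410422925d080c4e90d2e9034430c6160350a0350a00000fffff61ba561ba5245cb61ba524a65245cb0cd3261ba524b4524a650d441245cb0d4410cd32042296a20725d08272400c4e9272400d2e90d7470344325d080c6160d2e90350a0c4e90350a0344300000fffff61ba561ba5245cb61ba524a65245cb0cd3261ba524b4524a650d441245cb0d4410cd320422961ba524a6524b450d44124a650d6a30d441046cd245cb0d4410d4410481d0cd32046cd042290115b61ba5245cb24a650cd3224b450d4410d4410422924a650d4410d6a3046cd0d4410481d046cd0115b245cb0cd320d441042290d441046cd0481d0115b0cd3204229046cd0115b042290115b0115b00000bd37147d8e1e2b200000bd37147b781e23e00000bd37147b7847d8e1a3f6353bf0edb70edd800000bd37147d8e1e2b200000bd37147d8e47b781a3f6353bf0edd80edb700000bd37147d8e47b781a3f647d8e1a9571a3f608dbf487b0180f3199e70685c180f30698b0685c00000bd37100000bd3711e3ab473e900000bd371357ec47d8e0ee61473e90eea91947e00000bd37148f7d47b781819248f7d131941819200000bd37148f7d47b781819247d8e19c131a3f60682d473e9183361a2b9069b41947e068c2082f200000bd371473e91e3ab00000bd371473e93a6810ec9b4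73e9195bc0ec9b00000bd371473e94cb391821847d8e1a3c91a28c06876473e9195bc1a968068a11947e0841f066cd00000bd371473e947d8e1947e357ec0eea90ee6100000bd371473e947d8e1947e4cb391a9681a28c066cd473e9195bc1a3c90841f18218068a10687600000bd371473e947d8e1947e47b781a2b91a3f6082f248f7d1833619c13068c218192069b40682d00000bd371473e947d8e1947e47b781a2b91a3f6082f247d8e1a3c91a95708cbf1a3f608fb208dbf02281473e9195bc1a3c90841f1a2b908cf608fb20231c1947e0841f08cbf02348082f20231c02281000008b562338511c696000008b562338511c696000008b5623385133851118c6325c70cb910cb91000008b562000008b5621c69633851000008b5622e7d12e7d1000008b5622e7d1338510cde5338510cde5101a7000008b562338511c696000008b56233851325c70cb9133851118c60cb91000008b5623385133851101a72e7d10cde50cde5000008b5623385133851101a73385111cfc118c60455733851118c611cfc04557101a70455704557000008b2b9342811c5d1000008b2b9336dd1c644000008b2b9336dd34281117852e3050cd6a0ccec000008b2b9000008b2b91c644336dd000008b2b92e305342810ccec336dd0cd6a11785000008b2b9315441c839000008b2b931544329c60cc65336dd103640cb2e000008b2b931544336dd10364329c60cc650cb2e000008b2b931544336dd1036434281115631178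5045a1336dd1036411c1e0466611785045a1043f700000652cf222041895d00000652cf00000652cf1895d2220400000652cf222041895d00000652cf22204222040882222204088220882200000873ec3271d1c5cb00000873ec3271d1c5cb00000873ec3271d3271d119062df680ccb70ccb700000873ec00000873ec1c78730eb600000873ec2e5483271d0ccf430eb60cdf11012100000873ec30eb61c78700000873ec30eb6337060cb4e30eb6103f20cb4e00000873ec30eb63271d101212e5480cdf10ccf400000873ec30eb63271d101213271d1136f119060450e30eb6103f21136f0466a101210466a0450e000006220822806188af0000062208000006220818aa81f4bc000006220821f4718967000006220821f4722806087041f4bc089e408959000006220822806188af000006220800000622081896721f4700000622081f4bc18aa800000622081f4bc228060895921f47089e40870400000423c500000423c5108ed108ed000005c621211071892f000005c621000005c621189e91f1ad000005c6211f1ad189e9000005c6211f1ad21107088a91f1ad08a77088a9000004078b000004078b108bf108bf000003ac86000003ac86109d3109d3000001f7800000000000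
  entries := [
    [([], [], 1, 0)], [([1], [], 17, 1)], [([2], [], 17, 1)], [([1, 2], [], 11, 3), ([3], [], 11,
    7)], [([4], [], 17, 1)], [([1, 4], [], 23, 9), ([5], [], 8, 13)], [([2, 4], [], 11, 3), ([6],
    [], 11, 7)], [([1, 2, 4], [], 16, 15), ([3, 4], [], 4, 23), ([1, 6], [], 4, 27), ([7], [], 7,
    31), ([5, 2], [], 1, 33)], [([8], [], 17, 1)], [([1, 8], [], 28, 37), ([9], [], 7, 41)], [([2,
    8], [], 23, 9), ([10], [], 8, 13)], [([1, 2, 8], [], 21, 43), ([3, 8], [], 9, 51), ([1, 10],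
    [], 3, 55), ([11], [], 5, 59), ([9, 2], [], 2, 61)], [([4, 8], [], 11, 3), ([12], [], 11, 7)],
    [([1, 4, 8], [], 21, 65), ([5, 8], [], 3, 73), ([1, 12], [], 9, 77), ([13], [], 5, 81), ([9,
    4], [], 2, 83)], [([2, 4, 8], [], 16, 15), ([6, 8], [], 4, 23), ([2, 12], [], 4, 27), ([14],
    [], 7, 31), ([10, 4], [], 1, 33)], [([1, 2, 4, 8], [], 18, 87), ([3, 4, 8], [], 6, 103), ([1,
    6, 8], [], 1, 111), ([7, 8], [], 3, 119), ([1, 2, 12], [], 6, 123), ([1, 14], [], 3, 131),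
    ([15], [], 4, 135), ([9, 2, 4], [], 1, 137), ([11, 4], [], 1, 145), ([13, 2], [], 1, 149)],
    [([16], [], 17, 1)], [([16, 1], [], 23, 9), ([17], [], 8, 13)], [([16, 2], [], 28, 37), ([18],
    [], 7, 41)], [([16, 1, 2], [], 21, 65), ([17, 2], [], 3, 73), ([16, 3], [], 9, 77), ([19], [],
    5, 81), ([18, 1], [], 2, 83)], [([4, 16], [], 23, 9), ([20], [], 8, 13)], [([1, 4, 16], [],
    26, 153), ([5, 16], [], 5, 161), ([1, 20], [], 5, 165), ([21], [], 4, 169), ([17, 4], [], 5,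
    171)], [([2, 4, 16], [], 21, 43), ([6, 16], [], 9, 51), ([2, 20], [], 3, 55), ([22], [], 5,
    59), ([18, 4], [], 2, 61)], [([1, 2, 4, 16], [], 23, 175), ([3, 4, 16], [], 4, 191), ([1, 6,
    16], [], 4, 199), ([7, 16], [], 5, 207), ([1, 2, 20], [], 3, 211), ([1, 22], [], 2, 219),
    ([23], [], 3, 223), ([17, 2, 4], [], 3, 225), ([19, 4], [], 2, 233), ([21, 2], [], 1, 237)],
    [([8, 16], [], 11, 3), ([24], [], 11, 7)], [([8, 16, 1], [], 21, 43), ([24, 1], [], 9, 51),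
    ([8, 17], [], 3, 55), ([25], [], 5, 59), ([9, 16], [], 2, 61)], [([2, 8, 16], [], 21, 65),
    ([10, 16], [], 3, 73), ([2, 24], [], 9, 77), ([26], [], 5, 81), ([18, 8], [], 2, 83)], [([1,
    2, 8, 16], [], 19, 241), ([3, 8, 16], [], 8, 257), ([1, 10, 16], [], 1, 265), ([11, 16], [],
    2, 273), ([1, 2, 24], [], 8, 277), ([3, 24], [], 1, 285), ([1, 26], [], 2, 289), ([27], [], 3,
    293), ([17, 2, 8], [], 1, 295), ([19, 8], [], 2, 303), ([25, 2], [], 2, 307)], [([4, 8, 16],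
    [], 16, 15), ([12, 16], [], 4, 23), ([4, 24], [], 4, 27), ([28], [], 7, 31), ([20, 8], [], 1,
    33)], [([4, 8, 16, 1], [], 23, 175), ([12, 16, 1], [], 4, 191), ([4, 24, 1], [], 4, 199),
    ([28, 1], [], 5, 207), ([4, 8, 17], [], 3, 211), ([4, 25], [], 2, 219), ([29], [], 3, 223),
    ([5, 8, 16], [], 3, 225), ([13, 16], [], 2, 233), ([21, 8], [], 1, 237)], [([2, 4, 8, 16], [],
    18, 87), ([6, 8, 16], [], 6, 103), ([2, 12, 16], [], 1, 111), ([14, 16], [], 3, 119), ([2, 4,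
    24], [], 6, 123), ([2, 28], [], 3, 131), ([30], [], 4, 135), ([18, 4, 8], [], 1, 137), ([22,
    8], [], 1, 145), ([26, 4], [], 1, 149)], [([1, 2, 4, 8, 16], [], 19, 311), ([3, 4, 8, 16], [],
    5, 343), ([1, 6, 8, 16], [], 3, 359), ([7, 8, 16], [], 3, 375), ([1, 2, 12, 16], [], 3, 383),
    ([1, 14, 16], [], 1, 399), ([15, 16], [], 2, 407), ([1, 2, 4, 24], [], 5, 411), ([3, 4, 24],
    [], 1, 427), ([1, 2, 28], [], 3, 435), ([1, 30], [], 2, 443), ([31], [], 2, 447), ([17, 2, 4,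
    8], [], 2, 449), ([19, 4, 8], [], 1, 465), ([23, 8], [], 1, 473), ([25, 2, 4], [], 1, 477),
    ([27, 4], [], 1, 485), ([29, 2], [], 1, 489)], [([32], [], 17, 1)], [([32, 1], [], 11, 3),
    ([33], [], 11, 7)], [([32, 2], [], 23, 9), ([34], [], 8, 13)], [([32, 1, 2], [], 16, 15),
    ([33, 2], [], 4, 23), ([32, 3], [], 4, 27), ([35], [], 7, 31), ([34, 1], [], 1, 33)], [([32,
    4], [], 28, 37), ([36], [], 7, 41)], [([32, 1, 4], [], 21, 43), ([33, 4], [], 9, 51), ([32,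
    5], [], 3, 55), ([37], [], 5, 59), ([36, 1], [], 2, 61)], [([32, 2, 4], [], 21, 65), ([34, 4],
    [], 3, 73), ([32, 6], [], 9, 77), ([38], [], 5, 81), ([36, 2], [], 2, 83)], [([32, 1, 2, 4],
    [], 18, 87), ([33, 2, 4], [], 6, 103), ([32, 3, 4], [], 1, 111), ([35, 4], [], 3, 119), ([32,
    1, 6], [], 6, 123), ([32, 7], [], 3, 131), ([39], [], 4, 135), ([36, 1, 2], [], 1, 137), ([37,
    2], [], 1, 145), ([38, 1], [], 1, 149)], [([8, 32], [], 23, 9), ([40], [], 8, 13)], [([8, 32,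
    1], [], 21, 65), ([40, 1], [], 3, 73), ([8, 33], [], 9, 77), ([41], [], 5, 81), ([9, 32], [],
    2, 83)], [([32, 2, 8], [], 26, 153), ([34, 8], [], 5, 161), ([32, 10], [], 5, 165), ([42], [],
    4, 169), ([40, 2], [], 5, 171)], [([32, 1, 2, 8], [], 23, 175), ([33, 2, 8], [], 4, 191),
    ([32, 3, 8], [], 4, 199), ([35, 8], [], 5, 207), ([32, 1, 10], [], 3, 211), ([32, 11], [], 2,
    219), ([43], [], 3, 223), ([40, 1, 2], [], 3, 225), ([41, 2], [], 2, 233), ([42, 1], [], 1,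
    237)], [([4, 8, 32], [], 21, 43), ([12, 32], [], 9, 51), ([4, 40], [], 3, 55), ([44], [], 5,
    59), ([36, 8], [], 2, 61)], [([32, 1, 4, 8], [], 19, 241), ([33, 4, 8], [], 8, 257), ([32, 5,
    8], [], 1, 265), ([37, 8], [], 2, 273), ([32, 1, 12], [], 8, 277), ([33, 12], [], 1, 285),
    ([32, 13], [], 2, 289), ([45], [], 3, 293), ([40, 1, 4], [], 1, 295), ([41, 4], [], 2, 303),
    ([44, 1], [], 2, 307)], [([2, 4, 8, 32], [], 23, 175), ([6, 8, 32], [], 4, 191), ([2, 12, 32],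
    [], 4, 199), ([14, 32], [], 5, 207), ([2, 4, 40], [], 3, 211), ([2, 44], [], 2, 219), ([46],
    [], 3, 223), ([34, 4, 8], [], 3, 225), ([38, 8], [], 2, 233), ([42, 4], [], 1, 237)], [([32,
    1, 2, 4, 8], [], 19, 311), ([33, 2, 4, 8], [], 5, 343), ([32, 3, 4, 8], [], 3, 359), ([35, 4,
    8], [], 3, 375), ([32, 1, 6, 8], [], 3, 383), ([32, 7, 8], [], 1, 399), ([39, 8], [], 2, 407),
    ([32, 1, 2, 12], [], 5, 411), ([33, 2, 12], [], 1, 427), ([32, 1, 14], [], 3, 435), ([32, 15],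
    [], 2, 443), ([47], [], 2, 447), ([40, 1, 2, 4], [], 2, 449), ([41, 2, 4], [], 1, 465), ([43,
    4], [], 1, 473), ([44, 1, 2], [], 1, 477), ([45, 2], [], 1, 485), ([46, 1], [], 1, 489)],
    [([16, 32], [], 11, 3), ([48], [], 11, 7)], [([16, 32, 1], [], 16, 15), ([48, 1], [], 4, 23),
    ([16, 33], [], 4, 27), ([49], [], 7, 31), ([17, 32], [], 1, 33)], [([16, 32, 2], [], 21, 43),
    ([48, 2], [], 9, 51), ([16, 34], [], 3, 55), ([50], [], 5, 59), ([18, 32], [], 2, 61)], [([16,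
    32, 1, 2], [], 18, 87), ([48, 1, 2], [], 6, 103), ([16, 33, 2], [], 1, 111), ([49, 2], [], 3,
    119), ([16, 32, 3], [], 6, 123), ([16, 35], [], 3, 131), ([51], [], 4, 135), ([18, 32, 1], [],
    1, 137), ([50, 1], [], 1, 145), ([19, 32], [], 1, 149)], [([4, 16, 32], [], 21, 65), ([20,
    32], [], 3, 73), ([4, 48], [], 9, 77), ([52], [], 5, 81), ([36, 16], [], 2, 83)], [([16, 32,
    1, 4], [], 23, 175), ([48, 1, 4], [], 4, 191), ([16, 33, 4], [], 4, 199), ([49, 4], [], 5,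
    207), ([16, 32, 5], [], 3, 211), ([16, 37], [], 2, 219), ([53], [], 3, 223), ([20, 32, 1], [],
    3, 225), ([52, 1], [], 2, 233), ([21, 32], [], 1, 237)], [([16, 32, 2, 4], [], 19, 241), ([48,
    2, 4], [], 8, 257), ([16, 34, 4], [], 1, 265), ([50, 4], [], 2, 273), ([16, 32, 6], [], 8,
    277), ([48, 6], [], 1, 285), ([16, 38], [], 2, 289), ([54], [], 3, 293), ([20, 32, 2], [], 1,
    295), ([52, 2], [], 2, 303), ([22, 32], [], 2, 307)], [([16, 32, 1, 2, 4], [], 19, 311), ([48,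
    1, 2, 4], [], 5, 343), ([16, 33, 2, 4], [], 3, 359), ([49, 2, 4], [], 3, 375), ([16, 32, 3,
    4], [], 3, 383), ([16, 35, 4], [], 1, 399), ([51, 4], [], 2, 407), ([16, 32, 1, 6], [], 5,
    411), ([48, 1, 6], [], 1, 427), ([16, 32, 7], [], 3, 435), ([16, 39], [], 2, 443), ([55], [],
    2, 447), ([20, 32, 1, 2], [], 2, 449), ([52, 1, 2], [], 1, 465), ([53, 2], [], 1, 473), ([22,
    32, 1], [], 1, 477), ([54, 1], [], 1, 485), ([23, 32], [], 1, 489)], [([8, 16, 32], [], 16,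
    15), ([24, 32], [], 4, 23), ([8, 48], [], 4, 27), ([56], [], 7, 31), ([40, 16], [], 1, 33)],
    [([8, 16, 32, 1], [], 18, 87), ([24, 32, 1], [], 6, 103), ([8, 48, 1], [], 1, 111), ([56, 1],
    [], 3, 119), ([8, 16, 33], [], 6, 123), ([8, 49], [], 3, 131), ([57], [], 4, 135), ([9, 16,
    32], [], 1, 137), ([25, 32], [], 1, 145), ([41, 16], [], 1, 149)], [([8, 16, 32, 2], [], 23,
    175), ([24, 32, 2], [], 4, 191), ([8, 48, 2], [], 4, 199), ([56, 2], [], 5, 207), ([8, 16,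
    34], [], 3, 211), ([8, 50], [], 2, 219), ([58], [], 3, 223), ([10, 16, 32], [], 3, 225), ([26,
    32], [], 2, 233), ([42, 16], [], 1, 237)], [([8, 16, 32, 1, 2], [], 19, 311), ([24, 32, 1, 2],
    [], 5, 343), ([8, 48, 1, 2], [], 3, 359), ([56, 1, 2], [], 3, 375), ([8, 16, 33, 2], [], 3,
    383), ([8, 49, 2], [], 1, 399), ([57, 2], [], 2, 407), ([8, 16, 32, 3], [], 5, 411), ([24, 32,
    3], [], 1, 427), ([8, 16, 35], [], 3, 435), ([8, 51], [], 2, 443), ([59], [], 2, 447), ([10,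
    16, 32, 1], [], 2, 449), ([26, 32, 1], [], 1, 465), ([58, 1], [], 1, 473), ([11, 16, 32], [],
    1, 477), ([27, 32], [], 1, 485), ([43, 16], [], 1, 489)], [([4, 8, 16, 32], [], 18, 87), ([12,
    16, 32], [], 6, 103), ([4, 24, 32], [], 1, 111), ([28, 32], [], 3, 119), ([4, 8, 48], [], 6,
    123), ([4, 56], [], 3, 131), ([60], [], 4, 135), ([36, 8, 16], [], 1, 137), ([44, 16], [], 1,
    145), ([52, 8], [], 1, 149)], [([4, 8, 16, 32, 1], [], 19, 311), ([12, 16, 32, 1], [], 5,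
    343), ([4, 24, 32, 1], [], 3, 359), ([28, 32, 1], [], 3, 375), ([4, 8, 48, 1], [], 3, 383),
    ([4, 56, 1], [], 1, 399), ([60, 1], [], 2, 407), ([4, 8, 16, 33], [], 5, 411), ([12, 16, 33],
    [], 1, 427), ([4, 8, 49], [], 3, 435), ([4, 57], [], 2, 443), ([61], [], 2, 447), ([5, 8, 16,
    32], [], 2, 449), ([13, 16, 32], [], 1, 465), ([29, 32], [], 1, 473), ([37, 8, 16], [], 1,
    477), ([45, 16], [], 1, 485), ([53, 8], [], 1, 489)], [([2, 4, 8, 16, 32], [], 19, 311), ([6,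
    8, 16, 32], [], 5, 343), ([2, 12, 16, 32], [], 3, 359), ([14, 16, 32], [], 3, 375), ([2, 4,
    24, 32], [], 3, 383), ([2, 28, 32], [], 1, 399), ([30, 32], [], 2, 407), ([2, 4, 8, 48], [],
    5, 411), ([6, 8, 48], [], 1, 427), ([2, 4, 56], [], 3, 435), ([2, 60], [], 2, 443), ([62], [],
    2, 447), ([34, 4, 8, 16], [], 2, 449), ([38, 8, 16], [], 1, 465), ([46, 16], [], 1, 473),
    ([50, 4, 8], [], 1, 477), ([54, 8], [], 1, 485), ([58, 4], [], 1, 489)], [([1, 2, 4, 8, 16,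
    32], [], 18, 493), ([3, 4, 8, 16, 32], [], 3, 557), ([1, 6, 8, 16, 32], [], 3, 589), ([7, 8,
    16, 32], [], 2, 621), ([1, 2, 12, 16, 32], [], 3, 637), ([1, 14, 16, 32], [], 2, 669), ([15,
    16, 32], [], 1, 685), ([1, 2, 4, 24, 32], [], 3, 693), ([3, 4, 24, 32], [], 1, 725), ([1, 2,
    28, 32], [], 2, 741), ([1, 30, 32], [], 1, 757), ([31, 32], [], 1, 765), ([33, 2, 4, 8, 16],
    [], 3, 769), ([35, 4, 8, 16], [], 2, 801), ([39, 8, 16], [], 1, 817), ([33, 2, 12, 16], [], 1,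
    825), ([47, 16], [], 1, 841), ([1, 2, 4, 8, 48], [], 3, 845), ([49, 2, 4, 8], [], 2, 877),
    ([51, 4, 8], [], 1, 893), ([1, 6, 8, 48], [], 1, 901), ([55, 8], [], 1, 917), ([1, 2, 4, 56],
    [], 2, 921), ([57, 2, 4], [], 1, 937), ([59, 4], [], 1, 945), ([1, 2, 60], [], 1, 949), ([61,
    2], [], 1, 957), ([1, 62], [], 1, 961), ([63], [], 1, 965)]]

/-- The graph on `0, …, n - 1` with the given lists of neighbours. -/
def graphOfMasks (n : ℕ) (N : List ℕ) : SimpleGraph (Fin n) :=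
  SimpleGraph.fromRel fun v w => (N.getD v 0).testBit w = true

instance decidableGraphOfMasksAdj (n : ℕ) (N : List ℕ) : DecidableRel (graphOfMasks n N).Adj :=
  fun _ _ => decidable_of_iff _ (SimpleGraph.fromRel_adj _ _ _).symm

/-- The prism over the hexagon `0, …, 5`. -/
def hexagonalPrism : SimpleGraph (Fin 12) :=
  graphOfMasks 12 [98, 133, 266, 532, 1064, 2065, 2177, 322, 644, 1288, 2576, 1120]

instance decidableHexagonalPrismAdj : DecidableRel hexagonalPrism.Adj :=
  decidableGraphOfMasksAdj _ _

/-- One of the two hexagons of the prism. -/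
def cyclePrism : CycleIn hexagonalPrism 6 where
  vert := Fin.castAdd 6
  three_le := by norm_num
  inj := Fin.castAdd_injective 6 6
  adj := by decide

theorem prismConn_fits : prismConn.Fits cyclePrism id :=
  ⟨rfl, rfl, Function.bijective_id, by decide +kernel, by decide⟩

/-- The rotation of the prism. -/
def rotationPrism : Equiv.Perm (Fin 12) where
  toFun := ![1, 2, 3, 4, 5, 0, 7, 8, 9, 10, 11, 6]
  invFun := ![5, 0, 1, 2, 3, 4, 11, 6, 7, 8, 9, 10]
  left_inv := by decide
  right_inv := by decide

set_option maxHeartbeats 1000000 in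
theorem prismConn_weight :
    cyclePrism.HasWeight false ((1100 : ℕ) / (1 : ℕ)) ((1101 : ℕ) / (1 : ℕ)) :=
  prismConn_fits.hasWeight rfl (ρ := rotateMask 6) (σ := finRotate 6) (by norm_num)
    (by decide +kernel)
    isMaskPerm_rotateMask_six (by decide +kernel) rotationPrism (by decide) (by decide)
    (reps := [1, 3, 5, 7, 9, 11, 13, 15, 21, 23, 27, 31, 63]) (by decide +kernel)
    (r := 6) (by decide +kernel)

theorem isDRegular_hexagonalPrism : IsDRegular hexagonalPrism 3 :=
  isDRegular_iff_card_filter.2 (by decide +kernel)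

theorem le_connConst_three : 1.792 ≤ connConst 3 := by
  have h := cyclePrism.rho_mem_Icc (by norm_num) (by norm_num) prismConn_weight
  refine cyclePrism.le_connConst_of_le_rho (n := 12) isDRegular_hexagonalPrism
    (prismConn_fits.connected (by decide)) (by simp) (by norm_num) (by norm_num) (le_trans ?_ h.1)
  norm_num


/-! ### A 4-regular gadget with eight vertices -/

def octoDom : CutTable where
  dom := true
  len := 6
  inner := 2
  nbrs := [192, 136, 160, 66, 192, 68, 57, 23]
  width := 16
  values :=
    0xffff0000ffff7d4d9e8d4b5e9e8d4b5e5b1120127d4d3b8c4b5e1fac4b5e1fac20120000db0f0000db0f7d4d6e103b8c85ef4b5e3adc1fac85ef4b5e3adc1fac3b70201200000000e3ad70ee5fd70000e3ad0000e3ad6fa170ee34e98d093f3c3feb16756fa1342134e916253f3c164216750000c3c05f6e57af0000c3c00000c3c06fa1606f34215f6e34e929391625724b3f3c2962164229ae167500000000e3ad70ee5fd70000e3ad0000e3ad70ee6fa134e98d093feb3f3c16756fa134e9342116253f3c167516420000c3c05f6e57af0000c3c00000c3c06fa15f6e34e9606f342129391625724b3f3c29ae16752962164200000000ccbd626062602d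4877c62bec2bec0000ccbd0000ccbd626062002c3962602d482c390fe662002c392ae30fc62c390fe60fc60000add34ff54f5a1d564ff51d851d560000add30000add362004ff52c394f5a2ae31d560fc64ff52c391d850fe61d560fc600000000e3ad0000e3ad70ee5fd70000e3ad6fa18d093f3c70ee34e93feb16756fa134213f3c164234e9162516750000c3c00000c3c057af5f6e0000c3c06fa1606f3421724b3f3c296216425f6e34e92939162529ae167500000000bc7e0000bc7e70ee00000000bc7e70ee00000000bc7e70ee70ee434f5b2e34e934e91e756e263feb3feb24c5270b167516750cd95b2e34e934e91e7526a0162516250c9f270b167516750cd900000000000000009fa900009fa95f6e000000009fa95f6e000000009fa95f6e5f6e38ed5b2e34e934e91e75478029392939179726a0162516250c9f481b29ae29ae17ec270b167516750cd900000000000000000000000000000000cadb0000cadb65565a120000cadb65565a120000cadb655662ab2c7c65562c732c7c0f9462ab2c7c2ca90f632c7c0f940f630000ae940000ae9451ed4d1a0000ae944d1a51ed0000ae9462ab51ed2c7c52c72ca91cab0f6351ed2c7c1cf20f941cab0f6300000000a89b0000a89b62604d592d484b1a2bec00000000a89b655600000000a89b626065563aad4d592d482c7319d14ca12c392c7c1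97a1b550fe60f9409044ca12c392c7c197a1b550fe60f9409041b1e0fc60f6308e7000000000000000088fc000088fc4ff532931d8532441d560000000088fc51ed0000000088fc4ff551ed2f964ca12c392c7c197a32931d851cf210ca1b550fe60f94090432441d561cab109f1b1e0fc60f6308e700000000000000000000000000000000db0f0000db0f7d4d85ef4b5e85ef4b5e3b7020126e103b8c3adc1fac3adc1fac00000000be990000be996e106e103b8c67623adc3adc1fac67623adc3adc1fac0000000000000000c3c05f6e57af0000c3c00000c3c06fa15f6e34e9724b3f3c29ae1675606f3421293916252962164200000000a78749b949ee0000a7870000a787606f606f342149b929392939162549ee2962296216420000000000000000c3c05f6e57af0000c3c00000c3c06fa15f6e34e9724b3f3c29ae1675606f3421293916252962164200000000a78749b949ee0000a7870000a787606f606f342149b929392939162549ee2962296216420000000000000000add34ff54ff51d854f5a1d561d560000add30000add362004ff52c394ff52c391d850fe64f5a2ae31d560fc61d560fc600000000c3c00000c3c05f6e57af0000c3c06fa1724b3f3c5f6e34e929ae1675606f3421296216422939162500000000a7870000a78749ee49b90000a787606f606f342149ee29622962164249b929392939162500000000000000009fa900009fa95f6e000000009fa95f6e000000009fa95b2e5f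6e34e95f6e34e938ed1e75481b270b29ae167529ae167517ec0cd9478026a0293916252939162517970c9f000000000000000000000000000000007b8d00007b8d49b9000000007b8d49b9000000007b8d478049b9293949b929392c0f1797478026a0293916252939162517970c9f0000000000000000000000000000000000000000000000000000000000000000ae940000ae9451ed4d1a0000ae9451ed4d1a0000ae9462ab51ed2c7c51ed2c7c1cf20f9452c72ca91cab0f631cab0f63000000009155349234920000915552c752c72ca934921cab1cab0f6334921cab1cab0f63000000000000000088fc000088fc4ff532931d8532441d560000000088fc51ed0000000088fc4ca14ff52c3951ed2c7c2f96197a32931b551d850fe61cf20f9410ca090432441b1e1d560fc61cab0f63109f08e700000000000000000000000000000000e3ad0000e3ad70ee5fd70000e3ad6fa170ee34e98d093f3c3feb16756fa1342134e916253f3c164216750000c3c00000c3c05f6e57af0000c3c06fa1606f34215f6e34e929391625724b3f3c2962164229ae167500000000cadb0000cadb65565a120000cadb65565a120000cadb62ab65562c7c65562c7c2c730f9462ab2ca92c7c0f632c7c0f630f940000ae940000ae9451ed4d1a0000ae944d1a51ed0000ae9462ab52c72ca951ed2c7c1cab0f6351ed2c7c1cab0f631cf20f9400000000bc7e0000bc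7e70ee00000000bc7e70ee00000000bc7e70ee70ee434f5b2e34e934e91e756e263feb3feb24c5270b167516750cd95b2e34e934e91e7526a0162516250c9f270b167516750cd900000000000000009fa900009fa95f6e000000009fa95f6e000000009fa95f6e5f6e38ed5b2e34e934e91e75478029392939179726a0162516250c9f481b29ae29ae17ec270b167516750cd900000000000000000000000000000000a89b0000a89b62604d592d484b1a2bec00000000a89b655600000000a89b626065563aad4ca12c392c7c197a4d592d482c7319d11b550fe60f9409044ca12c392c7c197a1b1e0fc60f6308e71b550fe60f940904000000000000000088fc000088fc4ff532441d5632931d850000000088fc51ed0000000088fc4ff551ed2f964ca12c392c7c197a32441d561cab109f1b1e0fc60f6308e732931d851cf210ca1b550fe60f94090400000000000000000000000000000000ccbd0000ccbd626062602d4877c62bec2bec0000ccbd620062602c3962602c392d480fe662002ae32c390fc62c390fc60fe60000add30000add34f5a4ff51d564ff51d561d850000add362004f5a2ae34ff52c391d560fc64ff52c391d560fc61d850fe600000000a89b0000a89b655600000000a89b62604d592d484b1a2bec00000000a89b655662603aad4ca12c7c2c39197a4d592c732d4819d11b550f940fe609044ca12c7c2c39197a1b1e0f630fc608e71b550f940f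e60904000000000000000088fc000088fc51ed0000000088fc4ff532441d5632931d850000000088fc51ed4ff52f964ca12c7c2c39197a32441cab1d56109f1b1e0f630fc608e732931cf21d8510ca1b550f940fe6090400000000000000000000000000000000a89b0000a89b655600000000a89b62604d592d484b1a2bec00000000a89b655662603aad4ca12c7c2c39197a4d592c732d4819d11b550f940fe609044ca12c7c2c39197a1b1e0f630fc608e71b550f940fe60904000000000000000088fc000088fc51ed0000000088fc4ff532441d5632931d850000000088fc51ed4ff52f964ca12c7c2c39197a32441cab1d56109f1b1e0f630fc608e732931cf21d8510ca1b550f940fe609040000000000000000000000000000000084cb000084cb4d594d592d48000000000000000084cb4d594d592d48000000000000000084cb4d594d592d484d592c8c2c7319d14d592c732c8c19d12d4819d119d10edd2f801b551b550fe61b550f9e0f9409041b550f940f9e09040fe60904090405302f801b551b550fe61b550f9e0f9409041b550f940f9e09040fe60904090405300000000000000000000000000000000000000000000000000000000000000000573c0000573c329332931d850000000000000000573c329332931d850000000000000000573c329332931d8532931d0c1cf210ca32931cf21d0c10ca1d8510ca10ca09a82f801b551b550fe61b550f9e0f9409041b550f940f9e09040fe6090409040530000000000000000000000000000000000000000000000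00000000000000000000000000000000000000000000000000000000000000000000000000000000000c3c00000c3c05f6e57af0000c3c06fa15f6e34e9724b3f3c29ae1675606f3421293916252962164200000000a7870000a78749b949ee0000a787606f606f342149b929392939162549ee2962296216420000000000000000ae940000ae9451ed4d1a0000ae9451ed4d1a0000ae9462ab51ed2c7c51ed2c7c1cf20f9452c72ca91cab0f631cab0f63000000009155349234920000915552c752c72ca934921cab1cab0f6334921cab1cab0f6300000000000000009fa900009fa95f6e000000009fa95f6e000000009fa95f6e5b2e34e95f6e38ed34e91e75481b29ae270b167529ae17ec16750cd94780293926a016252939179716250c9f000000000000000000000000000000007b8d00007b8d49b9000000007b8d49b9000000007b8d49b94780293949b92c0f293917974780293926a016252939179716250c9f000000000000000000000000000000000000000000000000000000000000000088fc000088fc4ff532931d8532441d560000000088fc51ed0000000088fc4ff54ca12c3951ed2f962c7c197a32931d851b550fe61cf210ca0f94090432441d561b1e0fc61cab109f0f6308e700000000000000000000000000000000add30000add34ff54ff51d854f5a1d561d560000add362004ff52c394ff52c391d850fe64f5a2ae31d560fc61d560fc60000000088fc000088fc51ed0000000088fc4ff532931d8532441d560000000088fc4ca151ed2c7c4ff5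2c392f96197a32931b551cf20f941d850fe610ca090432441b1e1cab0f631d560fc6109f08e70000000000000000000000000000000088fc000088fc51ed0000000088fc4ff532931d8532441d560000000088fc51ed4ca12c7c4ff52f962c39197a32931cf21b550f941d8510ca0fe6090432441cab1b1e0f631d56109f0fc608e700000000000000000000000000000000573c0000573c329332931d850000000000000000573c329332931d850000000000000000573c32932f801b5532931d851b550fe632931d0c1b550f9e1cf210ca0f94090432931cf21b550f941d0c10ca0f9e09041d8510ca0fe6090410ca09a80904053000000000000000000000000000000000000000000000000000000000000000000000000000000000000000000000000000000000000000000000000000000000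
  entries := [
    [], [([1], [2, 4, 8, 16, 32], 1, 0), ([1], [2, 4], 1, 64), ([1], [8, 32], 1, 72), ([1], [], 1,
    80)], [], [([1, 2], [4, 16, 32], 1, 82), ([1, 2], [4], 1, 114), ([3], [32], 1, 122), ([3], [],
    1, 126)], [], [([1, 4], [2, 8, 16], 1, 128), ([1, 4], [2], 1, 160), ([5], [8], 1, 168), ([5],
    [], 1, 172)], [], [([1, 2, 4], [16], 1, 174), ([1, 2, 4], [], 1, 190), ([7], [], 2, 198)], [],
    [([1, 8], [4, 16, 32], 1, 200), ([9], [4], 1, 232), ([1, 8], [32], 1, 236), ([9], [], 1,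
    244)], [([10], [1, 4, 16, 32], 1, 246), ([10], [4], 1, 278), ([10], [32], 1, 282), ([10], [],
    1, 286)], [([1, 10], [4, 16, 32], 1, 288), ([11], [4], 1, 320), ([11], [32], 1, 324), ([11],
    [], 1, 328)], [([4, 8], [1, 16], 1, 330), ([4, 8], [], 3, 346)], [([1, 4, 8], [16], 1, 350),
    ([9, 4], [], 1, 366), ([5, 8], [], 1, 370), ([13], [], 1, 374)], [([10, 4], [1, 16], 1, 376),
    ([10, 4], [], 1, 392), ([14], [], 2, 396)], [([1, 10, 4], [16], 1, 398), ([11, 4], [], 1,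
    414), ([15], [], 2, 418)], [([16], [1, 2, 4, 8, 32], 1, 420), ([16], [2, 4], 1, 484), ([16],
    [8, 32], 1, 492), ([16], [], 1, 500)], [([1, 16], [2, 4, 8, 32], 1, 502), ([17], [2, 4], 1,
    566), ([17], [8, 32], 1, 574), ([17], [], 1, 582)], [([2, 16], [1, 4, 32], 1, 584), ([2, 16],
    [4], 1, 616), ([18], [32], 1, 624), ([18], [], 1, 628)], [([1, 2, 16], [4, 32], 1, 630), ([17,
    2], [4], 1, 662), ([19], [32], 1, 670), ([19], [], 1, 674)], [([4, 16], [1, 2, 8], 1, 676),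
    ([4, 16], [2], 1, 708), ([20], [8], 1, 716), ([20], [], 1, 720)], [([1, 4, 16], [2, 8], 1,
    722), ([17, 4], [2], 1, 754), ([21], [8], 1, 762), ([21], [], 1, 766)], [([2, 4, 16], [1], 1,
    768), ([2, 4, 16], [], 1, 784), ([22], [], 2, 792)], [([1, 2, 4, 16], [], 1, 794), ([17, 2,
    4], [], 1, 810), ([23], [], 2, 818)], [([8, 16], [1, 4, 32], 1, 820), ([24], [4], 1, 852),
    ([8, 16], [32], 1, 856), ([24], [], 1, 864)], [([1, 8, 16], [4, 32], 1, 866), ([25], [4], 1,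
    898), ([17, 8], [32], 1, 902), ([25], [], 1, 910)], [([10, 16], [1, 4, 32], 1, 912), ([26],
    [4], 1, 944), ([26], [32], 1, 948), ([26], [], 1, 952)], [([1, 10, 16], [4, 32], 1, 954),
    ([27], [4], 1, 986), ([27], [32], 1, 990), ([27], [], 1, 994)], [([4, 8, 16], [1], 1, 996),
    ([4, 24], [], 1, 1012), ([20, 8], [], 1, 1016), ([28], [], 1, 1020)], [([1, 4, 8, 16], [], 1,
    1022), ([25, 4], [], 1, 1038), ([21, 8], [], 1, 1042), ([29], [], 1, 1046)], [([10, 4, 16],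
    [1], 1, 1048), ([26, 4], [], 1, 1064), ([30], [], 2, 1068)], [([1, 10, 4, 16], [], 1, 1070),
    ([27, 4], [], 1, 1086), ([31], [], 2, 1090)], [], [([1, 32], [2, 8, 16], 1, 1092), ([33], [2],
    1, 1124), ([1, 32], [8], 1, 1128), ([33], [], 1, 1136)], [([2, 32], [1, 16], 1, 1138), ([2,
    32], [], 3, 1154)], [([1, 2, 32], [16], 1, 1158), ([33, 2], [], 1, 1174), ([3, 32], [], 1,
    1178), ([35], [], 1, 1182)], [([36], [1, 2, 8, 16], 1, 1184), ([36], [2], 1, 1216), ([36],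
    [8], 1, 1220), ([36], [], 1, 1224)], [([1, 36], [2, 8, 16], 1, 1226), ([37], [2], 1, 1258),
    ([37], [8], 1, 1262), ([37], [], 1, 1266)], [([2, 36], [1, 16], 1, 1268), ([2, 36], [], 1,
    1284), ([38], [], 2, 1288)], [([1, 2, 36], [16], 1, 1290), ([37, 2], [], 1, 1306), ([39], [],
    2, 1310)], [], [([1, 8, 32], [16], 1, 1312), ([41], [], 2, 1328), ([1, 8, 32], [], 1, 1330)],
    [([10, 32], [1, 16], 1, 1338), ([42], [], 2, 1354), ([10, 32], [], 1, 1356)], [([1, 10, 32],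
    [16], 1, 1360), ([43], [], 2, 1376), ([11, 32], [], 1, 1378)], [([36, 8], [1, 16], 1, 1382),
    ([44], [], 2, 1398), ([36, 8], [], 1, 1400)], [([1, 36, 8], [16], 1, 1404), ([45], [], 2,
    1420), ([37, 8], [], 1, 1422)], [([10, 36], [1, 16], 1, 1426), ([46], [], 3, 1442)], [([1, 10,
    36], [16], 1, 1444), ([47], [], 3, 1460)], [([16, 32], [1, 2, 8], 1, 1462), ([48], [2], 1,
    1494), ([16, 32], [8], 1, 1498), ([48], [], 1, 1506)], [([1, 16, 32], [2, 8], 1, 1508), ([49],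
    [2], 1, 1540), ([17, 32], [8], 1, 1544), ([49], [], 1, 1552)], [([2, 16, 32], [1], 1, 1554),
    ([2, 48], [], 1, 1570), ([18, 32], [], 1, 1574), ([50], [], 1, 1578)], [([1, 2, 16, 32], [],
    1, 1580), ([49, 2], [], 1, 1596), ([19, 32], [], 1, 1600), ([51], [], 1, 1604)], [([36, 16],
    [1, 2, 8], 1, 1606), ([52], [2], 1, 1638), ([52], [8], 1, 1642), ([52], [], 1, 1646)], [([1,
    36, 16], [2, 8], 1, 1648), ([53], [2], 1, 1680), ([53], [8], 1, 1684), ([53], [], 1, 1688)],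
    [([2, 36, 16], [1], 1, 1690), ([2, 52], [], 1, 1706), ([54], [], 2, 1710)], [([1, 2, 36, 16],
    [], 1, 1712), ([53, 2], [], 1, 1728), ([55], [], 2, 1732)], [([8, 16, 32], [1], 1, 1734),
    ([56], [], 2, 1750), ([8, 16, 32], [], 1, 1752)], [([1, 8, 16, 32], [], 1, 1760), ([57], [],
    2, 1776), ([17, 8, 32], [], 1, 1778)], [([10, 16, 32], [1], 1, 1786), ([58], [], 2, 1802),
    ([26, 32], [], 1, 1804)], [([1, 10, 16, 32], [], 1, 1808), ([59], [], 2, 1824), ([27, 32], [],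
    1, 1826)], [([36, 8, 16], [1], 1, 1830), ([60], [], 2, 1846), ([52, 8], [], 1, 1848)], [([1,
    36, 8, 16], [], 1, 1852), ([61], [], 2, 1868), ([53, 8], [], 1, 1870)], [([10, 36, 16], [1],
    1, 1874), ([62], [], 3, 1890)], [([1, 10, 36, 16], [], 1, 1892), ([63], [], 3, 1908)]]

/-- A 4-regular graph with the hexagon `0, …, 5`. -/
def octoGraph : SimpleGraph (Fin 8) := graphOfMasks 8 [226, 141, 170, 86, 232, 85, 57, 23]

instance decidableOctoGraphAdj : DecidableRel octoGraph.Adj := decidableGraphOfMasksAdj _ _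

/-- The hexagon `0, …, 5`. -/
def cycleOcto : CycleIn octoGraph 6 where
  vert := Fin.castAdd 2
  three_le := by norm_num
  inj := Fin.castAdd_injective 6 2
  adj := by decide

theorem octoDom_fits : octoDom.Fits cycleOcto id :=
  ⟨rfl, rfl, Function.bijective_id, by decide +kernel, by decide⟩

set_option maxHeartbeats 1000000 in
theorem octoDom_weight : cycleOcto.HasLowerWeight true (154 : ℕ) :=
  octoDom_fits.hasLowerWeight rfl (by decide +kernel) (ρ := id) (σ := 1)
    (fun _ hm => ⟨hm, fun _ => rfl⟩) (by decide +kernel) 1 (by decide) (by decide)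
    (reps := List.range' 1 63) (by decide +kernel) (r := 1) (by decide +kernel) (by decide +kernel)

theorem isDRegular_octoGraph : IsDRegular octoGraph 4 :=
  isDRegular_iff_card_filter.2 (by decide +kernel)

theorem le_domConnConst_four : 1.875 ≤ domConnConst 4 := by
  have h := cycleOcto.le_domRho_of_hasLowerWeight (by norm_num) octoDom_weight
  refine cycleOcto.le_domConnConst_of_le_domRho (n := 8) isDRegular_octoGraph
    (octoDom_fits.connected (by decide)) (by simp) (by norm_num) (by norm_num) (le_trans ?_ h)
  norm_num


/-! ### Rooted columns -/

/-- How the root of a part of a column relates to the vertices seen so far: it is empty and already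
dominated, empty and not yet dominated, linked to a fixed vertex, linked to a vertex that is continued
to the right, or none of these. -/
inductive RootType
  | dominated | undominated | fixed | held | free
  deriving DecidableEq

namespace RootType

instance : Fintype RootType where
  elems := {.dominated, .undominated, .fixed, .held, .free}
  complete := fun x => by cases x <;> decide

/-- The root is occupied. -/
def occ : RootType → Bool
  | dominated | undominated => false
  | fixed | held | free => true

/-- The root is fixed. -/
def isFixed : RootType → Bool
  | fixed => true
  | _ => false

/-- The root is acceptable in a complete column. -/
def isFinal : RootType → Bool
  | dominated | fixed | held => true
  | _ => false

/-- The type of a root that is occupied if `a`, linked to a fixed vertex if `q`, linked to a continued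
vertex if `t`, and dominated if `d`. -/
def ofBools (D a q t d : Bool) : RootType :=
  bif a then (bif q then fixed else bif t then held else free)
  else (bif !D || d then dominated else undominated)

/-- The type of the root of the first part after the root of the second part has been joined to it by
an edge. -/
def join : RootType → RootType → Option RootType
  | undominated, dominated => some undominated
  | undominated, fixed => some dominated
  | undominated, held => some dominated
  | dominated, dominated => some dominated
  | dominated, fixed => some dominated
  | dominated, held => some dominated
  | fixed, _ => some fixed
  | held, fixed => some fixed
  | held, _ => some held
  | free, fixed => some fixed
  | free, held => some held
  | free, _ => some free
  | _, _ => none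

theorem join_ofBools (D a q t d b q' t' d' : Bool) :
    join (ofBools D a q t d) (ofBools D b q' t' d') =
      bif (!b || q' || t' || a) && (b || !D || d' || a) then
        some (ofBools D a (q || a && b && q') (t || a && b && t') (d || b)) else none := by
  cases D <;> cases a <;> cases q <;> cases t <;> cases d <;> cases b <;> cases q' <;> cases t' <;>
    cases d' <;> rfl

theorem occ_ofBools (D a q t d : Bool) : (ofBools D a q t d).occ = a := by
  cases D <;> cases a <;> cases q <;> cases t <;> cases d <;> rfl

theorem isFixed_ofBools (D a q t d : Bool) : (ofBools D a q t d).isFixed = (a && q) := by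
  cases D <;> cases a <;> cases q <;> cases t <;> cases d <;> rfl

theorem isFinal_ofBools (D a q t d : Bool) :
    (ofBools D a q t d).isFinal = bif a then q || t else !D || d := by
  cases D <;> cases a <;> cases q <;> cases t <;> cases d <;> rfl

end RootType

section Rooted

variable {V W ι κ : Type*}

section Single

variable (D : Bool) (G : SimpleGraph V) (r : V) (vert : ι → V) (c : CutState ι) (O : V → Bool)
  (p : ι → Bool)

/-- The vertices other than the root satisfy the requirements for a column, where components may
instead be linked to the root. -/
def RootedOk : Prop :=
  (∀ v, O v = true → (∃ i, OccLinked G O v (vert i) ∧ (c i = (true, true) ∨ p i = true)) ∨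
    (O r = true ∧ OccLinked G O v r)) ∧
  (D = true → ∀ v, v ≠ r → O v = false →
    (∃ w, G.Adj v w ∧ O w = true) ∨ ∃ i, v = vert i ∧ (c i = (false, true) ∨ p i = true))

/-- The root is linked to a fixed vertex. -/
def RootFixed : Prop := ∃ i, OccLinked G O r (vert i) ∧ c i = (true, true)

/-- The root is linked to a vertex that is continued to the right. -/
def RootHeld : Prop := ∃ i, OccLinked G O r (vert i) ∧ p i = true

/-- The root is dominated. -/
def RootDominated : Prop :=
  (∃ w, G.Adj r w ∧ O w = true) ∨ ∃ i, r = vert i ∧ (c i = (false, true) ∨ p i = true)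

open Classical in
/-- The type of the root. -/
noncomputable def rootType : RootType :=
  .ofBools D (O r) (decide (RootFixed G r vert c O)) (decide (RootHeld G r vert O p))
    (decide (RootDominated G r vert c O p))

open Classical in
/-- The next cut state, if in addition the root is linked to a fixed vertex outside in the case `e`. -/
noncomputable def rootedCut (e : Bool) : CutState ι := fun i =>
  (p i, if p i = true then decide (∃ j, c j = (true, true) ∧ OccLinked G O (vert i) (vert j)) ||
    (e && O r && decide (OccLinked G O (vert i) r)) else O (vert i))

/-- The set `O` is compatible with the cut state `c`. -/
def Compatible (vert : ι → V) (c : CutState ι) (O : V → Bool) : Prop := ∀ i, O (vert i) = (c i).1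

open Classical in
/-- The transfer operator of a rooted part of a column. -/
noncomputable def rootedTransfer [Fintype V] [Fintype ι] (s : RootType) (e : Bool)
    (φ : CutState ι → ℝ) (c : CutState ι) : ℝ :=
  ∑ O : V → Bool, ∑ p : ι → Bool,
    if Compatible vert c O ∧ RootedOk D G r vert c O p ∧ rootType D G r vert c O p = s then
      φ (rootedCut G r vert c O p e) else 0

theorem columnOk_iff_rooted : ColumnOk D G vert c O p ↔
    RootedOk D G r vert c O p ∧ (rootType D G r vert c O p).isFinal = true := by
  unfold rootType
  rw [RootType.isFinal_ofBools]
  constructor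
  · rintro ⟨h1, h2⟩
    refine ⟨⟨fun v hv => Or.inl (h1 v hv), fun hD v _ hv => h2 hD v hv⟩, ?_⟩
    cases hr : O r
    · cases hD : D
      · rfl
      · have : RootDominated G r vert c O p := h2 hD r hr
        simp [this]
    · obtain ⟨i, hi, h | h⟩ := h1 r hr
      · have : RootFixed G r vert c O := ⟨i, hi, h⟩
        simp [this]
      · have : RootHeld G r vert O p := ⟨i, hi, h⟩
        simp [this]
  · rintro ⟨⟨h1, h2⟩, h3⟩
    refine ⟨fun v hv => ?_, fun hD v hv => ?_⟩
    · rcases h1 v hv with h | ⟨hr, h⟩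
      · exact h
      · rw [hr] at h3
        simp only [cond_true, Bool.or_eq_true, decide_eq_true_iff] at h3
        rcases h3 with ⟨i, hi, hi'⟩ | ⟨i, hi, hi'⟩
        · exact ⟨i, h.trans hi, Or.inl hi'⟩
        · exact ⟨i, h.trans hi, Or.inr hi'⟩
    · by_cases hvr : v = r
      · subst hvr
        rw [hv, hD] at h3
        have : RootDominated G v vert c O p := by simpa using h3
        exact this
      · exact h2 hD v hvr hv

theorem rootedCut_false : rootedCut G r vert c O p false = nextCut G vert c O p := by
  funext i
  simp [rootedCut, nextCut]

theorem cutTransfer_eq_sum_rooted [Fintype V] [Fintype ι] (z : CutState ι → ℝ) :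
    cutTransfer D G vert z c = ∑ s : RootType, if s.isFinal = true then
      rootedTransfer D G r vert s false z c else 0 := by
  classical
  have h1 : ∀ s : RootType, (if s.isFinal = true then rootedTransfer D G r vert s false z c else 0) =
      ∑ O : V → Bool, ∑ p : ι → Bool, if s = rootType D G r vert c O p then
        (if Compatible vert c O ∧ RootedOk D G r vert c O p ∧ s.isFinal = true then
          z (nextCut G vert c O p) else 0) else 0 := fun s => by
    by_cases hs : s.isFinal = true
    · rw [if_pos hs, rootedTransfer]
      simp only [hs, and_true, rootedCut_false]
      refine Finset.sum_congr (by congr!) fun O _ => Finset.sum_congr (by congr!) fun p _ => ?_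
      by_cases h : s = rootType D G r vert c O p
      · simp only [← h, and_true, if_true]
      · rw [if_neg h, if_neg fun h' => h h'.2.2.symm]
    · simp [hs]
  rw [Finset.sum_congr rfl fun s _ => h1 s, Finset.sum_comm, cutTransfer]
  refine Finset.sum_congr (by congr!) fun O _ => ?_
  rw [Finset.sum_comm]
  refine Finset.sum_congr (by congr!) fun p _ => ?_
  rw [Finset.sum_ite_eq', if_pos (Finset.mem_univ _)]
  refine if_congr ?_ rfl rfl
  rw [columnOk_iff_rooted D G r vert c O p]
  rfl

end Single

/-! ### Joining the roots of two rooted columns by an edge -/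

/-- The disjoint union of two graphs with an edge between the roots. -/
def joinGraph (G : SimpleGraph V) (r : V) (H : SimpleGraph W) (r' : W) : SimpleGraph (V ⊕ W) where
  Adj
    | .inl v, .inl w => G.Adj v w
    | .inr v, .inr w => H.Adj v w
    | .inl v, .inr w => v = r ∧ w = r'
    | .inr v, .inl w => w = r ∧ v = r'
  symm := ⟨by
    rintro (v | v) (w | w) h
    · exact SimpleGraph.Adj.symm h
    · exact h
    · exact h
    · exact SimpleGraph.Adj.symm h⟩
  loopless := ⟨by
    rintro (v | v) h
    · exact G.loopless.irrefl v h
    · exact H.loopless.irrefl v h⟩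

instance decidableJoinGraphAdj [DecidableEq V] [DecidableEq W] (G : SimpleGraph V) (r : V)
    (H : SimpleGraph W) (r' : W) [DecidableRel G.Adj] [DecidableRel H.Adj] :
    DecidableRel (joinGraph G r H r').Adj
  | .inl v, .inl w => inferInstanceAs (Decidable (G.Adj v w))
  | .inr v, .inr w => inferInstanceAs (Decidable (H.Adj v w))
  | .inl v, .inr w => inferInstanceAs (Decidable (v = r ∧ w = r'))
  | .inr v, .inl w => inferInstanceAs (Decidable (w = r ∧ v = r'))

variable {G : SimpleGraph V} {r : V} {H : SimpleGraph W} {r' : W} {O : V → Bool} {O' : W → Bool}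

theorem occLinked_join_inl {v w : V} :
    OccLinked (joinGraph G r H r') (Sum.elim O O') (.inl v) (.inl w) ↔ OccLinked G O v w := by
  constructor
  · intro h
    refine h.induct (fun x => Sum.elim (fun y => OccLinked G O v y) (fun _ => OccLinked G O v r) x)
      ?_ (OccLinked.refl v)
    rintro (a | a) (b | b) hab ha hb hva
    · exact OccLinked.trans hva (OccLinked.of_adj hab ha hb)
    · obtain ⟨rfl, -⟩ := hab
      exact hva
    · obtain ⟨rfl, -⟩ := hab
      exact hva
    · exact hva
  · exact fun h => h.map Sum.inl fun a b hab ha hb =>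
      OccLinked.of_adj (G := joinGraph G r H r') hab ha hb

theorem occLinked_join_inr {v w : W} :
    OccLinked (joinGraph G r H r') (Sum.elim O O') (.inr v) (.inr w) ↔ OccLinked H O' v w := by
  constructor
  · intro h
    refine h.induct (fun x => Sum.elim (fun _ => OccLinked H O' v r') (fun y => OccLinked H O' v y) x)
      ?_ (OccLinked.refl v)
    rintro (a | a) (b | b) hab ha hb hva
    · exact hva
    · obtain ⟨-, rfl⟩ := hab
      exact hva
    · obtain ⟨-, rfl⟩ := hab
      exact hva
    · exact OccLinked.trans hva (OccLinked.of_adj hab ha hb)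
  · exact fun h => h.map Sum.inr fun a b hab ha hb =>
      OccLinked.of_adj (G := joinGraph G r H r') hab ha hb

theorem occLinked_join_inl_inr {v : V} {w : W} :
    OccLinked (joinGraph G r H r') (Sum.elim O O') (.inl v) (.inr w) ↔
      O r = true ∧ O' r' = true ∧ OccLinked G O v r ∧ OccLinked H O' r' w := by
  constructor
  · intro h
    refine h.induct (fun x => Sum.elim (fun y => OccLinked G O v y)
      (fun y => O r = true ∧ O' r' = true ∧ OccLinked G O v r ∧ OccLinked H O' r' y) x)
      ?_ (OccLinked.refl v)
    rintro (a | a) (b | b) hab ha hb hva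
    · exact OccLinked.trans hva (OccLinked.of_adj hab ha hb)
    · obtain ⟨rfl, rfl⟩ := hab
      exact ⟨ha, hb, hva, OccLinked.refl _⟩
    · obtain ⟨rfl, rfl⟩ := hab
      exact hva.2.2.1
    · obtain ⟨h1, h2, h3, h4⟩ := hva
      exact ⟨h1, h2, h3, h4.trans (OccLinked.of_adj hab ha hb)⟩
  · rintro ⟨h1, h2, h3, h4⟩
    exact ((occLinked_join_inl.2 h3).trans (OccLinked.of_adj (G := joinGraph G r H r')
      (v := .inl r) (w := .inr r') ⟨rfl, rfl⟩ h1 h2)).trans (occLinked_join_inr.2 h4)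

theorem occLinked_join_inr_inl {v : W} {w : V} :
    OccLinked (joinGraph G r H r') (Sum.elim O O') (.inr v) (.inl w) ↔
      O r = true ∧ O' r' = true ∧ OccLinked H O' v r' ∧ OccLinked G O r w := by
  refine ⟨fun h => ?_, fun ⟨h1, h2, h3, h4⟩ =>
    (occLinked_join_inl_inr.2 ⟨h1, h2, h4.symm, h3.symm⟩).symm⟩
  obtain ⟨h1, h2, h3, h4⟩ := occLinked_join_inl_inr.1 h.symm
  exact ⟨h1, h2, h4.symm, h3.symm⟩

end Rooted


section Join

variable {V W ι κ : Type*} {D : Bool} {G : SimpleGraph V} {r : V} {H : SimpleGraph W} {r' : W}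
  {vert : ι → V} {vert' : κ → W} {c : CutState (ι ⊕ κ)} {O : V → Bool} {O' : W → Bool}
  {p : ι → Bool} {p' : κ → Bool}

/-- The cycle vertices of the two parts. -/
abbrev joinVert (vert : ι → V) (vert' : κ → W) : ι ⊕ κ → V ⊕ W :=
  Sum.elim (fun i => .inl (vert i)) fun i => .inr (vert' i)

theorem exists_sum_iff {α β : Type*} {q : α ⊕ β → Prop} :
    (∃ x, q x) ↔ (∃ a, q (.inl a)) ∨ ∃ b, q (.inr b) := Sum.exists

theorem rootFixed_join : RootFixed (joinGraph G r H r') (.inl r) (joinVert vert vert') c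
      (Sum.elim O O') ↔
    RootFixed G r vert (c ∘ .inl) O ∨
      (O r = true ∧ O' r' = true) ∧ RootFixed H r' vert' (c ∘ .inr) O' := by
  unfold RootFixed
  rw [exists_sum_iff]
  refine or_congr ?_ ?_
  · exact exists_congr fun i => and_congr_left fun _ => occLinked_join_inl
  · rw [← exists_and_left]
    refine exists_congr fun i => ?_
    rw [← and_assoc]
    refine and_congr_left fun _ => occLinked_join_inl_inr.trans ?_
    exact ⟨fun h => ⟨⟨h.1, h.2.1⟩, h.2.2.2⟩, fun h => ⟨h.1.1, h.1.2, OccLinked.refl _, h.2⟩⟩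

theorem rootHeld_join : RootHeld (joinGraph G r H r') (.inl r) (joinVert vert vert')
      (Sum.elim O O') (Sum.elim p p') ↔
    RootHeld G r vert O p ∨ (O r = true ∧ O' r' = true) ∧ RootHeld H r' vert' O' p' := by
  unfold RootHeld
  rw [exists_sum_iff]
  refine or_congr ?_ ?_
  · exact exists_congr fun i => and_congr_left fun _ => occLinked_join_inl
  · rw [← exists_and_left]
    refine exists_congr fun i => ?_
    rw [← and_assoc]
    refine and_congr_left fun _ => occLinked_join_inl_inr.trans ?_
    exact ⟨fun h => ⟨⟨h.1, h.2.1⟩, h.2.2.2⟩, fun h => ⟨h.1.1, h.1.2, OccLinked.refl _, h.2⟩⟩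

theorem rootDominated_join : RootDominated (joinGraph G r H r') (.inl r) (joinVert vert vert') c
      (Sum.elim O O') (Sum.elim p p') ↔
    RootDominated G r vert (c ∘ .inl) O p ∨ O' r' = true := by
  unfold RootDominated
  rw [exists_sum_iff, exists_sum_iff]
  simp only [joinGraph, joinVert, Sum.elim_inl, Sum.elim_inr, Sum.inl.injEq, reduceCtorEq, false_and,
    exists_false, or_false, Function.comp_apply, true_and, exists_eq_left]
  rw [or_right_comm]

theorem rootedOk_join : RootedOk D (joinGraph G r H r') (.inl r) (joinVert vert vert') c
      (Sum.elim O O') (Sum.elim p p') ↔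
    RootedOk D G r vert (c ∘ .inl) O p ∧ RootedOk D H r' vert' (c ∘ .inr) O' p' ∧
      (O' r' = true → RootFixed H r' vert' (c ∘ .inr) O' ∨ RootHeld H r' vert' O' p' ∨
        O r = true) ∧
      (O' r' = false → D = true → RootDominated H r' vert' (c ∘ .inr) O' p' ∨ O r = true) := by
  constructor
  · rintro ⟨h1, h2⟩
    have hr1 : ∀ w, O' w = true → (∃ i, OccLinked H O' w (vert' i) ∧
        ((c ∘ .inr) i = (true, true) ∨ p' i = true)) ∨
        O r = true ∧ O' r' = true ∧ OccLinked H O' w r' := fun w hw => by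
      rcases h1 (.inr w) hw with ⟨i | i, hi, h⟩ | ⟨hr, h⟩
      · have := occLinked_join_inr_inl.1 hi
        exact Or.inr ⟨this.1, this.2.1, this.2.2.1⟩
      · exact Or.inl ⟨i, occLinked_join_inr.1 hi, h⟩
      · have := occLinked_join_inr_inl.1 h
        exact Or.inr ⟨this.1, this.2.1, this.2.2.1⟩
    refine ⟨⟨fun v hv => ?_, fun hD v hvr hv => ?_⟩, ⟨fun w hw => ?_, fun hD w hwr hw => ?_⟩,
      fun hr => ?_, fun hr hD => ?_⟩
    · rcases h1 (.inl v) hv with ⟨i | i, hi, h⟩ | ⟨hr, h⟩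
      · exact Or.inl ⟨i, occLinked_join_inl.1 hi, h⟩
      · have := occLinked_join_inl_inr.1 hi
        exact Or.inr ⟨this.1, this.2.2.1⟩
      · exact Or.inr ⟨hr, occLinked_join_inl.1 h⟩
    · rcases h2 hD (.inl v) (fun h => hvr (Sum.inl_injective h)) hv with ⟨w | w, h, hw⟩ | ⟨i | i, h, hi⟩
      · exact Or.inl ⟨w, h, hw⟩
      · exact absurd h.1 hvr
      · exact Or.inr ⟨i, Sum.inl_injective h, hi⟩
      · exact absurd h (by simp)
    · rcases hr1 w hw with h | h
      · exact Or.inl h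
      · exact Or.inr h.2
    · rcases h2 hD (.inr w) (by simp) hw with ⟨v | v, h, hv⟩ | ⟨i | i, h, hi⟩
      · exact absurd h.2 hwr
      · exact Or.inl ⟨v, h, hv⟩
      · exact absurd h (by simp)
      · exact Or.inr ⟨i, Sum.inr_injective h, hi⟩
    · rcases hr1 r' hr with ⟨i, hi, h | h⟩ | h
      · exact Or.inl ⟨i, hi, h⟩
      · exact Or.inr (Or.inl ⟨i, hi, h⟩)
      · exact Or.inr (Or.inr h.1)
    · rcases h2 hD (.inr r') (by simp) hr with ⟨v | v, h, hv⟩ | ⟨i | i, h, hi⟩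
      · exact Or.inr (h.1 ▸ hv)
      · exact Or.inl (Or.inl ⟨v, h, hv⟩)
      · exact absurd h (by simp)
      · exact Or.inl (Or.inr ⟨i, Sum.inr_injective h, hi⟩)
  · rintro ⟨⟨h1, h2⟩, ⟨h3, h4⟩, h5, h6⟩
    refine ⟨?_, fun hD => ?_⟩
    · rintro (v | w) hv
      · rcases h1 v hv with ⟨i, hi, h⟩ | ⟨hr, h⟩
        · exact Or.inl ⟨.inl i, occLinked_join_inl.2 hi, h⟩
        · exact Or.inr ⟨hr, occLinked_join_inl.2 h⟩
      · rcases h3 w hv with ⟨i, hi, h⟩ | ⟨hr, h⟩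
        · exact Or.inl ⟨.inr i, occLinked_join_inr.2 hi, h⟩
        · rcases h5 hr with ⟨i, hi, h'⟩ | ⟨i, hi, h'⟩ | hr'
          · exact Or.inl ⟨.inr i, occLinked_join_inr.2 (h.trans hi), Or.inl h'⟩
          · exact Or.inl ⟨.inr i, occLinked_join_inr.2 (h.trans hi), Or.inr h'⟩
          · exact Or.inr ⟨hr', occLinked_join_inr_inl.2 ⟨hr', hr, h, OccLinked.refl _⟩⟩
    · rintro (v | w) hvr hv
      · have hvr' : v ≠ r := fun h => hvr (congrArg Sum.inl h)
        rcases h2 hD v hvr' hv with ⟨w, h, hw⟩ | ⟨i, h, hi⟩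
        · exact Or.inl ⟨.inl w, h, hw⟩
        · exact Or.inr ⟨.inl i, congrArg Sum.inl h, hi⟩
      · by_cases hw : w = r'
        · subst hw
          rcases h6 hv hD with (⟨w, h, hw⟩ | ⟨i, h, hi⟩) | h
          · exact Or.inl ⟨.inr w, h, hw⟩
          · exact Or.inr ⟨.inr i, congrArg Sum.inr h, hi⟩
          · exact Or.inl ⟨.inl r, ⟨rfl, rfl⟩, h⟩
        · rcases h4 hD w hw hv with ⟨x, h, hx⟩ | ⟨i, h, hi⟩
          · exact Or.inl ⟨.inr x, h, hx⟩
          · exact Or.inr ⟨.inr i, congrArg Sum.inr h, hi⟩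

theorem rootedOk_join_iff (s : RootType) :
    (RootedOk D (joinGraph G r H r') (.inl r) (joinVert vert vert') c (Sum.elim O O')
        (Sum.elim p p') ∧
      rootType D (joinGraph G r H r') (.inl r) (joinVert vert vert') c (Sum.elim O O')
        (Sum.elim p p') = s) ↔
    (RootedOk D G r vert (c ∘ .inl) O p ∧ RootedOk D H r' vert' (c ∘ .inr) O' p') ∧
      (rootType D G r vert (c ∘ .inl) O p).join (rootType D H r' vert' (c ∘ .inr) O' p') =
        some s := by
  classical
  have h1 : rootType D (joinGraph G r H r') (.inl r) (joinVert vert vert') c (Sum.elim O O')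
      (Sum.elim p p') = .ofBools D (O r)
        (decide (RootFixed G r vert (c ∘ .inl) O) || O r && O' r' &&
          decide (RootFixed H r' vert' (c ∘ .inr) O'))
        (decide (RootHeld G r vert O p) || O r && O' r' && decide (RootHeld H r' vert' O' p'))
        (decide (RootDominated G r vert (c ∘ .inl) O p) || O' r') := by
    unfold rootType
    congr 1
    · rw [Bool.eq_iff_iff]
      simp only [decide_eq_true_iff, Bool.or_eq_true, Bool.and_eq_true, rootFixed_join]
    · rw [Bool.eq_iff_iff]
      simp only [decide_eq_true_iff, Bool.or_eq_true, Bool.and_eq_true, rootHeld_join]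
    · rw [Bool.eq_iff_iff]
      simp only [decide_eq_true_iff, Bool.or_eq_true, rootDominated_join]
  rw [h1, rootType, rootType, RootType.join_ofBools, rootedOk_join]
  generalize hq : decide (RootFixed H r' vert' (c ∘ .inr) O') = q
  generalize ht : decide (RootHeld H r' vert' O' p') = t
  generalize hd : decide (RootDominated H r' vert' (c ∘ .inr) O' p') = d
  rw [Bool.cond_eq_ite, Option.ite_none_right_eq_some, Option.some_inj]
  simp only [← and_assoc]
  refine and_congr_left fun _ => ?_
  rw [and_assoc]
  refine and_congr_right fun _ => ?_
  rw [← decide_eq_true_iff (p := RootFixed H r' vert' (c ∘ .inr) O'),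
    ← decide_eq_true_iff (p := RootHeld H r' vert' O' p'),
    ← decide_eq_true_iff (p := RootDominated H r' vert' (c ∘ .inr) O' p'), hq, ht, hd]
  cases O' r' <;> cases q <;> cases t <;> cases O r <;> cases D <;> cases d <;> simp

theorem rootedCut_join (e : Bool) :
    rootedCut (joinGraph G r H r') (.inl r) (joinVert vert vert') c (Sum.elim O O')
        (Sum.elim p p') e =
      Sum.elim
        (rootedCut G r vert (c ∘ .inl) O p
          (e || (rootType D H r' vert' (c ∘ .inr) O' p').isFixed))
        (rootedCut H r' vert' (c ∘ .inr) O' p'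
          ((rootType D G r vert (c ∘ .inl) O p).occ &&
            (e || (rootType D G r vert (c ∘ .inl) O p).isFixed))) := by
  classical
  simp only [rootType, RootType.isFixed_ofBools, RootType.occ_ofBools]
  funext i
  rcases i with i | i
  · simp only [rootedCut, Sum.elim_inl]
    refine Prod.ext rfl (if_congr Iff.rfl ?_ rfl)
    rw [Bool.eq_iff_iff]
    simp only [Bool.or_eq_true, Bool.and_eq_true, decide_eq_true_iff, exists_sum_iff]
    simp only [joinVert, Sum.elim_inl, Sum.elim_inr, occLinked_join_inl, occLinked_join_inl_inr,
      RootFixed, Function.comp_apply]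
    simp only [decide_eq_true_iff]
    constructor
    · rintro ((h | ⟨j, h1, h2, h3, h4, h5⟩) | ⟨⟨h1, h2⟩, h3⟩)
      · exact Or.inl h
      · exact Or.inr ⟨⟨Or.inr ⟨h3, j, h5, h1⟩, h2⟩, h4⟩
      · exact Or.inr ⟨⟨Or.inl h1, h2⟩, h3⟩
    · rintro (h | ⟨⟨h1 | ⟨h1, j, h5, h6⟩, h2⟩, h3⟩)
      · exact Or.inl (Or.inl h)
      · exact Or.inr ⟨⟨h1, h2⟩, h3⟩
      · exact Or.inl (Or.inr ⟨j, h6, h2, h1, h3, h5⟩)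
  · simp only [rootedCut, Sum.elim_inr]
    refine Prod.ext rfl (if_congr Iff.rfl ?_ rfl)
    rw [Bool.eq_iff_iff]
    simp only [Bool.or_eq_true, Bool.and_eq_true, decide_eq_true_iff, exists_sum_iff]
    simp only [joinVert, Sum.elim_inl, Sum.elim_inr, occLinked_join_inr, occLinked_join_inr_inl,
      RootFixed, Function.comp_apply]
    simp only [decide_eq_true_iff]
    constructor
    · rintro ((⟨j, h1, h2, h3, h4, h5⟩ | h) | ⟨⟨h1, h2⟩, h3, h4, h5, -⟩)
      · exact Or.inr ⟨⟨⟨h2, Or.inr ⟨h2, j, h5, h1⟩⟩, h3⟩, h4⟩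
      · exact Or.inl h
      · exact Or.inr ⟨⟨⟨h2, Or.inl h1⟩, h4⟩, h5⟩
    · rintro (h | ⟨⟨⟨h1, h2 | ⟨-, j, h5, h6⟩⟩, h3⟩, h4⟩)
      · exact Or.inl (Or.inr h)
      · exact Or.inr ⟨⟨h2, h1⟩, h1, h3, h4, OccLinked.refl _⟩
      · exact Or.inl (Or.inl ⟨j, h6, h1, h3, h4, h5⟩)

theorem compatible_join : Compatible (joinVert vert vert') c (Sum.elim O O') ↔
    Compatible vert (c ∘ .inl) O ∧ Compatible vert' (c ∘ .inr) O' :=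
  Sum.forall

end Join

section Sums

open Classical in
theorem sum_sum_of_types {X Y S : Type*} [Fintype X] [Fintype Y] [Fintype S] (J : S → S → Prop)
    (g : X → Prop) (g' : Y → Prop) (t : X → S) (t' : Y → S) (F : X → Y → S → S → ℝ) :
    (∑ s, ∑ s', if J s s' then ∑ x, if g x ∧ t x = s then
      ∑ y, if g' y ∧ t' y = s' then F x y s s' else 0 else 0 else 0) =
    ∑ x, ∑ y, if (g x ∧ g' y) ∧ J (t x) (t' y) then F x y (t x) (t' y) else 0 := by
  have h1 : ∀ s s', (if J s s' then ∑ x, if g x ∧ t x = s then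
      ∑ y, if g' y ∧ t' y = s' then F x y s s' else 0 else 0 else 0) =
      ∑ z : X × Y, if t z.1 = s then if t' z.2 = s' then
        if (g z.1 ∧ g' z.2) ∧ J s s' then F z.1 z.2 s s' else 0 else 0 else 0 := fun s s' => by
    rw [Fintype.sum_prod_type]
    by_cases hJ : J s s'
    · rw [if_pos hJ]
      refine Finset.sum_congr rfl fun x _ => ?_
      by_cases hs : t x = s
      · by_cases hg : g x
        · rw [if_pos ⟨hg, hs⟩]
          refine Finset.sum_congr rfl fun y _ => ?_
          by_cases hs' : t' y = s' <;> simp [hs, hs', hg, hJ]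
        · simp [hg]
      · simp [hs]
    · simp [hJ]
  simp_rw [h1]
  rw [← Fintype.sum_prod_type' (f := fun s s' => ∑ z : X × Y, if t z.1 = s then
    if t' z.2 = s' then if (g z.1 ∧ g' z.2) ∧ J s s' then F z.1 z.2 s s' else 0 else 0 else 0),
    Finset.sum_comm, ← Fintype.sum_prod_type' (f := fun x y => if (g x ∧ g' y) ∧ J (t x) (t' y) then
      F x y (t x) (t' y) else 0)]
  refine Finset.sum_congr rfl fun z _ => ?_
  rw [Fintype.sum_prod_type, Finset.sum_eq_single (t z.1), Finset.sum_eq_single (t' z.2)]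
  · simp
  · intro s' _ hs'
    rw [if_pos rfl, if_neg hs'.symm]
  · simp
  · intro s _ hs
    exact Finset.sum_eq_zero fun s' _ => if_neg hs.symm
  · simp

end Sums

section JoinTransfer

variable {V W ι κ : Type*} [Fintype V] [Fintype W] [Fintype ι] [Fintype κ]

theorem sum_arrow_sum {α β : Type*} {_ : Fintype (α ⊕ β → Bool)} [Fintype (α → Bool)]
    [Fintype (β → Bool)] (F : (α ⊕ β → Bool) → ℝ) :
    ∑ f, F f = ∑ f : α → Bool, ∑ f' : β → Bool, F (Sum.elim f f') := by
  rw [← (Equiv.sumArrowEquivProdArrow α β Bool).symm.sum_comp, Fintype.sum_prod_type]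
  rfl

open Classical in
theorem rootedTransfer_eq_sum (D : Bool) (G : SimpleGraph V) (r : V) (vert : ι → V) (s : RootType)
    (e : Bool) (φ : CutState ι → ℝ) (c : CutState ι) :
    rootedTransfer D G r vert s e φ c = ∑ x : (V → Bool) × (ι → Bool),
      if (Compatible vert c x.1 ∧ RootedOk D G r vert c x.1 x.2) ∧
          rootType D G r vert c x.1 x.2 = s then
        φ (rootedCut G r vert c x.1 x.2 e) else 0 := by
  rw [Fintype.sum_prod_type, rootedTransfer]
  simp only [and_assoc]

/-- The transfer operator of two rooted columns that are joined by an edge between the roots. -/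
theorem rootedTransfer_join (D : Bool) (G : SimpleGraph V) (r : V) (vert : ι → V)
    (H : SimpleGraph W) (r' : W) (vert' : κ → W) (s : RootType) (e : Bool)
    (φ : CutState (ι ⊕ κ) → ℝ) (c : CutState (ι ⊕ κ)) :
    rootedTransfer D (joinGraph G r H r') (.inl r) (joinVert vert vert') s e φ c =
      ∑ t : RootType, ∑ t' : RootType, if t.join t' = some s then
        rootedTransfer D G r vert t (e || t'.isFixed) (fun d =>
          rootedTransfer D H r' vert' t' (t.occ && (e || t.isFixed)) (fun d' => φ (Sum.elim d d'))
            (c ∘ .inr)) (c ∘ .inl) else 0 := by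
  classical
  rw [rootedTransfer]
  simp only [rootedTransfer_eq_sum]
  refine Eq.trans ?_ (Eq.trans (sum_sum_of_types (fun t t' => t.join t' = some s)
    (fun x : (V → Bool) × (ι → Bool) => Compatible vert (c ∘ .inl) x.1 ∧
      RootedOk D G r vert (c ∘ .inl) x.1 x.2)
    (fun y : (W → Bool) × (κ → Bool) => Compatible vert' (c ∘ .inr) y.1 ∧
      RootedOk D H r' vert' (c ∘ .inr) y.1 y.2)
    (fun x => rootType D G r vert (c ∘ .inl) x.1 x.2)
    (fun y => rootType D H r' vert' (c ∘ .inr) y.1 y.2)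
    (fun x y t t' => φ (Sum.elim
      (rootedCut G r vert (c ∘ .inl) x.1 x.2 (e || t'.isFixed))
      (rootedCut H r' vert' (c ∘ .inr) y.1 y.2 (t.occ && (e || t.isFixed)))))).symm ?_)
  · rw [sum_arrow_sum, Fintype.sum_prod_type]
    refine Finset.sum_congr rfl fun O _ => ?_
    simp_rw [sum_arrow_sum, Fintype.sum_prod_type]
    rw [Finset.sum_comm]
    refine Finset.sum_congr rfl fun p _ => Finset.sum_congr rfl fun O' _ =>
      Finset.sum_congr rfl fun p' _ => ?_
    rw [rootedCut_join (D := D)]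
    refine if_congr ?_ rfl rfl
    rw [compatible_join, rootedOk_join_iff, ← and_assoc, and_and_and_comm]
  · congr!

end JoinTransfer


/-! ### Tables for rooted columns -/

/-- The value of a functional that is given by a list of multiplicities and classes. -/
def dot (ψ : ℕ → ℝ) (l : List (ℕ × ℕ)) : ℝ := (l.map fun x => (x.1 : ℝ) * ψ x.2).sum

@[simp] theorem dot_nil (ψ : ℕ → ℝ) : dot ψ [] = 0 := rfl

@[simp] theorem dot_cons (ψ : ℕ → ℝ) (x : ℕ × ℕ) (l : List (ℕ × ℕ)) :
    dot ψ (x :: l) = x.1 * ψ x.2 + dot ψ l := by simp [dot]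

theorem dot_append (ψ : ℕ → ℝ) (l l' : List (ℕ × ℕ)) : dot ψ (l ++ l') = dot ψ l + dot ψ l' := by
  simp [dot]

theorem dot_flatMap {α : Type*} (ψ : ℕ → ℝ) (f : α → List (ℕ × ℕ)) (l : List α) :
    dot ψ (l.flatMap f) = (l.map fun x => dot ψ (f x)).sum := by
  induction l with
  | nil => rfl
  | cons x l ih => rw [List.flatMap_cons, dot_append, ih, List.map_cons, List.sum_cons]

/-- The products of the entries of two rows. -/
def productRow (π : ℕ → ℕ → ℕ) (l l' : List (ℕ × ℕ)) : List (ℕ × ℕ) :=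
  l.flatMap fun x => l'.map fun y => (x.1 * y.1, π x.2 y.2)

theorem dot_productRow (ψ : ℕ → ℝ) (π : ℕ → ℕ → ℕ) (l l' : List (ℕ × ℕ)) :
    dot ψ (productRow π l l') = dot (fun a => dot (fun b => ψ (π a b)) l') l := by
  rw [productRow, dot_flatMap, dot]
  congr 2
  funext x
  rw [dot, List.map_map, dot, ← List.sum_map_mul_left]
  congr 2
  funext y
  simp [mul_assoc]

/-- The pairs of types whose join is the given type. -/
def RootType.joinPairs : RootType → List (RootType × RootType)
  | undominated => [(undominated, dominated)]
  | dominated => [(undominated, fixed), (undominated, held), (dominated, dominated),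
      (dominated, fixed), (dominated, held)]
  | fixed => [(fixed, dominated), (fixed, undominated), (fixed, fixed), (fixed, held), (fixed, free),
      (held, fixed), (free, fixed)]
  | held => [(held, dominated), (held, undominated), (held, held), (held, free), (free, held)]
  | free => [(free, dominated), (free, undominated), (free, free)]

theorem RootType.sum_univ (F : RootType → ℝ) :
    ∑ t, F t = F .dominated + F .undominated + F .fixed + F .held + F .free := by
  have : (Finset.univ : Finset RootType) = {.dominated, .undominated, .fixed, .held, .free} := rfl
  rw [this]
  simp only [Finset.sum_insert, Finset.mem_insert, Finset.mem_singleton, reduceCtorEq, or_self,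
    not_false_eq_true, Finset.sum_singleton]
  ring

theorem RootType.sum_joinPairs (s : RootType) (F : RootType → RootType → ℝ) :
    (∑ t, ∑ t', if t.join t' = some s then F t t' else 0) =
      (s.joinPairs.map fun x => F x.1 x.2).sum := by
  simp only [RootType.sum_univ]
  cases s <;> simp [RootType.join, RootType.joinPairs] <;> ring

/-- A table for the transfer operators of a rooted part of a column: the cut states are divided into
classes, and `row s e i` is the transfer operator for the root type `s` at class `i`. The bits of
`live` mark the live classes. -/
structure PartTable where
  size : ℕ
  live : ℕ
  row : RootType → Bool → ℕ → List (ℕ × ℕ)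

theorem CutState.live_sum_iff {ι κ : Type*} {c : CutState (ι ⊕ κ)} :
    c.Live ↔ CutState.Live (c ∘ .inl) ∨ CutState.Live (c ∘ .inr) := Sum.exists

namespace PartTable

/-- The row of two parts whose roots are joined by an edge. -/
def joinRow (A B : PartTable) (π : ℕ → ℕ → ℕ) (s : RootType) (e : Bool) (i j : ℕ) :
    List (ℕ × ℕ) :=
  s.joinPairs.flatMap fun x => productRow π (A.row x.1 (e || x.2.isFixed) i)
    (B.row x.2 (x.1.occ && (e || x.1.isFixed)) j)

/-- The table describes the transfer operators of a rooted part of a column, where the class of a cut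
state is given by `id`. -/
structure Represents {V ι : Type*} [Fintype V] [Fintype ι] (T : PartTable) (D : Bool)
    (G : SimpleGraph V) (r : V) (vert : ι → V) (id : CutState ι → ℕ) : Prop where
  lt : ∀ c, id c < T.size
  live_iff : ∀ c, c.Live ↔ T.live.testBit (id c) = true
  row_eq : ∀ s e c (ψ : ℕ → ℝ),
    rootedTransfer D G r vert s e (fun d => ψ (id d)) c = dot ψ (T.row s e (id c))

variable {V W ι κ : Type*} [Fintype V] [Fintype W] [Fintype ι] [Fintype κ] {D : Bool}
  {A B T : PartTable} {G : SimpleGraph V} {r : V} {vert : ι → V} {id : CutState ι → ℕ}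
  {H : SimpleGraph W} {r' : W} {vert' : κ → W} {id' : CutState κ → ℕ}

theorem rootedTransfer_join_eq (hA : A.Represents D G r vert id) (hB : B.Represents D H r' vert' id')
    (ψ : ℕ → ℕ → ℝ) (s : RootType) (e : Bool) (c : CutState (ι ⊕ κ)) :
    rootedTransfer D (joinGraph G r H r') (.inl r) (joinVert vert vert') s e
        (fun d => ψ (id (d ∘ .inl)) (id' (d ∘ .inr))) c =
      (s.joinPairs.map fun x => dot (fun a => dot (ψ a)
        (B.row x.2 (x.1.occ && (e || x.1.isFixed)) (id' (c ∘ .inr))))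
        (A.row x.1 (e || x.2.isFixed) (id (c ∘ .inl)))).sum := by
  rw [rootedTransfer_join, ← RootType.sum_joinPairs s fun t t' => dot (fun a => dot (ψ a)
    (B.row t' (t.occ && (e || t.isFixed)) (id' (c ∘ .inr))))
    (A.row t (e || t'.isFixed) (id (c ∘ .inl)))]
  refine Finset.sum_congr rfl fun t _ => Finset.sum_congr rfl fun t' _ => if_congr Iff.rfl ?_ rfl
  simp only [Sum.elim_comp_inl, Sum.elim_comp_inr, hB.row_eq]
  exact hA.row_eq t (e || t'.isFixed) (c ∘ .inl) fun a => dot (ψ a)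
    (B.row t' (t.occ && (e || t.isFixed)) (id' (c ∘ .inr)))

theorem Represents.join {π : ℕ → ℕ → ℕ} (hA : A.Represents D G r vert id)
    (hB : B.Represents D H r' vert' id') (hlt : ∀ i < A.size, ∀ j < B.size, π i j < T.size)
    (hlive : ∀ i < A.size, ∀ j < B.size,
      T.live.testBit (π i j) = (A.live.testBit i || B.live.testBit j))
    (hrow : ∀ i < A.size, ∀ j < B.size, ∀ s e ψ,
      dot ψ (A.joinRow B π s e i j) = dot ψ (T.row s e (π i j))) :
    T.Represents D (joinGraph G r H r') (.inl r) (joinVert vert vert')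
      fun c => π (id (c ∘ .inl)) (id' (c ∘ .inr)) where
  lt c := hlt _ (hA.lt _) _ (hB.lt _)
  live_iff c := by
    rw [hlive _ (hA.lt _) _ (hB.lt _), CutState.live_sum_iff, hA.live_iff, hB.live_iff,
      Bool.or_eq_true]
  row_eq s e c ψ := by
    rw [rootedTransfer_join_eq hA hB (fun a b => ψ (π a b)), ← hrow _ (hA.lt _) _ (hB.lt _), joinRow,
      dot_flatMap]
    simp only [dot_productRow]

/-! #### Single vertices -/

/-- The table of a single vertex that does not lie on the cycle. -/
def inner (D : Bool) : PartTable where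
  size := 1
  live := 0
  row
    | .dominated, _, _ => bif D then [] else [(1, 0)]
    | .undominated, _, _ => bif D then [(1, 0)] else []
    | .free, _, _ => [(1, 0)]
    | _, _, _ => []

theorem rootedTransfer_unit (ι : Type*) [Fintype ι] [DecidableEq ι] (vert : ι → Unit) (s : RootType) (e : Bool)
    (φ : CutState ι → ℝ) (c : CutState ι) : rootedTransfer D ⊥ () vert s e φ c =
      ∑ o : Bool, ∑ p : ι → Bool, if (∀ i, o = (c i).1) ∧
        .ofBools D o (decide (∃ i, c i = (true, true))) (decide (∃ i, p i = true))
          (decide (∃ i, c i = (false, true) ∨ p i = true)) = s then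
        φ (fun i => (p i, if p i = true then decide (∃ j, c j = (true, true)) || (e && o) else o))
      else 0 := by
  classical
  rw [rootedTransfer]
  refine Finset.sum_equiv (Equiv.funUnique Unit Bool) (by simp) fun O _ => ?_
  refine Finset.sum_congr (by congr!) fun p _ => ?_
  have hO : ∀ v, O v = Equiv.funUnique Unit Bool O := fun _ => rfl
  have hl : ∀ v w, OccLinked (⊥ : SimpleGraph Unit) O v w ↔ True :=
    fun v w => by simp [OccLinked.refl v]
  refine if_congr ?_ ?_ rfl
  · refine and_congr Iff.rfl ?_
    have h1 : RootedOk D ⊥ () vert c O p :=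
      ⟨fun v hv => Or.inr ⟨hv, OccLinked.refl _⟩, fun _ v hv => absurd rfl hv⟩
    simp only [h1, true_and, rootType, RootFixed, RootHeld, RootDominated, hl, hO,
      SimpleGraph.bot_adj, false_and, exists_false, false_or]
  · congr 1
    funext i
    refine Prod.ext rfl (if_congr Iff.rfl ?_ (hO _))
    rw [Bool.eq_iff_iff]
    simp only [Bool.or_eq_true, Bool.and_eq_true, decide_eq_true_iff, hl, hO, and_true]

theorem inner_represents : (inner D).Represents D (⊥ : SimpleGraph Unit) () Empty.elim fun _ => 0 where
  lt _ := Nat.one_pos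
  live_iff c := by simp [CutState.Live, inner]
  row_eq s e c ψ := by
    rw [rootedTransfer_unit]
    cases s <;> cases D <;>
      simp [inner, RootType.ofBools]

theorem sum_unit_arrow (F : (Unit → Bool) → ℝ) :
    ∑ p, F p = F (fun _ => true) + F fun _ => false := by
  rw [← (Equiv.funUnique Unit Bool).symm.sum_comp, Fintype.sum_bool]
  rfl

/-- The table of a single vertex that lies on the cycle. -/
def leaf (D : Bool) : PartTable where
  size := bif D then 4 else 3
  live := 1
  row
    | .fixed, _, 0 => [(1, 0), (1, 2)]
    | .held, false, 1 => [(1, 1)]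
    | .held, true, 1 => [(1, 0)]
    | .free, _, 1 => [(1, 2)]
    | .dominated, _, 2 => bif D then [(1, 1), (1, 3)] else [(1, 1), (1, 2)]
    | .dominated, _, 3 => bif D then [(1, 1)] else []
    | .undominated, _, 3 => bif D then [(1, 3)] else []
    | _, _, _ => []

/-- The class of the state of a single vertex. -/
def leafClass (D : Bool) (x : Bool × Bool) : ℕ :=
  bif x.1 then (bif x.2 then 0 else 1) else bif x.2 || !D then 2 else 3

theorem leaf_represents :
    (leaf D).Represents D (⊥ : SimpleGraph Unit) () (fun i : Unit => i) fun c => leafClass D (c ()) where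
  lt c := by
    rcases h : c () with ⟨a, b⟩
    cases a <;> cases b <;> cases D <;> decide
  live_iff c := by
    have : c.Live ↔ c () = (true, true) := ⟨fun ⟨_, h⟩ => h, fun h => ⟨(), h⟩⟩
    rw [this]
    rcases c () with ⟨a, b⟩
    cases a <;> cases b <;> cases D <;> decide
  row_eq s e c ψ := by
    rw [rootedTransfer_unit]
    obtain ⟨⟨a, b⟩, rfl⟩ : ∃ x, c = fun _ => x := ⟨c (), rfl⟩
    simp only [sum_unit_arrow, exists_const, forall_const]
    cases a <;> cases b <;> cases D <;> cases s <;> cases e <;>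
      simp [leaf, leafClass, RootType.ofBools]

/-- The table of a part to which a new root is attached. -/
def graft (A : PartTable) (D : Bool) : PartTable where
  size := A.size
  live := A.live
  row s e j := (inner D).joinRow A (fun _ j => j) s e 0 j

theorem Represents.graft (hA : A.Represents D G r vert id) :
    (A.graft D).Represents D (joinGraph ⊥ () G r) (.inl ()) (joinVert Empty.elim vert)
      fun c => id (c ∘ .inr) := by
  refine inner_represents.join (T := A.graft D) (π := fun _ j => j) hA ?_ ?_ ?_
  · exact fun _ _ j hj => hj
  · intro i hi j hj
    simp [inner, PartTable.graft]
  · intro i hi j hj s e ψ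
    have : i = 0 := Nat.lt_one_iff.1 hi
    rw [this, PartTable.graft]

end PartTable


/-! ### Digits -/

/-- A digit in base `2 ^ w`. -/
def digit (w x a : ℕ) : ℕ := Nat.mod (Nat.shiftRight x (Nat.mul w a)) (Nat.pow 2 w)

/-- The number with given digits in base `2 ^ w`. -/
def packFn (w : ℕ) (f : ℕ → ℕ) (n : ℕ) : ℕ :=
  Nat.rec 0 (fun a acc => Nat.add (Nat.mul (f a) (Nat.pow 2 (Nat.mul w a))) acc) n

theorem packFn_eq (w : ℕ) (f : ℕ → ℕ) (n : ℕ) :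
    packFn w f n = ∑ a ∈ Finset.range n, f a * 2 ^ (w * a) := by
  induction n with
  | zero => rfl
  | succ n ih =>
    rw [Finset.sum_range_succ, ← ih, Nat.add_comm (packFn w f n)]
    rfl

theorem digit_packFn {w : ℕ} (n : ℕ) {f : ℕ → ℕ} (h : ∀ a, f a < 2 ^ w) (a : ℕ) :
    digit w (packFn w f n) a = if a < n then f a else 0 := by
  rw [packFn_eq]
  change (∑ a ∈ Finset.range n, f a * 2 ^ (w * a)) >>> (w * a) % 2 ^ w = _
  induction n generalizing f a with
  | zero => simp
  | succ n ih =>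
    have h1 : ∑ a ∈ Finset.range (n + 1), f a * 2 ^ (w * a) =
        f 0 + 2 ^ w * ∑ a ∈ Finset.range n, f (a + 1) * 2 ^ (w * a) := by
      rw [Finset.sum_range_succ', Finset.mul_sum, add_comm]
      simp only [mul_zero, pow_zero, mul_one]
      congr 1
      refine Finset.sum_congr rfl fun a _ => ?_
      rw [mul_add, mul_one, pow_add]
      ring
    rw [h1]
    cases a with
    | zero => simp [Nat.mod_eq_of_lt (h 0)]
    | succ a =>
      rw [mul_add, mul_one, add_comm (w * a), Nat.shiftRight_add, Nat.shiftRight_eq_div_pow _ w,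
        Nat.add_mul_div_left _ _ (by positivity), Nat.div_eq_of_lt (h 0), zero_add,
        ih (fun a => h (a + 1))]
      simp

/-- The value of a functional with natural coefficients. -/
def natDot (ψ : ℕ → ℕ) : List (ℕ × ℕ) → ℕ
  | [] => 0
  | x :: l => Nat.add (Nat.mul x.1 (ψ x.2)) (natDot ψ l)

theorem natDot_cons (ψ : ℕ → ℕ) (x : ℕ × ℕ) (l : List (ℕ × ℕ)) :
    natDot ψ (x :: l) = x.1 * ψ x.2 + natDot ψ l := rfl

theorem cast_natDot (ψ : ℕ → ℕ) (l : List (ℕ × ℕ)) :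
    (natDot ψ l : ℝ) = dot (fun a => (ψ a : ℝ)) l := by
  induction l with
  | nil => simp [natDot]
  | cons x l ih => rw [natDot_cons, dot_cons, Nat.cast_add, ih, Nat.cast_mul]

theorem natDot_packFn (w n : ℕ) (F : ℕ → ℕ) (f : ℕ → ℕ → ℕ) (h : ∀ b, F b = packFn w (f b) n)
    (l : List (ℕ × ℕ)) : natDot F l = packFn w (fun a => natDot (fun b => f b a) l) n := by
  induction l with
  | nil => simp [natDot, packFn_eq]
  | cons x l ih =>
    rw [natDot_cons, ih, h, packFn_eq, packFn_eq, packFn_eq, Finset.mul_sum, ← Finset.sum_add_distrib]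
    refine Finset.sum_congr rfl fun a _ => ?_
    rw [natDot_cons]
    ring

theorem natDot_lt {ψ : ℕ → ℕ} {B : ℕ} (h : ∀ a, ψ a < B) (l : List (ℕ × ℕ)) :
    natDot ψ l ≤ natDot (fun _ => 1) l * (B - 1) := by
  induction l with
  | nil => simp [natDot]
  | cons x l ih =>
    rw [natDot_cons, natDot_cons, add_mul, mul_one]
    exact Nat.add_le_add (Nat.mul_le_mul_left _ (Nat.le_sub_one_of_lt (h _))) ih

theorem natDot_congr {ψ ψ' : ℕ → ℕ} {l : List (ℕ × ℕ)} (h : ∀ x ∈ l, ψ x.2 = ψ' x.2) :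
    natDot ψ l = natDot ψ' l := by
  induction l with
  | nil => rfl
  | cons x l ih =>
    rw [natDot_cons, natDot_cons, h x (by simp), ih fun y hy => h y (by simp [hy])]

/-- Two rows with small coefficients and the same generating number define the same functional. -/
theorem dot_eq_of_natDot_eq {w : ℕ} {l l' : List (ℕ × ℕ)} (h : natDot (fun _ => 1) l < 2 ^ w)
    (h' : natDot (fun _ => 1) l' < 2 ^ w)
    (hc : natDot (fun k => 2 ^ (w * k)) l = natDot (fun k => 2 ^ (w * k)) l') (ψ : ℕ → ℝ) :
    dot ψ l = dot ψ l' := by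
  obtain ⟨n, hn⟩ : ∃ n, ∀ x ∈ l ++ l', x.2 < n := by
    refine ⟨((l ++ l').map Prod.snd).sum + 1, fun x hx => Nat.lt_succ_of_le ?_⟩
    exact List.single_le_sum (by simp) _ (List.mem_map_of_mem hx)
  have key : ∀ l : List (ℕ × ℕ), (∀ x ∈ l, x.2 < n) → natDot (fun _ => 1) l < 2 ^ w →
      dot ψ l = ∑ a ∈ Finset.range n, (digit w (natDot (fun k => 2 ^ (w * k)) l) a : ℝ) * ψ a := by
    intro l hl hw
    have h1 : natDot (fun k => 2 ^ (w * k)) l =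
        packFn w (fun a => natDot (fun k => if a = k then 1 else 0) l) n := by
      rw [← natDot_packFn w n (fun k => packFn w (fun a => if a = k then 1 else 0) n) _ fun _ => rfl]
      refine natDot_congr fun x hx => ?_
      rw [packFn_eq]
      simp [hl x hx]
    have h2 : ∀ a, natDot (fun k => if a = k then 1 else 0) l < 2 ^ w := fun a =>
      ((natDot_lt (B := 2) (fun k => by split_ifs <;> omega) l).trans (by simp)).trans_lt hw
    rw [h1]
    have h3 : ∑ a ∈ Finset.range n, (natDot (fun k => if a = k then 1 else 0) l : ℝ) * ψ a =
        dot ψ l := by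
      clear h1 h2 hw
      induction l with
      | nil => simp [natDot]
      | cons x l ih =>
        rw [dot_cons, ← ih fun y hy => hl y (by simp [hy])]
        simp only [natDot_cons, Nat.cast_add, add_mul, Finset.sum_add_distrib]
        simp [hl x (by simp)]
    rw [← h3]
    refine Finset.sum_congr rfl fun a ha => ?_
    rw [digit_packFn n h2, if_pos (Finset.mem_range.1 ha)]
  rw [key l (fun x hx => hn x (by simp [hx])) h, key l' (fun x hx => hn x (by simp [hx])) h', hc]

/-! ### Merging classes -/

namespace PartTable

/-- The rows `l` and `l'` have small coefficients and the same generating number. -/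
def rowsAgree (w : ℕ) (l l' : List (ℕ × ℕ)) : Bool :=
  Nat.blt (natDot (fun _ => 1) l) (Nat.pow 2 w) && Nat.blt (natDot (fun _ => 1) l') (Nat.pow 2 w) &&
    Nat.beq (natDot (fun k => Nat.pow 2 (Nat.mul w k)) l)
      (natDot (fun k => Nat.pow 2 (Nat.mul w k)) l')

/-- The table `T` arises from joining `A` and `B` and merging classes by `π`. -/
def mergeCheck (A B T : PartTable) (π : ℕ → ℕ → ℕ) (w : ℕ) : Bool :=
  (List.range A.size).all fun i => (List.range B.size).all fun j => Nat.blt (π i j) T.size &&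
    ((T.live.testBit (π i j)) == (A.live.testBit i || B.live.testBit j)) &&
    [RootType.dominated, .undominated, .fixed, .held, .free].all fun s => [false, true].all fun e =>
      rowsAgree w (A.joinRow B π s e i j) (T.row s e (π i j))

variable {V W ι κ : Type*} [Fintype V] [Fintype W] [Fintype ι] [Fintype κ] {D : Bool}
  {A B T : PartTable} {G : SimpleGraph V} {r : V} {vert : ι → V} {id : CutState ι → ℕ}
  {H : SimpleGraph W} {r' : W} {vert' : κ → W} {id' : CutState κ → ℕ}

theorem Represents.join_of_check {π : ℕ → ℕ → ℕ} {w : ℕ} (hA : A.Represents D G r vert id)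
    (hB : B.Represents D H r' vert' id') (h : mergeCheck A B T π w = true) :
    T.Represents D (joinGraph G r H r') (.inl r) (joinVert vert vert')
      fun c => π (id (c ∘ .inl)) (id' (c ∘ .inr)) := by
  simp only [mergeCheck, rowsAgree, List.all_eq_true, List.mem_range, Bool.and_eq_true, Nat.blt_eq,
    beq_iff_eq, Nat.beq_eq] at h
  refine hA.join hB (fun i hi j hj => (h i hi j hj).1.1) (fun i hi j hj => (h i hi j hj).1.2)
    fun i hi j hj s e ψ => ?_
  obtain ⟨⟨h1, h2⟩, h3⟩ := (h i hi j hj).2 s (by cases s <;> simp) e (by cases e <;> simp)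
  exact dot_eq_of_natDot_eq h1 h2 h3 ψ

/-! ### Weights of joined columns -/

/-- The contributions to the transfer operator of a complete column, where the types of the second
root are collected. -/
def groups : List (RootType × Bool × List RootType) :=
  [(.undominated, true, [.fixed]), (.undominated, false, [.held]), (.dominated, true, [.fixed]),
    (.dominated, false, [.dominated, .held]), (.fixed, true, [.fixed]),
    (.fixed, false, [.dominated, .undominated, .held, .free]), (.held, true, [.fixed]),
    (.held, false, [.dominated, .undominated, .held, .free]), (.free, true, [.fixed]),
    (.free, false, [.held])]

/-- The row of the second part in a contribution. -/
def groupRow (B : PartTable) (g : RootType × Bool × List RootType) (j : ℕ) : List (ℕ × ℕ) :=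
  g.2.2.flatMap fun t => B.row t g.1.isFixed j

theorem dot_add (ψ ψ' : ℕ → ℝ) (l : List (ℕ × ℕ)) :
    dot (fun a => ψ a + ψ' a) l = dot ψ l + dot ψ' l := by
  induction l with
  | nil => simp
  | cons x l ih => rw [dot_cons, dot_cons, dot_cons, ih]; ring

theorem cutTransfer_join (hA : A.Represents D G r vert id) (hB : B.Represents D H r' vert' id')
    (ψ : ℕ → ℕ → ℝ) (c : CutState (ι ⊕ κ)) :
    cutTransfer D (joinGraph G r H r') (joinVert vert vert')
        (fun d => ψ (id (d ∘ .inl)) (id' (d ∘ .inr))) c =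
      (groups.map fun g => dot (fun a => dot (ψ a) (B.groupRow g (id' (c ∘ .inr))))
        (A.row g.1 g.2.1 (id (c ∘ .inl)))).sum := by
  rw [cutTransfer_eq_sum_rooted D _ (.inl r)]
  simp only [rootedTransfer_join_eq hA hB]
  generalize id (c ∘ .inl) = i
  generalize id' (c ∘ .inr) = j
  simp only [RootType.sum_univ, RootType.isFinal, if_true, RootType.joinPairs, RootType.isFixed,
    RootType.occ, groups, groupRow, List.map_cons, List.map_nil, List.sum_cons, List.sum_nil,
    List.flatMap_cons, List.flatMap_nil, List.append_nil, dot_append, dot_add, Bool.false_or,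
    Bool.and_true, Bool.and_false, Bool.false_eq_true, if_false, add_zero]
  ring

/-- Evaluate the number `v` before it is passed to `f`. -/
def force {α : Type} (v : ℕ) (f : ℕ → α) : α :=
  Nat.rec (f 0) (fun n _ => f (Nat.succ n)) v

theorem force_eq {α : Type} (v : ℕ) (f : ℕ → α) : force v f = f v := by cases v <;> rfl

/-- Evaluate the numbers in the list `l` before it is passed to `f`. -/
def forceList {α : Type} : List ℕ → (List ℕ → α) → α
  | [], f => f []
  | a :: l, f => force a fun b => forceList l fun l' => f (b :: l')

theorem forceList_eq {α : Type} (l : List ℕ) (f : List ℕ → α) : forceList l f = f l := by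
  induction l generalizing f with
  | nil => rfl
  | cons a l ih => rw [forceList, force_eq, ih]

/-- The columns of a matrix, whose entry in row `a` and column `b` is the digit with the number
`idx a b` of `zs`. -/
def columns (n m w₀ w zs : ℕ) (idx : ℕ → ℕ → ℕ) : List ℕ :=
  (List.range m).map fun b => packFn w (fun a => digit w₀ zs (idx a b)) n

/-- The value of the transfer operator of the joined column. -/
def total (A : PartTable) (w : ℕ) (vs : List ℕ) (i : ℕ) : ℕ :=
  (List.zipWith (fun g v => natDot (digit w v) (A.row g.1 g.2.1 i)) groups vs).sum

/-- The matrix given by `zs` is multiplied by the transfer operator of the joined column by a factor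
between `lo / den` and `hi / den`. -/
def weightCheck (A B : PartTable) (w₀ w zs : ℕ) (idx : ℕ → ℕ → ℕ) (lo hi den : ℕ) : Bool :=
  Nat.ble w₀ w && forceList (columns A.size B.size w₀ w zs idx) fun L =>
    (List.range B.size).all fun j =>
      (groups.all fun g => Nat.ble
        (Nat.mul (natDot (fun _ => 1) (B.groupRow g j)) (Nat.pow 2 w₀)) (Nat.pow 2 w)) &&
      forceList (groups.map fun g => natDot (fun b => L.getD b 0) (B.groupRow g j)) fun vs =>
        (List.range A.size).all fun i =>
          force (digit w (L.getD j 0) i) fun z => force (Nat.mul den (total A w vs i)) fun t =>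
            (Nat.ble 1 z == (A.live.testBit i || B.live.testBit j)) && Nat.ble (Nat.mul lo z) t &&
              Nat.ble t (Nat.mul hi z)

theorem digit_lt (w x a : ℕ) : digit w x a < 2 ^ w := Nat.mod_lt _ (Nat.two_pow_pos w)

theorem getD_columns (n m w₀ w zs : ℕ) (idx : ℕ → ℕ → ℕ) (b : ℕ) :
    (columns n m w₀ w zs idx).getD b 0 =
      packFn w (fun a => if b < m then digit w₀ zs (idx a b) else 0) n := by
  unfold columns
  by_cases h : b < m
  · simp [h, List.getD_eq_getElem?_getD]
  · simp [h, List.getD_eq_getElem?_getD, packFn_eq]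

theorem digit_natDot_columns {n m w₀ w zs : ℕ} {idx : ℕ → ℕ → ℕ} (hw : w₀ ≤ w) {l : List (ℕ × ℕ)}
    (hl : natDot (fun _ => 1) l * 2 ^ w₀ ≤ 2 ^ w) (a : ℕ) :
    digit w (natDot (fun b => (columns n m w₀ w zs idx).getD b 0) l) a =
      natDot (fun b => digit w ((columns n m w₀ w zs idx).getD b 0) a) l := by
  have h0 : ∀ a b, (if b < m then digit w₀ zs (idx a b) else 0) < 2 ^ w₀ := fun a b => by
    split_ifs
    · exact digit_lt _ _ _
    · positivity
  rw [natDot_packFn w n _ _ (getD_columns n m w₀ w zs idx), digit_packFn]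
  · by_cases ha : a < n
    · rw [if_pos ha]
      refine natDot_congr fun x _ => ?_
      rw [getD_columns, digit_packFn n
        (fun a => (h0 a _).trans_le (Nat.pow_le_pow_right (by norm_num) hw)), if_pos ha]
    · rw [if_neg ha]
      have : ∀ l : List (ℕ × ℕ), natDot (fun _ => 0) l = 0 := fun l => by
        induction l with
        | nil => rfl
        | cons x l ih => rw [natDot_cons, ih]; rfl
      refine (this l).symm.trans (natDot_congr fun x _ => ?_)
      rw [getD_columns, digit_packFn n
        (fun a => (h0 a _).trans_le (Nat.pow_le_pow_right (by norm_num) hw)), if_neg ha]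
  · intro a
    have h1 := natDot_lt (fun b => h0 a b) l
    rcases Nat.eq_zero_or_pos (natDot (fun _ => 1) l) with h | h
    · rw [h, zero_mul] at h1
      exact h1.trans_lt (by positivity)
    · refine h1.trans_lt (lt_of_lt_of_le ?_ hl)
      exact Nat.mul_lt_mul_of_pos_left (Nat.sub_lt (by positivity) one_pos) h

theorem exists_weight_of_check {w₀ w zs lo hi den : ℕ} {idx : ℕ → ℕ → ℕ}
    (hA : A.Represents D G r vert id) (hB : B.Represents D H r' vert' id') (hden : 0 < den)
    (h : weightCheck A B w₀ w zs idx lo hi den = true) :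
    ∃ z : CutState (ι ⊕ κ) → ℝ, (∀ c, ¬ c.Live → z c = 0) ∧ ∀ c : CutState (ι ⊕ κ), c.Live →
      0 < z c ∧
      (lo / den : ℝ) * z c ≤ cutTransfer D (joinGraph G r H r') (joinVert vert vert') z c ∧
      cutTransfer D (joinGraph G r H r') (joinVert vert vert') z c ≤ (hi / den : ℝ) * z c := by
  set L := columns A.size B.size w₀ w zs idx with hL
  simp only [weightCheck, forceList_eq, force_eq, ← hL, List.all_eq_true, List.mem_range,
    Bool.and_eq_true, Nat.ble_eq, beq_iff_eq] at h
  obtain ⟨hw, h⟩ := h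
  set Z : ℕ → ℕ → ℕ := fun a b => digit w (L.getD b 0) a with hZ
  have hpos : ∀ c : CutState (ι ⊕ κ), 0 < Z (id (c ∘ .inl)) (id' (c ∘ .inr)) ↔ c.Live := fun c => by
    rw [CutState.live_sum_iff, hA.live_iff, hB.live_iff, ← Bool.or_eq_true,
      ← ((h _ (hB.lt _)).2 _ (hA.lt _)).1.1, Nat.ble_eq]
    exact Iff.rfl
  refine ⟨fun c => (Z (id (c ∘ .inl)) (id' (c ∘ .inr)) : ℝ), fun c hc => ?_, fun c hc => ?_⟩
  · rw [← hpos] at hc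
    change (Z (id (c ∘ .inl)) (id' (c ∘ .inr)) : ℝ) = 0
    exact_mod_cast Nat.eq_zero_of_not_pos hc
  · refine ⟨Nat.cast_pos.2 ((hpos c).2 hc), ?_⟩
    rw [cutTransfer_join hA hB (fun a b => (Z a b : ℝ))]
    obtain ⟨⟨-, h2⟩, h3⟩ := (h _ (hB.lt (c ∘ .inr))).2 _ (hA.lt (c ∘ .inl))
    have h1 := (h _ (hB.lt (c ∘ .inr))).1
    beta_reduce
    generalize id (c ∘ .inl) = i at *
    generalize id' (c ∘ .inr) = j at *
    have ht : ((groups.map fun g => dot (fun a => dot (fun b => (Z a b : ℝ)) (B.groupRow g j))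
        (A.row g.1 g.2.1 i)).sum) =
        (total A w (groups.map fun g => natDot (fun b => L.getD b 0) (B.groupRow g j)) i : ℕ) := by
      rw [total, List.zipWith_map_right, List.zipWith_self, Nat.cast_list_sum, List.map_map]
      congr 1
      refine List.map_congr_left fun g hg => ?_
      rw [Function.comp_apply, cast_natDot]
      congr 1
      funext a
      rw [← cast_natDot, digit_natDot_columns hw (h1 g hg)]
    rw [ht]
    have hd : (0 : ℝ) < den := by exact_mod_cast hden
    rw [div_mul_eq_mul_div, div_le_iff₀ hd, div_mul_eq_mul_div, le_div_iff₀ hd, mul_comm _ (den : ℝ)]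
    refine ⟨?_, ?_⟩
    · rw [← Nat.cast_mul, ← Nat.cast_mul]
      exact Nat.cast_le.2 h2
    · rw [← Nat.cast_mul, ← Nat.cast_mul]
      exact Nat.cast_le.2 h3

theorem hasWeight_of_check {M : Type*} [Fintype M] {Γ : SimpleGraph M} {ℓ : ℕ} [NeZero ℓ]
    {C : CycleIn Γ ℓ} {w₀ w zs lo hi den : ℕ} {idx : ℕ → ℕ → ℕ} (hA : A.Represents D G r vert id)
    (hB : B.Represents D H r' vert' id') (hden : 0 < den)
    (h : weightCheck A B w₀ w zs idx lo hi den = true) (e : V ⊕ W ≃ M) (s : ι ⊕ κ ≃ Fin ℓ)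
    (he : ∀ v w, (joinGraph G r H r').Adj v w ↔ C.column.Adj (e v) (e w))
    (hv : ∀ i, e (joinVert vert vert' i) = C.vert (s i)) :
    C.HasWeight D (lo / den) (hi / den) := by
  obtain ⟨z, h0, h1⟩ := exists_weight_of_check hA hB hden h
  have hlive : ∀ c : CutState (Fin ℓ), CutState.Live (c ∘ s) ↔ c.Live := fun c =>
    s.exists_congr_right (q := fun i => c i = (true, true))
  refine ⟨fun c => z (c ∘ s), fun c hc => h0 _ fun h => hc ((hlive c).1 h), fun c hc => ?_⟩
  rw [← cutTransfer_comp_equiv e s he hv]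
  exact h1 _ ((hlive c).2 hc)

end PartTable


/-! ### Tables for trees -/

namespace PartTable

/-- The table of two leaves with a common neighbour, for connected sets. -/
def cherryConn : PartTable where
  size := 6
  live := 11
  row s e i := List.getD (match s, e with
    | .dominated, _ =>
      [[(1, 0), (2, 3), (1, 5)], [(1, 1), (1, 4)], [(1, 2)], [(1, 1), (1, 3), (1, 4), (1, 5)], [(1,
      2), (1, 4)], [(1, 2), (2, 4), (1, 5)]]
    | .undominated, _ =>
      []
    | .fixed, false =>
      [[(1, 0), (2, 3), (1, 5)], [(1, 0), (2, 3), (1, 5)], [], [(1, 1), (1, 3), (1, 4), (1, 5)]]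
    | .fixed, true =>
      [[(1, 0), (2, 3), (1, 5)], [(1, 0), (2, 3), (1, 5)], [], [(1, 1), (1, 3), (1, 4), (1, 5)]]
    | .held, false =>
      [[], [], [(1, 2), (2, 4)], [], [(1, 2), (1, 4)]]
    | .held, true =>
      [[], [], [(1, 0), (2, 3)], [], [(1, 1), (1, 3)]]
    | .free, false =>
      [[], [], [(1, 5)], [], [(1, 4), (1, 5)], [(1, 2), (2, 4), (1, 5)]]
    | .free, true =>
      [[], [], [(1, 5)], [], [(1, 4), (1, 5)], [(1, 2), (2, 4), (1, 5)]]) i []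

/-- The table of two cherries with a common neighbour of their roots, for connected sets. -/
def forkConn : PartTable where
  size := 21
  live := 372703
  row s e i := List.getD (match s, e with
    | .dominated, _ =>
      [[(4, 0), (16, 6), (16, 9), (8, 15), (16, 18), (4, 20)], [(2, 0), (2, 1), (8, 6), (4, 7), (8,
      9), (2, 10), (4, 13), (4, 15), (2, 16), (8, 18), (2, 19), (2, 20)], [(1, 0), (2, 1), (1, 2),
      (4, 6), (4, 7), (4, 9), (2, 10), (2, 11), (4, 13), (1, 14), (2, 15), (2, 16), (4, 18), (2,
      19), (1, 20)], [(4, 3), (8, 8), (4, 10), (8, 13), (4, 17), (4, 19)], [(2, 3), (2, 4), (4, 8),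
      (2, 10), (2, 11), (2, 12), (4, 13), (2, 14), (2, 17), (2, 19)], [(4, 5), (8, 12), (4, 14)],
      [(4, 1), (4, 6), (8, 7), (8, 9), (4, 10), (8, 13), (4, 15), (4, 16), (12, 18), (4, 19), (4,
      20)], [(2, 1), (2, 2), (2, 6), (6, 7), (4, 9), (2, 10), (4, 11), (6, 13), (2, 14), (2, 15),
      (4, 16), (6, 18), (4, 19), (2, 20)], [(4, 4), (4, 8), (4, 11), (4, 12), (4, 13), (4, 14), (4,
      17), (4, 19)], [(4, 2), (8, 7), (4, 9), (8, 11), (8, 13), (4, 14), (8, 16), (8, 18), (8, 19),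
      (4, 20)], [(4, 3), (8, 8), (4, 10), (8, 13), (4, 17), (4, 19)], [(2, 3), (2, 4), (4, 8), (2,
      10), (2, 11), (2, 12), (4, 13), (2, 14), (2, 17), (2, 19)], [(4, 5), (8, 12), (4, 14)], [(4,
      4), (4, 8), (4, 11), (4, 12), (4, 13), (4, 14), (4, 17), (4, 19)], [(4, 5), (8, 12), (4,
      14)], [(2, 3), (4, 8), (4, 10), (8, 13), (2, 15), (2, 17), (4, 18), (4, 19), (2, 20)], [(1,
      3), (1, 4), (2, 8), (2, 10), (2, 11), (1, 12), (4, 13), (2, 14), (1, 15), (1, 16), (1, 17),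
      (2, 18), (3, 19), (1, 20)], [(2, 5), (6, 12), (4, 14), (2, 17), (2, 19)], [(2, 4), (2, 8),
      (4, 11), (2, 12), (4, 13), (4, 14), (2, 16), (2, 17), (2, 18), (6, 19), (2, 20)], [(2, 5),
      (6, 12), (4, 14), (2, 17), (2, 19)], [(1, 5), (4, 12), (4, 14), (2, 17), (4, 19), (1, 20)]]
    | .undominated, _ =>
      []
    | .fixed, false =>
      [[(3, 0), (12, 6), (12, 9), (6, 15), (12, 18), (3, 20)], [(2, 0), (1, 1), (8, 6), (2, 7), (8,
      9), (1, 10), (2, 13), (4, 15), (1, 16), (8, 18), (1, 19), (2, 20)], [(1, 0), (2, 1), (4, 6),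
      (4, 7), (4, 9), (2, 10), (4, 13), (2, 15), (2, 16), (4, 18), (2, 19), (1, 20)], [(1, 0), (1,
      3), (4, 6), (2, 8), (4, 9), (2, 15), (1, 17), (4, 18), (1, 20)], [(1, 0), (1, 3), (4, 6), (2,
      8), (4, 9), (2, 15), (1, 17), (4, 18), (1, 20)], [], [(3, 1), (3, 6), (6, 7), (6, 9), (3,
      10), (6, 13), (3, 15), (3, 16), (9, 18), (3, 19), (3, 20)], [(2, 1), (1, 2), (2, 6), (5, 7),
      (4, 9), (2, 10), (2, 11), (5, 13), (1, 14), (2, 15), (3, 16), (6, 18), (3, 19), (2, 20)],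
      [(1, 1), (1, 4), (1, 6), (2, 7), (1, 8), (2, 9), (1, 10), (1, 12), (2, 13), (1, 15), (1, 16),
      (1, 17), (3, 18), (1, 19), (1, 20)], [(3, 2), (6, 7), (3, 9), (6, 11), (6, 13), (3, 14), (6,
      16), (6, 18), (6, 19), (3, 20)], [(1, 1), (1, 3), (1, 6), (2, 7), (2, 8), (2, 9), (2, 10),
      (4, 13), (1, 15), (1, 16), (1, 17), (3, 18), (2, 19), (1, 20)], [(1, 1), (1, 3), (1, 6), (2,
      7), (2, 8), (2, 9), (2, 10), (4, 13), (1, 15), (1, 16), (1, 17), (3, 18), (2, 19), (1, 20)],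
      [], [(1, 2), (1, 4), (2, 7), (1, 8), (1, 9), (3, 11), (1, 12), (3, 13), (2, 14), (2, 16), (1,
      17), (2, 18), (3, 19), (1, 20)], [], [(2, 3), (4, 8), (4, 10), (8, 13), (2, 15), (2, 17), (4,
      18), (4, 19), (2, 20)], [(2, 3), (4, 8), (4, 10), (8, 13), (2, 15), (2, 17), (4, 18), (4,
      19), (2, 20)], [], [(2, 4), (2, 8), (4, 11), (2, 12), (4, 13), (4, 14), (2, 16), (2, 17), (2,
      18), (6, 19), (2, 20)]]
    | .fixed, true =>
      [[(3, 0), (12, 6), (12, 9), (6, 15), (12, 18), (3, 20)], [(2, 0), (1, 1), (8, 6), (2, 7), (8,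
      9), (1, 10), (2, 13), (4, 15), (1, 16), (8, 18), (1, 19), (2, 20)], [(1, 0), (2, 1), (4, 6),
      (4, 7), (4, 9), (2, 10), (4, 13), (2, 15), (2, 16), (4, 18), (2, 19), (1, 20)], [(1, 0), (1,
      3), (4, 6), (2, 8), (4, 9), (2, 15), (1, 17), (4, 18), (1, 20)], [(1, 0), (1, 3), (4, 6), (2,
      8), (4, 9), (2, 15), (1, 17), (4, 18), (1, 20)], [], [(3, 1), (3, 6), (6, 7), (6, 9), (3,
      10), (6, 13), (3, 15), (3, 16), (9, 18), (3, 19), (3, 20)], [(2, 1), (1, 2), (2, 6), (5, 7),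
      (4, 9), (2, 10), (2, 11), (5, 13), (1, 14), (2, 15), (3, 16), (6, 18), (3, 19), (2, 20)],
      [(1, 1), (1, 4), (1, 6), (2, 7), (1, 8), (2, 9), (1, 10), (1, 12), (2, 13), (1, 15), (1, 16),
      (1, 17), (3, 18), (1, 19), (1, 20)], [(3, 2), (6, 7), (3, 9), (6, 11), (6, 13), (3, 14), (6,
      16), (6, 18), (6, 19), (3, 20)], [(1, 1), (1, 3), (1, 6), (2, 7), (2, 8), (2, 9), (2, 10),
      (4, 13), (1, 15), (1, 16), (1, 17), (3, 18), (2, 19), (1, 20)], [(1, 1), (1, 3), (1, 6), (2,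
      7), (2, 8), (2, 9), (2, 10), (4, 13), (1, 15), (1, 16), (1, 17), (3, 18), (2, 19), (1, 20)],
      [], [(1, 2), (1, 4), (2, 7), (1, 8), (1, 9), (3, 11), (1, 12), (3, 13), (2, 14), (2, 16), (1,
      17), (2, 18), (3, 19), (1, 20)], [], [(2, 3), (4, 8), (4, 10), (8, 13), (2, 15), (2, 17), (4,
      18), (4, 19), (2, 20)], [(2, 3), (4, 8), (4, 10), (8, 13), (2, 15), (2, 17), (4, 18), (4,
      19), (2, 20)], [], [(2, 4), (2, 8), (4, 11), (2, 12), (4, 13), (4, 14), (2, 16), (2, 17), (2,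
      18), (6, 19), (2, 20)]]
    | .held, false =>
      [[], [], [], [(1, 3), (2, 8), (2, 10), (4, 13), (1, 17), (2, 19)], [(1, 4), (2, 11), (1, 12),
      (2, 14)], [(3, 5), (8, 12), (4, 14), (2, 17), (4, 19)], [], [], [(1, 4), (1, 8), (2, 11), (1,
      12), (2, 13), (2, 14), (1, 17), (2, 19)], [], [(1, 3), (2, 8), (1, 10), (2, 13), (1, 17), (1,
      19)], [(1, 4), (1, 11), (1, 12), (1, 14)], [(3, 5), (8, 12), (6, 14), (2, 17), (3, 19)], [(1,
      4), (1, 8), (1, 11), (1, 12), (1, 13), (1, 14), (1, 17), (1, 19)], [(3, 5), (8, 12), (5, 14),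
      (2, 17), (2, 19)], [], [], [(2, 5), (8, 12), (8, 14), (2, 17), (4, 19)], [], [(2, 5), (6,
      12), (4, 14), (2, 17), (2, 19)]]
    | .held, true =>
      [[], [], [], [(1, 0), (4, 6), (4, 9), (1, 15), (2, 18)], [(1, 1), (2, 7), (1, 10), (2, 13)],
      [(1, 0), (2, 3), (4, 6), (4, 8), (4, 9), (2, 15), (4, 18)], [], [], [(1, 1), (1, 6), (2, 7),
      (2, 9), (1, 10), (2, 13), (1, 15), (2, 18)], [], [(1, 1), (1, 6), (2, 7), (2, 9), (1, 16),
      (1, 18)], [(1, 2), (1, 7), (1, 11), (1, 13)], [(1, 1), (1, 3), (1, 4), (1, 6), (2, 7), (3,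
      8), (2, 9), (2, 10), (4, 13), (1, 15), (1, 16), (3, 18)], [(1, 2), (2, 7), (1, 9), (1, 11),
      (1, 13), (1, 16), (1, 18)], [(1, 2), (2, 4), (2, 7), (2, 8), (1, 9), (4, 11), (4, 13), (2,
      16), (2, 18)], [], [], [(2, 3), (4, 8), (4, 10), (8, 13), (2, 15), (4, 18)], [], [(2, 4), (2,
      8), (4, 11), (4, 13), (2, 16), (2, 18)]]
    | .free, false =>
      [[(1, 0), (4, 6), (4, 9), (2, 15), (4, 18), (1, 20)], [(1, 1), (2, 7), (1, 10), (2, 13), (1,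
      16), (1, 19)], [(1, 2), (2, 11), (1, 14)], [(1, 3), (2, 8), (1, 15), (1, 17), (2, 18), (1,
      20)], [(1, 4), (1, 12), (1, 16), (1, 19)], [(1, 5), (2, 17), (1, 20)], [(1, 1), (1, 6), (2,
      7), (2, 9), (1, 10), (2, 13), (1, 15), (1, 16), (3, 18), (1, 19), (1, 20)], [(1, 2), (1, 7),
      (2, 11), (1, 13), (1, 14), (1, 16), (1, 19)], [(1, 4), (1, 8), (1, 12), (1, 16), (1, 17), (1,
      18), (1, 19), (1, 20)], [(1, 2), (2, 7), (1, 9), (2, 11), (2, 13), (1, 14), (2, 16), (2, 18),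
      (2, 19), (1, 20)], [(1, 3), (2, 8), (2, 10), (4, 13), (1, 15), (1, 17), (2, 18), (2, 19), (1,
      20)], [(1, 4), (2, 11), (1, 12), (2, 14), (1, 16), (1, 19)], [(1, 5), (2, 12), (2, 17), (2,
      19), (1, 20)], [(1, 4), (1, 8), (2, 11), (1, 12), (2, 13), (2, 14), (1, 16), (1, 17), (1,
      18), (3, 19), (1, 20)], [(1, 5), (4, 12), (4, 14), (2, 17), (4, 19), (1, 20)], [(2, 3), (4,
      8), (4, 10), (8, 13), (2, 15), (2, 17), (4, 18), (4, 19), (2, 20)], [(2, 4), (4, 11), (2,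
      12), (4, 14), (2, 16), (2, 19)], [(2, 5), (4, 12), (4, 17), (4, 19), (2, 20)], [(2, 4), (2,
      8), (4, 11), (2, 12), (4, 13), (4, 14), (2, 16), (2, 17), (2, 18), (6, 19), (2, 20)], [(2,
      5), (8, 12), (8, 14), (4, 17), (8, 19), (2, 20)], [(4, 5), (16, 12), (16, 14), (8, 17), (16,
      19), (4, 20)]]
    | .free, true =>
      [[(1, 0), (4, 6), (4, 9), (2, 15), (4, 18), (1, 20)], [(1, 1), (2, 7), (1, 10), (2, 13), (1,
      16), (1, 19)], [(1, 2), (2, 11), (1, 14)], [(1, 3), (2, 8), (1, 15), (1, 17), (2, 18), (1,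
      20)], [(1, 4), (1, 12), (1, 16), (1, 19)], [(1, 5), (2, 17), (1, 20)], [(1, 1), (1, 6), (2,
      7), (2, 9), (1, 10), (2, 13), (1, 15), (1, 16), (3, 18), (1, 19), (1, 20)], [(1, 2), (1, 7),
      (2, 11), (1, 13), (1, 14), (1, 16), (1, 19)], [(1, 4), (1, 8), (1, 12), (1, 16), (1, 17), (1,
      18), (1, 19), (1, 20)], [(1, 2), (2, 7), (1, 9), (2, 11), (2, 13), (1, 14), (2, 16), (2, 18),
      (2, 19), (1, 20)], [(1, 3), (2, 8), (2, 10), (4, 13), (1, 15), (1, 17), (2, 18), (2, 19), (1,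
      20)], [(1, 4), (2, 11), (1, 12), (2, 14), (1, 16), (1, 19)], [(1, 5), (2, 12), (2, 17), (2,
      19), (1, 20)], [(1, 4), (1, 8), (2, 11), (1, 12), (2, 13), (2, 14), (1, 16), (1, 17), (1,
      18), (3, 19), (1, 20)], [(1, 5), (4, 12), (4, 14), (2, 17), (4, 19), (1, 20)], [(2, 3), (4,
      8), (4, 10), (8, 13), (2, 15), (2, 17), (4, 18), (4, 19), (2, 20)], [(2, 4), (4, 11), (2,
      12), (4, 14), (2, 16), (2, 19)], [(2, 5), (4, 12), (4, 17), (4, 19), (2, 20)], [(2, 4), (2,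
      8), (4, 11), (2, 12), (4, 13), (4, 14), (2, 16), (2, 17), (2, 18), (6, 19), (2, 20)], [(2,
      5), (8, 12), (8, 14), (4, 17), (8, 19), (2, 20)], [(4, 5), (16, 12), (16, 14), (8, 17), (16,
      19), (4, 20)]]) i []

/-- The table of two leaves with a common neighbour, for connected dominating sets. -/
def cherryDom : PartTable where
  size := 10
  live := 75
  row s e i := List.getD (match s, e with
    | .dominated, _ =>
      [[(1, 0), (2, 3), (1, 5)], [(1, 1), (1, 4)], [(1, 2)], [(1, 1), (1, 4), (1, 6), (1, 8)], [(1,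
      2), (1, 7)], [], [(1, 1), (1, 4)], [(1, 2)]]
    | .undominated, _ =>
      [[], [], [], [], [], [(1, 2), (2, 7), (1, 9)], [], [], [(1, 2), (1, 7)], [(1, 2)]]
    | .fixed, false =>
      [[(1, 0), (2, 3), (1, 5)], [(1, 0), (2, 3), (1, 5)], [], [(1, 1), (1, 4), (1, 6), (1, 8)],
      [], [], [(1, 1), (1, 4), (1, 6), (1, 8)]]
    | .fixed, true =>
      [[(1, 0), (2, 3), (1, 5)], [(1, 0), (2, 3), (1, 5)], [], [(1, 1), (1, 4), (1, 6), (1, 8)],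
      [], [], [(1, 1), (1, 4), (1, 6), (1, 8)]]
    | .held, false =>
      [[], [], [(1, 2), (2, 4)], [], [(1, 2), (1, 7)], [], [], [(1, 2), (1, 7)]]
    | .held, true =>
      [[], [], [(1, 0), (2, 3)], [], [(1, 1), (1, 6)], [], [], [(1, 1), (1, 6)]]
    | .free, false =>
      [[], [], [(1, 5)], [], [(1, 4), (1, 8)], [(1, 2), (2, 7), (1, 9)], [], [(1, 4), (1, 8)], [(1,
      2), (2, 7), (1, 9)], [(1, 2), (2, 7), (1, 9)]]
    | .free, true =>
      [[], [], [(1, 5)], [], [(1, 4), (1, 8)], [(1, 2), (2, 7), (1, 9)], [], [(1, 4), (1, 8)], [(1,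
      2), (2, 7), (1, 9)], [(1, 2), (2, 7), (1, 9)]]) i []

/-- The table of two cherries with a common neighbour of their roots, for connected dominating sets. -/
def forkDom : PartTable where
  size := 55
  live := 2644002266787807
  row s e i := List.getD (match s, e with
    | .dominated, _ =>
      [[(3, 0), (12, 6), (12, 9), (6, 15), (12, 18), (3, 20)], [(2, 0), (1, 1), (8, 6), (2, 7), (8,
      9), (1, 10), (2, 13), (4, 15), (1, 16), (8, 18), (1, 19), (2, 20)], [(1, 0), (2, 1), (4, 6),
      (4, 7), (4, 9), (2, 10), (4, 13), (2, 15), (2, 16), (4, 18), (2, 19), (1, 20)], [(3, 3), (6,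
      8), (4, 10), (8, 13), (3, 17), (4, 19)], [(2, 3), (1, 4), (4, 8), (2, 10), (2, 11), (1, 12),
      (4, 13), (2, 14), (2, 17), (2, 19)], [(3, 5), (8, 12), (4, 14)], [(3, 1), (6, 7), (3, 10),
      (6, 13), (3, 16), (3, 19), (3, 21), (6, 24), (3, 26), (3, 36), (6, 39), (3, 41)], [(2, 1),
      (1, 2), (4, 7), (2, 10), (2, 11), (4, 13), (1, 14), (2, 16), (2, 19), (2, 21), (1, 22), (4,
      24), (1, 25), (2, 26), (2, 36), (1, 37), (4, 39), (1, 40), (2, 41)], [(3, 4), (4, 11), (3,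
      12), (4, 14), (3, 23), (4, 25), (3, 38), (4, 40)], [(3, 2), (6, 11), (3, 14), (6, 22), (6,
      25), (3, 27), (6, 37), (6, 40), (6, 42), (3, 44)], [(3, 3), (6, 8), (3, 17), (3, 28), (6,
      31), (3, 33)], [(2, 3), (1, 4), (4, 8), (1, 12), (2, 17), (2, 28), (1, 29), (4, 31), (1, 32),
      (2, 33)], [(3, 5), (4, 12), (3, 30), (4, 32)], [(3, 4), (3, 12), (3, 23), (3, 29), (3, 32),
      (3, 34), (3, 38), (3, 43)], [(3, 5), (6, 30), (3, 35)], [], [], [], [], [], [], [(3, 1), (6,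
      7), (3, 10), (6, 13), (3, 16), (3, 19), (2, 21), (4, 24), (2, 26), (2, 36), (4, 39), (2,
      41)], [(2, 1), (1, 2), (4, 7), (2, 10), (2, 11), (4, 13), (1, 14), (2, 16), (2, 19), (1, 21),
      (1, 22), (2, 24), (1, 25), (1, 26), (1, 36), (1, 37), (2, 39), (1, 40), (1, 41)], [(3, 4),
      (4, 11), (3, 12), (4, 14), (2, 23), (2, 25), (2, 38), (2, 40)], [(3, 2), (6, 11), (3, 14),
      (5, 22), (5, 25), (2, 27), (5, 37), (5, 40), (4, 42), (2, 44)], [(3, 4), (3, 12), (2, 23),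
      (3, 29), (3, 32), (2, 34), (2, 38), (2, 43)], [], [(3, 2), (6, 11), (3, 14), (4, 22), (4,
      25), (1, 27), (4, 37), (4, 40), (2, 42), (1, 44)], [(3, 3), (6, 8), (3, 17), (2, 28), (4,
      31), (2, 33)], [(2, 3), (1, 4), (4, 8), (1, 12), (2, 17), (1, 28), (1, 29), (2, 31), (1, 32),
      (1, 33)], [(3, 5), (4, 12), (2, 30), (2, 32)], [(3, 4), (3, 12), (3, 23), (2, 29), (2, 32),
      (2, 34), (3, 38), (2, 43)], [(3, 5), (5, 30), (2, 35)], [], [(3, 4), (3, 12), (2, 23), (2,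
      29), (2, 32), (1, 34), (2, 38), (1, 43)], [(3, 5), (4, 30), (1, 35)]]
    | .undominated, _ =>
      [[(1, 0), (4, 6), (4, 9), (2, 15), (4, 18), (1, 20)], [(1, 1), (2, 7), (1, 10), (2, 13), (1,
      16), (1, 19)], [(1, 2), (2, 11), (1, 14)], [(1, 3), (2, 8), (1, 17)], [(1, 4), (1, 12)], [(1,
      5)], [(1, 1), (2, 7), (1, 10), (2, 13), (1, 16), (1, 19), (1, 21), (2, 24), (1, 26), (1, 36),
      (2, 39), (1, 41)], [(1, 2), (2, 11), (1, 14), (1, 22), (1, 25), (1, 37), (1, 40)], [(1, 4),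
      (1, 12), (1, 23), (1, 38)], [(1, 2), (2, 11), (1, 14), (2, 22), (2, 25), (1, 27), (2, 37),
      (2, 40), (2, 42), (1, 44)], [(1, 3), (2, 8), (1, 17), (1, 28), (2, 31), (1, 33)], [(1, 4),
      (1, 12), (1, 29), (1, 32)], [(1, 5), (1, 30)], [(1, 4), (1, 12), (1, 23), (1, 29), (1, 32),
      (1, 34), (1, 38), (1, 43)], [(1, 5), (2, 30), (1, 35)], [], [], [], [], [], [], [(1, 1), (2,
      7), (1, 10), (2, 13), (1, 16), (1, 19)], [(1, 2), (2, 11), (1, 14)], [(1, 4), (1, 12)], [(1,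
      2), (2, 11), (1, 14), (1, 22), (1, 25), (1, 37), (1, 40)], [(1, 4), (1, 12), (1, 29), (1,
      32)], [], [(1, 2), (2, 11), (1, 14)], [(1, 3), (2, 8), (1, 17)], [(1, 4), (1, 12)], [(1, 5)],
      [(1, 4), (1, 12), (1, 23), (1, 38)], [(1, 5), (1, 30)], [], [(1, 4), (1, 12)], [(1, 5)]]
    | .fixed, false =>
      [[(3, 0), (12, 6), (12, 9), (6, 15), (12, 18), (3, 20)], [(2, 0), (1, 1), (8, 6), (2, 7), (8,
      9), (1, 10), (2, 13), (4, 15), (1, 16), (8, 18), (1, 19), (2, 20)], [(1, 0), (2, 1), (4, 6),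
      (4, 7), (4, 9), (2, 10), (4, 13), (2, 15), (2, 16), (4, 18), (2, 19), (1, 20)], [(1, 0), (1,
      3), (4, 6), (2, 8), (4, 9), (2, 15), (1, 17), (4, 18), (1, 20)], [(1, 0), (1, 3), (4, 6), (2,
      8), (4, 9), (2, 15), (1, 17), (4, 18), (1, 20)], [], [(3, 1), (6, 7), (3, 10), (6, 13), (3,
      16), (3, 19), (3, 21), (6, 24), (3, 26), (3, 36), (6, 39), (3, 41)], [(2, 1), (1, 2), (4, 7),
      (2, 10), (2, 11), (4, 13), (1, 14), (2, 16), (2, 19), (2, 21), (1, 22), (4, 24), (1, 25), (2,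
      26), (2, 36), (1, 37), (4, 39), (1, 40), (2, 41)], [(1, 1), (1, 4), (2, 7), (1, 10), (1, 12),
      (2, 13), (1, 16), (1, 19), (1, 21), (1, 23), (2, 24), (1, 26), (1, 36), (1, 38), (2, 39), (1,
      41)], [(3, 2), (6, 11), (3, 14), (6, 22), (6, 25), (3, 27), (6, 37), (6, 40), (6, 42), (3,
      44)], [(1, 1), (1, 3), (2, 7), (2, 8), (1, 10), (2, 13), (1, 16), (1, 17), (1, 19), (1, 21),
      (2, 24), (1, 26), (1, 28), (2, 31), (1, 33), (1, 36), (2, 39), (1, 41)], [(1, 1), (1, 3), (2,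
      7), (2, 8), (1, 10), (2, 13), (1, 16), (1, 17), (1, 19), (1, 21), (2, 24), (1, 26), (1, 28),
      (2, 31), (1, 33), (1, 36), (2, 39), (1, 41)], [], [(1, 2), (1, 4), (2, 11), (1, 12), (1, 14),
      (2, 22), (1, 23), (2, 25), (1, 27), (1, 29), (1, 32), (1, 34), (2, 37), (1, 38), (2, 40), (2,
      42), (1, 43), (1, 44)], [], [(2, 3), (4, 8), (2, 17), (4, 28), (8, 31), (4, 33), (2, 45), (4,
      48), (2, 50)], [(2, 3), (4, 8), (2, 17), (4, 28), (8, 31), (4, 33), (2, 45), (4, 48), (2,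
      50)], [], [(2, 4), (2, 12), (2, 23), (4, 29), (4, 32), (4, 34), (2, 38), (4, 43), (2, 46),
      (2, 49), (2, 51), (2, 53)], [], [], [(3, 1), (6, 7), (3, 10), (6, 13), (3, 16), (3, 19), (2,
      21), (4, 24), (2, 26), (2, 36), (4, 39), (2, 41)], [(2, 1), (1, 2), (4, 7), (2, 10), (2, 11),
      (4, 13), (1, 14), (2, 16), (2, 19), (1, 21), (1, 22), (2, 24), (1, 25), (1, 26), (1, 36), (1,
      37), (2, 39), (1, 40), (1, 41)], [(1, 1), (1, 4), (2, 7), (1, 10), (1, 12), (2, 13), (1, 16),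
      (1, 19), (1, 21), (1, 23), (2, 24), (1, 26), (1, 36), (1, 38), (2, 39), (1, 41)], [(3, 2),
      (6, 11), (3, 14), (5, 22), (5, 25), (2, 27), (5, 37), (5, 40), (4, 42), (2, 44)], [(1, 2),
      (1, 4), (2, 11), (1, 12), (1, 14), (2, 22), (1, 23), (2, 25), (1, 27), (1, 29), (1, 32), (1,
      34), (2, 37), (1, 38), (2, 40), (2, 42), (1, 43), (1, 44)], [(2, 4), (2, 12), (2, 23), (4,
      29), (4, 32), (4, 34), (2, 38), (4, 43), (2, 46), (2, 49), (2, 51), (2, 53)], [(3, 2), (6,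
      11), (3, 14), (4, 22), (4, 25), (1, 27), (4, 37), (4, 40), (2, 42), (1, 44)], [(1, 1), (1,
      3), (2, 7), (2, 8), (1, 10), (2, 13), (1, 16), (1, 17), (1, 19), (1, 21), (2, 24), (1, 26),
      (1, 36), (2, 39), (1, 41)], [(1, 1), (1, 3), (2, 7), (2, 8), (1, 10), (2, 13), (1, 16), (1,
      17), (1, 19), (1, 21), (2, 24), (1, 26), (1, 36), (2, 39), (1, 41)], [], [(1, 2), (1, 4), (2,
      11), (1, 12), (1, 14), (2, 22), (1, 23), (2, 25), (1, 27), (2, 37), (1, 38), (2, 40), (2,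
      42), (1, 44)], [], [], [(1, 2), (1, 4), (2, 11), (1, 12), (1, 14), (2, 22), (1, 23), (2, 25),
      (1, 27), (2, 37), (1, 38), (2, 40), (2, 42), (1, 44)], [], [(2, 3), (4, 8), (2, 17), (3, 28),
      (6, 31), (3, 33), (1, 45), (2, 48), (1, 50)], [(2, 3), (4, 8), (2, 17), (3, 28), (6, 31), (3,
      33), (1, 45), (2, 48), (1, 50)], [], [(2, 4), (2, 12), (2, 23), (3, 29), (3, 32), (3, 34),
      (2, 38), (3, 43), (1, 46), (1, 49), (1, 51), (1, 53)], [], [], [(2, 4), (2, 12), (2, 23), (3,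
      29), (3, 32), (3, 34), (2, 38), (3, 43), (1, 46), (1, 49), (1, 51), (1, 53)], [], [], [(2,
      3), (4, 8), (2, 17), (2, 28), (4, 31), (2, 33), (1, 45), (2, 48), (1, 50)], [(2, 3), (4, 8),
      (2, 17), (2, 28), (4, 31), (2, 33), (1, 45), (2, 48), (1, 50)], [], [(2, 4), (2, 12), (2,
      23), (2, 29), (2, 32), (2, 34), (2, 38), (2, 43), (1, 46), (1, 49), (1, 51), (1, 53)], [],
      [], [(2, 4), (2, 12), (2, 23), (2, 29), (2, 32), (2, 34), (2, 38), (2, 43), (1, 46), (1, 49),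
      (1, 51), (1, 53)]]
    | .fixed, true =>
      [[(3, 0), (12, 6), (12, 9), (6, 15), (12, 18), (3, 20)], [(2, 0), (1, 1), (8, 6), (2, 7), (8,
      9), (1, 10), (2, 13), (4, 15), (1, 16), (8, 18), (1, 19), (2, 20)], [(1, 0), (2, 1), (4, 6),
      (4, 7), (4, 9), (2, 10), (4, 13), (2, 15), (2, 16), (4, 18), (2, 19), (1, 20)], [(1, 0), (1,
      3), (4, 6), (2, 8), (4, 9), (2, 15), (1, 17), (4, 18), (1, 20)], [(1, 0), (1, 3), (4, 6), (2,
      8), (4, 9), (2, 15), (1, 17), (4, 18), (1, 20)], [], [(3, 1), (6, 7), (3, 10), (6, 13), (3,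
      16), (3, 19), (3, 21), (6, 24), (3, 26), (3, 36), (6, 39), (3, 41)], [(2, 1), (1, 2), (4, 7),
      (2, 10), (2, 11), (4, 13), (1, 14), (2, 16), (2, 19), (2, 21), (1, 22), (4, 24), (1, 25), (2,
      26), (2, 36), (1, 37), (4, 39), (1, 40), (2, 41)], [(1, 1), (1, 4), (2, 7), (1, 10), (1, 12),
      (2, 13), (1, 16), (1, 19), (1, 21), (1, 23), (2, 24), (1, 26), (1, 36), (1, 38), (2, 39), (1,
      41)], [(3, 2), (6, 11), (3, 14), (6, 22), (6, 25), (3, 27), (6, 37), (6, 40), (6, 42), (3,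
      44)], [(1, 1), (1, 3), (2, 7), (2, 8), (1, 10), (2, 13), (1, 16), (1, 17), (1, 19), (1, 21),
      (2, 24), (1, 26), (1, 28), (2, 31), (1, 33), (1, 36), (2, 39), (1, 41)], [(1, 1), (1, 3), (2,
      7), (2, 8), (1, 10), (2, 13), (1, 16), (1, 17), (1, 19), (1, 21), (2, 24), (1, 26), (1, 28),
      (2, 31), (1, 33), (1, 36), (2, 39), (1, 41)], [], [(1, 2), (1, 4), (2, 11), (1, 12), (1, 14),
      (2, 22), (1, 23), (2, 25), (1, 27), (1, 29), (1, 32), (1, 34), (2, 37), (1, 38), (2, 40), (2,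
      42), (1, 43), (1, 44)], [], [(2, 3), (4, 8), (2, 17), (4, 28), (8, 31), (4, 33), (2, 45), (4,
      48), (2, 50)], [(2, 3), (4, 8), (2, 17), (4, 28), (8, 31), (4, 33), (2, 45), (4, 48), (2,
      50)], [], [(2, 4), (2, 12), (2, 23), (4, 29), (4, 32), (4, 34), (2, 38), (4, 43), (2, 46),
      (2, 49), (2, 51), (2, 53)], [], [], [(3, 1), (6, 7), (3, 10), (6, 13), (3, 16), (3, 19), (2,
      21), (4, 24), (2, 26), (2, 36), (4, 39), (2, 41)], [(2, 1), (1, 2), (4, 7), (2, 10), (2, 11),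
      (4, 13), (1, 14), (2, 16), (2, 19), (1, 21), (1, 22), (2, 24), (1, 25), (1, 26), (1, 36), (1,
      37), (2, 39), (1, 40), (1, 41)], [(1, 1), (1, 4), (2, 7), (1, 10), (1, 12), (2, 13), (1, 16),
      (1, 19), (1, 21), (1, 23), (2, 24), (1, 26), (1, 36), (1, 38), (2, 39), (1, 41)], [(3, 2),
      (6, 11), (3, 14), (5, 22), (5, 25), (2, 27), (5, 37), (5, 40), (4, 42), (2, 44)], [(1, 2),
      (1, 4), (2, 11), (1, 12), (1, 14), (2, 22), (1, 23), (2, 25), (1, 27), (1, 29), (1, 32), (1,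
      34), (2, 37), (1, 38), (2, 40), (2, 42), (1, 43), (1, 44)], [(2, 4), (2, 12), (2, 23), (4,
      29), (4, 32), (4, 34), (2, 38), (4, 43), (2, 46), (2, 49), (2, 51), (2, 53)], [(3, 2), (6,
      11), (3, 14), (4, 22), (4, 25), (1, 27), (4, 37), (4, 40), (2, 42), (1, 44)], [(1, 1), (1,
      3), (2, 7), (2, 8), (1, 10), (2, 13), (1, 16), (1, 17), (1, 19), (1, 21), (2, 24), (1, 26),
      (1, 36), (2, 39), (1, 41)], [(1, 1), (1, 3), (2, 7), (2, 8), (1, 10), (2, 13), (1, 16), (1,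
      17), (1, 19), (1, 21), (2, 24), (1, 26), (1, 36), (2, 39), (1, 41)], [], [(1, 2), (1, 4), (2,
      11), (1, 12), (1, 14), (2, 22), (1, 23), (2, 25), (1, 27), (2, 37), (1, 38), (2, 40), (2,
      42), (1, 44)], [], [], [(1, 2), (1, 4), (2, 11), (1, 12), (1, 14), (2, 22), (1, 23), (2, 25),
      (1, 27), (2, 37), (1, 38), (2, 40), (2, 42), (1, 44)], [], [(2, 3), (4, 8), (2, 17), (3, 28),
      (6, 31), (3, 33), (1, 45), (2, 48), (1, 50)], [(2, 3), (4, 8), (2, 17), (3, 28), (6, 31), (3,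
      33), (1, 45), (2, 48), (1, 50)], [], [(2, 4), (2, 12), (2, 23), (3, 29), (3, 32), (3, 34),
      (2, 38), (3, 43), (1, 46), (1, 49), (1, 51), (1, 53)], [], [], [(2, 4), (2, 12), (2, 23), (3,
      29), (3, 32), (3, 34), (2, 38), (3, 43), (1, 46), (1, 49), (1, 51), (1, 53)], [], [], [(2,
      3), (4, 8), (2, 17), (2, 28), (4, 31), (2, 33), (1, 45), (2, 48), (1, 50)], [(2, 3), (4, 8),
      (2, 17), (2, 28), (4, 31), (2, 33), (1, 45), (2, 48), (1, 50)], [], [(2, 4), (2, 12), (2,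
      23), (2, 29), (2, 32), (2, 34), (2, 38), (2, 43), (1, 46), (1, 49), (1, 51), (1, 53)], [],
      [], [(2, 4), (2, 12), (2, 23), (2, 29), (2, 32), (2, 34), (2, 38), (2, 43), (1, 46), (1, 49),
      (1, 51), (1, 53)]]
    | .held, false =>
      [[], [], [], [(1, 3), (2, 8), (2, 10), (4, 13), (1, 17), (2, 19)], [(1, 4), (2, 11), (1, 12),
      (2, 14)], [(3, 5), (8, 12), (4, 14), (2, 17), (4, 19)], [], [], [(1, 4), (2, 11), (1, 12),
      (2, 14), (1, 23), (2, 25), (1, 38), (2, 40)], [], [(1, 3), (2, 8), (1, 17), (1, 28), (2, 31),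
      (1, 33)], [(1, 4), (1, 12), (1, 29), (1, 32)], [(3, 5), (5, 12), (2, 14), (1, 17), (3, 30),
      (4, 32), (1, 33), (1, 38), (2, 40)], [(1, 4), (1, 12), (1, 23), (1, 29), (1, 32), (1, 34),
      (1, 38), (1, 43)], [(3, 5), (2, 12), (6, 30), (2, 32), (3, 35), (2, 38), (2, 43)], [], [],
      [(2, 5), (4, 12), (4, 30), (8, 32), (2, 47), (4, 49)], [], [(2, 5), (6, 30), (4, 35), (2,
      47), (2, 52)], [], [], [], [(1, 4), (2, 11), (1, 12), (2, 14)], [], [(1, 4), (1, 12), (1,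
      29), (1, 32)], [], [], [(1, 3), (2, 8), (1, 17), (1, 28), (2, 31), (1, 33)], [(1, 4), (1,
      12), (1, 29), (1, 32)], [(3, 5), (5, 12), (2, 14), (1, 17), (2, 30), (2, 32), (1, 33), (1,
      38), (2, 40)], [(1, 4), (1, 12), (1, 23), (1, 29), (1, 32), (1, 34), (1, 38), (1, 43)], [(3,
      5), (2, 12), (5, 30), (2, 32), (2, 35), (2, 38), (2, 43)], [(2, 5), (6, 30), (4, 35), (2,
      47), (2, 52)], [(1, 4), (1, 12), (1, 29), (1, 32)], [(3, 5), (2, 12), (4, 30), (2, 32), (1,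
      35), (2, 38), (2, 43)], [], [], [(2, 5), (4, 12), (3, 30), (6, 32), (1, 47), (2, 49)], [],
      [(2, 5), (5, 30), (3, 35), (1, 47), (1, 52)], [], [], [(2, 5), (5, 30), (3, 35), (1, 47), (1,
      52)], [], [], [], [(2, 5), (4, 12), (2, 30), (4, 32), (1, 47), (2, 49)], [], [(2, 5), (4,
      30), (2, 35), (1, 47), (1, 52)], [], [], [(2, 5), (4, 30), (2, 35), (1, 47), (1, 52)]]
    | .held, true =>
      [[], [], [], [(1, 0), (4, 6), (4, 9), (1, 15), (2, 18)], [(1, 1), (2, 7), (1, 10), (2, 13)],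
      [(1, 0), (2, 3), (4, 6), (4, 8), (4, 9), (2, 15), (4, 18)], [], [], [(1, 1), (2, 7), (1, 10),
      (2, 13), (1, 21), (2, 24), (1, 36), (2, 39)], [], [(1, 1), (2, 7), (1, 16), (1, 21), (2, 24),
      (1, 26)], [(1, 2), (1, 11), (1, 22), (1, 25)], [(1, 1), (1, 3), (1, 4), (2, 7), (2, 8), (1,
      10), (2, 13), (1, 16), (1, 21), (1, 23), (2, 24), (1, 26), (1, 28), (2, 31), (1, 36), (2,
      39)], [(1, 2), (1, 11), (2, 22), (1, 25), (1, 27), (1, 37), (1, 42)], [(1, 2), (2, 4), (2,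
      11), (2, 22), (2, 23), (2, 25), (1, 27), (2, 29), (2, 34), (2, 37), (2, 42)], [], [], [(2,
      3), (4, 8), (4, 28), (8, 31), (2, 45), (4, 48)], [], [(2, 4), (2, 23), (4, 29), (4, 34), (2,
      46), (2, 51)], [], [], [], [(1, 1), (2, 7), (1, 10), (2, 13)], [], [(1, 2), (1, 11), (1, 22),
      (1, 25)], [], [], [(1, 1), (2, 7), (1, 16), (1, 21), (2, 24), (1, 26)], [(1, 2), (1, 11), (1,
      22), (1, 25)], [(1, 1), (1, 3), (1, 4), (2, 7), (2, 8), (1, 10), (2, 13), (1, 16), (1, 21),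
      (1, 23), (2, 24), (1, 26), (1, 36), (2, 39)], [(1, 2), (1, 11), (2, 22), (1, 25), (1, 27),
      (1, 37), (1, 42)], [(1, 2), (2, 4), (2, 11), (2, 22), (2, 23), (2, 25), (1, 27), (1, 29), (1,
      34), (2, 37), (2, 42)], [(2, 4), (2, 23), (4, 29), (4, 34), (2, 46), (2, 51)], [(1, 2), (1,
      11), (1, 22), (1, 25)], [(1, 2), (2, 4), (2, 11), (2, 22), (2, 23), (2, 25), (1, 27), (2,
      37), (2, 42)], [], [], [(2, 3), (4, 8), (3, 28), (6, 31), (1, 45), (2, 48)], [], [(2, 4), (2,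
      23), (3, 29), (3, 34), (1, 46), (1, 51)], [], [], [(2, 4), (2, 23), (3, 29), (3, 34), (1,
      46), (1, 51)], [], [], [], [(2, 3), (4, 8), (2, 28), (4, 31), (1, 45), (2, 48)], [], [(2, 4),
      (2, 23), (2, 29), (2, 34), (1, 46), (1, 51)], [], [], [(2, 4), (2, 23), (2, 29), (2, 34), (1,
      46), (1, 51)]]
    | .free, false =>
      [[(1, 0), (4, 6), (4, 9), (2, 15), (4, 18), (1, 20)], [(1, 1), (2, 7), (1, 10), (2, 13), (1,
      16), (1, 19)], [(1, 2), (2, 11), (1, 14)], [(1, 3), (2, 8), (1, 15), (1, 17), (2, 18), (1,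
      20)], [(1, 4), (1, 12), (1, 16), (1, 19)], [(1, 5), (2, 17), (1, 20)], [(1, 1), (2, 7), (1,
      10), (2, 13), (1, 16), (1, 19), (1, 21), (2, 24), (1, 26), (1, 36), (2, 39), (1, 41)], [(1,
      2), (2, 11), (1, 14), (1, 22), (1, 25), (1, 37), (1, 40)], [(1, 4), (1, 12), (1, 16), (1,
      19), (1, 23), (1, 26), (1, 38), (1, 41)], [(1, 2), (2, 11), (1, 14), (2, 22), (2, 25), (1,
      27), (2, 37), (2, 40), (2, 42), (1, 44)], [(1, 3), (2, 8), (1, 10), (2, 13), (1, 17), (1,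
      19), (1, 28), (2, 31), (1, 33), (1, 36), (2, 39), (1, 41)], [(1, 4), (1, 11), (1, 12), (1,
      14), (1, 29), (1, 32), (1, 37), (1, 40)], [(1, 5), (1, 12), (1, 17), (1, 19), (1, 30), (1,
      33), (1, 38), (1, 41)], [(1, 4), (1, 11), (1, 12), (1, 14), (1, 23), (1, 25), (1, 29), (1,
      32), (1, 34), (1, 37), (1, 38), (2, 40), (1, 42), (1, 43), (1, 44)], [(1, 5), (2, 12), (1,
      14), (2, 30), (2, 32), (1, 35), (2, 38), (2, 40), (2, 43), (1, 44)], [(2, 3), (4, 8), (2,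
      17), (4, 28), (8, 31), (4, 33), (2, 45), (4, 48), (2, 50)], [(2, 4), (2, 12), (4, 29), (4,
      32), (2, 46), (2, 49)], [(2, 5), (2, 17), (4, 30), (4, 33), (2, 47), (2, 50)], [(2, 4), (2,
      12), (2, 23), (4, 29), (4, 32), (4, 34), (2, 38), (4, 43), (2, 46), (2, 49), (2, 51), (2,
      53)], [(2, 5), (2, 12), (6, 30), (4, 32), (4, 35), (2, 38), (4, 43), (2, 47), (2, 49), (2,
      52), (2, 53)], [(4, 5), (16, 30), (16, 35), (8, 47), (16, 52), (4, 54)], [(1, 1), (2, 7), (1,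
      10), (2, 13), (1, 16), (1, 19)], [(1, 2), (2, 11), (1, 14)], [(1, 4), (1, 12), (1, 16), (1,
      19)], [(1, 2), (2, 11), (1, 14), (1, 22), (1, 25), (1, 37), (1, 40)], [(1, 4), (1, 11), (1,
      12), (1, 14), (1, 29), (1, 32), (1, 37), (1, 40)], [(2, 4), (2, 12), (4, 29), (4, 32), (2,
      46), (2, 49)], [(1, 2), (2, 11), (1, 14)], [(1, 3), (2, 8), (1, 10), (2, 13), (1, 17), (1,
      19), (1, 36), (2, 39), (1, 41)], [(1, 4), (1, 11), (1, 12), (1, 14), (1, 37), (1, 40)], [(1,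
      5), (1, 12), (1, 17), (1, 19), (1, 38), (1, 41)], [(1, 4), (1, 11), (1, 12), (1, 14), (1,
      23), (1, 25), (1, 37), (1, 38), (2, 40), (1, 42), (1, 44)], [(1, 5), (2, 12), (1, 14), (1,
      30), (1, 32), (2, 38), (2, 40), (1, 43), (1, 44)], [(2, 5), (2, 12), (4, 30), (4, 32), (2,
      38), (4, 43), (2, 47), (2, 49), (2, 53)], [(1, 4), (1, 11), (1, 12), (1, 14), (1, 37), (1,
      40)], [(1, 5), (2, 12), (1, 14), (2, 38), (2, 40), (1, 44)], [(2, 3), (4, 8), (2, 17), (3,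
      28), (6, 31), (3, 33), (1, 45), (2, 48), (1, 50)], [(2, 4), (2, 12), (3, 29), (3, 32), (1,
      46), (1, 49)], [(2, 5), (2, 17), (3, 30), (3, 33), (1, 47), (1, 50)], [(2, 4), (2, 12), (2,
      23), (3, 29), (3, 32), (3, 34), (2, 38), (3, 43), (1, 46), (1, 49), (1, 51), (1, 53)], [(2,
      5), (2, 12), (5, 30), (3, 32), (3, 35), (2, 38), (3, 43), (1, 47), (1, 49), (1, 52), (1,
      53)], [(4, 5), (14, 30), (12, 35), (6, 47), (10, 52), (2, 54)], [(2, 4), (2, 12), (3, 29),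
      (3, 32), (1, 46), (1, 49)], [(2, 5), (2, 12), (3, 30), (3, 32), (2, 38), (3, 43), (1, 47),
      (1, 49), (1, 53)], [(4, 5), (12, 30), (9, 35), (4, 47), (6, 52), (1, 54)], [(2, 3), (4, 8),
      (2, 17), (2, 28), (4, 31), (2, 33), (1, 45), (2, 48), (1, 50)], [(2, 4), (2, 12), (2, 29),
      (2, 32), (1, 46), (1, 49)], [(2, 5), (2, 17), (2, 30), (2, 33), (1, 47), (1, 50)], [(2, 4),
      (2, 12), (2, 23), (2, 29), (2, 32), (2, 34), (2, 38), (2, 43), (1, 46), (1, 49), (1, 51), (1,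
      53)], [(2, 5), (2, 12), (4, 30), (2, 32), (2, 35), (2, 38), (2, 43), (1, 47), (1, 49), (1,
      52), (1, 53)], [(4, 5), (12, 30), (8, 35), (6, 47), (8, 52), (2, 54)], [(2, 4), (2, 12), (2,
      29), (2, 32), (1, 46), (1, 49)], [(2, 5), (2, 12), (2, 30), (2, 32), (2, 38), (2, 43), (1,
      47), (1, 49), (1, 53)], [(4, 5), (10, 30), (6, 35), (4, 47), (5, 52), (1, 54)], [(4, 5), (8,
      30), (4, 35), (4, 47), (4, 52), (1, 54)]]
    | .free, true =>
      [[(1, 0), (4, 6), (4, 9), (2, 15), (4, 18), (1, 20)], [(1, 1), (2, 7), (1, 10), (2, 13), (1,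
      16), (1, 19)], [(1, 2), (2, 11), (1, 14)], [(1, 3), (2, 8), (1, 15), (1, 17), (2, 18), (1,
      20)], [(1, 4), (1, 12), (1, 16), (1, 19)], [(1, 5), (2, 17), (1, 20)], [(1, 1), (2, 7), (1,
      10), (2, 13), (1, 16), (1, 19), (1, 21), (2, 24), (1, 26), (1, 36), (2, 39), (1, 41)], [(1,
      2), (2, 11), (1, 14), (1, 22), (1, 25), (1, 37), (1, 40)], [(1, 4), (1, 12), (1, 16), (1,
      19), (1, 23), (1, 26), (1, 38), (1, 41)], [(1, 2), (2, 11), (1, 14), (2, 22), (2, 25), (1,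
      27), (2, 37), (2, 40), (2, 42), (1, 44)], [(1, 3), (2, 8), (1, 10), (2, 13), (1, 17), (1,
      19), (1, 28), (2, 31), (1, 33), (1, 36), (2, 39), (1, 41)], [(1, 4), (1, 11), (1, 12), (1,
      14), (1, 29), (1, 32), (1, 37), (1, 40)], [(1, 5), (1, 12), (1, 17), (1, 19), (1, 30), (1,
      33), (1, 38), (1, 41)], [(1, 4), (1, 11), (1, 12), (1, 14), (1, 23), (1, 25), (1, 29), (1,
      32), (1, 34), (1, 37), (1, 38), (2, 40), (1, 42), (1, 43), (1, 44)], [(1, 5), (2, 12), (1,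
      14), (2, 30), (2, 32), (1, 35), (2, 38), (2, 40), (2, 43), (1, 44)], [(2, 3), (4, 8), (2,
      17), (4, 28), (8, 31), (4, 33), (2, 45), (4, 48), (2, 50)], [(2, 4), (2, 12), (4, 29), (4,
      32), (2, 46), (2, 49)], [(2, 5), (2, 17), (4, 30), (4, 33), (2, 47), (2, 50)], [(2, 4), (2,
      12), (2, 23), (4, 29), (4, 32), (4, 34), (2, 38), (4, 43), (2, 46), (2, 49), (2, 51), (2,
      53)], [(2, 5), (2, 12), (6, 30), (4, 32), (4, 35), (2, 38), (4, 43), (2, 47), (2, 49), (2,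
      52), (2, 53)], [(4, 5), (16, 30), (16, 35), (8, 47), (16, 52), (4, 54)], [(1, 1), (2, 7), (1,
      10), (2, 13), (1, 16), (1, 19)], [(1, 2), (2, 11), (1, 14)], [(1, 4), (1, 12), (1, 16), (1,
      19)], [(1, 2), (2, 11), (1, 14), (1, 22), (1, 25), (1, 37), (1, 40)], [(1, 4), (1, 11), (1,
      12), (1, 14), (1, 29), (1, 32), (1, 37), (1, 40)], [(2, 4), (2, 12), (4, 29), (4, 32), (2,
      46), (2, 49)], [(1, 2), (2, 11), (1, 14)], [(1, 3), (2, 8), (1, 10), (2, 13), (1, 17), (1,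
      19), (1, 36), (2, 39), (1, 41)], [(1, 4), (1, 11), (1, 12), (1, 14), (1, 37), (1, 40)], [(1,
      5), (1, 12), (1, 17), (1, 19), (1, 38), (1, 41)], [(1, 4), (1, 11), (1, 12), (1, 14), (1,
      23), (1, 25), (1, 37), (1, 38), (2, 40), (1, 42), (1, 44)], [(1, 5), (2, 12), (1, 14), (1,
      30), (1, 32), (2, 38), (2, 40), (1, 43), (1, 44)], [(2, 5), (2, 12), (4, 30), (4, 32), (2,
      38), (4, 43), (2, 47), (2, 49), (2, 53)], [(1, 4), (1, 11), (1, 12), (1, 14), (1, 37), (1,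
      40)], [(1, 5), (2, 12), (1, 14), (2, 38), (2, 40), (1, 44)], [(2, 3), (4, 8), (2, 17), (3,
      28), (6, 31), (3, 33), (1, 45), (2, 48), (1, 50)], [(2, 4), (2, 12), (3, 29), (3, 32), (1,
      46), (1, 49)], [(2, 5), (2, 17), (3, 30), (3, 33), (1, 47), (1, 50)], [(2, 4), (2, 12), (2,
      23), (3, 29), (3, 32), (3, 34), (2, 38), (3, 43), (1, 46), (1, 49), (1, 51), (1, 53)], [(2,
      5), (2, 12), (5, 30), (3, 32), (3, 35), (2, 38), (3, 43), (1, 47), (1, 49), (1, 52), (1,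
      53)], [(4, 5), (14, 30), (12, 35), (6, 47), (10, 52), (2, 54)], [(2, 4), (2, 12), (3, 29),
      (3, 32), (1, 46), (1, 49)], [(2, 5), (2, 12), (3, 30), (3, 32), (2, 38), (3, 43), (1, 47),
      (1, 49), (1, 53)], [(4, 5), (12, 30), (9, 35), (4, 47), (6, 52), (1, 54)], [(2, 3), (4, 8),
      (2, 17), (2, 28), (4, 31), (2, 33), (1, 45), (2, 48), (1, 50)], [(2, 4), (2, 12), (2, 29),
      (2, 32), (1, 46), (1, 49)], [(2, 5), (2, 17), (2, 30), (2, 33), (1, 47), (1, 50)], [(2, 4),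
      (2, 12), (2, 23), (2, 29), (2, 32), (2, 34), (2, 38), (2, 43), (1, 46), (1, 49), (1, 51), (1,
      53)], [(2, 5), (2, 12), (4, 30), (2, 32), (2, 35), (2, 38), (2, 43), (1, 47), (1, 49), (1,
      52), (1, 53)], [(4, 5), (12, 30), (8, 35), (6, 47), (8, 52), (2, 54)], [(2, 4), (2, 12), (2,
      29), (2, 32), (1, 46), (1, 49)], [(2, 5), (2, 12), (2, 30), (2, 32), (2, 38), (2, 43), (1,
      47), (1, 49), (1, 53)], [(4, 5), (10, 30), (6, 35), (4, 47), (5, 52), (1, 54)], [(4, 5), (8,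
      30), (4, 35), (4, 47), (4, 52), (1, 54)]]) i []

/-! ### Trees -/

/-- The column consisting of a new root and two copies of a rooted column. -/
abbrev forkGraph {V : Type} (G : SimpleGraph V) (r : V) : SimpleGraph ((Unit ⊕ V) ⊕ V) :=
  joinGraph (joinGraph (⊥ : SimpleGraph Unit) () G r) (.inl ()) G r

/-- The cycle vertices of a fork. -/
abbrev forkVert {V ι : Type} (vert : ι → V) : (Empty ⊕ ι) ⊕ ι → (Unit ⊕ V) ⊕ V :=
  joinVert (joinVert Empty.elim vert) vert

/-- The number of an unordered pair. -/
def triIndex (i j : ℕ) : ℕ :=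
  bif Nat.ble i j then Nat.add (Nat.div (Nat.mul j (Nat.succ j)) 2) i
  else Nat.add (Nat.div (Nat.mul i (Nat.succ i)) 2) j

theorem Represents.fork {V ι : Type} [Fintype V] [Fintype ι] {A T : PartTable} {D : Bool}
    {G : SimpleGraph V} {r : V} {vert : ι → V} {id : CutState ι → ℕ} {w : ℕ}
    (hA : A.Represents D G r vert id) (h : mergeCheck (A.graft D) A T triIndex w = true) :
    T.Represents D (forkGraph G r) (.inl (.inl ())) (forkVert vert)
      fun c => triIndex (id ((c ∘ .inl) ∘ .inr)) (id (c ∘ .inr)) :=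
  hA.graft.join_of_check hA h

/-- The column consisting of a path of three vertices, whose end vertices lie on the cycle. -/
abbrev cherryGraph : SimpleGraph ((Unit ⊕ Unit) ⊕ Unit) := forkGraph (⊥ : SimpleGraph Unit) ()

/-- The cycle vertices of a cherry. -/
abbrev cherryVert : (Empty ⊕ Unit) ⊕ Unit → (Unit ⊕ Unit) ⊕ Unit := forkVert fun i : Unit => i

/-- The column consisting of a binary tree with four leaves. -/
abbrev doubleForkGraph := forkGraph cherryGraph (.inl (.inl ()))

/-- The cycle vertices of a binary tree with four leaves. -/
abbrev doubleForkVert := forkVert cherryVert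

/-- The class of a cut state of a cherry. -/
def cherryClass (D : Bool) (c : CutState ((Empty ⊕ Unit) ⊕ Unit)) : ℕ :=
  triIndex (leafClass D (c (.inl (.inr ())))) (leafClass D (c (.inr ())))

/-- The class of a cut state of a binary tree with four leaves. -/
def doubleForkClass (D : Bool)
    (c : CutState ((Empty ⊕ ((Empty ⊕ Unit) ⊕ Unit)) ⊕ ((Empty ⊕ Unit) ⊕ Unit))) : ℕ :=
  triIndex (cherryClass D ((c ∘ .inl) ∘ .inr)) (cherryClass D (c ∘ .inr))

theorem cherryConn_represents :
    cherryConn.Represents false cherryGraph (.inl (.inl ())) cherryVert (cherryClass false) :=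
  leaf_represents.fork (w := 8) (by decide +kernel)

theorem cherryDom_represents :
    cherryDom.Represents true cherryGraph (.inl (.inl ())) cherryVert (cherryClass true) :=
  leaf_represents.fork (w := 8) (by decide +kernel)

theorem forkConn_represents : forkConn.Represents false doubleForkGraph (.inl (.inl ()))
    doubleForkVert (doubleForkClass false) :=
  cherryConn_represents.fork (w := 8) (by decide +kernel)

theorem forkDom_represents : forkDom.Represents true doubleForkGraph (.inl (.inl ()))
    doubleForkVert (doubleForkClass true) :=
  cherryDom_represents.fork (w := 8) (by decide +kernel)

end PartTable


/-! ### The gadgets with tree columns -/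

theorem connected_joinGraph {V W : Type*} {G : SimpleGraph V} {r : V} {H : SimpleGraph W} {r' : W}
    (hG : G.Connected) (hH : H.Connected) : (joinGraph G r H r').Connected := by
  have h1 : ∀ v, (joinGraph G r H r').Reachable (.inl v) (.inl r) := fun v =>
    (hG.preconnected v r).map (G' := joinGraph G r H r') ⟨Sum.inl, fun h => h⟩
  have h2 : ∀ v, (joinGraph G r H r').Reachable (.inr v) (.inl r) := fun v =>
    ((hH.preconnected v r').map (G' := joinGraph G r H r') ⟨Sum.inr, fun h => h⟩).trans
      (SimpleGraph.Adj.reachable (G := joinGraph G r H r') ⟨rfl, rfl⟩)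
  have h : ∀ v, (joinGraph G r H r').Reachable v (.inl r) := by
    rintro (v | v)
    · exact h1 v
    · exact h2 v
  have : Nonempty (V ⊕ W) := ⟨.inl r⟩
  exact SimpleGraph.Connected.mk fun v w => (h v).trans (h w).symm

theorem connected_bot_unit : (⊥ : SimpleGraph Unit).Connected :=
  SimpleGraph.Connected.mk fun v _ => SimpleGraph.Reachable.refl v

namespace PartTable

theorem connected_forkGraph {V : Type} {G : SimpleGraph V} {r : V} (hG : G.Connected) :
    (forkGraph G r).Connected :=
  connected_joinGraph (connected_joinGraph connected_bot_unit hG) hG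

theorem connected_cherryGraph : cherryGraph.Connected := connected_forkGraph connected_bot_unit

theorem connected_doubleForkGraph : doubleForkGraph.Connected :=
  connected_forkGraph connected_cherryGraph

/-- The map from the vertices of a fork that is given by the image of the root and maps from the two
copies. -/
abbrev forkMap {V M : Type} (a : M) (f g : V → M) : (Unit ⊕ V) ⊕ V → M :=
  Sum.elim (Sum.elim (fun _ => a) f) g

/-- The map from the indices of the cycle vertices of a fork that is given by maps from the two
copies. -/
abbrev forkIndex {ι κ : Type} (f g : ι → κ) : (Empty ⊕ ι) ⊕ ι → κ :=
  Sum.elim (Sum.elim Empty.elim f) g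

/-- The map from the vertices of a cherry that is given by the images of the root and the leaves. -/
abbrev cherryMap {M : Type} (a b c : M) : (Unit ⊕ Unit) ⊕ Unit → M :=
  forkMap a (fun _ => b) fun _ => c

/-- The map from the indices of the cycle vertices of a cherry that is given by the images of the
leaves. -/
abbrev cherryIndex {κ : Type} (b c : κ) : (Empty ⊕ Unit) ⊕ Unit → κ :=
  forkIndex (fun _ => b) fun _ => c

end PartTable

open PartTable

theorem connected_of_joinGraph {V W M : Type*} {G : SimpleGraph V} {r : V} {H : SimpleGraph W}
    {r' : W} {Γ : SimpleGraph M} (hG : G.Connected) (hH : H.Connected) (e : V ⊕ W ≃ M)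
    (he : ∀ v w, (joinGraph G r H r').Adj v w ↔ Γ.Adj (e v) (e w)) : Γ.Connected :=
  (SimpleGraph.Iso.connected_iff (G := joinGraph G r H r') ⟨e, (he _ _).symm⟩).1
    (connected_joinGraph hG hH)

instance decidablePetersenAdj : DecidableRel petersen.Adj := fun v w =>
  decidable_of_iff _ (SimpleGraph.fromRel_adj _ v w).symm

instance decidableHeawoodAdj : DecidableRel heawood.Adj := fun v w =>
  decidable_of_iff _ (SimpleGraph.fromRel_adj _ v w).symm

/-! #### The column of `K_{3,3}` -/

/-- The vertices of the column of `K_{3,3}`. -/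
noncomputable def labelK33 :=
  Equiv.ofBijective (Sum.elim (cherryMap (.inl 2) (.inr 0) (.inr 1)) (cherryMap (.inr 2) (.inl 1) (.inl 0))) (by decide : Function.Bijective (_ : _ → Fin 3 ⊕ Fin 3))

/-- The numbers of the cycle vertices. -/
noncomputable def indexK33 :=
  Equiv.ofBijective (Sum.elim (cherryIndex 1 3) (cherryIndex 2 0)) (by decide : Function.Bijective (_ : _ → Fin 4))

set_option synthInstance.maxSize 1000 in
theorem joinGraph_adj_labelK33 : ∀ v w,
    (joinGraph cherryGraph (.inl (.inl ())) cherryGraph (.inl (.inl ()))).Adj v w ↔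
      cycleK33.column.Adj (labelK33 v) (labelK33 w) := by
  unfold labelK33
  simp only [Equiv.ofBijective_apply]
  decide +kernel

theorem labelK33_vert : ∀ i, labelK33 (joinVert cherryVert cherryVert i) =
    cycleK33.vert (indexK33 i) := by
  unfold labelK33 indexK33
  simp only [Equiv.ofBijective_apply]
  decide +kernel

theorem connected_columnK33 : cycleK33.column.Connected :=
  connected_of_joinGraph connected_cherryGraph connected_cherryGraph labelK33 joinGraph_adj_labelK33

theorem isDRegular_K33 : IsDRegular (Kdd 3) 3 := isDRegular_iff_card_filter.2 (by decide +kernel)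

/-- The digits of a weight for `K_{3,3}` and connected sets. -/
def weightK33Conn : ℕ :=
  0x400000014043362000094180002b086e29415151a4c54df44000186b3ce28e91a03cbf2

theorem hasWeightK33Conn :
    cycleK33.HasWeight false ((30295 : ℕ) / (1000 : ℕ)) ((30305 : ℕ) / (1000 : ℕ)) :=
  hasWeight_of_check (w₀ := 15) (w := 24) (zs := weightK33Conn) (idx := triIndex)
    cherryConn_represents cherryConn_represents (by norm_num) (by decide +kernel) labelK33 indexK33
    joinGraph_adj_labelK33 labelK33_vert

/-- The digits of a weight for `K_{3,3}` and connected dominating sets. -/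
def weightK33Dom : ℕ :=
  0x100000000000100000001a981a9800000000130600000000130600001fb91fb9000020e60000000025a500002e2b3acb37fd17ad25b046772d9348d8682e0000000017ad00002717271700002bb100003510450c588a33f25b3c821300003f3c50675e1785b9bd2a

theorem hasWeightK33Dom :
    cycleK33.HasWeight true ((26145 : ℕ) / (1000 : ℕ)) ((26155 : ℕ) / (1000 : ℕ)) :=
  hasWeight_of_check (w₀ := 16) (w := 25) (zs := weightK33Dom) (idx := triIndex)
    cherryDom_represents cherryDom_represents (by norm_num) (by decide +kernel) labelK33 indexK33
    joinGraph_adj_labelK33 labelK33_vert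

theorem tableRow_K33 : cycleK33.TableRow 3 30.30 1.766 26.15 1.723 := by
  have h1 := cycleK33.rho_mem_Icc (by norm_num) (by norm_num) hasWeightK33Conn
  have h2 := cycleK33.domRho_mem_Icc (by norm_num) (by norm_num) hasWeightK33Dom
  refine cycleK33.tableRow_of_rho (n := 6) isDRegular_K33 connected_columnK33
    (by simp) (by norm_num) (abs_le.2 ⟨?_, ?_⟩) (by norm_num) (by norm_num) (by norm_num)
    (by norm_num) (abs_le.2 ⟨?_, ?_⟩) (by norm_num) (by norm_num) (by norm_num) (by norm_num)
  · linarith [h1.1]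
  · linarith [h1.2]
  · linarith [h2.1]
  · linarith [h2.2]

/-! #### The column of the Petersen graph -/

/-- The vertices of the column of the Petersen graph. -/
noncomputable def labelPetersen :=
  Equiv.ofBijective (Sum.elim (forkMap (.inr 4) (cherryMap (.inl 4) (.inl 3) (.inl 0))
      (cherryMap (.inr 1) (.inr 3) (.inl 1))) (cherryMap (.inr 2) (.inr 0) (.inl 2))) (by decide : Function.Bijective (_ : _ → Fin 5 ⊕ Fin 5))

/-- The numbers of the cycle vertices. -/
noncomputable def indexPetersen :=
  Equiv.ofBijective (Sum.elim (forkIndex (cherryIndex 3 0) (cherryIndex 4 1)) (cherryIndex 5 2)) (by decide : Function.Bijective (_ : _ → Fin 6))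

set_option synthInstance.maxSize 1000 in
theorem joinGraph_adj_labelPetersen : ∀ v w,
    (joinGraph doubleForkGraph (.inl (.inl ())) cherryGraph (.inl (.inl ()))).Adj v w ↔
      cyclePetersen.column.Adj (labelPetersen v) (labelPetersen w) := by
  unfold labelPetersen
  simp only [Equiv.ofBijective_apply]
  decide +kernel

theorem labelPetersen_vert : ∀ i, labelPetersen (joinVert doubleForkVert cherryVert i) =
    cyclePetersen.vert (indexPetersen i) := by
  unfold labelPetersen indexPetersen
  simp only [Equiv.ofBijective_apply]
  decide +kernel

theorem connected_columnPetersen : cyclePetersen.column.Connected :=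
  connected_of_joinGraph connected_doubleForkGraph connected_cherryGraph labelPetersen joinGraph_adj_labelPetersen

theorem isDRegular_petersen : IsDRegular petersen 3 := isDRegular_iff_card_filter.2 (by decide +kernel)

/-- The digits of a weight for the Petersen graph and connected sets. -/
def weightPetersenConn : ℕ :=
  0x80000000002ccec19242000000000002c95c000000d9a08841b020000164ae1b8b006a2dc7254a4c58c000000000003516e000000fa5e899fa82ccec1b3411c95287d2f4701204ddd70c9210841b098b18267ea26eeb99ec1000000000000c87b0000003b1ea244210b2570643d87c5b81be351f14595461400000000000df1a8000004198027d210d9a08763d47c51620cc01dd42150054420d8244212a8c289f484a802a72d771b8b00f8b711012e44be140c6c2da8703516e1be35225f0879198881105d79a1c9528f8a2d031b0440883c92f2b434c98b18551855b50e175e695a1a6f3ac2000000000003c8cc0000011f7d8ab1283e97a20cc02204408fbec81d7e5b910133f509f484baf342ac4a2dc881f6d9c701203ba843c92f103afce035ca153626eeb9500555a1a65b91050a9b399278cf60872d7779d611f6d9dcc93d44141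

theorem hasWeightPetersenConn :
    cyclePetersen.HasWeight false ((329805 : ℕ) / (1000 : ℕ)) ((329815 : ℕ) / (1000 : ℕ)) :=
  hasWeight_of_check (w₀ := 21) (w := 30) (zs := weightPetersenConn) (idx := (fun a b => Nat.add (Nat.mul 6 a) b))
    forkConn_represents cherryConn_represents (by norm_num) (by decide +kernel) labelPetersen indexPetersen
    joinGraph_adj_labelPetersen labelPetersen_vert

/-- The digits of a weight for the Petersen graph and connected dominating sets. -/
def weightPetersenDom : ℕ :=
  0x40000000000000000200000000000d17681a2ed000000000000000000130f80000000000000987c00000003e72807ce50000000000000000000829d8000000000000474fa0000001761a8365fb02000004c3e01053b034f9902f98808edb41f89d82e76608e8ae1736a40000000000000000005f3100000000000002f98800000013740026e8000000000000000000023b6d000000000000135ba8000000679b80eda88080000130f80474fa0fc4ec0be62026b750925ba0cc7cc2b04d86b9ee0000000000000000002e766000000000000198f9800000081d501330580d17681f39405d86a11d15c13740033cdc0ac136103aa02ef4c07c8100345da07ce501b2fd85cda904dd000eda8835cf704cc160f902026c6200000000000000000005ad380000000000002d69c000000129e28253c500000000000000000026ee80000000000001541180000006f9481037fc0987c016b4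e04ddd00fcb680e2c102a93f0966f60ddb1c2a85706ecc70000000000000000001c5820000000000000e2c100000005cc600b98c0000000000000000000aa4fc0000000000005c4f40000001ee6b046e310261f005ad381541184b37b038b040b89e82ba0e03cf9d0cd4d2201a08000000000000000000ddb1c00000000000079f3a00000026bca85b9ad03e728094f141be520550ae05cc600f73583353484d7950e032a2527640f9ca0253c5081bfe1bb31c17318046e31100d0416e6b44a4ec8b921d0000000000000000003dd5d00000000000022d670000000ac5f41a83f81053b026ee807baba1ed4c8182a084712512cf9e14deac50bee0dacfe000000000000000000305410000000000001a65900000008a25014193c0000000000000000011c494000000000000a01fa00000031cab87a6840474fa0aa08c22d670967cf0699641403f45aba305daa118c81441eda40000000000000000014deac000000000000bb54200000039bd688d54b05d86a0df2902b17d0a17dc08a25018e55c632050737ad1a181e4731281b2fd840dff0d41fc36b3f82832787a68420f6d223552c8e6251796ab069f320fcb683da990e0c6109c8c823eecc8a64b8a8874241bf062f9a80be6201c582060a8213919011ae7034dfe0ba512112630348ee088d240476da0aa4fc2389288fbb3069bfc145eb0576270609c617a1183face41f89d84b37b12cf9e45325c2e9448aec4e2a4b6c3384ccb25649e30f705ce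cc0ddb1c29bd58a88740893181827186709986eefc1b57d44a592c23a2b8550ae142fb84837e0348ee0bd08c2c959236afa8b7e4c9f96af0b9b521bb31c6d67f18be6a111a483face4f187b92964b3f2d5eaa54500000000000000000008d73800000000000046b9c0000001cddf039bbe00000000000000000034dfe0000000000001cab78000000991b015f8000be6201c582069964174a2411ae703956f0d815c12e08c3f66809e8180000000000000000004498c00000000000025c118000000bf2261c47501374002e63008a2501a47701cddf04c8d80fd9a017e44c451798b6eaa04dd000b98c028327888d2407377c15f8004f40c0711d416dd5438e98800000000000000000145eb0000000000000b73d60000003976408cb1d04d6ea0b89e82807e8aec4e072ade16e7ac68ce186c94f1cef4a4c524400000000000000000182718000000000000d929e000000430f58a48dd0679b80f735831cab8bd08c0991b01cbb2073bd28861eb1ea414533f701db51046e310f4d083face42bf0008cb1d262922292374a67ee1b57d30925ba15d0705aba31525b60d815c34670cccbdf0f974a36bb1c91e5e0198f983cf9d0bb5423384cc25c1186c94f1f2e941ee968865e6967d9b0ac13619a9a463205164ac90fd9a039de94daec710cbcd38d8f69abf3c35cf708068220f6d278c3dc4f40c13149148f2f059f66d357e7b357720000000000000000006eefc0000000000003d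d2d0000001312b22e36082075404d7950e6f5a36afa82fc898861eb21979a2625648c39c97f09809982c16e6b446aa592964b0e23a8292374b3ecd8b8d822fe1307fbbc82ef4c0701951a181e5bf264451798f520a38d8f6461ce4e81f6a7e9ca0f90202527648e6251f96af16dd54533f71357e797f0984fd394d826604d8c40b921d2f2d56aa545071d311b57d366aee47fbbc9b04cc476359

theorem hasWeightPetersenDom :
    cyclePetersen.HasWeight true ((252695 : ℕ) / (1000 : ℕ)) ((252705 : ℕ) / (1000 : ℕ)) :=
  hasWeight_of_check (w₀ := 23) (w := 32) (zs := weightPetersenDom) (idx := (fun a b => Nat.add (Nat.mul 10 a) b))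
    forkDom_represents cherryDom_represents (by norm_num) (by decide +kernel) labelPetersen indexPetersen
    joinGraph_adj_labelPetersen labelPetersen_vert

theorem tableRow_Petersen : cyclePetersen.TableRow 3 329.81 1.786 252.7 1.739 := by
  have h1 := cyclePetersen.rho_mem_Icc (by norm_num) (by norm_num) hasWeightPetersenConn
  have h2 := cyclePetersen.domRho_mem_Icc (by norm_num) (by norm_num) hasWeightPetersenDom
  refine cyclePetersen.tableRow_of_rho (n := 10) isDRegular_petersen connected_columnPetersen
    (by simp) (by norm_num) (abs_le.2 ⟨?_, ?_⟩) (by norm_num) (by norm_num) (by norm_num)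
    (by norm_num) (abs_le.2 ⟨?_, ?_⟩) (by norm_num) (by norm_num) (by norm_num) (by norm_num)
  · linarith [h1.1]
  · linarith [h1.2]
  · linarith [h2.1]
  · linarith [h2.2]

/-! #### The column of the Heawood graph -/

/-- The vertices of the column of the Heawood graph. -/
noncomputable def labelHeawood :=
  Equiv.ofBijective (Sum.elim (forkMap (.inl 6) (cherryMap (.inr 6) (.inl 2) (.inl 0))
      (cherryMap (.inr 5) (.inl 1) (.inl 5)))
    (forkMap (.inr 3) (cherryMap (.inl 3) (.inr 0) (.inr 2)) (cherryMap (.inl 4) (.inr 1) (.inr 4)))) (by decide : Function.Bijective (_ : _ → Fin 7 ⊕ Fin 7))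

/-- The numbers of the cycle vertices. -/
noncomputable def indexHeawood :=
  Equiv.ofBijective (Sum.elim (forkIndex (cherryIndex 4 0) (cherryIndex 2 6))
    (forkIndex (cherryIndex 1 5) (cherryIndex 3 7))) (by decide : Function.Bijective (_ : _ → Fin 8))

set_option synthInstance.maxSize 1000 in
theorem joinGraph_adj_labelHeawood : ∀ v w,
    (joinGraph doubleForkGraph (.inl (.inl ())) doubleForkGraph (.inl (.inl ()))).Adj v w ↔
      cycleHeawood.column.Adj (labelHeawood v) (labelHeawood w) := by
  unfold labelHeawood
  simp only [Equiv.ofBijective_apply]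
  decide +kernel

theorem labelHeawood_vert : ∀ i, labelHeawood (joinVert doubleForkVert doubleForkVert i) =
    cycleHeawood.vert (indexHeawood i) := by
  unfold labelHeawood indexHeawood
  simp only [Equiv.ofBijective_apply]
  decide +kernel

theorem connected_columnHeawood : cycleHeawood.column.Connected :=
  connected_of_joinGraph connected_doubleForkGraph connected_doubleForkGraph labelHeawood joinGraph_adj_labelHeawood

theorem isDRegular_heawood : IsDRegular heawood 3 := isDRegular_iff_card_filter.2 (by decide +kernel)

/-- The digits of a weight for the Heawood graph and connected sets. -/
def weightHeawoodConn : ℕ :=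
  0x800000000000000bbec9f031a9830000000002ecb0c40000000039f005410f50e50675848c0e3e6b206d4a0a023825db0000000010e7e34050ddf9c1af040b093bb4f82fe53b0000000000d09c0e000000001072fda04d0c5c0000000003d0a7080000000048eee4c15d919409241f8c1143c8d0939448431bb79b000000001469c3006173d60238202c0c649f2842bb400090e11641012c4609f79fc8326f74503be31a02a4e81d042c00242be40430e77ff6c5a5a0550be5a6c4577abe11e39a95011e6f840c260ad4409909a149535107458f4828276704000000004e62440176a8940000000011a9a9e0000000014fefe60647df702b41c5c04dfde102b23e7e0ea572b8000000005cac6b81b610060a50169c39ca1271399851029781000dafef14125665c0b36875c1458bca0b32481c3ccd62117b71c1031aad8d1687be707e547b5057ed438310d94010bb398853edd831dde9a9ca7520541149965c15b62cc0e8a4d4017f65dc0eeec6f04ebdedc1e957660410bb3c1d79153ca2c5888065d8de841d7e6f15e3ad7c6e99fa7270aba78d76de460000000010803b10000000013a957c05da48902858d9e04911ad428517bd0da74c640000000056f28ec199cf9f09a57cb0360215a12461db82efa865047ca644301b0a70ff69e3065e5b7d0ceda30c617fbc521fc3ed4131152b0d26690c45e679e16ca7dac81780632d17914400000000560b4ec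194ad200b029efc13b504f0afd9e283b6dbd40000000017ab00e06de39b02a08c6a0eb087804f60d330bebf7c840e36f91996e34834aab0e182ac258880b29b05c5f01c33e2c9611ae7c1859b9240200270f8b41031f1588be6c88f0444118207bc8296faa2d7c5e641aaba2311af8bc85e101ee1e74e764ace7e4a3c2f7bf8da16af61c173f80cfc689e4850fbb02e9046f1bea69ac966ed18306fd3a512c66935f93676838615151abd46849592ba4053a39883940e2312feed4063b716923732f78c6269ed312bb4c913128f20ba8d314691348423b2e5e8b6bcd3340f11e396b19d6f5faaf2643ea48cb25095ad8c78e850400b54c16b0df237e32b78400000000658d3c81cf53470b29bdfc3e32e6214e04880383fe6b132cc8106152e2622bf4d1cc3d4c03197655bc84dfc2b2f35d77507be6382a5b5650f12396b5478ba75569038377a1d75e98ec5d0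

theorem hasWeightHeawoodConn :
    cycleHeawood.HasWeight false ((3512305 : ℕ) / (1000 : ℕ)) ((3512315 : ℕ) / (1000 : ℕ)) :=
  hasWeight_of_check (w₀ := 30) (w := 39) (zs := weightHeawoodConn) (idx := triIndex)
    forkConn_represents forkConn_represents (by norm_num) (by decide +kernel) labelHeawood indexHeawood
    joinGraph_adj_labelHeawood labelHeawood_vert

/-- The digits of a weight for the Heawood graph and connected dominating sets. -/
def weightHeawoodDom : ℕ :=
  0x1000000000000000000000200000000000000cce36806671b40000000000000000987228000000000000000130e450000000007a1f4c03d0fa600000000104c860000000000000000239761000000000b8f3c806b1d34034d34000beddc008e9d4007e01ba02e183f0234b59816fc8140000000000000000beddc0000000004c505c026282e0000000009a96940000000033285801d3d000124b9e80657fb40555c460355bcc000000000800f9204b6ff302e52e501eb92d0132473e00000000000000004c4d7c0000000000000000989af8000000003d1c2401e8e1200000000000000002d702a00000000000000005ae05400000000246cb6012365b0000000004dbe5c0000000000000000a9c4080000000037281301ff26800fbfcbc038e1f402a83e402590b180dbeb280a867e406dae10000000000000000038e1f40000000016c23580b611ac000000002e15b8000000000f41ae008b86ea057439701e43d9019744e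40fe96b0000000002631f2016806b80dd11d00929e4e05b59da000000000460232000000000000000097ff90000000003221ae01cb422800000000000000029bbcc00000000000000005a9a02000000001de7368111efd0000000003de0db000000000000000089dc84000000002ae047819bc2c40e8ac74033f3dc02361ea823935800a6728809742f2066806d8000000000000000386a050000000012910d80aa310e00000000277b08000000000c4d438076681e056072c8170cae017422be0f7b5a9000000001ca3b18110eeea0c27cfc084afbf8580763007417f6017de040130a3b8114d7300641f7e04e2f4d0330817805af8d40537e8c0453bb800e399b80b5a8700a514d803bbbe402ea5ef01e72fd407d15b6078e959019fc30811dc82c128691e054748b04ed644035bcf681a11d6e05609dc04622f7040d8a40149697c10aa7350b95242008e49240711b260668d7b025155e01cec67812ddcd6051882b055ed750184428c16ee0880f9f6010a09b998328225429802901ca3b0e0382cd103545810245a1041526a320eb4c1d0a1b43d40000000000000000bef020000000004c87a802643d4000000000000000038d980000000000000000071b300000000002d9d5f016ceaf80000000061285a0000000000000000d42e500000000044f337027f2f9813ac9e40472a1e03522e902eed050112ddb40d26bd00890bfd0000000000000000472a1e000000001c7fd100e3fe8800000000399a4f00000000131330c0ae7efe06d019b025d45d81fcdc4813e1a4e0000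00002fbf2181c2352811442440b7389c072280b800000000522686000000001b89a980f967a800000000000000016b2ce000000000000000030f6d200000000106cd44094c1b00000000022137e80000000000000004bc7e30000000017aaec00e28dce07e822901c448f013681a4134dbcc05c1bd00527018037af39c0000000000000001e7fa4000000000a340e605c74c400000000159988c000000006c487c040d8c982e88dd40cbf5200ca865208624b4800000000fdd5c0097092f06a300d048464602fb5b420505f9d01b5f35017a8fb00ed099c016be35016a8e2814a2e08038e66e030fc9b02fed1b010546340e1dc9008d6e5f021c0d882319980070e2a804cfc94054e607016a71e4170c0be0f62f7c0772be9019a4e24143d1dc126c27505fd5fd04c6fe9434a4a1a023924901e834381dc5ca00a2480608c05e4057a159015e999c18730c40681f8e06aa8f304717db82d45bc40e842a50bd81e6881296b00eeef980f975680a71c4386140d344323c202d943870000000011a08d40a3da660000000000000000eeca1000000000000000020a307800000000a84062061be7d00000000156de5c0000000000000002f9399800000000ecd84608d7866052a13881291e7c0c574920ca9d5b038ff83035702742455f8a000000000000000144fe5000000000685f9403cace5000000000dbe75000000000445c3d0290ad641ebb79607d8d28083a89e05822c04000000009cc02e05c8058844650042ec1c2c1f32f30033d24002288838048e87403bcdb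e02ea26f00b6930408367cc070e38002a12b401eec03c149b63e058c64d051b02a0129be000cbd2780c9b3d803bc15b834c7b38244d370119971d039f27a82fa22402be43d20dd62420b2ee7387caf9d007239ce051d06d0461d5c81a1a5d8132a8a20cc2add03a7a9a83acc068113bc6a0f6c0880a9b33a86d1b9d422291521be603f13558c6027b4ea4238199c186a3230e1e02209d4dfc86c8a6060ac9f9d0123a1d0111f5f40f3826402da4c102531d282357f500c38ea60a4da0e067028f81936acc197d4c605554af039b36503dafce810d0c16109f5a70b1533a855b63f412e8a820ebae120d3ec468453d74836b0980259544901c8e738172d67015f360807975c4066236883fc7574107b7d611cd6ef04d8c3b04d10f483349f4620899dc0a7eb81087825445c291320b034b00b30c05877cea94453f1f22fb15f8204eb2d00000000000000001b16520000000000000000362ca40000000015ba9200add490000000002e5aa600000000000000006538c60000000020e5f18130e88409641b2021e7c7019596101665f84083282006471d50416b32800000000000000021e7c7000000000d931a406c98d2000000001b7a3f8000000009199980533b0a03407740120c9b80f2e5e6097d7830000000016c8cb80d6c87e083e0b0057769c0367e6fc0000000031c5d500000000000000006c0dea0000000023ac290146d2980000000049d0780000000000000000a4731a000000003327c381eb5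2b011597b003df45d02a34e202a70ec00c68fd60b47b1007a4d56000000000000000043465d0000000016257500cb0686000000002f180d800000000ead59408d49180669fde81b7ee941bbfd921278ae000000000222b194145a7ae0e810b109e514c8690826c0a52698021e21301b12090189c66008e767c06f4bad048a5b9012a50c81207f7003df4fc02a987b02c335cc0c96e2e0bc1f7a0803b1e03e358d40cd38e20a7573e09abb530311fc8c27c51221ba377e0152e68010da93c0f49a5a0586f43045001902d0209c0c26d260cd01fc039dfc0036b6cb025471a017f35b607881e586306d904455c56085fac807f1c39056bc5bc32789342316f98181ce93000000000000000021e213000000000d9a54006cd2a0000000001cf56f00000000000000003f3e1700000000148ef200be9a1805dd50b015347780fd66e80dfca40051f23803ebd26028dcbd400000000000000015347780000000087f6aa043fb5500000000112b3cc000000005b005803408cd8207d4d40b47250097b64805ed778000000000e3cf16086438c05261fa836a33b0220abc8000000001d32990000000009cc17e058bd13000000001452fc40000000000000002d3277000000000e1e6ac08729fc04b76c1010dacac0b931440b83a2e036f0988312e3cc2138602000000000000000122f4ac00000000615dd303725a1000000000ce1dc60000000040986f026b02b41bc161c079a661078d04185005c3000000000976baf05a1b3403f5a1e82b1e3061c7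66a603927f2013787a010d69180a8b4520283ed5029df014086911a05bca5906545d401b02f741b7ec04125b3e508e2d0881e94b94182464815fa41007252ca85b319083ecdcc802a5cd00245ef002380e800c17aca0a7015806884a681a1ff841d29f9207c276507f3df8854d02dc360195e1150d530e2140d09a1505811ce97612995aa0c758d0074062b05017dc0365e7a400000000191961c0e95024000000003324c90000000000000000718a89000000002355564151b3600c5392302c4fd801d73dbc1e3931e088083d07f8e3f056bb344000000000000000307797000000000f9183a090d0a10000000020cc9a400000000a32b99061f89704957d3012ba00813a3e260d25c0680000000176203c0dcca500a341d506f9a4284a771ac0939bd90625eff01a7ac90185fc64058cb9903ccb3483c2e95c11d2f680fbfc760ad501185406d7411491700e3662d0d18bc10420dde03564676253435f0220a7381865e2414ea27a07c90d505b7bb703ce888c1171184118af3d0523ecf049a087032a2c2a208dfad0a3123f085301f05c4c1340bd7e5b0a9803b0748c60043654b42eeead9206172a83d7808c0f0a6f20f361e5032e52d8226b62c24cfd400a07f9a09eb881869d334433274d00b4813408ca4c787e78988295194020a36dd166d9c60110539c0dd2c980d189b9048731d03cf1648260e08c09d4eb00a9f99a02e427082dfdb7c1e9b9d8136ab3186433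80050dd98c36fe96f0691c4406ad7734477d79229529e71c7558b9346bd10000000007197800000000000000000fc377c000000004ebc3c82efdb601c0187405cb2ea041409b844398f8130c5a012346e40c3ff20000000000000000064177a0000000020d1edc12a835e0000000048755c8000000016b4f160d8cdc80a4020f02a232202ca2cf41d6e0d00000000034768b41f28a4a17647980fddd490a6db6f020d6a6605bcef7041a20f84edaa9412d1d96158ced40e34c2d876736c8165e25e1316e47122eaab85918c284be685033a2db402427c0019496a019f65f407ed89b078a38084b39d2c12eb6d416da24705799348649541841fa3ac2c41f760d647000bb132b87d767c20c4cb510e810c789976724606bbc641e2b952c0356380000000000000006654f3000000001fcf818131ead00ac960c0268f3601a4109c1a6406207b769d07037cb84c11e7800000000000000029e3d1800000000dc7fda07e7747000000001d4fd74000000009211a9057fe1903fd41ac111b2e811417b00b7de2f00000000153eed60cabbbb0904e9d86279d48415d13e0000000048e6cf8000000016c6dee0d9aaa50811ea001a7ae7012d226813a596f05847c78540c5bc38814a20000000000000001c8b0040000000096c1dd0556a798000000014e70d20000000068f78183ea57602f2e7b40c37b550cdfebd8879bdc400000000f353f2090c33086c1e6fc494ad4230184430bbc3a28297917033fe66821d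a8ca11c2084836d513c2dbd3d82b824c20d5c4960b65c63c7b99fde04ef80803843bb03eccb48119cdb6129dc030b6116502a08c00364a7f20c14d9f0f22aad89cdf2f8698be2e1fdca611c0a6c512b539701ae127e22f68e316d6c758e7f83ec9e0ed0a690d5ec00000000342ecbc1ec56b0129b9e303e914302b467602d3e9100c949480c13c41881953a4000000000000000432623800000001613ab80c6f151000000002fb246800000000f0ef4008e144706c7afb01ba0fdc1d8ffab136812a0000000022a56601456ab60f7ddd58a79a4686daf7f61c192a6129febf09a9c7ac1d2b626191c10f17c1bc5074ae27062a797443246d6033572602321a6022179640af32de09bdbe7862128981a4cda61e32ad10799596083661b456a7d5839e95c6119f51d8f34b30ca358e4c110d26512de9c30c8bddd87cd7854554a55139075a48c1e61046586c1613e1f5c108047f8f8ab5fc4cbf9a840df9792be2d0401dc2a9c150b90016c3490068ce8906b2d38c41641340fb5ca81398ebf047db5a856d61983832b7225b03288b7370f49f8486e6a3932f09eb78c8c7a8404825d9ee522c1ad37ded25a50f87e4699a890134452a112f76d901c02a850aef4e43909da2d7c54801d45fd4177713c1602c6a07a3bdd867ca4b03f2402c12859bc147ebd9856a30485a229583aa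932226e396a0c27b6d4a5a59b06d9c5ed0c1fb6d0d0a6b708a21f1c55a91973a02d8b263efda40ff02920cf9f4e0bfaea083cece0c314478c223cb6601a8265014fc93012fec9806e05e7055bae9837e981c0f1cec80fe5bfb047ed50043e17282e3f4e41dab23209574e787aabab454a4d140a6673709da59a86b922cc3e864b62b77cc51dde21f0589cf0c544f6e219f27e6160e4860efa3e4c09e340c0733af8077c71a02488ecc232da3c15bd890056a2e4069d04c819273701d40db1131e8b10ccda15c3e4d41a364fed42453d320388906c43b2cfa2cabbeb1c0d270932458f0cc0e1ec4e924f418c526a949f15a4ddd32a608ba08f07295a386cdfe80257837c205a2b513834c005a1e23c644cbce1a5384f1baa64b11efac10bd734723b93bba32860ac215eb3fc3acb9a8401cfc62a4dac91a2721a11b16470ba4bfec0f0c6d20ce3e9908c305500664d5404458b4046ddd241513b54146c7ee0cc37a68330a7103e158e60eabbc7110c2920b293228789888c24248111fc3d0b1549716820cfb20271ddb719ca5121054c274b257dbe77051522b13bd99cfc8d541392f3e0f4b3fb0e1defc84f0ae7c41ef40a2845d020c12ea20d2c43d8384c81c39963a42587bfa18e79ce47c790ba699f00245e1bc787dbdf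7484c7d665800c40366e49c24d45521846570e9ba7caf065fc56052aba5c4dc5eaa1ae162b16f7aaa8dd5c17840dddea4749e8812df9ae938f8a6ccab54f885b27822a2a214a37f1c85768bbc829f3e362d216f29dc089dd24d6eecc5ba13281e7bac80000000000000003504ca0000000015435480aa1aa4000000002ae147000000000e34c9a08202a8051149481c2963c17aa2ea0ecb28200000000238c3c814f57920cd9c1b088599a854f2940000000005a9b83000000001e4ee80112e5f400000000402900800000001418a7c0c0ce4e08a2202825da7802592dcc18e5e28000000002f182c81c0e3fc13b400e0d69dd108dbb9b0160d69e078667a067b657840e738c1040740121679904d2df504ee68a434984d02170fb20abbfc488bfb9105f65fbc0b0fec00b8727e07b91c4447d6b5e3196a4621a8df7000000001350a900b3dde00000000028b6ea000000000ca550a079a8b605af3220173a6061857f1b104da03000000001cf9a04111fa010ca4e0388a532445c564d20e2c83d096ec1582b44e202b6b7bc0cbcfc40b6309c87d456545069556193587e148ed2f0e3e2dfc1d51b601a330111202c230a66b95073de7d44fec39f0bc740c030cfeec348db9a0e56e070e363dc897555d45fdc2b01ef49fa18f18c090f5eab8208c87a20fd96a16135170cbe35388c63e425f13b14000000003018e0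400000000f205e40905d1486c13ffc1c45fd21d93e09136f77380000000233282c14f694c0f8ca9e8a8875446e60d6c1f5138f06f037008c631305a9727e3cb688d127a2af10305050ac516f20f7199b1456cbc8d41ad948633bce5b4f4103c845f900000000230f7f414b61ff0fc618b0408be9444e5ef22d344010000000050ddfd82f9b3d62424cb118705e98ffbcf344cb59fc326960e21a93b20a48597c8de2e2c5f0369009d63150b0b73c8753edf048f2a9631c4e8721312fc481feffa56d2e8c1a99f5a970c53f0f4dcc5016e152b1d1275012f0c81cbe57b9281396785579ee89c8077309095dbe79ec2c25050d1288c6b9389c4434066a10543f32d3eaab13725c05dc1a2b07a1a26472399988bb2c23c360e2f33c9e1ebd01f93bc792cd6fc6de8ed6f0540b566c2abf7fe44cc4e2651d7057361940e215df36168e8beced8654d70781e90c842b04db85b569010e625846e053b83da46700131c00000000b49bce068c1360508461e3635cd5233f31f0ca0159885eafd653c89133928dc4262a0d80ae5af6e6f236e84b7f877320efa1512349b4b95b3e87a1d130be87f72e915645dae0b78d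

theorem hasWeightHeawoodDom :
    cycleHeawood.HasWeight true ((2396455 : ℕ) / (1000 : ℕ)) ((2396465 : ℕ) / (1000 : ℕ)) :=
  hasWeight_of_check (w₀ := 29) (w := 38) (zs := weightHeawoodDom) (idx := triIndex)
    forkDom_represents forkDom_represents (by norm_num) (by decide +kernel) labelHeawood indexHeawood
    joinGraph_adj_labelHeawood labelHeawood_vert

theorem tableRow_Heawood : cycleHeawood.TableRow 3 3512.31 1.792 2396.46 1.743 := by
  have h1 := cycleHeawood.rho_mem_Icc (by norm_num) (by norm_num) hasWeightHeawoodConn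
  have h2 := cycleHeawood.domRho_mem_Icc (by norm_num) (by norm_num) hasWeightHeawoodDom
  refine cycleHeawood.tableRow_of_rho (n := 14) isDRegular_heawood connected_columnHeawood
    (by simp) (by norm_num) (abs_le.2 ⟨?_, ?_⟩) (by norm_num) (by norm_num) (by norm_num)
    (by norm_num) (abs_le.2 ⟨?_, ?_⟩) (by norm_num) (by norm_num) (by norm_num) (by norm_num)
  · linarith [h1.1]
  · linarith [h1.2]
  · linarith [h2.1]
  · linarith [h2.2]

/-! ### The table -/

theorem mainTheorem1 :
    -- the table: gadget with its cycle, `d`, `λ` and its root (connected sets),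
    -- `λ` and its root (connected dominating sets)
    cycleK33.TableRow 3 30.30 1.766 26.15 1.723 ∧
    cyclePetersen.TableRow 3 329.81 1.786 252.7 1.739 ∧
    cycleHeawood.TableRow 3 3512.31 1.792 2396.46 1.743 ∧
    cycleK44.TableRow 4 167.97 1.897 152.66 1.875 ∧
    cycleK55.TableRow 5 807.93 1.953 756.64 1.940 ∧
    -- the resulting bounds
    connConst 3 ≥ 1.792 ∧ connConst 4 ≥ 1.897 ∧ connConst 5 ≥ 1.953 ∧
    domConnConst 3 ≥ 1.743 ∧ domConnConst 4 ≥ 1.875 ∧ domConnConst 5 ≥ 1.940 := by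
  have c4 := cycleK44.le_connConst_of_le_rho (b := 1.897) isDRegular_K44
    (k44Conn_fits.connected (by decide)) (n := 8) (by simp) (by norm_num) (by norm_num)
    (le_trans (by norm_num) (cycleK44.rho_mem_Icc (by norm_num) (by norm_num) k44Conn_weight).1)
  have c5 := cycleK55.le_connConst_of_le_rho (b := 1.953) isDRegular_K55
    (k55Conn_fits.connected (by decide)) (n := 10) (by simp) (by norm_num) (by norm_num)
    (le_trans (by norm_num) (cycleK55.rho_mem_Icc (by norm_num) (by norm_num) k55Conn_weight).1)
  have d3 := cycleHeawood.le_domConnConst_of_le_domRho (b := 1.743) isDRegular_heawood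
    connected_columnHeawood (n := 14) (by simp) (by norm_num) (by norm_num)
    (le_trans (by norm_num)
      (cycleHeawood.domRho_mem_Icc (by norm_num) (by norm_num) hasWeightHeawoodDom).1)
  have d5 := cycleK55.le_domConnConst_of_le_domRho (b := 1.940) isDRegular_K55
    (k55Conn_fits.connected (by decide)) (n := 10) (by simp) (by norm_num) (by norm_num)
    (le_trans (by norm_num) (cycleK55.domRho_mem_Icc (by norm_num) (by norm_num) k55Dom_weight).1)
  exact ⟨tableRow_K33, tableRow_Petersen, tableRow_Heawood, tableRow_K44, tableRow_K55,
    le_connConst_three, c4, c5, d3, le_domConnConst_four, d5⟩
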